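/- Let $\mathbb S^2=\{x\in\mathbb R^3:\|x\|=1\}$, let $\lambda$ be the Lebesgue measure on $\mathbb S^2$ normalized by $\lambda(\mathbb S^2)=1$, and for a closed set $D\subset\mathbb S^2$ let $\lambda_D$ be the restriction of $\lambda$ to $D$. Let $\phi:\mathbb S^2\to\mathbb C\cup\{\infty\}$ be the stereographic projection $\phi(x_1,x_2,x_3)=\frac{x_1+ix_2}{1-x_3}$, $\phi(0,0,1)=\infty$. For a finite positive measure $\sigma$ on $\mathbb S^2$ put $U^\sigma(x)=\int\log\frac1{\|x-y\|}\,d\sigma(y)\in(-\infty,+\infty]$. An equilibrium measure in an external field $Q$ on $X=\mathbb S^2$ or $X=\mathbb R$ is a minimizer, among all Borel probability measures $\mu$ on $X$, of the weighted logarithmic energy $$I_Q[\mu]=\iint\log\frac1{\|x-y\|}\,d\mu(x)\,d\mu(y)+2\int Q\,d\mu ,$$ understood as $\iint\big(\log\frac1{\|x-y\|}+Q(x)+Q(y)\big)\,d\mu(x)\,d\mu(y)$. Let $a>0$ and $b\ge1$, and let $p_1,p_2\in\mathbb S^2$ be the points with $\phi(p_1)=ib$, $\phi(p_2)=-ib$.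 There is exactly one equilibrium measure on $\mathbb S^2$ in the external field $$Q(x)=a\log\frac1{\|x-p_1\|}+a\log\frac1{\|x-p_2\|};$$ let $D$ (the droplet) be its support. There is exactly one equilibrium measure $\mu_V$ on $\mathbb R$ in the external field $$V(x)=\tfrac{1+a}2\log(x^2+b^{-2})-\tfrac a2\log(x^2+b^2).$$ It is given as follows, where $a_{cr}=(b^2-1)^{-1}$ (and $a_{cr}=+\infty$ if $b=1$). If $a\le a_{cr}$, then $$\frac{d\mu_V}{dx}=\frac{(1+a-b^2a)x^2+b^2+b^2a-a}{\pi b(x^2+b^2)(x^2+b^{-2})},\qquad x\in\mathbb R;$$ if $a>a_{cr}$, then $\mu_V$ is supported on $[-A,A]$ with $$\frac{d\mu_V}{dx}=\frac{\sqrt C\sqrt{A^2-x^2}}{\pi(x^2+b^2)(x^2+b^{-2})},\qquad x\in[-A,A],$$ $$A=\frac{b\sqrt{1+2a}}{\sqrt{b^2a+a+1}\sqrt{b^2a-a-1}},\qquad C=\frac{(b^4-1)(b^2a+a+1)(b^2a-a-1)}{b^4}.$$ Then the positive measure $\sigma^*=\frac1{2a}(\phi^{-1})_*(\mu_V)$ is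 supported on the great circle $\phi^{-1}(\mathbb R\cup\{\infty\})$, has total mass $\frac1{2a}$, and is a mother body for the droplet in the sense that, for some constant $m\in\mathbb R$, $$U^{\lambda_D}(x)=U^{\frac{2a}{1+2a}\sigma^*}(x)+m\quad\text{if }x\in\mathbb S^2\setminus D,$$ $$U^{\lambda_D}(x)\le U^{\frac{2a}{1+2a}\sigma^*}(x)+m\quad\text{if }x\in D.$$ -/

import Mathlib

open MeasureTheory
open scoped ENNReal

/-- The unit sphere `{x ∈ ℝ³ : ‖x‖ = 1}`, with the Euclidean (chordal) distance. -/
abbrev S2 : Type := Metric.sphere (0 : EuclideanSpace ℝ (Fin 3)) 1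

theorem S2.sq_sum (x : S2) : x.1 0 ^ 2 + x.1 1 ^ 2 + x.1 2 ^ 2 = 1 := by
  have h : ‖x.1‖ = 1 := by simp
  have h2 := EuclideanSpace.real_norm_sq_eq x.1
  rw [h, Fin.sum_univ_three] at h2
  linarith

/-- The north pole `(0, 0, 1)`. -/
noncomputable def S2.north : S2 :=
  ⟨!₂[0, 0, 1], by simp [EuclideanSpace.norm_eq, Fin.sum_univ_three]⟩

theorem S2.eq_north (x : S2) (h : x.1 2 = 1) : x = S2.north := by
  have hs := S2.sq_sum x
  rw [h] at hs
  have h0 : x.1 0 = 0 := by nlinarith [sq_nonneg (x.1 0), sq_nonneg (x.1 1)]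
  have h1 : x.1 1 = 0 := by nlinarith [sq_nonneg (x.1 0), sq_nonneg (x.1 1)]
  apply Subtype.ext
  ext i
  fin_cases i
  · simpa [S2.north] using h0
  · simpa [S2.north] using h1
  · simpa [S2.north] using h

/-- The point `(2 Re z, 2 Im z, |z|² - 1) / (|z|² + 1)` of the sphere. -/
noncomputable def S2.ofComplex (z : ℂ) : S2 :=
  ⟨!₂[2 * z.re / (z.re ^ 2 + z.im ^ 2 + 1), 2 * z.im / (z.re ^ 2 + z.im ^ 2 + 1),
      (z.re ^ 2 + z.im ^ 2 - 1) / (z.re ^ 2 + z.im ^ 2 + 1)], by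
    have h : z.re ^ 2 + z.im ^ 2 + 1 ≠ 0 := by positivity
    rw [mem_sphere_zero_iff_norm, EuclideanSpace.norm_eq, Real.sqrt_eq_one]
    simp [Fin.sum_univ_three]
    field_simp
    ring⟩

/-- Stereographic projection `φ : S² → ℂ ∪ {∞}` from the north pole,
`φ (x₁, x₂, x₃) = (x₁ + i x₂) / (1 - x₃)` and `φ (0, 0, 1) = ∞`, as a bijection. -/
noncomputable def stereo : S2 ≃ OnePoint ℂ where
  toFun x := if x.1 2 = 1 then OnePoint.infty
    else (((x.1 0 + x.1 1 * Complex.I) / (1 - x.1 2) : ℂ) : OnePoint ℂ)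
  invFun w := w.elim S2.north S2.ofComplex
  left_inv x := by
    by_cases h : x.1 2 = 1
    · simp only [if_pos h, OnePoint.elim_infty]
      exact (S2.eq_north x h).symm
    · have hs := S2.sq_sum x
      have h' : 1 - x.1 2 ≠ 0 := sub_ne_zero.mpr (Ne.symm h)
      have e : ((x.1 0 + x.1 1 * Complex.I) / (1 - x.1 2) : ℂ) =
          ⟨x.1 0 / (1 - x.1 2), x.1 1 / (1 - x.1 2)⟩ := by
        have h'' : (1 - (x.1 2 : ℂ)) ≠ 0 := by
          rw [← Complex.ofReal_one, ← Complex.ofReal_sub]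
          exact Complex.ofReal_ne_zero.mpr h'
        rw [Complex.mk_eq_add_mul_I]
        push_cast
        field_simp
      have hd : (x.1 0 / (1 - x.1 2)) ^ 2 + (x.1 1 / (1 - x.1 2)) ^ 2 =
          (1 + x.1 2) / (1 - x.1 2) := by
        field_simp
        linarith
      have hd1 : (1 + x.1 2) / (1 - x.1 2) + 1 = 2 / (1 - x.1 2) := by
        field_simp
        ring
      have hd2 : (1 + x.1 2) / (1 - x.1 2) - 1 = 2 * x.1 2 / (1 - x.1 2) := by
        field_simp
        ring
      simp only [h, if_false, OnePoint.elim_some, e]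
      apply Subtype.ext
      ext i
      fin_cases i <;> simp [S2.ofComplex, hd, hd1, hd2] <;> field_simp
  right_inv w := by
    induction w using OnePoint.rec with
    | infty => simp [S2.north]
    | coe z =>
      have h : z.re ^ 2 + z.im ^ 2 + 1 ≠ 0 := by positivity
      have h2 : (z.re ^ 2 + z.im ^ 2 - 1) / (z.re ^ 2 + z.im ^ 2 + 1) ≠ 1 := by
        rw [ne_eq, div_eq_one_iff_eq h]
        intro hh
        linarith
      have hd : 1 - (z.re ^ 2 + z.im ^ 2 - 1) / (z.re ^ 2 + z.im ^ 2 + 1) =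
          2 / (z.re ^ 2 + z.im ^ 2 + 1) := by
        field_simp
        ring
      have hc : ((z.re : ℂ) ^ 2 + (z.im : ℂ) ^ 2 + 1) ≠ 0 := by exact_mod_cast h
      have hd' : 1 - ((z.re : ℂ) ^ 2 + (z.im : ℂ) ^ 2 - 1) /
          ((z.re : ℂ) ^ 2 + (z.im : ℂ) ^ 2 + 1) =
          2 / ((z.re : ℂ) ^ 2 + (z.im : ℂ) ^ 2 + 1) := by exact_mod_cast congrArg Complex.ofReal hd
      simp only [OnePoint.elim_some, S2.ofComplex]
      simp only [Matrix.cons_val, h2, if_false]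
      congr 1
      push_cast
      rw [hd']
      field_simp
      exact Complex.re_add_im z

/-- The great circle `φ⁻¹(ℝ ∪ {∞})`. -/
def greatCircle : Set S2 :=
  {x | stereo x = OnePoint.infty ∨ ∃ t : ℝ, stereo x = ((t : ℂ) : OnePoint ℂ)}

/-- Lebesgue (surface) measure `λ` on the sphere, normalized to `λ(S²) = 1`. -/
noncomputable def sphereMeasure : Measure S2 :=
  ((volume : Measure (EuclideanSpace ℝ (Fin 3))).toSphere Set.univ)⁻¹ •
    (volume : Measure (EuclideanSpace ℝ (Fin 3))).toSphere

/-- The integral, with values in `[-∞, ∞]`, of an extended-real-valued function: the integral of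
the positive part minus the integral of the negative part. It is used below only where
the negative part has a finite integral. -/
noncomputable def extIntegral {X : Type*} [MeasurableSpace X] (μ : Measure X) (f : X → EReal) :
    EReal :=
  ((∫⁻ x, (f x).toENNReal ∂μ : ℝ≥0∞) : EReal) - ((∫⁻ x, (-f x).toENNReal ∂μ : ℝ≥0∞) : EReal)

/-- The logarithmic kernel `log (1 / ‖x - y‖)`, equal to `+∞` on the diagonal. -/
noncomputable def logKernel {X : Type*} [PseudoEMetricSpace X] (x y : X) : EReal :=
  ENNReal.log (edist x y)⁻¹

/-- The logarithmic potential `U^σ(x) = ∫ log (1 / ‖x - y‖) dσ(y)`. -/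
noncomputable def logPotential {X : Type*} [PseudoEMetricSpace X] [MeasurableSpace X]
    (σ : Measure X) (x : X) : EReal :=
  extIntegral σ (fun y => logKernel x y)

/-- The weighted logarithmic energy `∬ log (1 / ‖x - y‖) dμ(x) dμ(y) + 2 ∫ Q dμ` of a probability
measure, written as the double integral of `log (1 / ‖x - y‖) + Q(x) + Q(y)`. This is the usual
meaning of the energy on the real line, where for a weakly admissible `Q` and a heavy-tailed `μ`
the two summands can be `-∞` and `+∞`, while the combined integrand is bounded below. -/
noncomputable def weightedEnergy {X : Type*} [PseudoEMetricSpace X] [MeasurableSpace X]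
    (Q : X → EReal) (μ : Measure X) : EReal :=
  extIntegral (μ.prod μ) (fun p => logKernel p.1 p.2 + Q p.1 + Q p.2)

/-- `μ` is an equilibrium measure in the external field `Q`: it minimizes the weighted logarithmic
energy among all (Borel) probability measures. -/
def IsEquilibriumMeasure {X : Type*} [PseudoEMetricSpace X] [MeasurableSpace X]
    (Q : X → EReal) (μ : Measure X) : Prop :=
  IsProbabilityMeasure μ ∧
    ∀ ν : Measure X, IsProbabilityMeasure ν → weightedEnergy Q μ ≤ weightedEnergy Q ν

/-- The charge distribution `a δ_{p₁} + a δ_{p₂}`. -/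
noncomputable def twoCharges (a : ℝ) (p₁ p₂ : S2) : Measure S2 :=
  ENNReal.ofReal a • Measure.dirac p₁ + ENNReal.ofReal a • Measure.dirac p₂

/-- The external field `V(x) = (1+a)/2 log (x² + b⁻²) - a/2 log (x² + b²)` on the real line. -/
noncomputable def fieldV (a b x : ℝ) : EReal :=
  (((1 + a) / 2 * Real.log (x ^ 2 + (b ^ 2)⁻¹) - a / 2 * Real.log (x ^ 2 + b ^ 2) : ℝ) : EReal)

/-- The endpoint `A` of the support of `μ_V` in the case `a > a_cr`. -/
noncomputable def constA (a b : ℝ) : ℝ :=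
  b * √(1 + 2 * a) / (√(b ^ 2 * a + a + 1) * √(b ^ 2 * a - a - 1))

/-- The constant `C` in the density of `μ_V` in the case `a > a_cr`. -/
noncomputable def constC (a b : ℝ) : ℝ :=
  (b ^ 4 - 1) * (b ^ 2 * a + a + 1) * (b ^ 2 * a - a - 1) / b ^ 4

/-- The density of `μ_V`. With `a_cr = 1 / (b² - 1)`, which is `+∞` for `b = 1`, the condition
`a ≤ a_cr` reads `a (b² - 1) ≤ 1`. -/
noncomputable def densityV (a b x : ℝ) : ℝ :=
  if a * (b ^ 2 - 1) ≤ 1 then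
    ((1 + a - b ^ 2 * a) * x ^ 2 + b ^ 2 + b ^ 2 * a - a) /
      (Real.pi * b * (x ^ 2 + b ^ 2) * (x ^ 2 + (b ^ 2)⁻¹))
  else if x ∈ Set.Icc (-constA a b) (constA a b) then
    √(constC a b) * √(constA a b ^ 2 - x ^ 2) /
      (Real.pi * (x ^ 2 + b ^ 2) * (x ^ 2 + (b ^ 2)⁻¹))
  else 0

/-- The measure `μ_V` on the real line. -/
noncomputable def muV (a b : ℝ) : Measure ℝ :=
  volume.withDensity (fun x => ENNReal.ofReal (densityV a b x))

/-!
The kernel `chordKernel x y = log (2 / ‖x - y‖)` is nonnegative on the sphere, and it is the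
logarithmic kernel up to an additive constant. All energies therefore become `[0, ∞]`-valued
integrals (`weightedEnergy_eq_of_map`). The problem on `ℝ` is transported to the sphere by
`realPoint`: since `‖φ⁻¹ s - φ⁻¹ t‖ = 2 |s - t| / (√(1 + s²) √(1 + t²))`, this only adds
`log √(1 + x²)` to the field. The logarithmic energy is positive definite: Abel regularization
of the kernel gives a power series in the inner product whose coefficients control the moments
(`mutualEnergy_gap`), and measures on the sphere are determined by their moments
(`eq_of_mutualEnergy_le`). Consequently a probability measure that satisfies the Frostman conditions
is the unique equilibrium measure (`isEquilibriumMeasure_sphere_iff`,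
`isEquilibriumMeasure_fieldV_iff`), and everything reduces to the computation of three potentials
(`motherBody_of_potentials`, `exists_droplet`): that of the field, that of `μ_V`, and that of the
uniform distribution on the droplet.

If `a (b² - 1) ≤ 1`, the droplet is the complement of two disjoint open spherical caps of area
`a / (1 + 2a)` centred at `p₁` and `p₂`. A cap acts outside itself like a point charge at its centre
and, being the complement of a cap, it acts inside itself like a negative charge at the antipode of
its centre, up to constants. On the other side, `μ_V` is `1 + a` times the Cauchy distribution
of scale `b⁻¹` minus `a` times the one of scale `b` (`muV_add_cauchyLaw`), and a Cauchy distribution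
acts on either half plane like a charge in the other one (`chordPotential_cauchyLaw_eq`).

If `a (b² - 1) > 1`, the caps would overlap. Now `μ_V = (1 + a) ω_w - a ω_u`, where `ω_u` and `ω_w`
are the harmonic measures of the complement of the slit `[-A, A]` seen from `i b` and from `i / b`
(`muV_add_slitLaw`). In the elliptic coordinates `z = A cosh ((ρ + i β) / 2)` the points `i b` and
`i / b` have `ρ = 2u` and `ρ = 2w`, and the potential of `μ_V` is explicit there
(`chordPotential_muV_elliptic`). The droplet is the inside of the ellipse `ρ = u - w` with foci
`± A` (`ellipseDroplet`). Its potential is found by slicing it into confocal ellipses. The spherical area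
on the ellipse `r` has a density with a double pole in `e^{iα}` (`ellipseDensity`), so that the mean
of the kernel over this ellipse is given by Cauchy's formula for a derivative
(`integral_mul_ellipseDensity`, `ellipseMean_eq`), and these means have elementary primitives in `r`
for points outside and inside the ellipse (`outerPrimitive`, `innerPrimitive`), which yields
`chordPotential_confocalRegion_of_le` and `chordPotential_confocalRegion_of_ge`. Outside the droplet
its potential agrees with that of `μ_V` up to a constant, and inside it cancels the field. The
Frostman inequality outside and the mother body inequality inside are one and the same elementary
inequality, on the two sides of the boundary: `dropletGap_nonpos`.
-/

/-! ### The chordal kernel and the translation of the energies to `[0, ∞]` -/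

/-- The kernel `log (2 / ‖x - y‖)` on the sphere, with value `∞` on the diagonal. The shift by
`log 2` makes the logarithmic kernel nonnegative. -/
noncomputable def chordKernel (x y : S2) : ℝ≥0∞ :=
  if x = y then ⊤ else ENNReal.ofReal (Real.log (2 / dist x y))

theorem chordKernel_self (x : S2) : chordKernel x x = ⊤ := if_pos rfl

theorem chordKernel_of_ne {x y : S2} (h : x ≠ y) :
    chordKernel x y = ENNReal.ofReal (Real.log (2 / dist x y)) := if_neg h

theorem S2.dist_le_two (x y : S2) : dist x y ≤ 2 := by
  have h1 : ‖x.1‖ = 1 := by simp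
  have h2 : ‖y.1‖ = 1 := by simp
  rw [Subtype.dist_eq, dist_eq_norm]
  linarith [norm_sub_le x.1 y.1]

theorem log_two_div_dist_nonneg (x y : S2) : 0 ≤ Real.log (2 / dist x y) := by
  rcases eq_or_lt_of_le (dist_nonneg (x := x) (y := y)) with h | h
  · simp [← h]
  · exact Real.log_nonneg ((one_le_div h).2 (S2.dist_le_two x y))

theorem logKernel_eq_of_ne {X : Type*} [MetricSpace X] {x y : X} (h : x ≠ y) :
    logKernel x y = ((-Real.log (dist x y) : ℝ) : EReal) := by
  have hd : 0 < dist x y := dist_pos.2 h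
  rw [logKernel, ENNReal.log_inv, edist_dist, ENNReal.log_ofReal_of_pos hd, EReal.coe_neg]

theorem logKernel_self {X : Type*} [MetricSpace X] (x : X) : logKernel x x = ⊤ := by
  simp [logKernel]

theorem logKernel_eq_chordKernel (x y : S2) :
    logKernel x y = (chordKernel x y : EReal) - (Real.log 2 : ℝ) := by
  by_cases h : x = y
  · subst h
    rw [logKernel_self, chordKernel_self, EReal.coe_ennreal_top, EReal.top_sub_coe]
  · have hd : 0 < dist x y := dist_pos.2 h
    rw [logKernel_eq_of_ne h, chordKernel_of_ne h, EReal.coe_ennreal_ofReal,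
      max_eq_left (log_two_div_dist_nonneg x y), ← EReal.coe_sub,
      Real.log_div two_ne_zero hd.ne']
    congr 1
    ring

theorem measurable_chordKernel : Measurable (fun p : S2 × S2 => chordKernel p.1 p.2) := by
  unfold chordKernel
  refine Measurable.ite (measurableSet_eq_fun measurable_fst measurable_snd) measurable_const ?_
  fun_prop

theorem measurable_chordKernel_right (x : S2) : Measurable (chordKernel x) :=
  measurable_chordKernel.comp (measurable_prodMk_left (x := x))

/-- The potential `∫ log (2 / ‖x - y‖) dσ(y)`, with values in `[0, ∞]`. -/
noncomputable def chordPotential (σ : Measure S2) (x : S2) : ℝ≥0∞ := ∫⁻ y, chordKernel x y ∂σ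

theorem measurable_chordPotential (σ : Measure S2) [SFinite σ] :
    Measurable (chordPotential σ) :=
  measurable_chordKernel.lintegral_prod_right'

/-- The mutual energy `∬ log (2 / ‖x - y‖) dμ(x) dν(y)`, with values in `[0, ∞]`. -/
noncomputable def mutualEnergy (μ ν : Measure S2) : ℝ≥0∞ := ∫⁻ x, chordPotential ν x ∂μ

/-- A function that is bounded below by `-c` has, for a finite measure, the extended integral that
one gets by integrating the nonnegative function `f + c` and subtracting the mass times `c`. -/
theorem extIntegral_of_eq_sub {X : Type*} [MeasurableSpace X] (μ : Measure X) [IsFiniteMeasure μ]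
    {f : X → EReal} {g : X → ℝ≥0∞} (hg : Measurable g) {c : ℝ} (hc : 0 ≤ c)
    (hf : ∀ᵐ x ∂μ, f x = (g x : EReal) - (c : ℝ)) :
    extIntegral μ f = ((∫⁻ x, g x ∂μ : ℝ≥0∞) : EReal) - ((c * μ.real Set.univ : ℝ) : EReal) := by
  have hcc : ((c : ℝ) : EReal) = ((ENNReal.ofReal c : ℝ≥0∞) : EReal) := by
    rw [EReal.coe_ennreal_ofReal, max_eq_left hc]
  set C := ENNReal.ofReal c with hC
  have h1 : ∫⁻ x, (f x).toENNReal ∂μ = ∫⁻ x, (g x - C) ∂μ := by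
    refine lintegral_congr_ae ?_
    filter_upwards [hf] with x hx
    rw [hx, hcc, EReal.toENNReal_sub (by positivity), EReal.toENNReal_coe, EReal.toENNReal_coe]
  have h2 : ∫⁻ x, (-f x).toENNReal ∂μ = ∫⁻ x, (C - g x) ∂μ := by
    refine lintegral_congr_ae ?_
    filter_upwards [hf] with x hx
    rw [hx, hcc, EReal.neg_sub (by simp) (by right; rw [← hcc]; simp), add_comm, ← sub_eq_add_neg,
      EReal.toENNReal_sub (by positivity), EReal.toENNReal_coe, EReal.toENNReal_coe]
  have hCm : ∫⁻ _, C ∂μ = C * μ Set.univ := by simp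
  have hCfin : C * μ Set.univ ≠ ⊤ := ENNReal.mul_ne_top ENNReal.ofReal_ne_top (measure_ne_top _ _)
  have hB : ∫⁻ x, (C - g x) ∂μ ≠ ⊤ := by
    refine ne_top_of_le_ne_top hCfin ?_
    rw [← hCm]
    exact lintegral_mono fun x => tsub_le_self
  have key : ∫⁻ x, (g x - C) ∂μ + C * μ Set.univ = ∫⁻ x, g x ∂μ + ∫⁻ x, (C - g x) ∂μ := by
    rw [← hCm, ← lintegral_add_right _ measurable_const, ← lintegral_add_left hg]
    refine lintegral_congr fun x => ?_
    rcases le_total (g x) C with h | h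
    · rw [tsub_eq_zero_of_le h, zero_add, add_tsub_cancel_of_le h]
    · rw [tsub_eq_zero_of_le h, add_zero, tsub_add_cancel_of_le h]
  have hK : ((c * μ.real Set.univ : ℝ) : EReal) = ((C * μ Set.univ : ℝ≥0∞) : EReal) := by
    rw [EReal.coe_ennreal_mul, ← hcc, EReal.coe_mul, measureReal_def,
      EReal.coe_ennreal_toReal]
    exact measure_ne_top _ _
  rw [extIntegral, h1, h2, hK]
  generalize ∫⁻ x, (g x - C) ∂μ = P at *
  generalize ∫⁻ x, (C - g x) ∂μ = N at *
  generalize ∫⁻ x, g x ∂μ = G at *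
  generalize C * μ Set.univ = K at *
  lift N to NNReal using hB
  lift K to NNReal using hCfin
  induction G using ENNReal.recTopCoe with
  | top =>
    have : P = ⊤ := by
      by_contra hP
      lift P to NNReal using hP
      rw [top_add] at key
      exact ENNReal.coe_ne_top (by exact_mod_cast key)
    subst this
    simp only [EReal.coe_ennreal_top]
    change (⊤ : EReal) - ((N : ℝ) : EReal) = ⊤ - ((K : ℝ) : EReal)
    simp
  | coe G =>
    have hP : P ≠ ⊤ := by
      rintro rfl
      rw [top_add] at key
      exact ENNReal.coe_ne_top (r := G + N) (by exact_mod_cast key.symm)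
    lift P to NNReal using hP
    change ((P : ℝ) : EReal) - ((N : ℝ) : EReal) = ((G : ℝ) : EReal) - ((K : ℝ) : EReal)
    rw [← EReal.coe_sub, ← EReal.coe_sub]
    have : (P : ℝ) + K = G + N := by exact_mod_cast key
    congr 1
    linarith

theorem logPotential_eq_chordPotential (σ : Measure S2) [IsFiniteMeasure σ] (x : S2) :
    logPotential σ x =
      (chordPotential σ x : EReal) - ((Real.log 2 * σ.real Set.univ : ℝ) : EReal) :=
  extIntegral_of_eq_sub σ (measurable_chordKernel_right x) (Real.log_nonneg one_le_two)
    (.of_forall fun y => logKernel_eq_chordKernel x y)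

/-- The weighted energy in terms of the chordal kernel. The general form, for a map `j` to the
sphere, also covers the real line: there the factor `log √(1 + x²)` of the chordal distance is
absorbed into the external field. -/
theorem weightedEnergy_eq_of_map {X : Type*} [PseudoEMetricSpace X] [MeasurableSpace X]
    {j : X → S2} (hj : Measurable j) {Q : X → EReal} {q : S2 → ℝ≥0∞} (hq : Measurable q)
    {c : ℝ} (hc : 0 ≤ c)
    (h : ∀ x y : X, logKernel x y + Q x + Q y =
      ((chordKernel (j x) (j y) + q (j x) + q (j y) : ℝ≥0∞) : EReal) - (c : ℝ))
    (ν : Measure X) [IsProbabilityMeasure ν] :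
    weightedEnergy Q ν =
      ((mutualEnergy (ν.map j) (ν.map j) + 2 * ∫⁻ x, q x ∂(ν.map j) : ℝ≥0∞) : EReal)
        - ((c : ℝ) : EReal) := by
  have : IsProbabilityMeasure (ν.map j) := Measure.isProbabilityMeasure_map hj.aemeasurable
  have hq1 : Measurable (fun p : S2 × S2 => q p.1) := hq.comp measurable_fst
  have hq2 : Measurable (fun p : S2 × S2 => q p.2) := hq.comp measurable_snd
  have hG : Measurable (fun p : S2 × S2 => chordKernel p.1 p.2 + q p.1 + q p.2) :=
    (measurable_chordKernel.add hq1).add hq2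
  have hm : Measurable (fun p : X × X => chordKernel (j p.1) (j p.2) + q (j p.1) + q (j p.2)) :=
    hG.comp (hj.prodMap hj)
  rw [weightedEnergy, extIntegral_of_eq_sub (ν.prod ν) hm hc (.of_forall fun p => h p.1 p.2)]
  congr 2
  · have hmap := lintegral_map (μ := ν.prod ν) hG (hj.prodMap hj)
    rw [← Measure.map_prod_map ν ν hj hj] at hmap
    refine hmap.symm.trans ?_
    rw [lintegral_add_right _ hq2, lintegral_add_right _ hq1,
      lintegral_prod _ measurable_chordKernel.aemeasurable,
      lintegral_prod _ hq1.aemeasurable, lintegral_prod _ hq2.aemeasurable]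
    simp only [mutualEnergy, chordPotential, lintegral_const, measure_univ, mul_one]
    rw [two_mul, add_assoc]
  · simp

/-! ### Positive definiteness of the logarithmic energy on the sphere -/

theorem S2.dist_sq (x y : S2) : dist x y ^ 2 = 2 - 2 * inner ℝ x.1 y.1 := by
  have h1 : ‖x.1‖ = 1 := by simp
  have h2 : ‖y.1‖ = 1 := by simp
  rw [Subtype.dist_eq, dist_eq_norm, norm_sub_sq_real, h1, h2]
  ring

theorem S2.inner_eq_sum (x y : S2) : inner ℝ x.1 y.1 = ∑ i, x.1 i * y.1 i := by
  simp [PiLp.inner_apply, mul_comm]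

theorem S2.abs_inner_le_one (x y : S2) : |inner ℝ x.1 y.1| ≤ 1 := by
  have h1 : ‖x.1‖ = 1 := by simp
  have h2 : ‖y.1‖ = 1 := by simp
  simpa [h1, h2] using abs_real_inner_le_norm x.1 y.1

theorem S2.inner_lt_one {x y : S2} (h : x ≠ y) : inner ℝ x.1 y.1 < 1 := by
  have := S2.dist_sq x y
  have hd : 0 < dist x y := dist_pos.2 h
  nlinarith

theorem log_two_div_dist {x y : S2} (h : x ≠ y) :
    Real.log (2 / dist x y) = Real.log 2 / 2 - Real.log (1 - inner ℝ x.1 y.1) / 2 := by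
  have hd : 0 < dist x y := dist_pos.2 h
  have hi := S2.inner_lt_one h
  have h2 : Real.log (dist x y ^ 2) = Real.log 2 + Real.log (1 - inner ℝ x.1 y.1) := by
    rw [← Real.log_mul two_ne_zero (by linarith), S2.dist_sq]
    congr 1
    ring
  rw [Real.log_pow] at h2
  rw [Real.log_div two_ne_zero hd.ne']
  push_cast at h2
  linarith

/-- The Abel regularization `log √(2 / (1 - r ⟨x, y⟩))` of the chordal kernel, bounded for
`r < 1`. -/
noncomputable def abelKernel (r : ℝ) (p : S2 × S2) : ℝ :=
  Real.log 2 / 2 - Real.log (1 - r * inner ℝ p.1.1 p.2.1) / 2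

theorem one_sub_mul_inner_pos {r : ℝ} (h0 : 0 ≤ r) (h1 : r < 1) (x y : S2) :
    0 < 1 - r * inner ℝ x.1 y.1 := by
  have := abs_le.1 (S2.abs_inner_le_one x y)
  nlinarith

theorem abelKernel_nonneg {r : ℝ} (h0 : 0 ≤ r) (h1 : r < 1) (p : S2 × S2) :
    0 ≤ abelKernel r p := by
  have h := abs_le.1 (S2.abs_inner_le_one p.1 p.2)
  have h2 : Real.log (1 - r * inner ℝ p.1.1 p.2.1) ≤ Real.log 2 :=
    Real.log_le_log (one_sub_mul_inner_pos h0 h1 p.1 p.2) (by nlinarith)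
  unfold abelKernel
  linarith

theorem continuous_abelKernel {r : ℝ} (h0 : 0 ≤ r) (h1 : r < 1) : Continuous (abelKernel r) := by
  unfold abelKernel
  refine continuous_const.sub (Continuous.div_const (Continuous.log (by fun_prop) fun p => ?_) _)
  exact (one_sub_mul_inner_pos h0 h1 p.1 p.2).ne'

theorem abelKernel_le {r : ℝ} (h0 : 0 ≤ r) (h1 : r < 1) (p : S2 × S2) :
    ENNReal.ofReal (abelKernel r p) ≤ chordKernel p.1 p.2 + ENNReal.ofReal ((1 - r) / 2) := by
  obtain ⟨x, y⟩ := p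
  by_cases h : x = y
  · subst h
    simp [chordKernel_self]
  rw [chordKernel_of_ne h, ← ENNReal.ofReal_add (log_two_div_dist_nonneg x y) (by linarith)]
  refine ENNReal.ofReal_le_ofReal ?_
  rw [log_two_div_dist h, abelKernel]
  have hi := S2.inner_lt_one h
  have habs := abs_le.1 (S2.abs_inner_le_one x y)
  have hp := one_sub_mul_inner_pos h0 h1 x y
  simp only
  set s : ℝ := inner ℝ x.1 y.1
  have h3 : Real.log ((1 - s) / (1 - r * s)) ≤ (1 - s) / (1 - r * s) - 1 :=
    Real.log_le_sub_one_of_pos (div_pos (by linarith) hp)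
  have h4 : (1 - s) / (1 - r * s) - 1 ≤ 1 - r := by
    rw [sub_le_iff_le_add, div_le_iff₀ hp]
    have : 0 ≤ 1 + s * (1 - r) := by nlinarith
    nlinarith
  rw [Real.log_div (by linarith) hp.ne'] at h3
  linarith

open Filter Topology in
theorem tendsto_abelKernel {r : ℕ → ℝ} (h1 : ∀ n, r n < 1)
    (hr : Tendsto r atTop (𝓝 1)) (p : S2 × S2) :
    Tendsto (fun n => ENNReal.ofReal (abelKernel (r n) p)) atTop (𝓝 (chordKernel p.1 p.2)) := by
  obtain ⟨x, y⟩ := p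
  have ht : Tendsto (fun n => 1 - r n * inner ℝ x.1 y.1) atTop (𝓝 (1 - 1 * inner ℝ x.1 y.1)) :=
    tendsto_const_nhds.sub (hr.mul_const _)
  by_cases h : x = y
  · subst h
    have hx : inner ℝ x.1 x.1 = (1 : ℝ) := by
      rw [real_inner_self_eq_norm_sq]
      simp
    rw [chordKernel_self]
    refine ENNReal.tendsto_ofReal_nhds_top.2 ?_
    unfold abelKernel
    rw [hx] at ht
    simp only [hx] at ht ⊢
    have ht' : Tendsto (fun n => 1 - r n * 1) atTop (𝓝[>] 0) := by
      refine tendsto_nhdsWithin_iff.2 ⟨by simpa using ht, .of_forall fun n => ?_⟩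
      simpa using h1 n
    have := Real.tendsto_log_nhdsGT_zero.comp ht'
    have h2 : Tendsto (fun n => -(Real.log (1 - r n * 1) / 2)) atTop atTop :=
      tendsto_neg_atBot_atTop.comp (this.atBot_div_const two_pos)
    simpa [sub_eq_add_neg] using tendsto_atTop_add_const_left atTop (Real.log 2 / 2) h2
  · rw [chordKernel_of_ne h, log_two_div_dist h]
    refine ENNReal.tendsto_ofReal (tendsto_const_nhds.sub (Tendsto.div_const ?_ _))
    have hi := S2.inner_lt_one h
    rw [one_mul] at ht
    exact ht.log (by linarith)

/-- The moment `∫ ∏ x_{f i} dμ` of a monomial in the coordinates, the monomial being given as a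
word `f` in the indices. -/
noncomputable def coordMoment (μ : Measure S2) {k : ℕ} (f : Fin k → Fin 3) : ℝ :=
  ∫ x, ∏ i, x.1 (f i) ∂μ

theorem continuous_coordMonomial {k : ℕ} (f : Fin k → Fin 3) :
    Continuous (fun x : S2 => ∏ i, x.1 (f i)) := by
  fun_prop

theorem integrable_of_continuous_S2 (μ : Measure S2) [IsFiniteMeasure μ] {g : S2 → ℝ}
    (hg : Continuous g) : Integrable g μ :=
  hg.integrable_of_hasCompactSupport (HasCompactSupport.of_compactSpace g)

theorem integral_inner_pow (μ ν : Measure S2) [IsFiniteMeasure μ] [IsFiniteMeasure ν] (k : ℕ) :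
    ∫ p, (inner ℝ p.1.1 p.2.1 : ℝ) ^ k ∂(μ.prod ν) =
      ∑ f : Fin k → Fin 3, coordMoment μ f * coordMoment ν f := by
  have h : ∀ p : S2 × S2, (inner ℝ p.1.1 p.2.1 : ℝ) ^ k =
      ∑ f : Fin k → Fin 3, (∏ i, p.1.1 (f i)) * (∏ i, p.2.1 (f i)) := by
    intro p
    rw [S2.inner_eq_sum, Fintype.sum_pow]
    simp [Finset.prod_mul_distrib]
  simp_rw [h]
  rw [integral_finsetSum]
  · refine Finset.sum_congr rfl fun f _ => ?_
    exact integral_prod_mul (fun x : S2 => ∏ i, x.1 (f i)) (fun y : S2 => ∏ i, y.1 (f i))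
  · intro f _
    exact (integrable_of_continuous_S2 μ (continuous_coordMonomial f)).mul_prod
      (integrable_of_continuous_S2 ν (continuous_coordMonomial f))

theorem integrable_abelKernel {r : ℝ} (h0 : 0 ≤ r) (h1 : r < 1) (μ ν : Measure S2)
    [IsFiniteMeasure μ] [IsFiniteMeasure ν] : Integrable (abelKernel r) (μ.prod ν) :=
  (continuous_abelKernel h0 h1).integrable_of_hasCompactSupport
    (HasCompactSupport.of_compactSpace _)

theorem hasSum_integral_abelKernel {r : ℝ} (h0 : 0 ≤ r) (h1 : r < 1) (μ ν : Measure S2)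
    [IsProbabilityMeasure μ] [IsProbabilityMeasure ν] :
    HasSum (fun n : ℕ => r ^ (n + 1) / (n + 1) *
        ∑ f : Fin (n + 1) → Fin 3, coordMoment μ f * coordMoment ν f)
      (2 * ∫ p, abelKernel r p ∂(μ.prod ν) - Real.log 2) := by
  have hcont : ∀ n : ℕ, Continuous (fun p : S2 × S2 =>
      (r * inner ℝ p.1.1 p.2.1 : ℝ) ^ (n + 1) / (n + 1)) := fun n => by fun_prop
  have hint : ∀ n : ℕ, Integrable (fun p : S2 × S2 =>
      (r * inner ℝ p.1.1 p.2.1 : ℝ) ^ (n + 1) / (n + 1)) (μ.prod ν) := fun n =>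
    (hcont n).integrable_of_hasCompactSupport (HasCompactSupport.of_compactSpace _)
  have hbound : ∀ (n : ℕ) (p : S2 × S2),
      ‖(r * inner ℝ p.1.1 p.2.1 : ℝ) ^ (n + 1) / (n + 1)‖ ≤ r ^ n := by
    intro n p
    have hn : (0 : ℝ) < n + 1 := by positivity
    rw [norm_div, norm_pow, Real.norm_eq_abs, Real.norm_eq_abs, abs_of_pos hn, abs_mul,
      abs_of_nonneg h0, div_le_iff₀ hn]
    have h2 : r * |(inner ℝ p.1.1 p.2.1 : ℝ)| ≤ r :=
      mul_le_of_le_one_right h0 (S2.abs_inner_le_one _ _)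
    calc (r * |(inner ℝ p.1.1 p.2.1 : ℝ)|) ^ (n + 1) ≤ r ^ (n + 1) := by gcongr
      _ ≤ r ^ n := pow_le_pow_of_le_one h0 h1.le (Nat.le_succ n)
      _ ≤ r ^ n * (n + 1) :=
          le_mul_of_one_le_right (by positivity) (by linarith [n.cast_nonneg (α := ℝ)])
  have hsum := hasSum_integral_of_summable_integral_norm hint (by
    refine Summable.of_nonneg_of_le (fun n => integral_nonneg fun p => norm_nonneg _) (fun n => ?_)
      (summable_geometric_of_lt_one h0 h1)
    calc ∫ p, ‖(r * inner ℝ p.1.1 p.2.1 : ℝ) ^ (n + 1) / (n + 1)‖ ∂(μ.prod ν)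
        ≤ ∫ _, r ^ n ∂(μ.prod ν) :=
          integral_mono (hint n).norm (integrable_const _) (hbound n)
      _ = r ^ n := by simp)
  have e1 : ∫ p : S2 × S2, ∑' n : ℕ, (r * inner ℝ p.1.1 p.2.1 : ℝ) ^ (n + 1) / (n + 1) ∂(μ.prod ν)
      = 2 * ∫ p, abelKernel r p ∂(μ.prod ν) - Real.log 2 := by
    have : ∀ p : S2 × S2, ∑' n : ℕ, (r * inner ℝ p.1.1 p.2.1 : ℝ) ^ (n + 1) / (n + 1) =
        2 * abelKernel r p - Real.log 2 := by
      intro p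
      have habs : |r * inner ℝ p.1.1 p.2.1| < 1 := by
        rw [abs_mul, abs_of_nonneg h0]
        exact (mul_le_of_le_one_right h0 (S2.abs_inner_le_one _ _)).trans_lt h1
      rw [(Real.hasSum_pow_div_log_of_abs_lt_one habs).tsum_eq, abelKernel]
      ring
    simp_rw [this]
    rw [integral_sub ((integrable_abelKernel h0 h1 μ ν).const_mul 2) (integrable_const _),
      integral_const_mul]
    simp
  rw [e1] at hsum
  have e2 : (fun n : ℕ => r ^ (n + 1) / (n + 1) *
      ∑ f : Fin (n + 1) → Fin 3, coordMoment μ f * coordMoment ν f) =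
      fun n : ℕ =>
        ∫ p : S2 × S2, (r * inner ℝ p.1.1 p.2.1 : ℝ) ^ (n + 1) / (n + 1) ∂(μ.prod ν) := by
    funext n
    rw [← integral_inner_pow, ← integral_const_mul]
    refine integral_congr_ae (.of_forall fun p => ?_)
    simp only
    rw [mul_pow]
    ring
  rw [e2]
  exact hsum

/-- The regularized energy distance of two probability measures dominates the squared difference
of any of their moments. -/
theorem integral_abelKernel_gap {r : ℝ} (h0 : 0 ≤ r) (h1 : r < 1) (μ ν : Measure S2)
    [IsProbabilityMeasure μ] [IsProbabilityMeasure ν] {k : ℕ} (f : Fin (k + 1) → Fin 3) :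
    r ^ (k + 1) / (k + 1) * (coordMoment μ f - coordMoment ν f) ^ 2 / 2 ≤
      ∫ p, abelKernel r p ∂(μ.prod μ) + ∫ p, abelKernel r p ∂(ν.prod ν)
        - 2 * ∫ p, abelKernel r p ∂(μ.prod ν) := by
  have hs := ((hasSum_integral_abelKernel h0 h1 μ μ).add
    (hasSum_integral_abelKernel h0 h1 ν ν)).sub
    ((hasSum_integral_abelKernel h0 h1 μ ν).mul_left 2)
  have hterm : ∀ n : ℕ, (r ^ (n + 1) / (n + 1) *
        ∑ f : Fin (n + 1) → Fin 3, coordMoment μ f * coordMoment μ f + r ^ (n + 1) / (n + 1) *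
        ∑ f : Fin (n + 1) → Fin 3, coordMoment ν f * coordMoment ν f) - 2 * (r ^ (n + 1) / (n + 1) *
        ∑ f : Fin (n + 1) → Fin 3, coordMoment μ f * coordMoment ν f) = r ^ (n + 1) / (n + 1) *
        ∑ f : Fin (n + 1) → Fin 3, (coordMoment μ f - coordMoment ν f) ^ 2 := by
    intro n
    rw [← mul_add, ← Finset.sum_add_distrib, mul_left_comm, ← mul_sub, Finset.mul_sum,
      ← Finset.sum_sub_distrib]
    congr 1
    exact Finset.sum_congr rfl fun g _ => by ring
  have hle := le_hasSum hs k fun n _ => by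
    rw [hterm]
    exact mul_nonneg (by positivity) (Finset.sum_nonneg fun g _ => sq_nonneg _)
  rw [hterm] at hle
  have hsingle : (coordMoment μ f - coordMoment ν f) ^ 2 ≤
      ∑ f : Fin (k + 1) → Fin 3, (coordMoment μ f - coordMoment ν f) ^ 2 :=
    Finset.single_le_sum (f := fun f : Fin (k + 1) → Fin 3 =>
      (coordMoment μ f - coordMoment ν f) ^ 2) (fun g _ => sq_nonneg _) (Finset.mem_univ f)
  have := mul_le_mul_of_nonneg_left hsingle (by positivity : 0 ≤ r ^ (k + 1) / ((k : ℝ) + 1))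
  linarith

theorem mutualEnergy_eq_lintegral_prod (μ ν : Measure S2) [SFinite ν] :
    mutualEnergy μ ν = ∫⁻ p, chordKernel p.1 p.2 ∂(μ.prod ν) :=
  (lintegral_prod _ measurable_chordKernel.aemeasurable).symm

theorem integral_abelKernel_le {r : ℝ} (h0 : 0 ≤ r) (h1 : r < 1) (μ : Measure S2)
    [IsProbabilityMeasure μ] (h : mutualEnergy μ μ ≠ ⊤) :
    ∫ p, abelKernel r p ∂(μ.prod μ) ≤ (mutualEnergy μ μ).toReal + (1 - r) / 2 := by
  rw [integral_eq_lintegral_of_nonneg_ae (.of_forall (abelKernel_nonneg h0 h1))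
    (continuous_abelKernel h0 h1).aestronglyMeasurable]
  rw [← ENNReal.toReal_ofReal (r := (1 - r) / 2) (by linarith), ← ENNReal.toReal_add h (by simp)]
  refine ENNReal.toReal_mono (by simp [h]) ?_
  calc ∫⁻ p, ENNReal.ofReal (abelKernel r p) ∂(μ.prod μ)
      ≤ ∫⁻ p, (chordKernel p.1 p.2 + ENNReal.ofReal ((1 - r) / 2)) ∂(μ.prod μ) :=
        lintegral_mono fun p => abelKernel_le h0 h1 p
    _ = _ := by
        rw [lintegral_add_right _ measurable_const, mutualEnergy_eq_lintegral_prod]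
        simp

open Filter Topology in
/-- The logarithmic energy of `μ - ν` is nonnegative, with a quantitative lower bound in terms of
the moments. -/
theorem mutualEnergy_gap (μ ν : Measure S2) [IsProbabilityMeasure μ] [IsProbabilityMeasure ν]
    (hμ : mutualEnergy μ μ ≠ ⊤) (hν : mutualEnergy ν ν ≠ ⊤) {k : ℕ} (f : Fin (k + 1) → Fin 3) :
    mutualEnergy μ ν ≠ ⊤ ∧ 2 * (mutualEnergy μ ν).toReal +
      (coordMoment μ f - coordMoment ν f) ^ 2 / (2 * (k + 1)) ≤
        (mutualEnergy μ μ).toReal + (mutualEnergy ν ν).toReal := by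
  obtain ⟨r, -, hr, hlim⟩ := exists_seq_strictMono_tendsto' (zero_lt_one (α := ℝ))
  have h0 : ∀ n, 0 ≤ r n := fun n => (hr n).1.le
  have h1 : ∀ n, r n < 1 := fun n => (hr n).2
  set E := (mutualEnergy μ μ).toReal + (mutualEnergy ν ν).toReal with hE
  set Δ := (coordMoment μ f - coordMoment ν f) ^ 2 with hΔ
  set g : ℕ → ℝ := fun n => (E + (1 - r n) - r n ^ (k + 1) / (k + 1) * Δ / 2) / 2 with hg
  have hgt : Tendsto g atTop (𝓝 ((E - Δ / (2 * (k + 1))) / 2)) := by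
    have : Tendsto g atTop (𝓝 ((E + (1 - 1) - 1 ^ (k + 1) / (k + 1) * Δ / 2) / 2)) :=
      (((hlim.const_sub 1).const_add E).sub
        ((((hlim.pow (k + 1)).div_const _).mul_const _).div_const _)).div_const _
    convert this using 2
    field_simp
    ring
  have hbound : ∀ n, ∫ p, abelKernel (r n) p ∂(μ.prod ν) ≤ g n := by
    intro n
    have e1 := integral_abelKernel_gap (h0 n) (h1 n) μ ν f
    have e2 := integral_abelKernel_le (h0 n) (h1 n) μ hμ
    have e3 := integral_abelKernel_le (h0 n) (h1 n) ν hν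
    simp only [hg]
    linarith
  have hnn : ∀ n, 0 ≤ ∫ p, abelKernel (r n) p ∂(μ.prod ν) := fun n =>
    integral_nonneg (abelKernel_nonneg (h0 n) (h1 n))
  have hle : mutualEnergy μ ν ≤ ENNReal.ofReal ((E - Δ / (2 * (k + 1))) / 2) := by
    rw [mutualEnergy_eq_lintegral_prod]
    calc ∫⁻ p, chordKernel p.1 p.2 ∂(μ.prod ν)
        = ∫⁻ p, liminf (fun n => ENNReal.ofReal (abelKernel (r n) p)) atTop ∂(μ.prod ν) := by
          refine lintegral_congr fun p => ?_
          rw [(tendsto_abelKernel h1 hlim p).liminf_eq]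
      _ ≤ liminf (fun n => ∫⁻ p, ENNReal.ofReal (abelKernel (r n) p) ∂(μ.prod ν)) atTop :=
          lintegral_liminf_le fun n =>
            (continuous_abelKernel (h0 n) (h1 n)).measurable.ennreal_ofReal
      _ ≤ liminf (fun n => ENNReal.ofReal (g n)) atTop := by
          refine liminf_le_liminf (.of_forall fun n => ?_)
          rw [← ofReal_integral_eq_lintegral_ofReal (integrable_abelKernel (h0 n) (h1 n) μ ν)
            (.of_forall (abelKernel_nonneg (h0 n) (h1 n)))]
          exact ENNReal.ofReal_le_ofReal (hbound n)
      _ = _ := (ENNReal.tendsto_ofReal hgt).liminf_eq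
  have hnn' : 0 ≤ (E - Δ / (2 * (k + 1))) / 2 :=
    ge_of_tendsto' hgt fun n => (hnn n).trans (hbound n)
  refine ⟨ne_top_of_le_ne_top ENNReal.ofReal_ne_top hle, ?_⟩
  have := ENNReal.toReal_mono ENNReal.ofReal_ne_top hle
  rw [ENNReal.toReal_ofReal hnn'] at this
  linarith

/-- A probability measure on the sphere is determined by its moments. -/
theorem eq_of_coordMoment_eq (μ ν : Measure S2) [IsProbabilityMeasure μ] [IsProbabilityMeasure ν]
    (h : ∀ (k : ℕ) (f : Fin (k + 1) → Fin 3), coordMoment μ f = coordMoment ν f) : μ = ν := by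
  let c : Fin 3 → C(S2, ℝ) := fun i => ⟨fun x => x.1 i, by fun_prop⟩
  let A : Subalgebra ℝ C(S2, ℝ) := Algebra.adjoin ℝ (Set.range c)
  have hA : A.topologicalClosure = ⊤ := by
    refine ContinuousMap.subalgebra_topologicalClosure_eq_top_of_separatesPoints A ?_
    intro x y hxy
    by_contra hcon
    push Not at hcon
    refine hxy (Subtype.ext (PiLp.ext fun i => ?_))
    exact hcon (c i) ⟨c i, Algebra.subset_adjoin ⟨i, rfl⟩, rfl⟩
  have hint : ∀ (ρ : Measure S2) [IsFiniteMeasure ρ] (g : C(S2, ℝ)), Integrable g ρ :=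
    fun ρ _ g => integrable_of_continuous_S2 ρ g.continuous
  have hmem : ∀ g ∈ A, ∫ x, g x ∂μ = ∫ x, g x ∂ν := by
    intro g hg
    have hg' : g ∈ Submodule.span ℝ (Submonoid.closure (Set.range c) : Set C(S2, ℝ)) := by
      rw [← Algebra.adjoin_eq_span]
      exact hg
    clear hg
    induction hg' using Submodule.span_induction with
    | mem g hg =>
      obtain ⟨l, hl, rfl⟩ := Submonoid.exists_list_of_mem_closure hg
      obtain ⟨l', rfl⟩ : ∃ l' : List (Fin 3), l'.map c = l := by
        have := Set.range_list_map c
        have h2 : l ∈ Set.range (List.map c) := by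
          rw [this]
          exact hl
        exact h2
      rcases l' with _ | ⟨i, l'⟩
      · simp
      · have e : ∀ x : S2, ((i :: l').map c).prod x =
            ∏ j : Fin (l'.length + 1), x.1 ((i :: l').get j) := by
          intro x
          have hmap : ∀ l : List (Fin 3), (l.map c).prod x = (l.map fun i => x.1 i).prod := by
            intro l
            induction l with
            | nil => simp
            | cons i l ih =>
              simp only [List.map_cons, List.prod_cons, ContinuousMap.mul_apply, ih]
              rfl
          rw [hmap]
          rw [← List.prod_ofFn]
          congr 1
          conv_lhs => rw [← List.ofFn_get (i :: l'), List.map_ofFn]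
          rfl
        simp_rw [e]
        exact h _ _
    | zero => simp
    | add g₁ g₂ _ _ h1 h2 =>
      simp only [ContinuousMap.add_apply]
      rw [integral_add (hint μ g₁) (hint μ g₂), integral_add (hint ν g₁) (hint ν g₂), h1, h2]
    | smul r g _ h1 =>
      simp only [ContinuousMap.smul_apply, smul_eq_mul]
      rw [integral_const_mul, integral_const_mul, h1]
  have hdist : ∀ (ρ : Measure S2) [IsProbabilityMeasure ρ] (g g' : C(S2, ℝ)),
      |∫ x, g x ∂ρ - ∫ x, g' x ∂ρ| ≤ dist g g' := by
    intro ρ _ g g'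
    rw [← integral_sub (hint ρ g) (hint ρ g')]
    have := norm_integral_le_of_norm_le_const (μ := ρ) (f := fun x => g x - g' x)
      (C := dist g g') (.of_forall fun x => by
        rw [← dist_eq_norm]
        exact ContinuousMap.dist_apply_le_dist x)
    simpa using this
  refine ext_of_forall_integral_eq_of_IsFiniteMeasure fun g => ?_
  have hg : g.toContinuousMap ∈ closure (A : Set C(S2, ℝ)) := by
    have : g.toContinuousMap ∈ A.topologicalClosure := by simp [hA]
    exact this
  refine eq_of_forall_dist_le fun ε hε => ?_
  obtain ⟨g', hg', hgg'⟩ := Metric.mem_closure_iff.1 hg (ε / 2) (by positivity)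
  have h1 := hdist μ g.toContinuousMap g'
  have h2 := hdist ν g.toContinuousMap g'
  rw [hmem g' hg'] at h1
  rw [abs_le] at h1 h2
  change |∫ x, g.toContinuousMap x ∂μ - ∫ x, g.toContinuousMap x ∂ν| ≤ ε
  rw [abs_le]
  constructor <;> linarith

theorem eq_of_mutualEnergy_le (μ ν : Measure S2) [IsProbabilityMeasure μ] [IsProbabilityMeasure ν]
    (hμ : mutualEnergy μ μ ≠ ⊤) (hν : mutualEnergy ν ν ≠ ⊤)
    (h : (mutualEnergy μ μ).toReal + (mutualEnergy ν ν).toReal ≤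
      2 * (mutualEnergy μ ν).toReal) : μ = ν := by
  refine eq_of_coordMoment_eq μ ν fun k f => ?_
  have h1 := (mutualEnergy_gap μ ν hμ hν f).2
  have h2 : (coordMoment μ f - coordMoment ν f) ^ 2 / (2 * (k + 1)) ≤ 0 := by linarith
  have h3 : (0 : ℝ) < 2 * (k + 1) := by positivity
  rw [div_le_iff₀ h3, zero_mul] at h2
  have := pow_eq_zero_iff two_ne_zero |>.1 (le_antisymm h2 (sq_nonneg _))
  linarith

/-! ### A sufficient condition for being the unique equilibrium measure -/

/-- A measure of finite energy has no atoms. -/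
theorem measure_singleton_of_mutualEnergy_ne_top {ν : Measure S2} [IsFiniteMeasure ν]
    (h : mutualEnergy ν ν ≠ ⊤) (x : S2) : ν {x} = 0 := by
  by_contra hx
  refine h (top_le_iff.1 ?_)
  calc ⊤ = ⊤ * ν {x} * ν {x} := by rw [ENNReal.top_mul hx, ENNReal.top_mul hx]
    _ = ∫⁻ _ in {x}, (⊤ * ν {x}) ∂ν := by simp
    _ ≤ ∫⁻ z in {x}, chordPotential ν z ∂ν := by
        refine setLIntegral_mono' (measurableSet_singleton x) fun z hz => ?_
        rw [Set.mem_singleton_iff.1 hz]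
        calc ⊤ * ν {x} = ∫⁻ _ in {x}, ⊤ ∂ν := by simp
          _ ≤ ∫⁻ y in {x}, chordKernel x y ∂ν := by
              refine setLIntegral_mono' (measurableSet_singleton x) fun y hy => ?_
              rw [Set.mem_singleton_iff.1 hy, chordKernel_self]
          _ ≤ chordPotential ν x := setLIntegral_le_lintegral _ _
    _ ≤ mutualEnergy ν ν := setLIntegral_le_lintegral _ _

/-- If the total potential `U^μ + q` is equal to a finite constant `F` almost everywhere for `μ`
and at least `F` almost everywhere for `ν`, then the weighted energy of `ν` is at least that of
`μ`, with equality only for `ν = μ`. -/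
theorem energy_le_of_potential {q : S2 → ℝ≥0∞} (hq : Measurable q) {F : ℝ≥0∞} (hF : F ≠ ⊤)
    (μ ν : Measure S2) [IsProbabilityMeasure μ] [IsProbabilityMeasure ν]
    (hμ : ∀ᵐ x ∂μ, chordPotential μ x + q x = F)
    (hν : mutualEnergy ν ν ≠ ⊤ → ∀ᵐ x ∂ν, F ≤ chordPotential μ x + q x) :
    mutualEnergy μ μ + 2 * ∫⁻ x, q x ∂μ ≤ mutualEnergy ν ν + 2 * ∫⁻ x, q x ∂ν ∧
    (mutualEnergy ν ν + 2 * ∫⁻ x, q x ∂ν ≤ mutualEnergy μ μ + 2 * ∫⁻ x, q x ∂μ → ν = μ) := by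
  have e1 : mutualEnergy μ μ + ∫⁻ x, q x ∂μ = F := by
    rw [mutualEnergy, ← lintegral_add_right _ hq, lintegral_congr_ae hμ]
    simp
  have hμμ : mutualEnergy μ μ ≠ ⊤ := fun h => hF (by rw [← e1, h, top_add])
  have hqμ : ∫⁻ x, q x ∂μ ≠ ⊤ := fun h => hF (by rw [← e1, h, add_top])
  have hμfin : mutualEnergy μ μ + 2 * ∫⁻ x, q x ∂μ ≠ ⊤ := by finiteness
  by_cases hνfin : mutualEnergy ν ν + 2 * ∫⁻ x, q x ∂ν = ⊤
  · rw [hνfin]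
    exact ⟨le_top, fun h => absurd (top_le_iff.1 h) hμfin⟩
  obtain ⟨hνν, hqν'⟩ := ENNReal.add_ne_top.1 hνfin
  have hqν : ∫⁻ x, q x ∂ν ≠ ⊤ := fun h => hqν' (by rw [h]; simp)
  have e2 : F ≤ mutualEnergy ν μ + ∫⁻ x, q x ∂ν := by
    rw [mutualEnergy, ← lintegral_add_right _ hq]
    calc F = ∫⁻ _, F ∂ν := by simp
      _ ≤ _ := lintegral_mono_ae (hν hνν)
  obtain ⟨hfin, -⟩ := mutualEnergy_gap ν μ hνν hμμ (k := 0) (fun _ => 0)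
  have e3 : 2 * (mutualEnergy ν μ).toReal ≤
      (mutualEnergy ν ν).toReal + (mutualEnergy μ μ).toReal := by
    have := (mutualEnergy_gap ν μ hνν hμμ (k := 0) (fun _ => 0)).2
    have h0 : 0 ≤ (coordMoment ν (fun _ : Fin (0 + 1) => 0) -
      coordMoment μ (fun _ : Fin (0 + 1) => 0)) ^ 2 / (2 * (((0 : ℕ) : ℝ) + 1)) := by positivity
    linarith
  have huniq := eq_of_mutualEnergy_le ν μ hνν hμμ
  lift F to NNReal using hF
  generalize mutualEnergy μ μ = a at *
  generalize mutualEnergy ν ν = b at *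
  generalize mutualEnergy ν μ = c at *
  generalize ∫⁻ x, q x ∂μ = d at *
  generalize ∫⁻ x, q x ∂ν = e at *
  lift a to NNReal using hμμ
  lift b to NNReal using hνν
  lift c to NNReal using hfin
  lift d to NNReal using hqμ
  lift e to NNReal using hqν
  simp only [ENNReal.coe_toReal] at e3 huniq
  have e1' : (a : ℝ) + d = F := by exact_mod_cast e1
  have e2' : (F : ℝ) ≤ c + e := by exact_mod_cast e2
  constructor
  · have : (a : ℝ) + 2 * d ≤ b + 2 * e := by linarith
    exact_mod_cast this
  · intro h
    have h' : (b : ℝ) + 2 * e ≤ a + 2 * d := by exact_mod_cast h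
    exact huniq (by linarith)

/-- The condition of `energy_le_of_potential` for a space `X` that is mapped into the sphere in such
a way that the weighted kernels correspond up to a constant. -/
theorem isEquilibriumMeasure_iff_of_potential {X : Type*} [PseudoEMetricSpace X]
    [MeasurableSpace X] {j : X → S2} (hj : MeasurableEmbedding j) {Q : X → EReal}
    {q : S2 → ℝ≥0∞} (hq : Measurable q) {c : ℝ} (hc : 0 ≤ c)
    (h : ∀ x y : X, logKernel x y + Q x + Q y =
      ((chordKernel (j x) (j y) + q (j x) + q (j y) : ℝ≥0∞) : EReal) - (c : ℝ))
    {F : ℝ≥0∞} (hF : F ≠ ⊤) (μ : Measure X) [IsProbabilityMeasure μ]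
    (hμ : ∀ᵐ x ∂μ, chordPotential (μ.map j) (j x) + q (j x) = F)
    (hν : ∀ x, j x ≠ S2.north → F ≤ chordPotential (μ.map j) (j x) + q (j x))
    (ν : Measure X) : IsEquilibriumMeasure Q ν ↔ ν = μ := by
  have hprob : ∀ ρ : Measure X, IsProbabilityMeasure ρ → IsProbabilityMeasure (ρ.map j) :=
    fun ρ _ => Measure.isProbabilityMeasure_map hj.measurable.aemeasurable
  have hE : ∀ ρ : Measure X, IsProbabilityMeasure ρ → _ := fun ρ _ =>
    weightedEnergy_eq_of_map hj.measurable hq hc h ρ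
  have key : ∀ ρ : Measure X, IsProbabilityMeasure ρ →
      _ := fun ρ hρ => by
    have := hprob ρ hρ
    have := hprob μ inferInstance
    refine energy_le_of_potential hq hF (μ.map j) (ρ.map j) (hj.ae_map_iff.2 hμ) fun hfin => ?_
    have hn := measure_singleton_of_mutualEnergy_ne_top hfin S2.north
    have hn' : ∀ᵐ x ∂(ρ.map j), x ≠ S2.north := by
      rw [ae_iff]
      simpa using hn
    rw [hj.ae_map_iff] at hn' ⊢
    filter_upwards [hn'] with x hx using hν x hx
  have hmono : ∀ {u v : ℝ≥0∞}, (u : EReal) - (c : ℝ) ≤ (v : EReal) - (c : ℝ) ↔ u ≤ v := by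
    intro u v
    constructor
    · intro huv
      have := add_le_add_left huv ((c : ℝ) : EReal)
      rw [EReal.sub_add_cancel, EReal.sub_add_cancel] at this
      exact_mod_cast this
    · intro huv
      exact EReal.sub_le_sub (by exact_mod_cast huv) le_rfl
  constructor
  · rintro ⟨hν1, hν2⟩
    have h1 := hν2 μ inferInstance
    rw [hE ν hν1, hE μ inferInstance, hmono] at h1
    have h2 := (key ν hν1).2 h1
    exact hj.map_injective h2
  · rintro rfl
    refine ⟨inferInstance, fun ρ hρ => ?_⟩
    rw [hE ν inferInstance, hE ρ hρ, hmono]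
    exact (key ρ hρ).1

/-! ### The sphere in the stereographic coordinate -/

theorem S2.ofComplex_eq_stereo_symm (z : ℂ) : S2.ofComplex z = stereo.symm (z : OnePoint ℂ) := rfl

theorem S2.north_eq_stereo_symm : S2.north = stereo.symm OnePoint.infty := rfl

theorem S2.ofComplex_injective : Function.Injective S2.ofComplex := fun _ _ h =>
  OnePoint.coe_injective (stereo.symm.injective h)

theorem S2.ofComplex_ne_north (z : ℂ) : S2.ofComplex z ≠ S2.north := fun h =>
  OnePoint.coe_ne_infty z (stereo.symm.injective h)

theorem S2.exists_ofComplex {x : S2} (hx : x ≠ S2.north) : ∃ z : ℂ, x = S2.ofComplex z := by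
  rcases hw : stereo x with _ | z
  · exact absurd (stereo.symm_apply_apply x ▸ congrArg stereo.symm hw) hx
  · exact ⟨z, stereo.symm_apply_apply x ▸ congrArg stereo.symm hw⟩

@[simp] theorem S2.ofComplex_apply_zero (z : ℂ) :
    (S2.ofComplex z).1 0 = 2 * z.re / (z.re ^ 2 + z.im ^ 2 + 1) := rfl

@[simp] theorem S2.ofComplex_apply_one (z : ℂ) :
    (S2.ofComplex z).1 1 = 2 * z.im / (z.re ^ 2 + z.im ^ 2 + 1) := rfl

@[simp] theorem S2.ofComplex_apply_two (z : ℂ) :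
    (S2.ofComplex z).1 2 = (z.re ^ 2 + z.im ^ 2 - 1) / (z.re ^ 2 + z.im ^ 2 + 1) := rfl

@[simp] theorem S2.north_apply_zero : S2.north.1 0 = 0 := rfl

@[simp] theorem S2.north_apply_one : S2.north.1 1 = 0 := rfl

@[simp] theorem S2.north_apply_two : S2.north.1 2 = 1 := rfl

theorem S2.continuous_ofComplex : Continuous S2.ofComplex := by
  refine Continuous.subtype_mk ?_ _
  refine (PiLp.continuous_toLp 2 (fun _ : Fin 3 => ℝ)).comp (continuous_pi fun i => ?_)
  have hne : ∀ z : ℂ, z.re ^ 2 + z.im ^ 2 + 1 ≠ 0 := fun z => by positivity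
  fin_cases i
  · exact Continuous.div (by fun_prop) (by fun_prop) hne
  · exact Continuous.div (by fun_prop) (by fun_prop) hne
  · exact Continuous.div (by fun_prop) (by fun_prop) hne

theorem S2.measurableEmbedding_ofComplex : MeasurableEmbedding S2.ofComplex :=
  S2.continuous_ofComplex.measurableEmbedding S2.ofComplex_injective

theorem Complex.sq_norm_eq (z : ℂ) : ‖z‖ ^ 2 = z.re ^ 2 + z.im ^ 2 := by
  rw [Complex.sq_norm, Complex.normSq_apply]
  ring

theorem S2.dist_sq_eq_sum (x y : S2) :
    dist x y ^ 2 = (x.1 0 - y.1 0) ^ 2 + (x.1 1 - y.1 1) ^ 2 + (x.1 2 - y.1 2) ^ 2 := by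
  rw [Subtype.dist_eq, EuclideanSpace.dist_eq, Real.sq_sqrt (by positivity), Fin.sum_univ_three]
  simp [Real.dist_eq, sq_abs]

theorem S2.dist_sq_ofComplex (z w : ℂ) :
    dist (S2.ofComplex z) (S2.ofComplex w) ^ 2 =
      4 * ‖z - w‖ ^ 2 / ((1 + ‖z‖ ^ 2) * (1 + ‖w‖ ^ 2)) := by
  rw [S2.dist_sq_eq_sum]
  simp only [S2.ofComplex_apply_zero, S2.ofComplex_apply_one, S2.ofComplex_apply_two,
    Complex.sq_norm_eq, Complex.sub_re, Complex.sub_im]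
  have h1 : z.re ^ 2 + z.im ^ 2 + 1 ≠ 0 := by positivity
  have h2 : w.re ^ 2 + w.im ^ 2 + 1 ≠ 0 := by positivity
  rw [show 1 + (z.re ^ 2 + z.im ^ 2) = z.re ^ 2 + z.im ^ 2 + 1 by ring,
    show 1 + (w.re ^ 2 + w.im ^ 2) = w.re ^ 2 + w.im ^ 2 + 1 by ring]
  field_simp
  ring

theorem S2.dist_sq_north (w : ℂ) :
    dist S2.north (S2.ofComplex w) ^ 2 = 4 / (1 + ‖w‖ ^ 2) := by
  rw [S2.dist_sq_eq_sum]
  simp only [S2.ofComplex_apply_zero, S2.ofComplex_apply_one, S2.ofComplex_apply_two,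
    S2.north_apply_zero, S2.north_apply_one, S2.north_apply_two, Complex.sq_norm_eq]
  have h2 : w.re ^ 2 + w.im ^ 2 + 1 ≠ 0 := by positivity
  rw [show 1 + (w.re ^ 2 + w.im ^ 2) = w.re ^ 2 + w.im ^ 2 + 1 by ring]
  field_simp
  ring

theorem log_two_div_dist_eq {x y : S2} (h : x ≠ y) :
    Real.log (2 / dist x y) = Real.log 2 - Real.log (dist x y ^ 2) / 2 := by
  rw [Real.log_div two_ne_zero (dist_pos.2 h).ne', Real.log_pow]
  push_cast
  ring

theorem Real.log_four : Real.log 4 = 2 * Real.log 2 := by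
  rw [show (4 : ℝ) = 2 ^ 2 by norm_num, Real.log_pow]
  push_cast
  ring

theorem log_two_div_dist_ofComplex {z w : ℂ} (h : z ≠ w) :
    Real.log (2 / dist (S2.ofComplex z) (S2.ofComplex w)) =
      Real.log (1 + ‖z‖ ^ 2) / 2 + Real.log (1 + ‖w‖ ^ 2) / 2 - Real.log ‖z - w‖ := by
  have hn : 0 < ‖z - w‖ := norm_pos_iff.2 (sub_ne_zero.2 h)
  rw [log_two_div_dist_eq (S2.ofComplex_injective.ne h), S2.dist_sq_ofComplex,
    Real.log_div (by positivity) (by positivity), Real.log_mul (by norm_num) (by positivity),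
    Real.log_mul (by positivity) (by positivity), Real.log_pow, Real.log_four]
  push_cast
  ring

theorem log_two_div_dist_north (w : ℂ) :
    Real.log (2 / dist S2.north (S2.ofComplex w)) = Real.log (1 + ‖w‖ ^ 2) / 2 := by
  rw [log_two_div_dist_eq (S2.ofComplex_ne_north w).symm, S2.dist_sq_north,
    Real.log_div (by norm_num) (by positivity), Real.log_four]
  ring

/-- The density `1 / (π (1 + |z|²)²)` of the normalized surface measure in the stereographic
coordinate. -/
noncomputable def sphereDensity (z : ℂ) : ℝ := 1 / (Real.pi * (1 + ‖z‖ ^ 2) ^ 2)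

theorem continuous_sphereDensity : Continuous sphereDensity := by
  unfold sphereDensity
  refine Continuous.div continuous_const (by fun_prop) fun z => ?_
  have := Real.pi_pos
  positivity

/-- Polar coordinates in space with the stereographic coordinate as angular variable. -/
noncomputable def conePoint (p : Fin 3 → ℝ) : Fin 3 → ℝ :=
  ![p 0 * (2 * p 1 / (p 1 ^ 2 + p 2 ^ 2 + 1)), p 0 * (2 * p 2 / (p 1 ^ 2 + p 2 ^ 2 + 1)),
    p 0 * ((p 1 ^ 2 + p 2 ^ 2 - 1) / (p 1 ^ 2 + p 2 ^ 2 + 1))]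

/-- The Jacobian matrix of `conePoint`. -/
noncomputable def coneJacobian (p : Fin 3 → ℝ) : Matrix (Fin 3) (Fin 3) ℝ :=
  let D := p 1 ^ 2 + p 2 ^ 2 + 1
  !![2 * p 1 / D, p 0 * (2 / D - 4 * p 1 ^ 2 / D ^ 2), p 0 * (-4 * p 1 * p 2 / D ^ 2);
    2 * p 2 / D, p 0 * (-4 * p 1 * p 2 / D ^ 2), p 0 * (2 / D - 4 * p 2 ^ 2 / D ^ 2);
    (D - 2) / D, p 0 * (4 * p 1 / D ^ 2), p 0 * (4 * p 2 / D ^ 2)]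

theorem det_coneJacobian (p : Fin 3 → ℝ) :
    (coneJacobian p).det = -(p 0 ^ 2 * (4 / (p 1 ^ 2 + p 2 ^ 2 + 1) ^ 2)) := by
  have h : p 1 ^ 2 + p 2 ^ 2 + 1 ≠ 0 := by positivity
  rw [Matrix.det_fin_three]
  simp only [coneJacobian, Matrix.of_apply, Matrix.cons_val]
  field_simp
  ring

theorem HasFDerivAt.real_div {E : Type*} [NormedAddCommGroup E] [NormedSpace ℝ E] {f g : E → ℝ}
    {f' g' : E →L[ℝ] ℝ} {x : E} (hf : HasFDerivAt f f' x) (hg : HasFDerivAt g g' x)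
    (h : g x ≠ 0) :
    HasFDerivAt (fun y => f y / g y) ((g x)⁻¹ • f' - (f x / g x ^ 2) • g') x := by
  have h1 := hf.mul ((hasDerivAt_inv h).comp_hasFDerivAt x hg)
  refine h1.congr_fderiv ?_
  ext v
  simp
  field_simp
  ring

theorem hasFDerivAt_conePoint (p : Fin 3 → ℝ) :
    HasFDerivAt conePoint (LinearMap.toContinuousLinearMap (Matrix.toLin' (coneJacobian p))) p := by
  have h : p 1 ^ 2 + p 2 ^ 2 + 1 ≠ 0 := by positivity
  have h0 := hasFDerivAt_apply (𝕜 := ℝ) (F' := fun _ : Fin 3 => ℝ) 0 p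
  have h1 := hasFDerivAt_apply (𝕜 := ℝ) (F' := fun _ : Fin 3 => ℝ) 1 p
  have h2 := hasFDerivAt_apply (𝕜 := ℝ) (F' := fun _ : Fin 3 => ℝ) 2 p
  have hD := ((h1.pow 2).add (h2.pow 2)).add_const 1
  have hD' := ((h1.pow 2).add (h2.pow 2)).sub_const 1
  rw [hasFDerivAt_pi']
  intro i
  fin_cases i
  · refine ((h0.mul ((h1.const_mul 2).real_div hD h)).congr_fderiv ?_)
    ext v
    simp [coneJacobian, dotProduct, Fin.sum_univ_three]
    field_simp
    ring
  · refine ((h0.mul ((h2.const_mul 2).real_div hD h)).congr_fderiv ?_)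
    ext v
    simp [coneJacobian, dotProduct, Fin.sum_univ_three]
    field_simp
    ring
  · refine ((h0.mul (hD'.real_div hD h)).congr_fderiv ?_)
    ext v
    simp [coneJacobian, dotProduct, Fin.sum_univ_three]
    field_simp
    ring

/-- The volume-preserving identification of `ℝ × ℂ` with `ℝ³`. -/
noncomputable def realProdComplexEquiv : ℝ × ℂ ≃ᵐ (Fin 3 → ℝ) :=
  (MeasurableEquiv.prodCongr (MeasurableEquiv.refl ℝ) Complex.measurableEquivPi).trans
    (MeasurableEquiv.piFinSuccAbove (fun _ : Fin 3 => ℝ) 0).symm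

theorem realProdComplexEquiv_apply (r : ℝ) (z : ℂ) :
    realProdComplexEquiv (r, z) = ![r, z.re, z.im] := by
  funext i
  fin_cases i
  · rfl
  · rfl
  · rfl

theorem measurePreserving_realProdComplexEquiv :
    MeasurePreserving realProdComplexEquiv (volume : Measure (ℝ × ℂ)) volume := by
  refine MeasurePreserving.trans (μb := (volume : Measure (ℝ × (Fin 2 → ℝ)))) ?_ ?_
  · exact (MeasurePreserving.id volume).prod Complex.volume_preserving_equiv_pi
  · exact (volume_preserving_piFinSuccAbove (fun _ : Fin 3 => ℝ) 0).symm

theorem toLp_conePoint (r : ℝ) (z : ℂ) :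
    WithLp.toLp 2 (conePoint (realProdComplexEquiv (r, z))) = r • (S2.ofComplex z).1 := by
  rw [realProdComplexEquiv_apply]
  ext i
  fin_cases i <;> simp [conePoint]

theorem injOn_conePoint : Set.InjOn conePoint {p | 0 < p 0} := by
  intro p hp q hq h
  obtain ⟨⟨r, z⟩, rfl⟩ := realProdComplexEquiv.surjective p
  obtain ⟨⟨t, w⟩, rfl⟩ := realProdComplexEquiv.surjective q
  have h' : r • (S2.ofComplex z).1 = t • (S2.ofComplex w).1 := by
    rw [← toLp_conePoint, ← toLp_conePoint, h]
  simp only [realProdComplexEquiv_apply, Set.mem_ofPred_eq, Matrix.cons_val_zero] at hp hq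
  have hrt : r = t := by
    have := congrArg norm h'
    simpa [norm_smul, abs_of_pos hp, abs_of_pos hq] using this
  subst hrt
  have := S2.ofComplex_injective (Subtype.ext (smul_right_injective _ hp.ne' h'))
  rw [this]

theorem toSphere_north_eq_zero :
    (volume : Measure (EuclideanSpace ℝ (Fin 3))).toSphere {S2.north} = 0 := by
  rw [Measure.toSphere_apply' _ (measurableSet_singleton _)]
  refine mul_eq_zero_of_right _ (measure_mono_null (t := (ℝ ∙ S2.north.1 :
    Submodule ℝ (EuclideanSpace ℝ (Fin 3)))) ?_ (Measure.addHaar_submodule _ _ ?_))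
  · rintro _ ⟨r, -, _, ⟨_, rfl, rfl⟩, rfl⟩
    exact Submodule.smul_mem _ _ (Submodule.mem_span_singleton_self _)
  · intro h
    have : (!₂[1, 0, 0] : EuclideanSpace ℝ (Fin 3)) ∈ (ℝ ∙ S2.north.1 :
        Submodule ℝ (EuclideanSpace ℝ (Fin 3))) := h ▸ Submodule.mem_top
    obtain ⟨c, hc⟩ := Submodule.mem_span_singleton.1 this
    have := congrArg (fun v : EuclideanSpace ℝ (Fin 3) => v 0) hc
    simp at this

open scoped Pointwise in
/-- The surface measure is computed as the volume of the cone over `E`, parametrized by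
`conePoint`. -/
theorem toSphere_image_ofComplex {E : Set ℂ} (hE : MeasurableSet E) :
    (volume : Measure (EuclideanSpace ℝ (Fin 3))).toSphere (S2.ofComplex '' E) =
      ENNReal.ofReal (4 * Real.pi) * ∫⁻ z in E, ENNReal.ofReal (sphereDensity z) := by
  have hE' : MeasurableSet (S2.ofComplex '' E) :=
    S2.measurableEmbedding_ofComplex.measurableSet_image.2 hE
  have hB : MeasurableSet (Set.Ioo (0 : ℝ) 1 ×ˢ E) := measurableSet_Ioo.prod hE
  have hΩ : MeasurableSet (realProdComplexEquiv '' (Set.Ioo (0 : ℝ) 1 ×ˢ E)) :=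
    realProdComplexEquiv.measurableSet_image.2 hB
  have hsub : realProdComplexEquiv '' (Set.Ioo (0 : ℝ) 1 ×ˢ E) ⊆ {p | 0 < p 0} := by
    rintro _ ⟨⟨r, z⟩, ⟨hr, -⟩, rfl⟩
    rw [realProdComplexEquiv_apply]
    exact hr.1
  have hset : Set.Ioo (0 : ℝ) 1 • (Subtype.val '' (S2.ofComplex '' E)) =
      WithLp.ofLp ⁻¹' (conePoint '' (realProdComplexEquiv '' (Set.Ioo (0 : ℝ) 1 ×ˢ E))) := by
    ext v
    constructor
    · rintro ⟨r, hr, _, ⟨_, ⟨z, hz, rfl⟩, rfl⟩, rfl⟩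
      refine ⟨_, ⟨(r, z), ⟨hr, hz⟩, rfl⟩, ?_⟩
      have := congrArg WithLp.ofLp (toLp_conePoint r z)
      exact this
    · rintro ⟨_, ⟨⟨r, z⟩, ⟨hr, hz⟩, rfl⟩, h⟩
      refine ⟨r, hr, _, ⟨_, ⟨z, hz, rfl⟩, rfl⟩, ?_⟩
      have := toLp_conePoint r z
      simp only
      rw [← this, h]
  rw [Measure.toSphere_apply' _ hE', hset]
  have hvol := (PiLp.volume_preserving_ofLp (Fin 3)).measure_preimage_emb
    (MeasurableEquiv.toLp 2 (Fin 3 → ℝ)).symm.measurableEmbedding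
    (conePoint '' (realProdComplexEquiv '' (Set.Ioo (0 : ℝ) 1 ×ˢ E)))
  rw [hvol]
  have hcov := lintegral_abs_det_fderiv_eq_addHaar_image (volume : Measure (Fin 3 → ℝ)) hΩ
    (fun p _ => (hasFDerivAt_conePoint p).hasFDerivWithinAt) (injOn_conePoint.mono hsub)
  rw [← hcov, ← measurePreserving_realProdComplexEquiv.setLIntegral_comp_emb
    realProdComplexEquiv.measurableEmbedding]
  have hint : ∀ q : ℝ × ℂ, ENNReal.ofReal |(LinearMap.toContinuousLinearMap
      (Matrix.toLin' (coneJacobian (realProdComplexEquiv q)))).det| =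
      ENNReal.ofReal (q.1 ^ 2) * ENNReal.ofReal (4 * Real.pi * sphereDensity q.2) := by
    rintro ⟨r, z⟩
    rw [LinearMap.det_toContinuousLinearMap, LinearMap.det_toLin', det_coneJacobian,
      realProdComplexEquiv_apply, abs_neg, abs_of_nonneg (by positivity),
      ← ENNReal.ofReal_mul (by positivity), sphereDensity, Complex.sq_norm_eq]
    simp only [Matrix.cons_val]
    congr 2
    have := Real.pi_pos
    rw [add_comm 1]
    field_simp
  simp_rw [hint]
  rw [Measure.volume_eq_prod, ← Measure.prod_restrict,
    lintegral_prod_mul (f := fun r : ℝ => ENNReal.ofReal (r ^ 2))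
      (g := fun z : ℂ => ENNReal.ofReal (4 * Real.pi * sphereDensity z)) (by fun_prop) (by
      have := continuous_sphereDensity
      fun_prop)]
  have h13 : ∫⁻ r in Set.Ioo (0 : ℝ) 1, ENNReal.ofReal (r ^ 2) = ENNReal.ofReal (1 / 3) := by
    rw [restrict_Ioo_eq_restrict_Ioc, ← ofReal_integral_eq_lintegral_ofReal]
    · rw [← intervalIntegral.integral_of_le zero_le_one, integral_pow]
      norm_num
    · exact (by fun_prop : Continuous fun r : ℝ => r ^ 2).integrableOn_Ioc
    · exact .of_forall fun r => by positivity
  rw [h13]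
  simp_rw [ENNReal.ofReal_mul (show 0 ≤ 4 * Real.pi by positivity)]
  rw [lintegral_const_mul _ (by
      have := continuous_sphereDensity
      fun_prop), ← mul_assoc, ← mul_assoc]
  congr 1
  rw [finrank_euclideanSpace_fin, ← ENNReal.ofReal_natCast, ← ENNReal.ofReal_mul (by positivity),
    ← ENNReal.ofReal_mul (by positivity)]
  congr 1
  push_cast
  ring

/-- The normalized surface measure is the image of the measure `dA / (π (1 + |z|²)²)`. -/
theorem sphereMeasure_eq_map : sphereMeasure =
    (volume.withDensity fun z : ℂ => ENNReal.ofReal (sphereDensity z)).map S2.ofComplex := by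
  have htot : (volume : Measure (EuclideanSpace ℝ (Fin 3))).toSphere Set.univ =
      ENNReal.ofReal (4 * Real.pi) := by
    rw [Measure.toSphere_apply_univ, EuclideanSpace.volume_ball_fin_three,
      finrank_euclideanSpace_fin, ENNReal.ofReal_one, one_pow, one_mul, ← ENNReal.ofReal_natCast,
      ← ENNReal.ofReal_mul (by positivity)]
    congr 1
    push_cast
    ring
  ext s hs
  rw [S2.measurableEmbedding_ofComplex.map_apply,
    withDensity_apply _ (S2.measurableEmbedding_ofComplex.measurable hs)]
  have hs' : s \ {S2.north} = S2.ofComplex '' (S2.ofComplex ⁻¹' s) := by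
    ext x
    constructor
    · rintro ⟨hx, hxn⟩
      obtain ⟨z, rfl⟩ := S2.exists_ofComplex hxn
      exact ⟨z, hx, rfl⟩
    · rintro ⟨z, hz, rfl⟩
      exact ⟨hz, S2.ofComplex_ne_north z⟩
  have h1 : (volume : Measure (EuclideanSpace ℝ (Fin 3))).toSphere s =
      (volume : Measure (EuclideanSpace ℝ (Fin 3))).toSphere (s \ {S2.north}) :=
    (measure_sdiff_null toSphere_north_eq_zero).symm
  rw [sphereMeasure, Measure.smul_apply, h1, hs', toSphere_image_ofComplex
    (S2.measurableEmbedding_ofComplex.measurable hs), htot, smul_eq_mul, ← mul_assoc,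
    ENNReal.inv_mul_cancel (by simp [Real.pi_pos]) ENNReal.ofReal_ne_top, one_mul]

instance : IsProbabilityMeasure sphereMeasure := by
  refine ⟨?_⟩
  rw [sphereMeasure, Measure.smul_apply, smul_eq_mul]
  refine ENNReal.inv_mul_cancel ?_ (measure_ne_top _ _)
  exact Measure.measure_univ_ne_zero.2 (Measure.toSphere_ne_zero _)

/-- The isometry of the sphere induced by a linear isometry of the space. -/
noncomputable def S2.mapIsometry (e : EuclideanSpace ℝ (Fin 3) ≃ₗᵢ[ℝ] EuclideanSpace ℝ (Fin 3))
    (x : S2) : S2 := ⟨e x.1, by simp⟩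

theorem S2.dist_mapIsometry (e : EuclideanSpace ℝ (Fin 3) ≃ₗᵢ[ℝ] EuclideanSpace ℝ (Fin 3))
    (x y : S2) : dist (S2.mapIsometry e x) (S2.mapIsometry e y) = dist x y :=
  e.dist_map x.1 y.1

theorem S2.continuous_mapIsometry
    (e : EuclideanSpace ℝ (Fin 3) ≃ₗᵢ[ℝ] EuclideanSpace ℝ (Fin 3)) :
    Continuous (S2.mapIsometry e) :=
  (e.continuous.comp continuous_subtype_val).subtype_mk _

open scoped Pointwise in
theorem map_mapIsometry_sphereMeasure
    (e : EuclideanSpace ℝ (Fin 3) ≃ₗᵢ[ℝ] EuclideanSpace ℝ (Fin 3)) :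
    sphereMeasure.map (S2.mapIsometry e) = sphereMeasure := by
  rw [sphereMeasure, Measure.map_smul]
  congr 1
  ext s hs
  have hm := (S2.continuous_mapIsometry e).measurable
  rw [Measure.map_apply hm hs, Measure.toSphere_apply' _ (hm hs), Measure.toSphere_apply' _ hs]
  congr 1
  rw [← e.measurePreserving.measure_preimage_emb e.toHomeomorph.measurableEmbedding
    (Set.Ioo (0 : ℝ) 1 • (Subtype.val '' s))]
  congr 1
  ext v
  constructor
  · rintro ⟨r, hr, _, ⟨x, hx, rfl⟩, rfl⟩
    exact ⟨r, hr, _, ⟨_, hx, rfl⟩, (e.map_smul r x.1).symm⟩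
  · rintro ⟨r, hr, _, ⟨x, hx, rfl⟩, h⟩
    simp only at h
    refine ⟨r, hr, _, ⟨S2.mapIsometry e.symm x, ?_, rfl⟩, ?_⟩
    · rw [Set.mem_preimage]
      convert hx
      exact Subtype.ext (e.apply_symm_apply x.1)
    · refine e.injective ?_
      rw [← h]
      simp [S2.mapIsometry]

theorem S2.exists_mapIsometry (p q : S2) :
    ∃ e : EuclideanSpace ℝ (Fin 3) ≃ₗᵢ[ℝ] EuclideanSpace ℝ (Fin 3), S2.mapIsometry e p = q :=
  ⟨(ℝ ∙ (p.1 - q.1))ᗮ.reflection, Subtype.ext (Submodule.reflection_sub (by simp))⟩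

/-! ### Potentials of measures given in the stereographic coordinate -/

theorem chordKernel_ofComplex {z w : ℂ} (h : z ≠ w) :
    chordKernel (S2.ofComplex z) (S2.ofComplex w) = ENNReal.ofReal
      (Real.log (1 + ‖z‖ ^ 2) / 2 + Real.log (1 + ‖w‖ ^ 2) / 2 - Real.log ‖z - w‖) := by
  rw [chordKernel_of_ne (S2.ofComplex_injective.ne h), log_two_div_dist_ofComplex h]

theorem chordPotential_map_ofComplex (σ : Measure ℂ) [IsFiniteMeasure σ] {z : ℂ} (hz : σ {z} = 0)
    (h1 : Integrable (fun w : ℂ => Real.log (1 + ‖w‖ ^ 2)) σ)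
    (h2 : Integrable (fun w : ℂ => Real.log ‖z - w‖) σ) :
    chordPotential (σ.map S2.ofComplex) (S2.ofComplex z) = ENNReal.ofReal
      (Real.log (1 + ‖z‖ ^ 2) / 2 * σ.real Set.univ + (∫ w, Real.log (1 + ‖w‖ ^ 2) ∂σ) / 2
        - ∫ w, Real.log ‖z - w‖ ∂σ) := by
  have hne : ∀ᵐ w ∂σ, z ≠ w := by
    rw [ae_iff]
    simpa using hz
  have hint : Integrable (fun w : ℂ => Real.log (1 + ‖z‖ ^ 2) / 2 + Real.log (1 + ‖w‖ ^ 2) / 2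
      - Real.log ‖z - w‖) σ := ((integrable_const _).add (h1.div_const 2)).sub h2
  rw [chordPotential, S2.measurableEmbedding_ofComplex.lintegral_map]
  rw [lintegral_congr_ae (g := fun w => ENNReal.ofReal (Real.log (1 + ‖z‖ ^ 2) / 2 +
      Real.log (1 + ‖w‖ ^ 2) / 2 - Real.log ‖z - w‖)) (by
    filter_upwards [hne] with w hw using chordKernel_ofComplex hw)]
  rw [← ofReal_integral_eq_lintegral_ofReal hint (by
    filter_upwards [hne] with w hw
    rw [← log_two_div_dist_ofComplex hw]
    exact log_two_div_dist_nonneg _ _)]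
  congr 1
  have h3 : Integrable (fun w : ℂ => Real.log (1 + ‖z‖ ^ 2) / 2 + Real.log (1 + ‖w‖ ^ 2) / 2) σ :=
    (integrable_const _).add (h1.div_const 2)
  rw [integral_sub h3 h2, integral_add (integrable_const _) (h1.div_const 2), integral_const,
    integral_div, smul_eq_mul]
  ring

theorem chordPotential_map_ofComplex_north (σ : Measure ℂ)
    (h1 : Integrable (fun w : ℂ => Real.log (1 + ‖w‖ ^ 2)) σ) :
    chordPotential (σ.map S2.ofComplex) S2.north =
      ENNReal.ofReal ((∫ w, Real.log (1 + ‖w‖ ^ 2) ∂σ) / 2) := by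
  rw [chordPotential, S2.measurableEmbedding_ofComplex.lintegral_map, ← integral_div,
    ofReal_integral_eq_lintegral_ofReal (h1.div_const 2)]
  · refine lintegral_congr fun w => ?_
    rw [chordKernel_of_ne (S2.ofComplex_ne_north w).symm, log_two_div_dist_north]
  · refine .of_forall fun w => ?_
    have : 0 ≤ Real.log (1 + ‖w‖ ^ 2) := Real.log_nonneg (by nlinarith [sq_nonneg ‖w‖])
    simp only [Pi.zero_apply]
    positivity

/-! ### The Cauchy distribution and its potential -/

/-- The centered Cauchy distribution with scale `γ`, the balayage of a unit mass at `iγ` onto the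
real line. -/
noncomputable def cauchyLaw (γ : ℝ) : Measure ℝ :=
  volume.withDensity fun t => ENNReal.ofReal (γ / (Real.pi * (t ^ 2 + γ ^ 2)))

/-- The inclusion `ℝ → S²` into the great circle, inverse to the stereographic projection. -/
noncomputable def realPoint (t : ℝ) : S2 := S2.ofComplex t

theorem measurableEmbedding_realPoint : MeasurableEmbedding realPoint :=
  S2.measurableEmbedding_ofComplex.comp
    (Complex.continuous_ofReal.measurableEmbedding Complex.ofReal_injective)

theorem map_realPoint (ρ : Measure ℝ) :
    ρ.map realPoint = (ρ.map ((↑) : ℝ → ℂ)).map S2.ofComplex :=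
  (Measure.map_map S2.measurableEmbedding_ofComplex.measurable Complex.measurable_ofReal).symm

/-- The parametrization of the real line by the angle `θ ∈ (0, 2π)` that carries the uniform
distribution to the Cauchy distribution. -/
noncomputable def cauchyParam (γ θ : ℝ) : ℝ := γ * Real.tan ((θ - Real.pi) / 2)

theorem measurable_cauchyParam (γ : ℝ) : Measurable (cauchyParam γ) := by
  unfold cauchyParam
  simp only [Real.tan_eq_sin_div_cos]
  fun_prop

theorem half_sub_pi_mem {θ : ℝ} (hθ : θ ∈ Set.Ioo 0 (2 * Real.pi)) :
    (θ - Real.pi) / 2 ∈ Set.Ioo (-(Real.pi / 2)) (Real.pi / 2) :=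
  ⟨by linarith [hθ.1], by linarith [hθ.2]⟩

theorem injOn_cauchyParam {γ : ℝ} (hγ : 0 < γ) :
    Set.InjOn (cauchyParam γ) (Set.Ioo 0 (2 * Real.pi)) := by
  intro θ hθ φ hφ h
  have h1 := mul_left_cancel₀ hγ.ne' h
  have := Real.injOn_tan (half_sub_pi_mem hθ) (half_sub_pi_mem hφ) h1
  linarith

theorem image_cauchyParam {γ : ℝ} (hγ : 0 < γ) :
    cauchyParam γ '' Set.Ioo 0 (2 * Real.pi) = Set.univ := by
  refine Set.eq_univ_of_forall fun t => ⟨2 * Real.arctan (t / γ) + Real.pi, ⟨?_, ?_⟩, ?_⟩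
  · linarith [Real.neg_pi_div_two_lt_arctan (t / γ)]
  · linarith [Real.arctan_lt_pi_div_two (t / γ)]
  · rw [cauchyParam, show (2 * Real.arctan (t / γ) + Real.pi - Real.pi) / 2 = Real.arctan (t / γ) by
      ring, Real.tan_arctan]
    field_simp

theorem hasDerivAt_cauchyParam (γ : ℝ) {θ : ℝ} (hθ : θ ∈ Set.Ioo 0 (2 * Real.pi)) :
    HasDerivAt (cauchyParam γ) (γ / (2 * Real.cos ((θ - Real.pi) / 2) ^ 2)) θ := by
  have hc := (Real.cos_pos_of_mem_Ioo (half_sub_pi_mem hθ)).ne'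
  have h1 : HasDerivAt (fun θ : ℝ => (θ - Real.pi) / 2) (1 / 2) θ :=
    ((hasDerivAt_id θ).sub_const _).div_const 2
  have h2 := ((Real.hasDerivAt_tan hc).comp θ h1).const_mul γ
  refine h2.congr_deriv ?_
  field_simp

theorem cauchyLaw_eq_map {γ : ℝ} (hγ : 0 < γ) : cauchyLaw γ =
    (ENNReal.ofReal (2 * Real.pi)⁻¹ • volume.restrict (Set.Ioo 0 (2 * Real.pi))).map
      (cauchyParam γ) := by
  have hmeas := measurable_cauchyParam γ
  ext s hs
  have h1 := lintegral_image_eq_lintegral_abs_deriv_mul measurableSet_Ioo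
    (fun θ hθ => (hasDerivAt_cauchyParam γ hθ).hasDerivWithinAt) (injOn_cauchyParam hγ)
    (s.indicator fun t => ENNReal.ofReal (γ / (Real.pi * (t ^ 2 + γ ^ 2))))
  rw [image_cauchyParam hγ, Measure.restrict_univ, lintegral_indicator hs] at h1
  rw [cauchyLaw, withDensity_apply _ hs, h1, Measure.map_apply hmeas hs, Measure.smul_apply,
    smul_eq_mul, ← lintegral_indicator_one (hmeas hs), ← lintegral_const_mul _
      (measurable_one.indicator (hmeas hs))]
  refine setLIntegral_congr_fun measurableSet_Ioo fun θ hθ => ?_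
  by_cases hm : cauchyParam γ θ ∈ s
  · have hm' : θ ∈ cauchyParam γ ⁻¹' s := hm
    have hc := (Real.cos_pos_of_mem_Ioo (half_sub_pi_mem hθ))
    simp only [Set.indicator_of_mem hm, Set.indicator_of_mem hm', Pi.one_apply, mul_one]
    rw [← ENNReal.ofReal_mul (abs_nonneg _), abs_of_pos (by positivity), cauchyParam,
      Real.tan_eq_sin_div_cos]
    congr 1
    have hsc := Real.sin_sq_add_cos_sq ((θ - Real.pi) / 2)
    have hpi := Real.pi_pos
    have : (γ * (Real.sin ((θ - Real.pi) / 2) / Real.cos ((θ - Real.pi) / 2))) ^ 2 + γ ^ 2 =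
        γ ^ 2 / Real.cos ((θ - Real.pi) / 2) ^ 2 := by
      field_simp
      exact hsc
    rw [this]
    field_simp
  · have hm' : θ ∉ cauchyParam γ ⁻¹' s := hm
    simp only [Set.indicator_of_notMem hm, Set.indicator_of_notMem hm', mul_zero]

theorem isProbabilityMeasure_cauchyLaw {γ : ℝ} (hγ : 0 < γ) :
    IsProbabilityMeasure (cauchyLaw γ) := by
  have hmeas := measurable_cauchyParam γ
  refine ⟨?_⟩
  rw [cauchyLaw_eq_map hγ, Measure.map_apply hmeas MeasurableSet.univ, Set.preimage_univ,
    Measure.smul_apply, Measure.restrict_apply_univ, Real.volume_Ioo, sub_zero, smul_eq_mul,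
    ← ENNReal.ofReal_mul (by have := Real.pi_pos; positivity), inv_mul_cancel₀
      (by have := Real.pi_pos; positivity), ENNReal.ofReal_one]

theorem add_mul_I_ne_zero {γ : ℝ} (hγ : 0 < γ) {z : ℂ} (hz : 0 ≤ z.im) :
    z + γ * Complex.I ≠ 0 := by
  intro h
  have := congrArg Complex.im h
  simp at this
  linarith

theorem circleMap_sub_one_ne_zero {θ : ℝ} (hθ : θ ∈ Set.Ioo 0 (2 * Real.pi)) :
    circleMap 0 1 θ - 1 ≠ 0 := by
  intro h
  have hre := congrArg Complex.re h
  simp only [circleMap, Complex.ofReal_one, one_mul, zero_add, Complex.sub_re, Complex.one_re,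
    Complex.exp_ofReal_mul_I_re, Complex.zero_re] at hre
  have hs := Real.sin_pos_of_mem_Ioo (x := θ / 2) ⟨by linarith [hθ.1], by linarith [hθ.2]⟩
  have h2 : Real.cos θ = 1 - 2 * Real.sin (θ / 2) ^ 2 := by
    have h3 := Real.cos_two_mul (θ / 2)
    have h4 := Real.sin_sq_add_cos_sq (θ / 2)
    rw [mul_div_cancel₀ _ two_ne_zero] at h3
    linarith
  nlinarith

/-- The Cayley transform carries the kernel of the half-plane to that of the disc. -/
theorem log_norm_sub_cauchyParam {γ : ℝ} (hγ : 0 < γ) {z : ℂ} (hz : 0 ≤ z.im) {θ : ℝ}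
    (hθ : θ ∈ Set.Ioo 0 (2 * Real.pi)) (hne : z ≠ cauchyParam γ θ) :
    Real.log ‖z - cauchyParam γ θ‖ = Real.log ‖z + γ * Complex.I‖ +
      Real.log ‖circleMap 0 1 θ - (z - γ * Complex.I) / (z + γ * Complex.I)‖
      - Real.log ‖circleMap 0 1 θ - 1‖ := by
  have h1 := add_mul_I_ne_zero hγ hz
  have h2 := circleMap_sub_one_ne_zero hθ
  have h3 : z - cauchyParam γ θ ≠ 0 := sub_ne_zero.2 hne
  have hc : (Real.cos ((θ - Real.pi) / 2) : ℂ) ≠ 0 := by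
    exact_mod_cast (Real.cos_pos_of_mem_Ioo (half_sub_pi_mem hθ)).ne'
  have hE : circleMap 0 1 θ = -((Real.cos ((θ - Real.pi) / 2) : ℂ) +
      (Real.sin ((θ - Real.pi) / 2) : ℂ) * Complex.I) ^ 2 := by
    rw [Complex.ofReal_cos, Complex.ofReal_sin, ← Complex.exp_mul_I, ← Complex.exp_nat_mul,
      circleMap, Complex.ofReal_one, one_mul, zero_add, ← neg_one_mul, ← Complex.exp_pi_mul_I,
      ← Complex.exp_add]
    congr 1
    push_cast
    ring
  have hsc : (Real.cos ((θ - Real.pi) / 2) : ℂ) ^ 2 +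
      (Real.sin ((θ - Real.pi) / 2) : ℂ) ^ 2 = 1 := by
    exact_mod_cast Real.cos_sq_add_sin_sq ((θ - Real.pi) / 2)
  -- The Moebius relation between the point `t` of the line and the point `e^{iθ}` of the circle.
  have key : (z - cauchyParam γ θ) * (circleMap 0 1 θ - 1) = (z + γ * Complex.I) *
      (circleMap 0 1 θ - (z - γ * Complex.I) / (z + γ * Complex.I)) := by
    have hct : (cauchyParam γ θ : ℂ) = γ * ((Real.sin ((θ - Real.pi) / 2) : ℂ) /
        (Real.cos ((θ - Real.pi) / 2) : ℂ)) := by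
      rw [cauchyParam, Real.tan_eq_sin_div_cos, Complex.ofReal_mul, Complex.ofReal_div]
    rw [mul_sub (z + γ * Complex.I), mul_div_cancel₀ _ h1, hE, hct]
    generalize (Real.cos ((θ - Real.pi) / 2) : ℂ) = c at *
    generalize (Real.sin ((θ - Real.pi) / 2) : ℂ) = s at *
    have hI := Complex.I_sq
    have e1 : -(c + s * Complex.I) ^ 2 - 1 = -2 * c * (c + s * Complex.I) := by
      linear_combination hsc - s ^ 2 * hI
    have e2 : (z - γ * (s / c)) * c = z * c - γ * s := by
      field_simp
    rw [e1]
    linear_combination -2 * (c + s * Complex.I) * e2 +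
      (s ^ 2 * (z + γ * Complex.I) + 2 * c * s * γ) * hI - (z - γ * Complex.I) * hsc
  have h4 : circleMap 0 1 θ - (z - γ * Complex.I) / (z + γ * Complex.I) ≠ 0 := by
    intro h
    rw [h, mul_zero] at key
    exact mul_ne_zero h3 h2 key
  have hlog := congrArg (fun u : ℂ => Real.log ‖u‖) key
  simp only [norm_mul] at hlog
  rw [Real.log_mul (norm_ne_zero_iff.2 h3) (norm_ne_zero_iff.2 h2),
    Real.log_mul (norm_ne_zero_iff.2 h1) (norm_ne_zero_iff.2 h4)] at hlog
  linarith

theorem norm_cayley_le_one {γ : ℝ} (hγ : 0 < γ) {z : ℂ} (hz : 0 ≤ z.im) :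
    ‖(z - γ * Complex.I) / (z + γ * Complex.I)‖ ≤ 1 := by
  rw [norm_div, div_le_one (norm_pos_iff.2 (add_mul_I_ne_zero hγ hz))]
  refine le_of_sq_le_sq ?_ (norm_nonneg _)
  rw [Complex.sq_norm_eq, Complex.sq_norm_eq]
  simp
  nlinarith

/-- The logarithmic potential of the Cauchy distribution: the potential of the line agrees in the
upper half plane with that of a unit mass at `-iγ`. -/
theorem integrable_log_norm_sub_cauchyLaw {γ : ℝ} (hγ : 0 < γ) {z : ℂ} (hz : 0 ≤ z.im) :
    Integrable (fun t : ℝ => Real.log ‖z - t‖) (cauchyLaw γ) ∧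
      ∫ t : ℝ, Real.log ‖z - t‖ ∂(cauchyLaw γ) = Real.log ‖z + γ * Complex.I‖ := by
  set w₀ := (z - γ * Complex.I) / (z + γ * Complex.I) with hw₀
  have hpi := Real.pi_pos
  have hmeas := measurable_cauchyParam γ
  have hae : (fun θ : ℝ => Real.log ‖z - cauchyParam γ θ‖) =ᵐ[volume.restrict
      (Set.Ioo 0 (2 * Real.pi))] fun θ => Real.log ‖z + γ * Complex.I‖ +
      Real.log ‖circleMap 0 1 θ - w₀‖ - Real.log ‖circleMap 0 1 θ - 1‖ := by
    have hnull : volume {θ | θ ∈ Set.Ioo 0 (2 * Real.pi) ∧ z = cauchyParam γ θ} = 0 := by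
      refine Set.Subsingleton.measure_zero ?_ _
      rintro θ ⟨hθ, h1⟩ φ ⟨hφ, h2⟩
      refine injOn_cauchyParam hγ hθ hφ ?_
      exact_mod_cast h1.symm.trans h2
    rw [Filter.EventuallyEq, ae_restrict_iff' measurableSet_Ioo]
    filter_upwards [measure_eq_zero_iff_ae_notMem.1 hnull] with θ hθ hmem
    exact log_norm_sub_cauchyParam hγ hz hmem fun h => hθ ⟨hmem, h⟩
  have hI : ∀ a : ℂ, IntegrableOn (fun θ : ℝ => Real.log ‖circleMap 0 1 θ - a‖)
      (Set.Ioo 0 (2 * Real.pi)) := by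
    intro a
    have := circleIntegrable_log_norm_sub_const (a := a) (c := 0) 1
    rw [CircleIntegrable, intervalIntegrable_iff_integrableOn_Ioo_of_le (by positivity)] at this
    exact this
  have hA : ∀ a : ℂ, ‖a‖ ≤ 1 → ∫ θ in Set.Ioo 0 (2 * Real.pi),
      Real.log ‖circleMap 0 1 θ - a‖ = 0 := by
    intro a ha
    have := circleAverage_log_norm_sub_const_of_mem_closedBall (a := a) (c := 0) (R := 1)
      (by simpa using ha)
    rw [Real.circleAverage, Real.log_one, smul_eq_mul, mul_eq_zero] at this
    rw [← integral_Ioc_eq_integral_Ioo, ← intervalIntegral.integral_of_le (by positivity)]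
    exact this.resolve_left (by positivity)
  have hI1 : IntegrableOn (fun _ : ℝ => Real.log ‖z + γ * Complex.I‖)
      (Set.Ioo 0 (2 * Real.pi)) := integrable_const _
  have hI2 : IntegrableOn (fun θ => Real.log ‖z + γ * Complex.I‖ +
      Real.log ‖circleMap 0 1 θ - w₀‖) (Set.Ioo 0 (2 * Real.pi)) :=
    hI1.add (hI w₀)
  have hint : IntegrableOn (fun θ : ℝ => Real.log ‖z - cauchyParam γ θ‖)
      (Set.Ioo 0 (2 * Real.pi)) := (integrable_congr hae).2 (hI2.sub (hI 1))
  have hval : ∫ θ in Set.Ioo 0 (2 * Real.pi), Real.log ‖z - cauchyParam γ θ‖ =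
      2 * Real.pi * Real.log ‖z + γ * Complex.I‖ := by
    rw [integral_congr_ae hae, integral_sub hI2 (hI 1), integral_add hI1 (hI w₀),
      hA w₀ (norm_cayley_le_one hγ hz),
      hA 1 (by simp)]
    simp [hpi.le]
  have hmf : Measurable fun t : ℝ => Real.log ‖z - t‖ := by fun_prop
  rw [cauchyLaw_eq_map hγ]
  constructor
  · rw [integrable_map_measure hmf.aestronglyMeasurable hmeas.aemeasurable]
    exact hint.smul_measure ENNReal.ofReal_ne_top
  · rw [integral_map hmeas.aemeasurable hmf.aestronglyMeasurable, integral_smul_measure, hval,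
      ENNReal.toReal_ofReal (by positivity), smul_eq_mul]
    field_simp

theorem integral_log_one_add_sq_cauchyLaw {γ : ℝ} (hγ : 0 < γ) :
    Integrable (fun t : ℝ => Real.log (1 + t ^ 2)) (cauchyLaw γ) ∧
      ∫ t : ℝ, Real.log (1 + t ^ 2) ∂(cauchyLaw γ) = 2 * Real.log (1 + γ) := by
  have h := integrable_log_norm_sub_cauchyLaw hγ (z := Complex.I) (by simp)
  have e : ∀ t : ℝ, Real.log (1 + t ^ 2) = 2 * Real.log ‖Complex.I - t‖ := by
    intro t
    have h1 : ‖Complex.I - t‖ ^ 2 = 1 + t ^ 2 := by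
      rw [Complex.sq_norm_eq]
      simp
      ring
    rw [← h1, Real.log_pow]
    push_cast
    ring
  simp_rw [e]
  refine ⟨h.1.const_mul 2, ?_⟩
  rw [integral_const_mul, h.2]
  congr 2
  rw [show Complex.I + γ * Complex.I = ((1 + γ : ℝ) : ℂ) * Complex.I by push_cast; ring, norm_mul,
    Complex.norm_I, mul_one, Complex.norm_real, Real.norm_of_nonneg (by linarith)]

theorem cauchyLaw_singleton (γ t : ℝ) : cauchyLaw γ {t} = 0 :=
  withDensity_absolutelyContinuous _ _ (by simp)

theorem chordPotential_cauchyLaw {γ : ℝ} (hγ : 0 < γ) {z : ℂ} (hz : 0 ≤ z.im) :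
    chordPotential ((cauchyLaw γ).map realPoint) (S2.ofComplex z) = ENNReal.ofReal
      (Real.log (1 + ‖z‖ ^ 2) / 2 + Real.log (1 + γ) - Real.log ‖z + γ * Complex.I‖) := by
  have := isProbabilityMeasure_cauchyLaw hγ
  have hm := Complex.measurable_ofReal
  have hme : MeasurableEmbedding ((↑) : ℝ → ℂ) :=
    Complex.continuous_ofReal.measurableEmbedding Complex.ofReal_injective
  have h1 := integral_log_one_add_sq_cauchyLaw hγ
  have h2 := integrable_log_norm_sub_cauchyLaw hγ hz
  have : IsProbabilityMeasure ((cauchyLaw γ).map ((↑) : ℝ → ℂ)) :=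
    Measure.isProbabilityMeasure_map hm.aemeasurable
  rw [map_realPoint, chordPotential_map_ofComplex]
  · rw [hme.integral_map, hme.integral_map, h2.2]
    simp only [Complex.norm_real, Real.norm_eq_abs, sq_abs, h1.2, probReal_univ]
    congr 1
    ring
  · rw [Measure.map_apply hm (measurableSet_singleton z)]
    have hs : (((↑) : ℝ → ℂ) ⁻¹' {z}).Subsingleton :=
      Set.subsingleton_singleton.preimage Complex.ofReal_injective
    rcases hs.eq_empty_or_singleton with h | ⟨t, h⟩ <;> rw [h]
    · simp
    · exact cauchyLaw_singleton γ t
  · rw [hme.integrable_map_iff]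
    simpa [Function.comp_def] using h1.1
  · rw [hme.integrable_map_iff]
    exact h2.1

theorem chordPotential_cauchyLaw_north {γ : ℝ} (hγ : 0 < γ) :
    chordPotential ((cauchyLaw γ).map realPoint) S2.north = ENNReal.ofReal (Real.log (1 + γ)) := by
  have hme : MeasurableEmbedding ((↑) : ℝ → ℂ) :=
    Complex.continuous_ofReal.measurableEmbedding Complex.ofReal_injective
  have h1 := integral_log_one_add_sq_cauchyLaw hγ
  rw [map_realPoint, chordPotential_map_ofComplex_north]
  · rw [hme.integral_map]
    simp only [Complex.norm_real, Real.norm_eq_abs, sq_abs, h1.2]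
    congr 1
    ring
  · rw [hme.integrable_map_iff]
    simpa [Function.comp_def] using h1.1

/-! ### The potential of the uniform distribution on a spherical cap -/

theorem Complex.setLIntegral_ball_eq_polar {f : ℂ → ℝ≥0∞} (hf : Measurable f) (R : ℝ) :
    ∫⁻ w in Metric.ball 0 R, f w = ∫⁻ r in Set.Ioo 0 R, ENNReal.ofReal r *
      ∫⁻ θ in Set.Ioo (-Real.pi) Real.pi, f (circleMap 0 r θ) := by
  have hind : Measurable ((Metric.ball (0 : ℂ) R).indicator f) :=
    hf.indicator measurableSet_ball
  have hcm : Measurable fun p : ℝ × ℝ => circleMap 0 p.1 p.2 := by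
    unfold circleMap
    fun_prop
  have hpol : ∀ p : ℝ × ℝ, Complex.polarCoord.symm p = circleMap 0 p.1 p.2 := by
    intro p
    rw [Complex.polarCoord_symm_apply, circleMap, Complex.exp_mul_I]
    simp
  rw [← lintegral_indicator measurableSet_ball, ← Complex.lintegral_comp_polarCoord_symm]
  simp_rw [hpol]
  change ∫⁻ p in Set.Ioi 0 ×ˢ Set.Ioo (-Real.pi) Real.pi, _ = _
  rw [Measure.volume_eq_prod, setLIntegral_prod _ (by
    refine Measurable.aemeasurable ?_
    simp only [smul_eq_mul]
    exact (ENNReal.measurable_ofReal.comp measurable_fst).mul (hind.comp hcm))]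
  rw [← lintegral_indicator measurableSet_Ioi, ← lintegral_indicator measurableSet_Ioo]
  refine lintegral_congr fun r => ?_
  by_cases h0 : 0 < r
  · rw [Set.indicator_of_mem (Set.mem_Ioi.2 h0)]
    have hn : ∀ θ, circleMap 0 r θ ∈ Metric.ball (0 : ℂ) R ↔ r < R := fun θ => by
      simp [abs_of_pos h0]
    by_cases h1 : r < R
    · rw [Set.indicator_of_mem (Set.mem_Ioo.2 ⟨h0, h1⟩), ← lintegral_const_mul' _ _ (by simp)]
      refine lintegral_congr fun θ => ?_
      rw [Set.indicator_of_mem ((hn θ).2 h1), smul_eq_mul]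
    · rw [Set.indicator_of_notMem (fun h => h1 h.2)]
      refine (lintegral_congr fun θ => ?_).trans lintegral_zero
      rw [Set.indicator_of_notMem (fun h => h1 ((hn θ).1 h)), smul_zero]
  · rw [Set.indicator_of_notMem (fun h => h0 (Set.mem_Ioi.1 h)),
      Set.indicator_of_notMem (fun h => h0 h.1)]

theorem integral_log_norm_sub_circleMap {z : ℂ} {r : ℝ} (h0 : 0 < r) (h1 : r < ‖z‖) :
    ∫ θ in Set.Ioo (-Real.pi) Real.pi, Real.log ‖z - circleMap 0 r θ‖ =
      2 * Real.pi * Real.log ‖z‖ := by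
  have hpi := Real.pi_pos
  have h := circleAverage_log_norm_sub_const_eq_log_radius_add_posLog (a := z) (c := 0) h0.ne'
  have h2 : (r⁻¹ * ‖(0 : ℂ) - z‖).posLog = Real.log ‖z‖ - Real.log r := by
    rw [zero_sub, norm_neg, Real.posLog_eq_log, Real.log_mul (by positivity) (by
      have := h0.trans h1
      positivity), Real.log_inv]
    · ring
    · rw [abs_of_nonneg (by positivity), inv_mul_eq_div, one_le_div h0]
      exact h1.le
  rw [h2, Real.circleAverage, smul_eq_mul] at h
  have hper : Function.Periodic (fun θ : ℝ => Real.log ‖circleMap 0 r θ - z‖) (2 * Real.pi) :=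
    fun θ => by simp only [periodic_circleMap 0 r θ]
  have h3 := hper.intervalIntegral_add_eq 0 (-Real.pi)
  rw [zero_add, show -Real.pi + 2 * Real.pi = Real.pi by ring] at h3
  rw [h3, intervalIntegral.integral_of_le (by linarith), integral_Ioc_eq_integral_Ioo] at h
  simp_rw [norm_sub_rev z]
  field_simp at h
  linarith

/-- The constant `∫ log √(1 + |w|²)` over the disc of spherical mass `τ`. -/
noncomputable def capConst (τ : ℝ) : ℝ :=
  ∫ r in Set.Ioo 0 √(τ / (1 - τ)), r / (1 + r ^ 2) ^ 2 * Real.log (1 + r ^ 2)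

theorem integral_radial_density (R : ℝ) (hR : 0 ≤ R) :
    ∫ r in Set.Ioo 0 R, 2 * r / (1 + r ^ 2) ^ 2 = R ^ 2 / (1 + R ^ 2) := by
  rw [← integral_Ioc_eq_integral_Ioo, ← intervalIntegral.integral_of_le hR]
  have hd : ∀ r ∈ Set.uIcc 0 R, HasDerivAt (fun r : ℝ => r ^ 2 / (1 + r ^ 2))
      (2 * r / (1 + r ^ 2) ^ 2) r := by
    intro r _
    have h1 : HasDerivAt (fun r : ℝ => r ^ 2) (2 * r) r := by simpa using hasDerivAt_pow 2 r
    have hne : 1 + r ^ 2 ≠ 0 := by positivity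
    refine (h1.div (h1.const_add 1) hne).congr_deriv ?_
    field_simp
    ring
  rw [intervalIntegral.integral_eq_sub_of_hasDerivAt hd]
  · simp
  · refine Continuous.intervalIntegrable ?_ _ _
    exact Continuous.div (by fun_prop) (by fun_prop) fun r => by positivity

theorem continuous_radial_density : Continuous fun r : ℝ => 2 * r / (1 + r ^ 2) ^ 2 :=
  Continuous.div (by fun_prop) (by fun_prop) fun r => by positivity

/-- The normalized surface measure of a disc about the origin, tested against a function whose
circle averages `g` are known. -/
theorem setLIntegral_ball_sphereDensity {k : ℂ → ℝ} (hk : Measurable k) {R : ℝ} {g : ℝ → ℝ}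
    (hg : Continuous g) (hk0 : ∀ w ∈ Metric.ball (0 : ℂ) R, 0 ≤ k w)
    (hint : ∀ r ∈ Set.Ioo 0 R, IntegrableOn (fun θ => k (circleMap 0 r θ))
      (Set.Ioo (-Real.pi) Real.pi))
    (havg : ∀ r ∈ Set.Ioo 0 R, ∫ θ in Set.Ioo (-Real.pi) Real.pi, k (circleMap 0 r θ) =
      2 * Real.pi * g r) :
    ∫⁻ w in Metric.ball 0 R, ENNReal.ofReal (k w) * ENNReal.ofReal (sphereDensity w) =
      ENNReal.ofReal (∫ r in Set.Ioo 0 R, g r * (2 * r / (1 + r ^ 2) ^ 2)) := by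
  have hpi := Real.pi_pos
  have hdm : Measurable fun w => ENNReal.ofReal (sphereDensity w) :=
    continuous_sphereDensity.measurable.ennreal_ofReal
  have hnn : ∀ r ∈ Set.Ioo 0 R, ∀ θ, 0 ≤ k (circleMap 0 r θ) := fun r hr θ => hk0 _ (by
    simp [abs_of_pos hr.1, hr.2])
  refine (Complex.setLIntegral_ball_eq_polar (hk.ennreal_ofReal.mul hdm) R).trans ?_
  have e1 : ∀ r ∈ Set.Ioo 0 R, ENNReal.ofReal r * ∫⁻ θ in Set.Ioo (-Real.pi) Real.pi,
      ENNReal.ofReal (k (circleMap 0 r θ)) * ENNReal.ofReal (sphereDensity (circleMap 0 r θ)) =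
      ENNReal.ofReal (g r * (2 * r / (1 + r ^ 2) ^ 2)) := by
    intro r hr
    have hd : ∀ θ, sphereDensity (circleMap 0 r θ) = 1 / (Real.pi * (1 + r ^ 2) ^ 2) := by
      intro θ
      simp [sphereDensity]
    simp_rw [hd]
    rw [lintegral_mul_const' _ _ (by simp), ← ofReal_integral_eq_lintegral_ofReal (hint r hr)
      (.of_forall (hnn r hr)), havg r hr, ← ENNReal.ofReal_mul' (by positivity),
      ← ENNReal.ofReal_mul hr.1.le]
    congr 1
    field_simp
  have hi : IntegrableOn (fun r : ℝ => g r * (2 * r / (1 + r ^ 2) ^ 2)) (Set.Ioo 0 R) :=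
    (hg.mul continuous_radial_density).integrableOn_Icc.mono_set Set.Ioo_subset_Icc_self
  rw [ofReal_integral_eq_lintegral_ofReal hi]
  · exact setLIntegral_congr_fun measurableSet_Ioo e1
  · rw [Filter.EventuallyLE, ae_restrict_iff' measurableSet_Ioo]
    refine .of_forall fun r hr => ?_
    have h1 : 0 ≤ ∫ θ in Set.Ioo (-Real.pi) Real.pi, k (circleMap 0 r θ) :=
      integral_nonneg (hnn r hr)
    rw [havg r hr] at h1
    have h2 : 0 ≤ g r := by
      by_contra hcon
      push Not at hcon
      nlinarith
    exact mul_nonneg h2 (div_nonneg (mul_nonneg two_pos.le hr.1.le) (sq_nonneg _))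

theorem integral_capKernel {A R : ℝ} (hR : 0 ≤ R) :
    ∫ r in Set.Ioo 0 R, (A + Real.log (1 + r ^ 2) / 2) * (2 * r / (1 + r ^ 2) ^ 2) =
      A * (R ^ 2 / (1 + R ^ 2)) +
        ∫ r in Set.Ioo 0 R, r / (1 + r ^ 2) ^ 2 * Real.log (1 + r ^ 2) := by
  have hc : Continuous fun r : ℝ => r / (1 + r ^ 2) ^ 2 * Real.log (1 + r ^ 2) :=
    (Continuous.div (by fun_prop) (by fun_prop) fun r => by positivity).mul
      (Continuous.log (by fun_prop) fun r => by positivity)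
  rw [← integral_radial_density R hR, ← integral_const_mul, ← integral_add]
  · refine integral_congr_ae (.of_forall fun r => ?_)
    simp only
    ring
  · exact (continuous_radial_density.integrableOn_Icc.mono_set Set.Ioo_subset_Icc_self).const_mul A
  · exact hc.integrableOn_Icc.mono_set Set.Ioo_subset_Icc_self

/-- The open cap about `p` of normalized area `τ`. -/
def openCap (p : S2) (τ : ℝ) : Set S2 := {x | dist x p ^ 2 < 4 * τ}

theorem isOpen_openCap (p : S2) (τ : ℝ) : IsOpen (openCap p τ) :=
  isOpen_lt (by fun_prop) continuous_const

theorem ofComplex_preimage_openCap {τ : ℝ} (h1 : τ < 1) :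
    S2.ofComplex ⁻¹' openCap (S2.ofComplex 0) τ = Metric.ball 0 √(τ / (1 - τ)) := by
  ext w
  have h2 : 0 < 1 - τ := by linarith
  simp only [openCap, Set.mem_preimage, Set.mem_ofPred_eq, S2.dist_sq_ofComplex, sub_zero,
    norm_zero, mem_ball_zero_iff]
  rw [Real.lt_sqrt (norm_nonneg w), div_lt_iff₀ (by positivity), lt_div_iff₀ h2]
  constructor <;> intro h <;> nlinarith

theorem sphereMeasure_restrict_openCap_zero {τ : ℝ} (h1 : τ < 1) :
    sphereMeasure.restrict (openCap (S2.ofComplex 0) τ) = ((volume.restrict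
      (Metric.ball 0 √(τ / (1 - τ)))).withDensity fun z : ℂ =>
        ENNReal.ofReal (sphereDensity z)).map S2.ofComplex := by
  rw [sphereMeasure_eq_map, Measure.restrict_map S2.measurableEmbedding_ofComplex.measurable
    (isOpen_openCap _ _).measurableSet, ofComplex_preimage_openCap h1,
    restrict_withDensity measurableSet_ball]

theorem sq_sqrt_div_one_sub {τ : ℝ} (h0 : 0 < τ) (h1 : τ < 1) :
    √(τ / (1 - τ)) ^ 2 / (1 + √(τ / (1 - τ)) ^ 2) = τ := by
  have h2 : 0 < 1 - τ := by linarith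
  rw [Real.sq_sqrt (by positivity)]
  field_simp
  ring

/-- A cap about the south pole is a disc in the stereographic coordinate, with a radial density. -/
theorem chordPotential_openCap_zero {τ : ℝ} (h0 : 0 < τ) (h1 : τ < 1) {x : S2}
    (hx : x ∉ openCap (S2.ofComplex 0) τ) :
    chordPotential (sphereMeasure.restrict (openCap (S2.ofComplex 0) τ)) x =
      ENNReal.ofReal (τ * Real.log (2 / dist x (S2.ofComplex 0)) + capConst τ) := by
  have hpi := Real.pi_pos
  have hdm : Measurable fun w => ENNReal.ofReal (sphereDensity w) :=
    continuous_sphereDensity.measurable.ennreal_ofReal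
  set R := √(τ / (1 - τ)) with hRdef
  have hR : 0 ≤ R := Real.sqrt_nonneg _
  have hkm : Measurable fun w => chordKernel x (S2.ofComplex w) :=
    (measurable_chordKernel_right x).comp S2.measurableEmbedding_ofComplex.measurable
  rw [sphereMeasure_restrict_openCap_zero h1, chordPotential,
    S2.measurableEmbedding_ofComplex.lintegral_map, ← hRdef,
    lintegral_withDensity_eq_lintegral_mul _ hdm hkm]
  simp only [Pi.mul_apply]
  simp_rw [mul_comm (ENNReal.ofReal (sphereDensity _))]
  have hval : ∫ r in Set.Ioo 0 R, (Real.log (2 / dist x (S2.ofComplex 0)) +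
      Real.log (1 + r ^ 2) / 2) * (2 * r / (1 + r ^ 2) ^ 2) =
      τ * Real.log (2 / dist x (S2.ofComplex 0)) + capConst τ := by
    rw [integral_capKernel hR, sq_sqrt_div_one_sub h0 h1, mul_comm τ]
    rfl
  have hgc : Continuous fun r : ℝ => Real.log (2 / dist x (S2.ofComplex 0)) +
      Real.log (1 + r ^ 2) / 2 :=
    continuous_const.add ((Continuous.log (by fun_prop) fun r => by positivity).div_const 2)
  rw [← hval]
  by_cases hn : x = S2.north
  · subst hn
    have hker : ∀ w, chordKernel S2.north (S2.ofComplex w) =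
        ENNReal.ofReal (Real.log (1 + ‖w‖ ^ 2) / 2) := fun w => by
      rw [chordKernel_of_ne (S2.ofComplex_ne_north w).symm, log_two_div_dist_north]
    simp_rw [hker]
    refine setLIntegral_ball_sphereDensity (by fun_prop) hgc ?_ ?_ ?_
    · intro w _
      have : 0 ≤ Real.log (1 + ‖w‖ ^ 2) := Real.log_nonneg (by nlinarith [sq_nonneg ‖w‖])
      positivity
    · intro r hr
      simp
    · intro r hr
      rw [log_two_div_dist_north]
      simp [hpi.le]
      exact Or.inl (two_mul _).symm
  · obtain ⟨z, rfl⟩ := S2.exists_ofComplex hn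
    have hz : R ≤ ‖z‖ := by
      have : z ∉ S2.ofComplex ⁻¹' openCap (S2.ofComplex 0) τ := hx
      rw [ofComplex_preimage_openCap h1] at this
      simpa using this
    have hz0 : z ≠ 0 := by
      rintro rfl
      refine hx ?_
      simp [openCap, h0]
    have hzw : ∀ w ∈ Metric.ball (0 : ℂ) R, z ≠ w := by
      rintro w hw rfl
      simp at hw
      linarith
    refine (setLIntegral_congr_fun measurableSet_ball fun w hw => ?_).trans
      (setLIntegral_ball_sphereDensity (k := fun w => Real.log (1 + ‖z‖ ^ 2) / 2 +
        Real.log (1 + ‖w‖ ^ 2) / 2 - Real.log ‖z - w‖) (by fun_prop) hgc ?_ ?_ ?_)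
    · rw [chordKernel_ofComplex (hzw w hw)]
    · intro w hw
      rw [← log_two_div_dist_ofComplex (hzw w hw)]
      exact log_two_div_dist_nonneg _ _
    all_goals
      intro r hr
      have hcont : Continuous fun θ => Real.log ‖z - circleMap 0 r θ‖ := by
        refine Continuous.log (by fun_prop) fun θ => norm_ne_zero_iff.2 (sub_ne_zero.2 ?_)
        exact hzw _ (by simp [abs_of_pos hr.1, hr.2])
      have hci : IntegrableOn (fun θ => Real.log ‖z - circleMap 0 r θ‖)
        (Set.Ioo (-Real.pi) Real.pi) :=
          hcont.integrableOn_Icc.mono_set Set.Ioo_subset_Icc_self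
      simp only [norm_circleMap_zero, sq_abs]
    · exact (integrable_const _).sub hci
    · rw [integral_sub (integrable_const _) hci, integral_log_norm_sub_circleMap hr.1
        (hr.2.trans_le hz), log_two_div_dist_ofComplex hz0]
      simp [hpi.le]
      ring

theorem sphereMeasure_openCap_zero {τ : ℝ} (h0 : 0 < τ) (h1 : τ < 1) :
    sphereMeasure (openCap (S2.ofComplex 0) τ) = ENNReal.ofReal τ := by
  have hpi := Real.pi_pos
  have h := sphereMeasure_restrict_openCap_zero h1
  have h2 := congrArg (fun μ : Measure S2 => μ Set.univ) h
  simp only [Measure.restrict_apply_univ] at h2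
  rw [h2, Measure.map_apply S2.measurableEmbedding_ofComplex.measurable MeasurableSet.univ,
    Set.preimage_univ, withDensity_apply _ MeasurableSet.univ, Measure.restrict_univ]
  have h3 := setLIntegral_ball_sphereDensity (k := fun _ => 1) (R := √(τ / (1 - τ)))
    (g := fun _ => 1) measurable_const continuous_const (fun _ _ => zero_le_one)
    (fun r _ => by simp) (fun r _ => by simp [hpi.le]; ring)
  simp only [ENNReal.ofReal_one, one_mul] at h3
  rw [h3, integral_radial_density _ (Real.sqrt_nonneg _), sq_sqrt_div_one_sub h0 h1]

theorem exists_mapIsometry_openCap (p : S2) (τ : ℝ) :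
    ∃ e : EuclideanSpace ℝ (Fin 3) ≃ₗᵢ[ℝ] EuclideanSpace ℝ (Fin 3),
      S2.mapIsometry e p = S2.ofComplex 0 ∧
      S2.mapIsometry e ⁻¹' openCap (S2.ofComplex 0) τ = openCap p τ := by
  obtain ⟨e, he⟩ := S2.exists_mapIsometry p (S2.ofComplex 0)
  refine ⟨e, he, ?_⟩
  ext y
  simp only [openCap, Set.mem_preimage, Set.mem_ofPred_eq]
  rw [← he, S2.dist_mapIsometry]

theorem sphereMeasure_openCap (p : S2) {τ : ℝ} (h0 : 0 < τ) (h1 : τ < 1) :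
    sphereMeasure (openCap p τ) = ENNReal.ofReal τ := by
  obtain ⟨e, -, he2⟩ := exists_mapIsometry_openCap p τ
  rw [← sphereMeasure_openCap_zero h0 h1, ← he2,
    ← Measure.map_apply (S2.continuous_mapIsometry e).measurable
      (isOpen_openCap _ _).measurableSet, map_mapIsometry_sphereMeasure]

theorem chordKernel_mapIsometry
    (e : EuclideanSpace ℝ (Fin 3) ≃ₗᵢ[ℝ] EuclideanSpace ℝ (Fin 3)) (x y : S2) :
    chordKernel (S2.mapIsometry e x) (S2.mapIsometry e y) = chordKernel x y := by
  have h : S2.mapIsometry e x = S2.mapIsometry e y ↔ x = y := by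
    rw [← dist_eq_zero, S2.dist_mapIsometry, dist_eq_zero]
  simp only [chordKernel, h, S2.dist_mapIsometry]

theorem chordPotential_restrict_preimage
    (e : EuclideanSpace ℝ (Fin 3) ≃ₗᵢ[ℝ] EuclideanSpace ℝ (Fin 3)) {s : Set S2}
    (hs : MeasurableSet s) (x : S2) :
    chordPotential (sphereMeasure.restrict (S2.mapIsometry e ⁻¹' s)) x =
      chordPotential (sphereMeasure.restrict s) (S2.mapIsometry e x) := by
  have hm := (S2.continuous_mapIsometry e).measurable
  conv_rhs => rw [chordPotential, ← map_mapIsometry_sphereMeasure e,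
    Measure.restrict_map hm hs, lintegral_map (measurable_chordKernel_right _) hm]
  simp only [chordKernel_mapIsometry]
  rfl

/-- Outside a cap its uniform distribution attracts like a point mass at the centre. -/
theorem chordPotential_openCap {p : S2} {τ : ℝ} (h0 : 0 < τ) (h1 : τ < 1) {x : S2}
    (hx : x ∉ openCap p τ) :
    chordPotential (sphereMeasure.restrict (openCap p τ)) x =
      ENNReal.ofReal (τ * Real.log (2 / dist x p) + capConst τ) := by
  obtain ⟨e, he1, he2⟩ := exists_mapIsometry_openCap p τ
  rw [← he2, chordPotential_restrict_preimage e (isOpen_openCap _ _).measurableSet,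
    chordPotential_openCap_zero h0 h1, ← he1, S2.dist_mapIsometry]
  rwa [← he2] at hx

theorem S2.dist_neg_sq (x p : S2) : dist x (-p) ^ 2 = 4 - dist x p ^ 2 := by
  rw [S2.dist_sq, S2.dist_sq]
  have : (-p).1 = -p.1 := rfl
  rw [this, inner_neg_right]
  ring

theorem openCap_neg_subset (p : S2) (τ : ℝ) : openCap (-p) (1 - τ) ⊆ (openCap p τ)ᶜ := by
  intro x hx
  simp only [openCap, Set.mem_ofPred_eq, Set.mem_compl_iff, not_lt, S2.dist_neg_sq] at hx ⊢
  linarith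

/-- The complement of a cap is, up to a null set, the opposite cap. -/
theorem compl_openCap_ae_eq (p : S2) {τ : ℝ} (h0 : 0 < τ) (h1 : τ < 1) :
    ((openCap p τ)ᶜ : Set S2) =ᵐ[sphereMeasure] (openCap (-p) (1 - τ) : Set S2) := by
  have hm := (isOpen_openCap p τ).measurableSet
  refine (ae_eq_of_subset_of_measure_ge (openCap_neg_subset p τ) ?_
    (isOpen_openCap _ _).nullMeasurableSet (measure_ne_top _ _)).symm
  rw [sphereMeasure_openCap _ (by linarith) (by linarith), prob_compl_eq_one_sub hm,
    sphereMeasure_openCap _ h0 h1, ENNReal.ofReal_sub _ h0.le, ENNReal.ofReal_one]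

theorem chordPotential_add_compl (s : Set S2) (hs : MeasurableSet s) (x : S2) :
    chordPotential (sphereMeasure.restrict s) x + chordPotential (sphereMeasure.restrict sᶜ) x =
      chordPotential sphereMeasure x :=
  lintegral_add_compl _ hs

theorem chordPotential_compl_openCap {p : S2} {τ : ℝ} (h0 : 0 < τ) (h1 : τ < 1) {x : S2}
    (hx : dist x p ^ 2 ≤ 4 * τ) :
    chordPotential (sphereMeasure.restrict (openCap p τ)ᶜ) x =
      ENNReal.ofReal ((1 - τ) * Real.log (2 / dist x (-p)) + capConst (1 - τ)) := by
  have hr : sphereMeasure.restrict (openCap p τ)ᶜ =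
      sphereMeasure.restrict (openCap (-p) (1 - τ)) :=
    Measure.restrict_congr_set (compl_openCap_ae_eq p h0 h1)
  rw [hr,
    chordPotential_openCap (by linarith) (by linarith)]
  simp only [openCap, Set.mem_ofPred_eq, S2.dist_neg_sq, not_lt]
  linarith

/-- The constant value of the potential of the normalized surface measure. -/
noncomputable def sphereConst : ℝ := (chordPotential sphereMeasure S2.north).toReal

theorem exists_dist_sq_eq (p : S2) {t : ℝ} (h0 : 0 < t) (h1 : t < 1) :
    ∃ x : S2, dist x p ^ 2 = 4 * t := by
  obtain ⟨e, he⟩ := S2.exists_mapIsometry (S2.ofComplex 0) p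
  refine ⟨S2.mapIsometry e (S2.ofComplex (√(t / (1 - t)) : ℝ)), ?_⟩
  rw [← he, S2.dist_mapIsometry, S2.dist_sq_ofComplex]
  have := sq_sqrt_div_one_sub h0 h1
  simp only [sub_zero, Complex.norm_real, norm_zero, Real.norm_eq_abs, sq_abs]
  rw [mul_div_assoc]
  congr 1
  refine Eq.trans ?_ this
  simp

theorem log_two_div_dist_of_sq {x p : S2} {t : ℝ} (ht : 0 < t) (h : dist x p ^ 2 = 4 * t) :
    Real.log (2 / dist x p) = -Real.log t / 2 := by
  have hne : x ≠ p := by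
    rintro rfl
    simp at h
    linarith
  rw [log_two_div_dist_eq hne, h, Real.log_mul (by norm_num) ht.ne', Real.log_four]
  ring

theorem capConst_nonneg (τ : ℝ) : 0 ≤ capConst τ := by
  refine setIntegral_nonneg measurableSet_Ioo fun r hr => ?_
  have : 0 ≤ Real.log (1 + r ^ 2) := Real.log_nonneg (by nlinarith [sq_nonneg r])
  exact mul_nonneg (div_nonneg hr.1.le (sq_nonneg _)) this

theorem chordPotential_sphereMeasure_const (x y : S2) :
    chordPotential sphereMeasure x = chordPotential sphereMeasure y := by
  obtain ⟨e, he⟩ := S2.exists_mapIsometry x y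
  have := chordPotential_restrict_preimage e MeasurableSet.univ x
  rwa [Set.preimage_univ, Measure.restrict_univ, he] at this

theorem chordPotential_sphereMeasure_eq_add {τ : ℝ} (h0 : 0 < τ) (h1 : τ < 1) (x : S2) :
    chordPotential sphereMeasure x = ENNReal.ofReal ((τ * (-Real.log τ / 2) + capConst τ) +
      ((1 - τ) * (-Real.log (1 - τ) / 2) + capConst (1 - τ))) := by
  obtain ⟨y, hy⟩ := exists_dist_sq_eq S2.north h0 h1
  have hy' : dist y (-S2.north) ^ 2 = 4 * (1 - τ) := by
    rw [S2.dist_neg_sq, hy]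
    ring
  have h2 : 0 < 1 - τ := by linarith
  rw [chordPotential_sphereMeasure_const x y, ← chordPotential_add_compl (openCap S2.north τ)
    (isOpen_openCap _ _).measurableSet, chordPotential_openCap h0 h1 (by simp [openCap, hy]),
    chordPotential_compl_openCap h0 h1 hy.le, log_two_div_dist_of_sq h0 hy,
    log_two_div_dist_of_sq h2 hy']
  refine (ENNReal.ofReal_add ?_ ?_).symm
  · have := Real.log_nonpos h0.le h1.le
    have := capConst_nonneg τ
    have : 0 ≤ τ * (-Real.log τ / 2) := mul_nonneg h0.le (by linarith)
    linarith
  · have := Real.log_nonpos h2.le (by linarith)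
    have := capConst_nonneg (1 - τ)
    have : 0 ≤ (1 - τ) * (-Real.log (1 - τ) / 2) := mul_nonneg h2.le (by linarith)
    linarith

theorem chordPotential_sphereMeasure (x : S2) :
    chordPotential sphereMeasure x = ENNReal.ofReal sphereConst := by
  rw [sphereConst, ENNReal.ofReal_toReal, chordPotential_sphereMeasure_const]
  rw [chordPotential_sphereMeasure_eq_add (τ := 1 / 2) (by norm_num) (by norm_num)]
  exact ENNReal.ofReal_ne_top

theorem sphereConst_eq {τ : ℝ} (h0 : 0 < τ) (h1 : τ < 1) :
    sphereConst = (τ * (-Real.log τ / 2) + capConst τ) +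
      ((1 - τ) * (-Real.log (1 - τ) / 2) + capConst (1 - τ)) := by
  have h2 : 0 < 1 - τ := by linarith
  rw [sphereConst, chordPotential_sphereMeasure_eq_add h0 h1, ENNReal.toReal_ofReal]
  have := Real.log_nonpos h0.le h1.le
  have := capConst_nonneg τ
  have : 0 ≤ τ * (-Real.log τ / 2) := mul_nonneg h0.le (by linarith)
  have := Real.log_nonpos h2.le (by linarith)
  have := capConst_nonneg (1 - τ)
  have : 0 ≤ (1 - τ) * (-Real.log (1 - τ) / 2) := mul_nonneg h2.le (by linarith)
  linarith

/-- Inside a cap, its potential is the one of the whole sphere minus that of the opposite cap. -/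
theorem chordPotential_openCap_of_mem {p : S2} {τ : ℝ} (h0 : 0 < τ) (h1 : τ < 1) {x : S2}
    (hx : x ∈ openCap p τ) :
    chordPotential (sphereMeasure.restrict (openCap p τ)) x = ENNReal.ofReal (sphereConst -
      ((1 - τ) * Real.log (2 / dist x (-p)) + capConst (1 - τ))) := by
  have h2 : 0 < 1 - τ := by linarith
  have hnn : 0 ≤ (1 - τ) * Real.log (2 / dist x (-p)) + capConst (1 - τ) :=
    add_nonneg (mul_nonneg h2.le (log_two_div_dist_nonneg _ _)) (capConst_nonneg _)
  have h := chordPotential_add_compl (openCap p τ) (isOpen_openCap _ _).measurableSet x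
  rw [chordPotential_sphereMeasure, chordPotential_compl_openCap h0 h1 (le_of_lt hx)] at h
  rw [ENNReal.ofReal_sub _ hnn]
  exact ENNReal.eq_sub_of_add_eq ENNReal.ofReal_ne_top h

/-! ### From potentials to equilibrium measures and mother bodies -/

theorem chordPotential_smul (c : ℝ≥0∞) (σ : Measure S2) (x : S2) :
    chordPotential (c • σ) x = c * chordPotential σ x :=
  lintegral_smul_measure _ _

theorem chordPotential_twoCharges (a : ℝ) (p₁ p₂ x : S2) :
    chordPotential (twoCharges a p₁ p₂) x =
      ENNReal.ofReal a * chordKernel x p₁ + ENNReal.ofReal a * chordKernel x p₂ := by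
  rw [chordPotential, twoCharges, lintegral_add_measure, lintegral_smul_measure,
    lintegral_smul_measure, lintegral_dirac' _ (measurable_chordKernel_right x),
    lintegral_dirac' _ (measurable_chordKernel_right x)]
  rfl

instance isFiniteMeasure_twoCharges (a : ℝ) (p₁ p₂ : S2) :
    IsFiniteMeasure (twoCharges a p₁ p₂) := by
  refine ⟨?_⟩
  simp [twoCharges]

theorem twoCharges_real_univ {a : ℝ} (ha : 0 < a) (p₁ p₂ : S2) :
    (twoCharges a p₁ p₂).real Set.univ = 2 * a := by
  rw [measureReal_def, twoCharges]
  simp only [Measure.coe_add, Measure.coe_smul, Pi.add_apply, Pi.smul_apply, measure_univ,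
    smul_eq_mul, mul_one]
  rw [← ENNReal.ofReal_add ha.le ha.le, ENNReal.toReal_ofReal (by linarith)]
  ring

/-- The Frostman conditions identify the equilibrium measure on the sphere. -/
theorem isEquilibriumMeasure_sphere_iff {a : ℝ} (ha : 0 < a) {p₁ p₂ : S2} (μ : Measure S2)
    [IsProbabilityMeasure μ] {F : ℝ≥0∞} (hF : F ≠ ⊤)
    (hμ : ∀ᵐ x ∂μ, chordPotential μ x + chordPotential (twoCharges a p₁ p₂) x = F)
    (hge : ∀ x, x ≠ S2.north →
      F ≤ chordPotential μ x + chordPotential (twoCharges a p₁ p₂) x) (ν : Measure S2) :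
    IsEquilibriumMeasure (logPotential (twoCharges a p₁ p₂)) ν ↔ ν = μ := by
  have hl : 0 ≤ Real.log 2 := Real.log_nonneg one_le_two
  refine isEquilibriumMeasure_iff_of_potential (j := id) MeasurableEmbedding.id
    (measurable_chordPotential (twoCharges a p₁ p₂))
    (c := Real.log 2 + 2 * (Real.log 2 * (2 * a))) (by positivity) (fun x y => ?_) hF μ
    (by simpa using hμ) (by simpa using hge) ν
  rw [logKernel_eq_chordKernel, logPotential_eq_chordPotential, logPotential_eq_chordPotential,
    twoCharges_real_univ ha]
  simp only [id, EReal.coe_ennreal_add]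
  generalize hA : ((chordKernel x y : ℝ≥0∞) : EReal) = A
  generalize hB : ((chordPotential (twoCharges a p₁ p₂) x : ℝ≥0∞) : EReal) = B
  generalize hC : ((chordPotential (twoCharges a p₁ p₂) y : ℝ≥0∞) : EReal) = C
  have hA0 : A ≠ ⊥ := by rw [← hA]; exact EReal.coe_ennreal_ne_bot _
  have hB0 : B ≠ ⊥ := by rw [← hB]; exact EReal.coe_ennreal_ne_bot _
  have hC0 : C ≠ ⊥ := by rw [← hC]; exact EReal.coe_ennreal_ne_bot _
  clear hA hB hC
  induction A using EReal.rec <;> induction B using EReal.rec <;> induction C using EReal.rec <;>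
    first
    | contradiction
    | rfl
    | (norm_cast; ring_nf)

theorem sphereMeasure_pos_of_isOpen {U : Set S2} (hU : IsOpen U) {x : S2} (hx : x ∈ U) :
    0 < sphereMeasure U := by
  obtain ⟨ε, hε, hb⟩ := Metric.isOpen_iff.1 hU x hx
  set τ := min (1 / 2) (ε ^ 2 / 4) with hτ
  have h0 : 0 < τ := by positivity
  have h1 : τ < 1 := (min_le_left _ _).trans_lt (by norm_num)
  have hsub : openCap x τ ⊆ U := fun y hy => hb <| by
    have hy' : dist y x ^ 2 < 4 * τ := hy
    have : 4 * τ ≤ ε ^ 2 := by linarith [min_le_right (1 / 2) (ε ^ 2 / 4)]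
    exact lt_of_pow_lt_pow_left₀ 2 hε.le (hy'.trans_le this)
  refine lt_of_lt_of_le ?_ (measure_mono hsub)
  rw [sphereMeasure_openCap x h0 h1]
  simpa using h0

/-- The law of total mass one that is uniform on the region `D`. -/
noncomputable def uniformDroplet (a : ℝ) (D : Set S2) : Measure S2 :=
  ENNReal.ofReal (1 + 2 * a) • sphereMeasure.restrict D

theorem mem_support_uniformDroplet {a : ℝ} (ha : 0 < a) {D O : Set S2} (hO : IsOpen O)
    (hOD : O ⊆ D) {x : S2} (hx : x ∈ O) : x ∈ (uniformDroplet a D).support := by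
  rw [Measure.mem_support_iff_forall]
  intro U hU
  obtain ⟨W, hWU, hW, hxW⟩ := mem_nhds_iff.1 hU
  have hpos := sphereMeasure_pos_of_isOpen (hW.inter hO) ⟨hxW, hx⟩
  have : 0 < sphereMeasure.restrict D U :=
    (hpos.trans_le (measure_mono (Set.inter_subset_inter hWU hOD))).trans_le
      (Measure.le_restrict_apply _ _)
  simp only [uniformDroplet, Measure.coe_smul, Pi.smul_apply, smul_eq_mul]
  exact ENNReal.mul_pos (by simpa using by linarith) this.ne'

theorem restrict_support_uniformDroplet {a : ℝ} (ha : 0 < a) {D : Set S2} (hD : IsClosed D) :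
    sphereMeasure.restrict (uniformDroplet a D).support = sphereMeasure.restrict D := by
  have h := (uniformDroplet a D).measure_compl_support
  simp only [uniformDroplet, Measure.coe_smul, Pi.smul_apply, smul_eq_mul, mul_eq_zero,
    ENNReal.ofReal_eq_zero] at h
  have h1 : sphereMeasure.restrict D (uniformDroplet a D).supportᶜ = 0 :=
    h.resolve_left (by linarith)
  have h2 := (uniformDroplet a D).isClosed_support
  have hsub : (uniformDroplet a D).support ⊆ D := by
    refine Measure.support_subset_of_isClosed hD ?_
    rw [mem_ae_iff, uniformDroplet, Measure.smul_apply,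
      Measure.restrict_apply hD.measurableSet.compl]
    simp
  refine Measure.restrict_congr_set ?_
  refine Filter.EventuallyLE.antisymm (LE.le.eventuallyLE hsub) ?_
  rw [Measure.restrict_apply h2.measurableSet.compl] at h1
  rwa [ae_le_set, Set.sdiff_eq_compl_inter]

theorem EReal.sub_eq_sub_add_of_add_eq {A B : ℝ≥0∞} {r s : ℝ} (t : ℝ) (hr : 0 ≤ r) (hs : 0 ≤ s)
    (h : A + ENNReal.ofReal r = B + ENNReal.ofReal s) :
    (A : EReal) - (t : ℝ) = (B : EReal) - (t : ℝ) + ((s - r : ℝ) : EReal) := by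
  have h' : (A : EReal) + (r : ℝ) = B + (s : ℝ) := by
    have := congrArg (fun y : ℝ≥0∞ => (y : EReal)) h
    simpa [EReal.coe_ennreal_ofReal, hr, hs] using this
  induction A with
  | top =>
    induction B with
    | top => rfl
    | coe B => exact absurd h.symm (by simp)
  | coe A =>
    induction B with
    | top => exact absurd h (by simp)
    | coe B =>
      have h2 : (A : ℝ) + r = B + s := by
        have e1 : ((A : ℝ≥0∞) : EReal) = ((A : ℝ) : EReal) := rfl
        have e2 : ((B : ℝ≥0∞) : EReal) = ((B : ℝ) : EReal) := rfl
        rw [e1, e2] at h'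
        exact_mod_cast h'
      change (((A : ℝ) : EReal)) - (t : ℝ) = ((B : ℝ) : EReal) - (t : ℝ) + ((s - r : ℝ) : EReal)
      norm_cast
      linarith

theorem EReal.sub_le_sub_add_of_add_le {A B : ℝ≥0∞} {r s : ℝ} (t : ℝ) (hr : 0 ≤ r) (hs : 0 ≤ s)
    (h : A + ENNReal.ofReal r ≤ B + ENNReal.ofReal s) :
    (A : EReal) - (t : ℝ) ≤ (B : EReal) - (t : ℝ) + ((s - r : ℝ) : EReal) := by
  induction B with
  | top => exact le_top
  | coe B =>
    induction A with
    | top => exact absurd h (by simp)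
    | coe A =>
      have h' : ((A : ℝ≥0∞) : EReal) + (r : ℝ) ≤ (B : ℝ≥0∞) + (s : ℝ) := by
        have := EReal.coe_ennreal_le_coe_ennreal_iff.2 h
        simpa [EReal.coe_ennreal_ofReal, hr, hs] using this
      have h2 : (A : ℝ) + r ≤ B + s := by
        have e1 : ((A : ℝ≥0∞) : EReal) = ((A : ℝ) : EReal) := rfl
        have e2 : ((B : ℝ≥0∞) : EReal) = ((B : ℝ) : EReal) := rfl
        rw [e1, e2] at h'
        exact_mod_cast h'
      change (((A : ℝ) : EReal)) - (t : ℝ) ≤ ((B : ℝ) : EReal) - (t : ℝ) + ((s - r : ℝ) : EReal)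
      norm_cast
      linarith

theorem isClosed_greatCircle : IsClosed greatCircle := by
  have : greatCircle = {x : S2 | x.1 1 = 0} := by
    ext x
    simp only [greatCircle, Set.mem_ofPred_eq]
    by_cases hx : x = S2.north
    · subst hx
      have h1 : stereo S2.north = OnePoint.infty := by
        rw [S2.north_eq_stereo_symm, Equiv.apply_symm_apply]
      simp [h1]
    · obtain ⟨z, rfl⟩ := S2.exists_ofComplex hx
      rw [S2.ofComplex_eq_stereo_symm, Equiv.apply_symm_apply, ← S2.ofComplex_eq_stereo_symm]
      have h : z.re ^ 2 + z.im ^ 2 + 1 ≠ 0 := by positivity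
      simp [h]
      constructor
      · rintro ⟨t, ht⟩
        rw [ht]
        simp
      · intro h
        exact ⟨z.re, Complex.ext rfl (by simpa using h)⟩
  rw [this]
  exact isClosed_eq (by fun_prop) continuous_const

theorem realPoint_mem_greatCircle (t : ℝ) : realPoint t ∈ greatCircle := by
  refine Or.inr ⟨t, ?_⟩
  rw [realPoint, S2.ofComplex_eq_stereo_symm, Equiv.apply_symm_apply]

/-- A comparison between the potentials of the uniform law on `D₀` and of `μ_V` yields the
conclusion on the droplet, which is the support of that law. The open set `O` absorbs
the points of `D₀` that may fail to lie in the support. -/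
theorem motherBody_of_potentials {a b : ℝ} (ha : 0 < a) {D₀ O : Set S2} (hD₀ : IsClosed D₀)
    (hO : IsOpen O) (hOD : O ⊆ D₀) [IsProbabilityMeasure (uniformDroplet a D₀)]
    [IsProbabilityMeasure (muV a b)] {r s : ℝ} (hr : 0 ≤ r) (hs : 0 ≤ s)
    (heq : ∀ x, x ∉ O → chordPotential (uniformDroplet a D₀) x + ENNReal.ofReal r =
      chordPotential ((muV a b).map realPoint) x + ENNReal.ofReal s)
    (hle : ∀ x, chordPotential (uniformDroplet a D₀) x + ENNReal.ofReal r ≤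
      chordPotential ((muV a b).map realPoint) x + ENNReal.ofReal s) :
    ∃ σ : Measure S2,
      σ = ENNReal.ofReal (1 / (2 * a)) •
        (muV a b).map (fun t : ℝ => stereo.symm ((t : ℂ) : OnePoint ℂ)) ∧
      σ.support ⊆ greatCircle ∧
      σ Set.univ = ENNReal.ofReal (1 / (2 * a)) ∧
      ∃ m : ℝ,
        (∀ x : S2, x ∉ (uniformDroplet a D₀).support →
          logPotential (sphereMeasure.restrict (uniformDroplet a D₀).support) x =
            logPotential (ENNReal.ofReal (2 * a / (1 + 2 * a)) • σ) x + (m : EReal)) ∧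
        (∀ x : S2, x ∈ (uniformDroplet a D₀).support →
          logPotential (sphereMeasure.restrict (uniformDroplet a D₀).support) x ≤
            logPotential (ENNReal.ofReal (2 * a / (1 + 2 * a)) • σ) x + (m : EReal)) := by
  have h12 : 0 < 1 + 2 * a := by linarith
  set k : ℝ := 1 / (1 + 2 * a) with hk
  have hk0 : 0 < k := by positivity
  have hmeas := measurableEmbedding_realPoint.measurable
  have hprob : IsProbabilityMeasure ((muV a b).map realPoint) :=
    Measure.isProbabilityMeasure_map hmeas.aemeasurable
  refine ⟨_, rfl, ?_, ?_, (s * k - r * k : ℝ), ?_⟩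
  · refine Measure.support_subset_of_isClosed isClosed_greatCircle ?_
    change greatCircle ∈ ae (ENNReal.ofReal (1 / (2 * a)) • (muV a b).map realPoint)
    rw [mem_ae_iff, Measure.smul_apply,
      Measure.map_apply hmeas isClosed_greatCircle.measurableSet.compl]
    have : realPoint ⁻¹' greatCircleᶜ = ∅ := by
      ext t
      simp [realPoint_mem_greatCircle]
    simp [this]
  · change (ENNReal.ofReal (1 / (2 * a)) • (muV a b).map realPoint) Set.univ = _
    simp
  · have hσ : ENNReal.ofReal (2 * a / (1 + 2 * a)) • (ENNReal.ofReal (1 / (2 * a)) •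
        (muV a b).map (fun t : ℝ => stereo.symm ((t : ℂ) : OnePoint ℂ))) =
        ENNReal.ofReal k • (muV a b).map realPoint := by
      rw [smul_smul, ← ENNReal.ofReal_mul (by positivity)]
      congr 2
      rw [hk]
      field_simp
    have hlam : sphereMeasure.restrict D₀ = ENNReal.ofReal k • uniformDroplet a D₀ := by
      rw [uniformDroplet, smul_smul, ← ENNReal.ofReal_mul hk0.le, hk, one_div,
        inv_mul_cancel₀ h12.ne', ENNReal.ofReal_one, one_smul]
    rw [hσ, restrict_support_uniformDroplet ha hD₀, hlam]
    have hreal : ∀ μ : Measure S2, IsProbabilityMeasure μ →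
        (ENNReal.ofReal k • μ).real Set.univ = k := fun μ hμ => by
      simp [measureReal_def, hk0.le]
    have hfin : ∀ μ : Measure S2, IsProbabilityMeasure μ →
        IsFiniteMeasure (ENNReal.ofReal k • μ) := fun μ hμ => ⟨by simp⟩
    have hf1 := hfin _ ‹IsProbabilityMeasure (uniformDroplet a D₀)›
    have hf2 := hfin _ hprob
    have hpot : ∀ (A : ℝ≥0∞) {u : ℝ}, 0 ≤ u → ENNReal.ofReal k * (A + ENNReal.ofReal u) =
        ENNReal.ofReal k * A + ENNReal.ofReal (u * k) := fun A u hu => by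
      rw [mul_add, ← ENNReal.ofReal_mul hk0.le, mul_comm k]
    constructor
    · intro x hx
      have hxO : x ∉ O := fun h => hx (mem_support_uniformDroplet ha hO hOD h)
      rw [logPotential_eq_chordPotential, logPotential_eq_chordPotential, hreal _ inferInstance,
        hreal _ hprob, chordPotential_smul, chordPotential_smul]
      refine EReal.sub_eq_sub_add_of_add_eq _ (by positivity) (by positivity) ?_
      rw [← hpot _ hr, ← hpot _ hs, heq x hxO]
    · intro x _
      rw [logPotential_eq_chordPotential, logPotential_eq_chordPotential, hreal _ inferInstance,
        hreal _ hprob, chordPotential_smul, chordPotential_smul]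
      refine EReal.sub_le_sub_add_of_add_le _ (by positivity) (by positivity) ?_
      rw [← hpot _ hr, ← hpot _ hs]
      exact mul_le_mul_right (hle x) _

/-- The field `V` transported to the sphere, where it absorbs the factors `√(1 + x²)` of the chordal
distance; the constant makes it nonnegative. -/
noncomputable def sphereField (a b x : ℝ) : ℝ :=
  (1 + a) / 2 * Real.log (x ^ 2 + (b ^ 2)⁻¹) - a / 2 * Real.log (x ^ 2 + b ^ 2) -
    Real.log (1 + x ^ 2) / 2 + (1 + 2 * a) * Real.log b

theorem sphereField_nonneg {a b : ℝ} (ha : 0 < a) (hb : 1 ≤ b) (x : ℝ) : 0 ≤ sphereField a b x := by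
  have hb0 : 0 < b := by linarith
  have h1 : Real.log (1 + x ^ 2) - 2 * Real.log b ≤ Real.log (x ^ 2 + (b ^ 2)⁻¹) := by
    rw [show 2 * Real.log b = Real.log (b ^ 2) by simp, ← Real.log_div (by positivity)
      (by positivity)]
    refine Real.log_le_log (by positivity) ?_
    rw [add_div, one_div, add_comm]
    have : x ^ 2 / b ^ 2 ≤ x ^ 2 := div_le_self (sq_nonneg x) (by nlinarith)
    linarith
  have h2 : Real.log (x ^ 2 + b ^ 2) ≤ Real.log (1 + x ^ 2) + 2 * Real.log b := by
    rw [show 2 * Real.log b = Real.log (b ^ 2) by simp, ← Real.log_mul (by positivity)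
      (by positivity)]
    refine Real.log_le_log (by positivity) ?_
    nlinarith [sq_nonneg x, mul_nonneg (sq_nonneg x) (show 0 ≤ b ^ 2 - 1 by nlinarith)]
  unfold sphereField
  nlinarith

/-- The Frostman conditions identify the equilibrium measure on the real line. -/
theorem isEquilibriumMeasure_fieldV_iff {a b : ℝ} (ha : 0 < a) (hb : 1 ≤ b) (μ : Measure ℝ)
    [IsProbabilityMeasure μ] {F : ℝ≥0∞} (hF : F ≠ ⊤)
    (hμ : ∀ᵐ x ∂μ, chordPotential (μ.map realPoint) (realPoint x) +
      ENNReal.ofReal (sphereField a b x) = F)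
    (hge : ∀ x, F ≤ chordPotential (μ.map realPoint) (realPoint x) +
      ENNReal.ofReal (sphereField a b x)) (ν : Measure ℝ) :
    IsEquilibriumMeasure (fieldV a b) ν ↔ ν = μ := by
  have hj := measurableEmbedding_realPoint
  have hg : Measurable fun x => ENNReal.ofReal (sphereField a b x) := by
    unfold sphereField
    fun_prop
  obtain ⟨q, hq, hqe⟩ := hj.exists_measurable_extend hg fun _ => ⟨0⟩
  have hqe' : ∀ x, q (realPoint x) = ENNReal.ofReal (sphereField a b x) := fun x => congrFun hqe x
  have hlb : 0 ≤ Real.log b := Real.log_nonneg hb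
  refine isEquilibriumMeasure_iff_of_potential hj hq
    (c := 2 * ((1 + 2 * a) * Real.log b)) (by positivity) (fun x y => ?_) hF μ
    (by simpa only [hqe'] using hμ) (fun x _ => by simpa only [hqe'] using hge x) ν
  rw [hqe', hqe']
  rcases eq_or_ne x y with rfl | hxy
  · rw [logKernel_self, chordKernel_self]
    have h1 : ∀ A : ℝ, (⊤ : EReal) + (A : EReal) = ⊤ := fun A => EReal.top_add_coe A
    rw [fieldV, h1, h1, top_add, top_add]
    rfl
  · have hz : (x : ℂ) ≠ y := by exact_mod_cast hxy
    have h0 : 0 ≤ Real.log (1 + ‖(x : ℂ)‖ ^ 2) / 2 + Real.log (1 + ‖(y : ℂ)‖ ^ 2) / 2 -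
        Real.log ‖(x : ℂ) - y‖ := by
      rw [← log_two_div_dist_ofComplex hz]
      exact log_two_div_dist_nonneg _ _
    have e1 : ‖(x : ℂ) - y‖ = dist x y := by
      rw [← Complex.ofReal_sub, Complex.norm_real, Real.dist_eq, Real.norm_eq_abs]
    rw [logKernel_eq_of_ne hxy, realPoint, realPoint, chordKernel_ofComplex hz,
      ← ENNReal.ofReal_add h0 (sphereField_nonneg ha hb x), ← ENNReal.ofReal_add
      (add_nonneg h0 (sphereField_nonneg ha hb x)) (sphereField_nonneg ha hb y),
      EReal.coe_ennreal_ofReal, max_eq_left (add_nonneg (add_nonneg h0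
      (sphereField_nonneg ha hb x)) (sphereField_nonneg ha hb y)), fieldV, fieldV, e1]
    simp only [Complex.norm_real, Real.norm_eq_abs, sq_abs, sphereField]
    norm_cast
    ring

/-! ### Potentials of Cauchy distributions on the sphere -/

/-- The point of the sphere over `i t`. -/
noncomputable def imagPoint (t : ℝ) : S2 := S2.ofComplex (t * Complex.I)

theorem neg_imagPoint {t : ℝ} (ht : t ≠ 0) : -imagPoint t = imagPoint (-t⁻¹) := by
  have h1 : t ^ 2 + 1 ≠ 0 := by positivity
  have h2 : (t ^ 2)⁻¹ + 1 ≠ 0 := by positivity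
  apply Subtype.ext
  ext i
  have hn : (-imagPoint t).1 i = -(imagPoint t).1 i := rfl
  rw [hn]
  fin_cases i
  · simp [imagPoint]
  · simp [imagPoint]
    field_simp
    ring
  · simp [imagPoint]
    field_simp
    ring

/-- The potential of the Cauchy distribution with scale `γ` exceeds that of its point charge by
this constant. -/
noncomputable def cauchyConst (γ : ℝ) : ℝ := Real.log (1 + γ) - Real.log (1 + γ ^ 2) / 2

theorem cauchyConst_nonneg {γ : ℝ} (hγ : 0 < γ) : 0 ≤ cauchyConst γ := by
  have : Real.log (1 + γ ^ 2) ≤ Real.log ((1 + γ) ^ 2) :=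
    Real.log_le_log (by positivity) (by nlinarith)
  rw [Real.log_pow] at this
  unfold cauchyConst
  push_cast at this
  linarith

theorem cauchyConst_inv {γ : ℝ} (hγ : 0 < γ) : cauchyConst γ⁻¹ = cauchyConst γ := by
  have h1 : 1 + γ⁻¹ = (1 + γ) / γ := by field_simp; ring
  have h2 : 1 + (γ⁻¹) ^ 2 = (1 + γ ^ 2) / γ ^ 2 := by field_simp; ring
  rw [cauchyConst, h1, h2, Real.log_div (by positivity) hγ.ne', Real.log_div (by positivity)
    (by positivity), Real.log_pow, cauchyConst]
  push_cast
  ring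

theorem chordPotential_realPoint_conj (ρ : Measure ℝ) (z : ℂ) :
    chordPotential (ρ.map realPoint) (S2.ofComplex (starRingEnd ℂ z)) =
      chordPotential (ρ.map realPoint) (S2.ofComplex z) := by
  have hm := measurableEmbedding_realPoint.measurable
  rw [chordPotential, chordPotential, lintegral_map (measurable_chordKernel_right _) hm,
    lintegral_map (measurable_chordKernel_right _) hm]
  refine lintegral_congr fun t => ?_
  have hn : ‖starRingEnd ℂ z - t‖ = ‖z - t‖ := by
    rw [← Complex.norm_conj (z - t), map_sub, Complex.conj_ofReal]
  by_cases h : z = t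
  · rw [h, Complex.conj_ofReal]
  · have h' : starRingEnd ℂ z ≠ t := by
      rw [← sub_ne_zero, ← norm_ne_zero_iff, hn]
      exact norm_ne_zero_iff.2 (sub_ne_zero.2 h)
    rw [realPoint, chordKernel_ofComplex h', chordKernel_ofComplex h, Complex.norm_conj, hn]

/-- The Cauchy distribution acts on a closed hemisphere like a unit charge in the opposite one. -/
theorem chordPotential_cauchyLaw_eq {γ : ℝ} (hγ : 0 < γ) {s : ℝ} (hs : s = 1 ∨ s = -1) {x : S2}
    (hx : 0 ≤ s * x.1 1) : chordPotential ((cauchyLaw γ).map realPoint) x =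
      ENNReal.ofReal (Real.log (2 / dist x (imagPoint (-(s * γ)))) + cauchyConst γ) := by
  have hnorm : ‖((-(s * γ) : ℝ) : ℂ) * Complex.I‖ ^ 2 = γ ^ 2 := by
    rw [norm_mul, Complex.norm_I, mul_one, Complex.norm_real, Real.norm_eq_abs, sq_abs]
    rcases hs with rfl | rfl <;> ring
  by_cases hn : x = S2.north
  · subst hn
    rw [chordPotential_cauchyLaw_north hγ, imagPoint, log_two_div_dist_north, hnorm, cauchyConst]
    congr 1
    ring
  obtain ⟨z, rfl⟩ := S2.exists_ofComplex hn
  have hd : 0 < z.re ^ 2 + z.im ^ 2 + 1 := by positivity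
  have him : 0 ≤ s * z.im := by
    rw [S2.ofComplex_apply_one] at hx
    by_contra hlt
    push Not at hlt
    have : s * (2 * z.im / (z.re ^ 2 + z.im ^ 2 + 1)) < 0 := by
      rw [show s * (2 * z.im / (z.re ^ 2 + z.im ^ 2 + 1)) =
        2 * (s * z.im) / (z.re ^ 2 + z.im ^ 2 + 1) by ring]
      exact div_neg_of_neg_of_pos (by linarith) hd
    linarith
  have key : ∀ w : ℂ, 0 ≤ w.im → chordPotential ((cauchyLaw γ).map realPoint) (S2.ofComplex w) =
      ENNReal.ofReal (Real.log (1 + ‖w‖ ^ 2) / 2 + Real.log (1 + γ) -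
        Real.log ‖w + γ * Complex.I‖) := fun w hw => chordPotential_cauchyLaw hγ hw
  have hne : z ≠ ((-(s * γ) : ℝ) : ℂ) * Complex.I := by
    intro h
    have h2 := congrArg Complex.im h
    simp at h2
    rw [h2] at him
    rcases hs with rfl | rfl <;> linarith
  rw [imagPoint, log_two_div_dist_ofComplex hne, hnorm, cauchyConst]
  rcases hs with rfl | rfl
  · rw [key z (by simpa using him)]
    congr 1
    have : z - ((-(1 * γ) : ℝ) : ℂ) * Complex.I = z + γ * Complex.I := by
      push_cast
      ring
    rw [this]
    ring
  · rw [← chordPotential_realPoint_conj, key _ (by simpa using him), Complex.norm_conj]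
    congr 1
    have : ‖starRingEnd ℂ z + γ * Complex.I‖ = ‖z - ((-(-1 * γ) : ℝ) : ℂ) * Complex.I‖ := by
      rw [← Complex.norm_conj, map_add, Complex.conj_conj, map_mul, Complex.conj_I,
        Complex.conj_ofReal]
      congr 1
      push_cast
      ring
    rw [this]
    ring

/-! ### The droplet with two separate caps removed -/

theorem ENNReal.eq_ofReal_sub {A : ℝ≥0∞} {u v : ℝ} (hu : 0 ≤ u) (hv : 0 ≤ v)
    (h : A + ENNReal.ofReal u = ENNReal.ofReal v) : A = ENNReal.ofReal (v - u) ∧ 0 ≤ v - u := by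
  constructor
  · rw [ENNReal.ofReal_sub _ hu]
    exact ENNReal.eq_sub_of_add_eq ENNReal.ofReal_ne_top h
  · rw [sub_nonneg, ← ENNReal.ofReal_le_ofReal_iff hv, ← h]
    exact le_add_self

theorem densityV_nonneg_of_le {a b : ℝ} (ha : 0 < a) (hb : 1 ≤ b) (hab : a * (b ^ 2 - 1) ≤ 1)
    (x : ℝ) : 0 ≤ densityV a b x := by
  have hpi := Real.pi_pos
  have hb0 : 0 < b := by linarith
  rw [densityV, if_pos hab]
  have h1 : 0 ≤ 1 + a - b ^ 2 * a := by nlinarith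
  have h2 : 0 ≤ b ^ 2 + b ^ 2 * a - a := by
    have : 1 ≤ b ^ 2 := one_le_pow₀ hb
    nlinarith
  refine div_nonneg ?_ (by positivity)
  nlinarith [mul_nonneg h1 (sq_nonneg x)]

/-- In the precritical case `μ_V` is a difference of Cauchy distributions. -/
theorem muV_add_cauchyLaw {a b : ℝ} (ha : 0 < a) (hb : 1 ≤ b) (hab : a * (b ^ 2 - 1) ≤ 1) :
    muV a b + ENNReal.ofReal a • cauchyLaw b = ENNReal.ofReal (1 + a) • cauchyLaw b⁻¹ := by
  have hpi := Real.pi_pos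
  have hb0 : 0 < b := by linarith
  have hm : ∀ γ : ℝ, Measurable fun t : ℝ => ENNReal.ofReal (γ / (Real.pi * (t ^ 2 + γ ^ 2))) :=
    fun γ => by fun_prop
  rw [muV, cauchyLaw, cauchyLaw, ← withDensity_smul _ (hm _), ← withDensity_smul _ (hm _),
    ← withDensity_add_right _ ((hm _).const_smul _)]
  congr 1
  funext x
  simp only [Pi.add_apply, Pi.smul_apply, smul_eq_mul]
  rw [← ENNReal.ofReal_mul ha.le, ← ENNReal.ofReal_mul (by linarith),
    ← ENNReal.ofReal_add (densityV_nonneg_of_le ha hb hab x) (by positivity), densityV, if_pos hab]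
  congr 1
  have h1 : x ^ 2 + b ^ 2 ≠ 0 := by positivity
  have h2 : x ^ 2 + (b ^ 2)⁻¹ ≠ 0 := by positivity
  have h3 : x ^ 2 + (b⁻¹) ^ 2 = x ^ 2 + (b ^ 2)⁻¹ := by rw [inv_pow]
  rw [h3]
  have h4 : x ^ 2 * b ^ 2 + 1 ≠ 0 := by positivity
  field_simp
  ring

theorem isProbabilityMeasure_muV_of_le {a b : ℝ} (ha : 0 < a) (hb : 1 ≤ b)
    (hab : a * (b ^ 2 - 1) ≤ 1) : IsProbabilityMeasure (muV a b) := by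
  have hb0 : 0 < b := by linarith
  have i1 := isProbabilityMeasure_cauchyLaw hb0
  have i2 := isProbabilityMeasure_cauchyLaw (inv_pos.2 hb0)
  have h := congrArg (fun μ : Measure ℝ => μ Set.univ) (muV_add_cauchyLaw ha hb hab)
  simp only [Measure.coe_add, Measure.coe_smul, Pi.add_apply, Pi.smul_apply, measure_univ,
    smul_eq_mul, mul_one] at h
  refine ⟨?_⟩
  rw [(ENNReal.eq_ofReal_sub ha.le (by linarith) h).1]
  simp

theorem chordPotential_muV_add {a b : ℝ} (ha : 0 < a) (hb : 1 ≤ b)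
    (hab : a * (b ^ 2 - 1) ≤ 1) (x : S2) :
    chordPotential ((muV a b).map realPoint) x +
      ENNReal.ofReal a * chordPotential ((cauchyLaw b).map realPoint) x =
      ENNReal.ofReal (1 + a) * chordPotential ((cauchyLaw b⁻¹).map realPoint) x := by
  have hm := measurableEmbedding_realPoint.measurable
  rw [← chordPotential_smul, ← chordPotential_smul, ← Measure.map_smul, ← Measure.map_smul,
    ← muV_add_cauchyLaw ha hb hab, Measure.map_add _ _ hm]
  exact (lintegral_add_measure _ _ _).symm

theorem chordPotential_muV_of_le {a b : ℝ} (ha : 0 < a) (hb : 1 ≤ b)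
    (hab : a * (b ^ 2 - 1) ≤ 1) {s : ℝ} (hs : s = 1 ∨ s = -1) {x : S2} (hx : 0 ≤ s * x.1 1) :
    chordPotential ((muV a b).map realPoint) x = ENNReal.ofReal
      ((1 + a) * Real.log (2 / dist x (-imagPoint (s * b))) -
        a * Real.log (2 / dist x (imagPoint (-(s * b)))) + cauchyConst b) ∧
    0 ≤ (1 + a) * Real.log (2 / dist x (-imagPoint (s * b))) -
        a * Real.log (2 / dist x (imagPoint (-(s * b)))) + cauchyConst b := by
  have hb0 : 0 < b := by linarith
  have hc := cauchyConst_nonneg hb0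
  have hsb : s * b ≠ 0 := by rcases hs with rfl | rfl <;> simp [hb0.ne']
  have hneg : -imagPoint (s * b) = imagPoint (-(s * b⁻¹)) := by
    rw [neg_imagPoint hsb]
    congr 2
    rcases hs with rfl | rfl <;> simp
  have h := chordPotential_muV_add ha hb hab x
  rw [chordPotential_cauchyLaw_eq hb0 hs hx, chordPotential_cauchyLaw_eq (inv_pos.2 hb0) hs hx,
    cauchyConst_inv hb0, ← ENNReal.ofReal_mul ha.le, ← ENNReal.ofReal_mul (by linarith),
    ← hneg] at h
  have hA := log_two_div_dist_nonneg x (imagPoint (-(s * b)))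
  have hB := log_two_div_dist_nonneg x (-imagPoint (s * b))
  have h2 := ENNReal.eq_ofReal_sub (by positivity) (by positivity) h
  have e : (1 + a) * Real.log (2 / dist x (-imagPoint (s * b))) -
        a * Real.log (2 / dist x (imagPoint (-(s * b)))) + cauchyConst b =
      (1 + a) * (Real.log (2 / dist x (-imagPoint (s * b))) + cauchyConst b) -
        a * (Real.log (2 / dist x (imagPoint (-(s * b)))) + cauchyConst b) := by ring
  rw [e]
  exact h2

theorem isEquilibriumMeasure_fieldV_iff_of_le {a b : ℝ} (ha : 0 < a) (hb : 1 ≤ b)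
    (hab : a * (b ^ 2 - 1) ≤ 1) (ν : Measure ℝ) :
    IsEquilibriumMeasure (fieldV a b) ν ↔ ν = muV a b := by
  have hb0 : 0 < b := by linarith
  have := isProbabilityMeasure_muV_of_le ha hb hab
  have key : ∀ x : ℝ, chordPotential ((muV a b).map realPoint) (realPoint x) +
      ENNReal.ofReal (sphereField a b x) = ENNReal.ofReal ((1 + a) * Real.log (1 + b⁻¹) -
        a * Real.log (1 + b) + (1 + 2 * a) * Real.log b) := fun x => by
    have h := chordPotential_muV_add ha hb hab (realPoint x)
    have hn : ∀ γ : ℝ, 0 < γ → chordPotential ((cauchyLaw γ).map realPoint) (realPoint x) =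
        ENNReal.ofReal (Real.log (1 + x ^ 2) / 2 + Real.log (1 + γ) -
          Real.log (x ^ 2 + γ ^ 2) / 2) ∧ 0 ≤ Real.log (1 + x ^ 2) / 2 + Real.log (1 + γ) -
          Real.log (x ^ 2 + γ ^ 2) / 2 := fun γ hγ => by
      have e : Real.log ‖(x : ℂ) + γ * Complex.I‖ = Real.log (x ^ 2 + γ ^ 2) / 2 := by
        have : ‖(x : ℂ) + γ * Complex.I‖ ^ 2 = x ^ 2 + γ ^ 2 := by
          rw [Complex.sq_norm_eq]
          simp
        rw [← this, Real.log_pow]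
        push_cast
        ring
      constructor
      · rw [realPoint, chordPotential_cauchyLaw hγ (by simp), e, Complex.norm_real,
          Real.norm_eq_abs, sq_abs]
      · have : Real.log (x ^ 2 + γ ^ 2) ≤ Real.log ((1 + x ^ 2) * (1 + γ) ^ 2) :=
          Real.log_le_log (by positivity) <| by
            nlinarith [mul_nonneg (sq_nonneg x) hγ.le, mul_nonneg (sq_nonneg x) (sq_nonneg γ)]
        rw [Real.log_mul (by positivity) (by positivity), Real.log_pow] at this
        push_cast at this
        linarith
    rw [(hn b hb0).1, (hn _ (inv_pos.2 hb0)).1, ← ENNReal.ofReal_mul ha.le,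
      ← ENNReal.ofReal_mul (by linarith)] at h
    have h2 := ENNReal.eq_ofReal_sub (mul_nonneg ha.le (hn b hb0).2)
      (mul_nonneg (by linarith) (hn _ (inv_pos.2 hb0)).2) h
    rw [h2.1, ← ENNReal.ofReal_add h2.2 (sphereField_nonneg ha hb x), sphereField, inv_pow]
    congr 1
    ring
  exact isEquilibriumMeasure_fieldV_iff ha hb _ ENNReal.ofReal_ne_top (.of_forall key)
    (fun x => (key x).ge) ν

/-- The mass of the cap that each of the two charges sweeps out in the precritical case. -/
noncomputable def capMass (a : ℝ) : ℝ := a / (1 + 2 * a)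

theorem capMass_pos {a : ℝ} (ha : 0 < a) : 0 < capMass a := by
  unfold capMass
  positivity

theorem capMass_lt_one {a : ℝ} (ha : 0 < a) : capMass a < 1 := by
  rw [capMass, div_lt_one (by linarith)]
  linarith

theorem mul_capMass {a : ℝ} (ha : 0 < a) : (1 + 2 * a) * capMass a = a := by
  rw [capMass]
  field_simp

theorem mul_one_sub_capMass {a : ℝ} (ha : 0 < a) : (1 + 2 * a) * (1 - capMass a) = 1 + a := by
  rw [mul_sub, mul_capMass ha]
  ring

/-- The complement of the two open caps around `± i b`. -/
def capDroplet (a b : ℝ) : Set S2 :=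
  (openCap (imagPoint b) (capMass a) ∪ openCap (imagPoint (-b)) (capMass a))ᶜ

theorem capDroplet_eq (a b : ℝ) {s : ℝ} (hs : s = 1 ∨ s = -1) : capDroplet a b =
    (openCap (imagPoint (s * b)) (capMass a) ∪ openCap (imagPoint (-(s * b))) (capMass a))ᶜ := by
  rcases hs with rfl | rfl
  · simp [capDroplet]
  · rw [capDroplet, Set.union_comm]
    simp

theorem isClosed_capDroplet (a b : ℝ) : IsClosed (capDroplet a b) :=
  ((isOpen_openCap _ _).union (isOpen_openCap _ _)).isClosed_compl

/-- In the precritical case the cap around `i b` lies in the open hemisphere around `i`. -/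
theorem capMass_sub_le_dist_sq {a b : ℝ} (ha : 0 < a) (hb : 1 ≤ b)
    (hab : a * (b ^ 2 - 1) ≤ 1) {s : ℝ} (hs : s = 1 ∨ s = -1) (x : S2) :
    4 * capMass a - 4 * b / (b ^ 2 + 1) * (s * x.1 1) ≤ dist x (imagPoint (s * b)) ^ 2 := by
  have hb0 : 0 < b := by linarith
  have hx2 := S2.sq_sum x
  have hd : (s * b) ^ 2 + 1 = b ^ 2 + 1 := by rcases hs with rfl | rfl <;> ring
  have hd' : (s * b) ^ 2 - 1 = b ^ 2 - 1 := by rcases hs with rfl | rfl <;> ring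
  rw [S2.dist_sq_eq_sum]
  simp only [imagPoint, S2.ofComplex_apply_zero, S2.ofComplex_apply_one, S2.ofComplex_apply_two,
    Complex.mul_re, Complex.mul_im, Complex.ofReal_re, Complex.ofReal_im, Complex.I_re,
    Complex.I_im, mul_zero, sub_zero, mul_one, zero_add, add_zero, zero_pow two_ne_zero,
    zero_div, hd, hd']
  set D := b ^ 2 + 1 with hD
  have hD0 : 0 < D := by positivity
  have e : (x.1 0) ^ 2 + (x.1 1 - 2 * (s * b) / D) ^ 2 + (x.1 2 - (b ^ 2 - 1) / D) ^ 2 =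
      2 - 2 * (b ^ 2 - 1) / D * x.1 2 - 4 * b / D * (s * x.1 1) := by
    have hs2 : s ^ 2 = 1 := by rcases hs with rfl | rfl <;> ring
    have : (x.1 0) ^ 2 = 1 - x.1 1 ^ 2 - x.1 2 ^ 2 := by linarith
    rw [this]
    field_simp
    rw [hD]
    linear_combination (4 * b ^ 2) * hs2
  rw [e]
  have h3 : x.1 2 ≤ 1 := by nlinarith [sq_nonneg (x.1 0), sq_nonneg (x.1 1)]
  have hb1 : 0 ≤ b ^ 2 - 1 := by nlinarith
  have h4 : 2 * (b ^ 2 - 1) / D * x.1 2 ≤ 2 * (b ^ 2 - 1) / D :=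
    mul_le_of_le_one_right (by positivity) h3
  have h5 : 2 * (b ^ 2 - 1) / D ≤ 2 - 4 * capMass a := by
    have : 2 - 4 * capMass a = 2 / (1 + 2 * a) := by
      rw [capMass]
      field_simp
      ring
    rw [this, div_le_div_iff₀ hD0 (by linarith)]
    nlinarith
  linarith

theorem mul_apply_one_nonneg_of_dist_le {a b : ℝ} (ha : 0 < a) (hb : 1 ≤ b)
    (hab : a * (b ^ 2 - 1) ≤ 1) {s : ℝ} (hs : s = 1 ∨ s = -1) {x : S2}
    (hx : dist x (imagPoint (s * b)) ^ 2 ≤ 4 * capMass a) : 0 ≤ s * x.1 1 := by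
  have hb0 : 0 < b := by linarith
  have := capMass_sub_le_dist_sq ha hb hab hs x
  exact nonneg_of_mul_nonneg_right (b := s * x.1 1) (a := 4 * b / (b ^ 2 + 1)) (by linarith)
    (by positivity)

theorem mul_apply_one_pos_of_mem_openCap {a b : ℝ} (ha : 0 < a) (hb : 1 ≤ b)
    (hab : a * (b ^ 2 - 1) ≤ 1) {s : ℝ} (hs : s = 1 ∨ s = -1) {x : S2}
    (hx : x ∈ openCap (imagPoint (s * b)) (capMass a)) : 0 < s * x.1 1 := by
  have hb0 : 0 < b := by linarith
  have := capMass_sub_le_dist_sq ha hb hab hs x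
  have h : dist x (imagPoint (s * b)) ^ 2 < 4 * capMass a := hx
  exact pos_of_mul_pos_right (b := s * x.1 1) (a := 4 * b / (b ^ 2 + 1)) (by linarith)
    (by positivity)

theorem openCap_disjoint {a b : ℝ} (ha : 0 < a) (hb : 1 ≤ b) (hab : a * (b ^ 2 - 1) ≤ 1) :
    Disjoint (openCap (imagPoint b) (capMass a)) (openCap (imagPoint (-b)) (capMass a)) := by
  rw [Set.disjoint_left]
  intro x h1 h2
  have := mul_apply_one_pos_of_mem_openCap ha hb hab (Or.inl rfl) (x := x) (by simpa using h1)
  have := mul_apply_one_pos_of_mem_openCap ha hb hab (Or.inr rfl) (x := x) (by simpa using h2)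
  linarith

theorem chordPotential_restrict_capDroplet_add {a b : ℝ} (ha : 0 < a) (hb : 1 ≤ b)
    (hab : a * (b ^ 2 - 1) ≤ 1) (x : S2) :
    chordPotential (sphereMeasure.restrict (capDroplet a b)) x +
      (chordPotential (sphereMeasure.restrict (openCap (imagPoint b) (capMass a))) x +
        chordPotential (sphereMeasure.restrict (openCap (imagPoint (-b)) (capMass a))) x) =
      ENNReal.ofReal sphereConst := by
  have hm := fun p => (isOpen_openCap p (capMass a)).measurableSet
  rw [← chordPotential_sphereMeasure x, ← chordPotential_add_compl _ ((hm (imagPoint b)).union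
    (hm (imagPoint (-b)))), add_comm, capDroplet]
  congr 1
  rw [Measure.restrict_union (openCap_disjoint ha hb hab) (hm _)]
  exact (lintegral_add_measure _ _ _).symm

theorem isProbabilityMeasure_uniformDroplet_capDroplet {a b : ℝ} (ha : 0 < a) (hb : 1 ≤ b)
    (hab : a * (b ^ 2 - 1) ≤ 1) : IsProbabilityMeasure (uniformDroplet a (capDroplet a b)) := by
  have h0 := capMass_pos ha
  have h1 := capMass_lt_one ha
  have hm := fun p => (isOpen_openCap p (capMass a)).measurableSet
  refine ⟨?_⟩
  rw [uniformDroplet, Measure.smul_apply, Measure.restrict_apply_univ, capDroplet,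
    prob_compl_eq_one_sub ((hm _).union (hm _)), measure_union (openCap_disjoint ha hb hab) (hm _),
    sphereMeasure_openCap _ h0 h1, sphereMeasure_openCap _ h0 h1, ← ENNReal.ofReal_add h0.le h0.le,
    ← ENNReal.ofReal_one, ← ENNReal.ofReal_sub _ (by linarith), smul_eq_mul,
    ← ENNReal.ofReal_mul (by linarith)]
  congr 1
  linarith [mul_capMass ha]

/-- Gibbs' inequality: the potential of the uniform measure on the sphere is an upper bound for the
combination of the potentials of opposite points that replaces it across the boundary of
a cap. -/
theorem sphereConst_le {τ : ℝ} (h0 : 0 < τ) (h1 : τ < 1) {x p : S2} (h : x ≠ p) (h' : x ≠ -p) :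
    sphereConst ≤ τ * Real.log (2 / dist x p) + capConst τ +
      ((1 - τ) * Real.log (2 / dist x (-p)) + capConst (1 - τ)) := by
  have h2 : 0 < 1 - τ := by linarith
  set T := dist x p ^ 2 / 4 with hT
  have hT0 : 0 < T := by
    have := dist_pos.2 h
    positivity
  have hT1 : 0 < 1 - T := by
    have := dist_pos.2 h'
    have h3 := S2.dist_neg_sq x p
    have : 0 < dist x (-p) ^ 2 := by positivity
    rw [hT]
    linarith
  rw [sphereConst_eq h0 h1, log_two_div_dist_of_sq hT0 (by rw [hT]; ring),
    log_two_div_dist_of_sq hT1 (by rw [S2.dist_neg_sq, hT]; ring)]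
  have k1 : Real.log T - Real.log τ ≤ T / τ - 1 := by
    rw [← Real.log_div hT0.ne' h0.ne']
    exact Real.log_le_sub_one_of_pos (by positivity)
  have k2 : Real.log (1 - T) - Real.log (1 - τ) ≤ (1 - T) / (1 - τ) - 1 := by
    rw [← Real.log_div hT1.ne' h2.ne']
    exact Real.log_le_sub_one_of_pos (by positivity)
  have k3 := mul_le_mul_of_nonneg_left k1 h0.le
  have k4 := mul_le_mul_of_nonneg_left k2 h2.le
  have e1 : τ * (T / τ - 1) = T - τ := by field_simp
  have e2 : (1 - τ) * ((1 - T) / (1 - τ) - 1) = τ - T := by field_simp; ring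
  rw [e1] at k3
  rw [e2] at k4
  linarith

theorem ENNReal.ofReal_sum_of_eq_add {A B : ℝ≥0∞} {f g m : ℝ} (hA : A = ENNReal.ofReal f)
    (hf : 0 ≤ f) (hB : B = ENNReal.ofReal g) (hg : 0 ≤ g) (h : f = g + m) :
    A + ENNReal.ofReal |m| = B + ENNReal.ofReal (|m| + m) := by
  rw [hA, hB, ← ENNReal.ofReal_add hf (abs_nonneg m),
    ← ENNReal.ofReal_add hg (by linarith [neg_abs_le m]), h]
  congr 1
  ring

theorem ENNReal.ofReal_sum_of_le_add {A B : ℝ≥0∞} {f g m : ℝ} (hA : A = ENNReal.ofReal f)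
    (hf : 0 ≤ f) (hB : B = ENNReal.ofReal g) (hg : 0 ≤ g) (h : f ≤ g + m) :
    A + ENNReal.ofReal |m| ≤ B + ENNReal.ofReal (|m| + m) := by
  rw [hA, hB, ← ENNReal.ofReal_add hf (abs_nonneg m),
    ← ENNReal.ofReal_add hg (by linarith [neg_abs_le m])]
  exact ENNReal.ofReal_le_ofReal (by linarith)

theorem chordPotential_twoCharges_sign (a b : ℝ) {s : ℝ} (hs : s = 1 ∨ s = -1) (x : S2) :
    chordPotential (twoCharges a (imagPoint b) (imagPoint (-b))) x =
      ENNReal.ofReal a * chordKernel x (imagPoint (s * b)) +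
        ENNReal.ofReal a * chordKernel x (imagPoint (-(s * b))) := by
  rw [chordPotential_twoCharges]
  rcases hs with rfl | rfl
  · simp
  · rw [add_comm]
    simp

/-- The potential of the uniform law on the droplet, outside the caps and inside one of them. -/
theorem chordPotential_capDroplet {a b : ℝ} (ha : 0 < a) (hb : 1 ≤ b)
    (hab : a * (b ^ 2 - 1) ≤ 1) {s : ℝ} (hs : s = 1 ∨ s = -1) {x : S2} (hx : 0 ≤ s * x.1 1) :
    ∃ f : ℝ, 0 ≤ f ∧ chordPotential (uniformDroplet a (capDroplet a b)) x = ENNReal.ofReal f ∧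
      (x ∉ openCap (imagPoint (s * b)) (capMass a) →
        f = (1 + 2 * a) * (sphereConst - 2 * capConst (capMass a)) -
          a * Real.log (2 / dist x (imagPoint (s * b))) -
          a * Real.log (2 / dist x (imagPoint (-(s * b))))) ∧
      (x ∈ openCap (imagPoint (s * b)) (capMass a) →
        f = (1 + a) * Real.log (2 / dist x (-imagPoint (s * b))) -
          a * Real.log (2 / dist x (imagPoint (-(s * b)))) +
          (1 + 2 * a) * (capConst (1 - capMass a) - capConst (capMass a))) := by
  have h0 := capMass_pos ha
  have h1 := capMass_lt_one ha
  have m1 := mul_capMass ha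
  have m2 := mul_one_sub_capMass ha
  have hk := capConst_nonneg (capMass a)
  have h12 : 0 ≤ 1 + 2 * a := by linarith
  have hc : 0 ≤ sphereConst := ENNReal.toReal_nonneg
  have hl' := log_two_div_dist_nonneg x (imagPoint (-(s * b)))
  have hl := log_two_div_dist_nonneg x (imagPoint (s * b))
  have hx' : x ∉ openCap (imagPoint (-(s * b))) (capMass a) := fun h => by
    have hs' : -s = 1 ∨ -s = -1 := by rcases hs with rfl | rfl <;> simp
    have := mul_apply_one_pos_of_mem_openCap ha hb hab hs' (x := x) (by simpa using h)
    linarith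
  have hsum : chordPotential (sphereMeasure.restrict (capDroplet a b)) x +
      (chordPotential (sphereMeasure.restrict (openCap (imagPoint (s * b)) (capMass a))) x +
        chordPotential (sphereMeasure.restrict
          (openCap (imagPoint (-(s * b))) (capMass a))) x) = ENNReal.ofReal sphereConst := by
    rw [← chordPotential_restrict_capDroplet_add ha hb hab x]
    rcases hs with rfl | rfl
    · simp
    · congr 1
      rw [add_comm]
      simp
  rw [chordPotential_openCap h0 h1 hx'] at hsum
  set τ := capMass a
  rw [uniformDroplet, chordPotential_smul]
  by_cases hxc : x ∈ openCap (imagPoint (s * b)) τ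
  · have hu : 0 ≤ sphereConst - ((1 - τ) * Real.log (2 / dist x (-imagPoint (s * b))) +
        capConst (1 - τ)) := by
      have h := chordPotential_add_compl (openCap (imagPoint (s * b)) τ)
        (isOpen_openCap _ _).measurableSet x
      rw [chordPotential_sphereMeasure, chordPotential_compl_openCap h0 h1 (le_of_lt hxc)] at h
      refine (ENNReal.eq_ofReal_sub (add_nonneg (mul_nonneg (by linarith)
        (log_two_div_dist_nonneg _ _)) (capConst_nonneg _)) hc h).2
    have hv : 0 ≤ τ * Real.log (2 / dist x (imagPoint (-(s * b)))) + capConst τ := by positivity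
    rw [chordPotential_openCap_of_mem h0 h1 hxc, ← ENNReal.ofReal_add hu hv] at hsum
    obtain ⟨e1, e2⟩ := ENNReal.eq_ofReal_sub (add_nonneg hu hv) hc hsum
    refine ⟨_, mul_nonneg h12 e2, by rw [e1, ENNReal.ofReal_mul h12], fun h => absurd hxc h,
      fun _ => ?_⟩
    linear_combination Real.log (2 / dist x (-imagPoint (s * b))) * m2 -
      Real.log (2 / dist x (imagPoint (-(s * b)))) * m1
  · have hu : 0 ≤ τ * Real.log (2 / dist x (imagPoint (s * b))) + capConst τ := by positivity
    have hv : 0 ≤ τ * Real.log (2 / dist x (imagPoint (-(s * b)))) + capConst τ := by positivity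
    rw [chordPotential_openCap h0 h1 hxc, ← ENNReal.ofReal_add hu hv] at hsum
    obtain ⟨e1, e2⟩ := ENNReal.eq_ofReal_sub (add_nonneg hu hv) hc hsum
    refine ⟨_, mul_nonneg h12 e2, by rw [e1, ENNReal.ofReal_mul h12], fun _ => ?_,
      fun h => absurd h hxc⟩
    linear_combination -Real.log (2 / dist x (imagPoint (s * b))) * m1 -
      Real.log (2 / dist x (imagPoint (-(s * b)))) * m1

theorem ne_neg_imagPoint {b s : ℝ} (hb : 1 ≤ b) (hs : s = 1 ∨ s = -1) {x : S2}
    (hx : 0 ≤ s * x.1 1) : x ≠ -imagPoint (s * b) := by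
  rintro rfl
  have hb0 : 0 < b := by linarith
  have e : (-imagPoint (s * b)).1 1 = -(imagPoint (s * b)).1 1 := rfl
  rw [e] at hx
  simp only [imagPoint, S2.ofComplex_apply_one, Complex.mul_im, Complex.ofReal_re, Complex.I_im,
    Complex.ofReal_im, mul_one, zero_mul, add_zero] at hx
  have h2 : 0 < 2 * b / ((((s * b : ℝ) : ℂ) * Complex.I).re ^ 2 + (s * b) ^ 2 + 1) := by
    positivity
  have hs2 : s ^ 2 = 1 := by rcases hs with rfl | rfl <;> ring
  have h3 : s * -(2 * (s * b) / ((((s * b : ℝ) : ℂ) * Complex.I).re ^ 2 + (s * b) ^ 2 + 1)) =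
      -(s ^ 2 * (2 * b / ((((s * b : ℝ) : ℂ) * Complex.I).re ^ 2 + (s * b) ^ 2 + 1))) := by ring
  rw [h3, hs2, one_mul] at hx
  linarith

/-- Gibbs' inequality at a point of the hemisphere of the charge. -/
theorem mul_sphereConst_le {a b : ℝ} (ha : 0 < a) (hb : 1 ≤ b)
    {s : ℝ} (hs : s = 1 ∨ s = -1) {x : S2} (hx : 0 ≤ s * x.1 1) (hne : x ≠ imagPoint (s * b)) :
    (1 + 2 * a) * sphereConst ≤ a * Real.log (2 / dist x (imagPoint (s * b))) +
      (1 + a) * Real.log (2 / dist x (-imagPoint (s * b))) +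
      (1 + 2 * a) * (capConst (capMass a) + capConst (1 - capMass a)) := by
  have h := mul_le_mul_of_nonneg_left (sphereConst_le (capMass_pos ha) (capMass_lt_one ha) hne
    (ne_neg_imagPoint hb hs hx)) (show 0 ≤ 1 + 2 * a by linarith)
  refine h.trans_eq ?_
  linear_combination Real.log (2 / dist x (imagPoint (s * b))) * mul_capMass ha +
    Real.log (2 / dist x (-imagPoint (s * b))) * mul_one_sub_capMass ha

theorem mul_sphereConst_eq {a : ℝ} (ha : 0 < a) {x p : S2}
    (hx : dist x p ^ 2 = 4 * capMass a) :
    (1 + 2 * a) * sphereConst = a * Real.log (2 / dist x p) +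
      (1 + a) * Real.log (2 / dist x (-p)) +
      (1 + 2 * a) * (capConst (capMass a) + capConst (1 - capMass a)) := by
  have h0 := capMass_pos ha
  have h1 := capMass_lt_one ha
  rw [sphereConst_eq h0 h1, log_two_div_dist_of_sq h0 hx, log_two_div_dist_of_sq
    (p := -p) (t := 1 - capMass a) (by linarith) (by rw [S2.dist_neg_sq, hx]; ring)]
  linear_combination (-Real.log (capMass a) / 2) * mul_capMass ha +
    (-Real.log (1 - capMass a) / 2) * mul_one_sub_capMass ha

theorem imagPoint_mem_openCap {a : ℝ} (ha : 0 < a) (t : ℝ) :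
    imagPoint t ∈ openCap (imagPoint t) (capMass a) := by
  simp [openCap, capMass_pos ha]

theorem exists_sign (r : ℝ) : ∃ s : ℝ, (s = 1 ∨ s = -1) ∧ 0 ≤ s * r := by
  rcases le_total 0 r with h | h
  · exact ⟨1, Or.inl rfl, by simpa using h⟩
  · exact ⟨-1, Or.inr rfl, by simpa using h⟩

/-- The Frostman conditions for the precritical droplet: the total potential is constant outside the
caps, and larger inside them. -/
theorem isEquilibriumMeasure_iff_capDroplet {a b : ℝ} (ha : 0 < a) (hb : 1 ≤ b)
    (hab : a * (b ^ 2 - 1) ≤ 1) (ν : Measure S2) :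
    IsEquilibriumMeasure (logPotential (twoCharges a (imagPoint b) (imagPoint (-b)))) ν ↔
      ν = uniformDroplet a (capDroplet a b) := by
  have := isProbabilityMeasure_uniformDroplet_capDroplet ha hb hab
  have hm : ∀ᵐ x ∂(uniformDroplet a (capDroplet a b)), x ∈ capDroplet a b := by
    rw [uniformDroplet]
    exact Measure.ae_smul_measure (ae_restrict_mem (isClosed_capDroplet a b).measurableSet) _
  have hfield : ∀ {s : ℝ}, (s = 1 ∨ s = -1) → ∀ {x : S2}, 0 ≤ s * x.1 1 →
      x ≠ imagPoint (s * b) →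
      chordPotential (twoCharges a (imagPoint b) (imagPoint (-b))) x = ENNReal.ofReal
        (a * Real.log (2 / dist x (imagPoint (s * b))) +
          a * Real.log (2 / dist x (imagPoint (-(s * b))))) := fun {s} hs {x} hx h => by
    have h' : x ≠ imagPoint (-(s * b)) := by
      rintro rfl
      have hs' : -s = 1 ∨ -s = -1 := by rcases hs with rfl | rfl <;> simp
      have := mul_apply_one_pos_of_mem_openCap ha hb hab hs' (x := imagPoint (-(s * b)))
        (by simpa using imagPoint_mem_openCap ha _)
      linarith
    rw [chordPotential_twoCharges_sign a b hs, chordKernel_of_ne h, chordKernel_of_ne h',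
      ← ENNReal.ofReal_mul ha.le, ← ENNReal.ofReal_mul ha.le, ← ENNReal.ofReal_add
        (mul_nonneg ha.le (log_two_div_dist_nonneg _ _))
        (mul_nonneg ha.le (log_two_div_dist_nonneg _ _))]
  have hfn : ∀ (s : ℝ) (x : S2), 0 ≤ a * Real.log (2 / dist x (imagPoint (s * b))) +
      a * Real.log (2 / dist x (imagPoint (-(s * b)))) := fun s x =>
    add_nonneg (mul_nonneg ha.le (log_two_div_dist_nonneg _ _))
        (mul_nonneg ha.le (log_two_div_dist_nonneg _ _))
  have hout : ∀ {s : ℝ}, (s = 1 ∨ s = -1) → ∀ {x : S2}, 0 ≤ s * x.1 1 →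
      x ∉ openCap (imagPoint (s * b)) (capMass a) →
      chordPotential (uniformDroplet a (capDroplet a b)) x +
        chordPotential (twoCharges a (imagPoint b) (imagPoint (-b))) x =
        ENNReal.ofReal ((1 + 2 * a) * (sphereConst - 2 * capConst (capMass a))) :=
    fun {s} hs {x} hx hxc => by
      obtain ⟨f, hf0, hf, hf1, -⟩ := chordPotential_capDroplet ha hb hab hs hx
      have hne : x ≠ imagPoint (s * b) := by
        rintro rfl
        exact hxc (imagPoint_mem_openCap ha _)
      rw [hf, hfield hs hx hne, ← ENNReal.ofReal_add hf0 (hfn _ _), hf1 hxc]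
      congr 1
      ring
  refine isEquilibriumMeasure_sphere_iff ha _ (F := ENNReal.ofReal
    ((1 + 2 * a) * (sphereConst - 2 * capConst (capMass a)))) ENNReal.ofReal_ne_top ?_ ?_ ν
  · filter_upwards [hm] with x hx
    obtain ⟨s, hs, hsx⟩ := exists_sign (x.1 1)
    rw [capDroplet_eq a b hs] at hx
    exact hout hs hsx fun h => hx (Or.inl h)
  · intro x _
    obtain ⟨s, hs, hsx⟩ := exists_sign (x.1 1)
    by_cases hxc : x ∈ openCap (imagPoint (s * b)) (capMass a)
    · by_cases hne : x = imagPoint (s * b)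
      · rw [chordPotential_twoCharges_sign a b hs, ← hne, chordKernel_self, ENNReal.mul_top
          (by simpa using ha), top_add, add_top]
        exact le_top
      · obtain ⟨f, hf0, hf, -, hf1⟩ := chordPotential_capDroplet ha hb hab hs hsx
        rw [hf, hfield hs hsx hne, ← ENNReal.ofReal_add hf0 (hfn _ _), hf1 hxc]
        refine ENNReal.ofReal_le_ofReal ?_
        linarith [mul_sphereConst_le ha hb hs hsx hne]
    · exact (hout hs hsx hxc).ge

/-- The interior of the droplet in the precritical case. -/
def capInterior (a b : ℝ) : Set S2 :=
  {x | 4 * capMass a < dist x (imagPoint b) ^ 2} ∩ {x | 4 * capMass a < dist x (imagPoint (-b)) ^ 2}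

theorem isOpen_capInterior (a b : ℝ) : IsOpen (capInterior a b) :=
  (isOpen_lt continuous_const (by fun_prop)).inter (isOpen_lt continuous_const (by fun_prop))

theorem capInterior_subset (a b : ℝ) : capInterior a b ⊆ capDroplet a b := by
  rintro x ⟨h1, h2⟩ (h | h)
  · exact not_lt_of_gt (show 4 * capMass a < _ from h1) h
  · exact not_lt_of_gt (show 4 * capMass a < _ from h2) h

/-- The precritical droplet and `μ_V` have the same potential in the caps up to the constant `m`,
and in the rest of the sphere the comparison is Gibbs' inequality `sphereConst_le`. The constants `|m|`
and `|m| + m` keep both sides nonnegative. -/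
theorem exists_potential_comparison_of_le {a b : ℝ} (ha : 0 < a) (hb : 1 ≤ b)
    (hab : a * (b ^ 2 - 1) ≤ 1) : ∃ m : ℝ,
    (∀ x, x ∉ capInterior a b →
      chordPotential (uniformDroplet a (capDroplet a b)) x + ENNReal.ofReal |m| =
        chordPotential ((muV a b).map realPoint) x + ENNReal.ofReal (|m| + m)) ∧
    (∀ x, chordPotential (uniformDroplet a (capDroplet a b)) x + ENNReal.ofReal |m| ≤
        chordPotential ((muV a b).map realPoint) x + ENNReal.ofReal (|m| + m)) := by
  refine ⟨(1 + 2 * a) * (capConst (1 - capMass a) - capConst (capMass a)) - cauchyConst b,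
    fun x hx => ?_, fun x => ?_⟩
  · obtain ⟨s, hs, hd⟩ : ∃ s : ℝ, (s = 1 ∨ s = -1) ∧
        dist x (imagPoint (s * b)) ^ 2 ≤ 4 * capMass a := by
      by_contra hcon
      push Not at hcon
      exact hx ⟨by simpa using hcon 1 (Or.inl rfl), by simpa using hcon (-1) (Or.inr rfl)⟩
    have hsx := mul_apply_one_nonneg_of_dist_le ha hb hab hs hd
    obtain ⟨hg, hg0⟩ := chordPotential_muV_of_le ha hb hab hs hsx
    obtain ⟨f, hf0, hf, hf1, hf2⟩ := chordPotential_capDroplet ha hb hab hs hsx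
    refine ENNReal.ofReal_sum_of_eq_add hf hf0 hg hg0 ?_
    by_cases hxc : x ∈ openCap (imagPoint (s * b)) (capMass a)
    · rw [hf2 hxc]
      ring
    · rw [hf1 hxc]
      have heq : dist x (imagPoint (s * b)) ^ 2 = 4 * capMass a := le_antisymm hd (not_lt.1 hxc)
      linarith [mul_sphereConst_eq ha heq]
  · obtain ⟨s, hs, hsx⟩ := exists_sign (x.1 1)
    obtain ⟨hg, hg0⟩ := chordPotential_muV_of_le ha hb hab hs hsx
    obtain ⟨f, hf0, hf, hf1, hf2⟩ := chordPotential_capDroplet ha hb hab hs hsx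
    refine ENNReal.ofReal_sum_of_le_add hf hf0 hg hg0 ?_
    by_cases hxc : x ∈ openCap (imagPoint (s * b)) (capMass a)
    · rw [hf2 hxc]
      linarith
    · rw [hf1 hxc]
      have hne : x ≠ imagPoint (s * b) := by
        rintro rfl
        exact hxc (imagPoint_mem_openCap ha _)
      linarith [mul_sphereConst_le ha hb hs hsx hne]

/-! ### Harmonic measures of a slit and their potentials -/

theorem lintegral_cauchyLaw_neg (γ : ℝ) {f : ℝ → ℝ≥0∞} (hf : Measurable f) :
    ∫⁻ t, f (-t) ∂(cauchyLaw γ) = ∫⁻ t, f t ∂(cauchyLaw γ) := by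
  have hm : Measurable fun t : ℝ => ENNReal.ofReal (γ / (Real.pi * (t ^ 2 + γ ^ 2))) := by fun_prop
  rw [cauchyLaw, lintegral_withDensity_eq_lintegral_mul _ hm (by fun_prop),
    lintegral_withDensity_eq_lintegral_mul _ hm hf, ← lintegral_neg_eq_self]
  simp

theorem ae_cauchyLaw_notMem (γ : ℝ) {s : Set ℝ} (hs : s.Subsingleton) :
    ∀ᵐ t ∂(cauchyLaw γ), t ∉ s := by
  refine measure_eq_zero_iff_ae_notMem.1 ?_
  rcases hs.eq_empty_or_singleton with h | ⟨t, h⟩ <;> rw [h]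
  · simp
  · exact cauchyLaw_singleton γ t

/-- The increasing parametrization of the slit `(-A, A)` by the real line. It carries the Cauchy
distributions to the harmonic measures of the complement of the slit from points of the imaginary
axis. -/
noncomputable def slitParam (A t : ℝ) : ℝ := A * t / √(1 + t ^ 2)

theorem continuous_slitParam (A : ℝ) : Continuous (slitParam A) :=
  (continuous_const.mul continuous_id).div (by fun_prop) fun t => by positivity

theorem slitParam_neg (A t : ℝ) : slitParam A (-t) = -slitParam A t := by
  simp [slitParam, neg_div]

theorem slitParam_sq (A t : ℝ) : slitParam A t ^ 2 = A ^ 2 * t ^ 2 / (1 + t ^ 2) := by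
  rw [slitParam, div_pow, Real.sq_sqrt (by positivity), mul_pow]

theorem hasDerivAt_slitParam (A t : ℝ) :
    HasDerivAt (slitParam A) (A / ((1 + t ^ 2) * √(1 + t ^ 2))) t := by
  have h0 : 0 < 1 + t ^ 2 := by positivity
  have h1 : HasDerivAt (fun t : ℝ => 1 + t ^ 2) (2 * t) t := by
    simpa using (hasDerivAt_pow 2 t).const_add 1
  have h2 := h1.sqrt h0.ne'
  have h3 : HasDerivAt (fun t : ℝ => A * t) A t := by
    simpa using (hasDerivAt_id t).const_mul A
  refine (h3.div h2 (by positivity)).congr_deriv ?_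
  rw [Real.sq_sqrt h0.le]
  have hs := Real.sq_sqrt h0.le
  field_simp
  rw [hs]
  ring

theorem injective_slitParam {A : ℝ} (hA : 0 < A) : Function.Injective (slitParam A) := by
  refine (strictMono_of_hasDerivAt_pos (hasDerivAt_slitParam A) fun t => ?_).injective
  positivity

theorem range_slitParam {A : ℝ} (hA : 0 < A) : Set.range (slitParam A) = Set.Ioo (-A) A := by
  ext x
  constructor
  · rintro ⟨t, rfl⟩
    rw [Set.mem_Ioo, ← abs_lt]
    refine abs_lt_of_sq_lt_sq ?_ hA.le
    rw [slitParam_sq, div_lt_iff₀ (by positivity)]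
    nlinarith [sq_pos_of_pos hA]
  · rintro ⟨h1, h2⟩
    have h : 0 < A ^ 2 - x ^ 2 := by nlinarith
    refine ⟨x / √(A ^ 2 - x ^ 2), ?_⟩
    have e : 1 + (x / √(A ^ 2 - x ^ 2)) ^ 2 = A ^ 2 / (A ^ 2 - x ^ 2) := by
      rw [div_pow, Real.sq_sqrt h.le]
      field_simp
      ring
    rw [slitParam, e, Real.sqrt_div (by positivity), Real.sqrt_sq hA.le]
    field_simp

/-- The harmonic measure of the slit `[-A, A]` seen from `± i A γ / √(1 - γ²)`, for `0 < γ < 1`. -/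
noncomputable def slitLaw (A γ : ℝ) : Measure ℝ := (cauchyLaw γ).map (slitParam A)

theorem isProbabilityMeasure_slitLaw (A : ℝ) {γ : ℝ} (hγ : 0 < γ) :
    IsProbabilityMeasure (slitLaw A γ) := by
  have := isProbabilityMeasure_cauchyLaw hγ
  exact Measure.isProbabilityMeasure_map (continuous_slitParam A).measurable.aemeasurable

theorem measurable_realPoint_slitParam (A : ℝ) : Measurable fun t => realPoint (slitParam A t) :=
  measurableEmbedding_realPoint.measurable.comp (continuous_slitParam A).measurable

theorem chordPotential_slitLaw_eq (A γ : ℝ) (x : S2) :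
    chordPotential ((slitLaw A γ).map realPoint) x =
      ∫⁻ t, chordKernel x (realPoint (slitParam A t)) ∂(cauchyLaw γ) := by
  have hm := measurableEmbedding_realPoint.measurable
  have hk := measurable_chordKernel_right x
  rw [chordPotential, lintegral_map hk hm, slitLaw, lintegral_map
    (f := fun t => chordKernel x (realPoint t)) (hk.comp hm) (continuous_slitParam A).measurable]

theorem integral_log_one_add_mul_sq_cauchyLaw {γ : ℝ} (hγ : 0 < γ) (A : ℝ) :
    Integrable (fun t : ℝ => Real.log (1 + (1 + A ^ 2) * t ^ 2)) (cauchyLaw γ) ∧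
      ∫ t : ℝ, Real.log (1 + (1 + A ^ 2) * t ^ 2) ∂(cauchyLaw γ) =
        2 * Real.log (1 + γ * √(1 + A ^ 2)) := by
  have := isProbabilityMeasure_cauchyLaw hγ
  have hk : 0 < √(1 + A ^ 2) := by positivity
  have hk2 : √(1 + A ^ 2) ^ 2 = 1 + A ^ 2 := Real.sq_sqrt (by positivity)
  set k := √(1 + A ^ 2)
  have h := integrable_log_norm_sub_cauchyLaw hγ (z := ((k⁻¹ : ℝ) : ℂ) * Complex.I)
    (by simp [hk.le])
  have e : ∀ t : ℝ, Real.log (1 + (1 + A ^ 2) * t ^ 2) =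
      2 * Real.log k + 2 * Real.log ‖((k⁻¹ : ℝ) : ℂ) * Complex.I - t‖ := fun t => by
    have h1 : ‖((k⁻¹ : ℝ) : ℂ) * Complex.I - t‖ ^ 2 = (1 + (1 + A ^ 2) * t ^ 2) / k ^ 2 := by
      rw [Complex.sq_norm_eq, ← hk2]
      simp
      field_simp
      ring
    have h2 : 2 * Real.log ‖((k⁻¹ : ℝ) : ℂ) * Complex.I - t‖ =
        Real.log (‖((k⁻¹ : ℝ) : ℂ) * Complex.I - t‖ ^ 2) := by
      rw [Real.log_pow]
      push_cast
      ring
    rw [h2, h1, Real.log_div (by positivity) (by positivity), Real.log_pow]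
    push_cast
    ring
  simp_rw [e]
  refine ⟨(integrable_const _).add (h.1.const_mul 2), ?_⟩
  rw [integral_add (integrable_const _) (h.1.const_mul 2),
    integral_const_mul 2 fun t : ℝ => Real.log ‖((k⁻¹ : ℝ) : ℂ) * Complex.I - t‖, h.2,
    show ((k⁻¹ : ℝ) : ℂ) * Complex.I + γ * Complex.I = ((k⁻¹ + γ : ℝ) : ℂ) * Complex.I by
      push_cast; ring, norm_mul, Complex.norm_I, mul_one, Complex.norm_real,
    Real.norm_of_nonneg (by positivity)]
  simp only [integral_const, probReal_univ, smul_eq_mul, one_mul]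
  rw [← mul_add, ← Real.log_mul hk.ne' (by positivity)]
  congr 2
  field_simp

theorem one_add_slitParam_sq (A t : ℝ) :
    1 + slitParam A t ^ 2 = (1 + (1 + A ^ 2) * t ^ 2) / (1 + t ^ 2) := by
  rw [slitParam_sq]
  field_simp
  ring

theorem chordPotential_slitLaw_north (A : ℝ) {γ : ℝ} (hγ : 0 < γ) :
    chordPotential ((slitLaw A γ).map realPoint) S2.north =
      ENNReal.ofReal (Real.log (1 + γ * √(1 + A ^ 2)) - Real.log (1 + γ)) := by
  have h1 := integral_log_one_add_mul_sq_cauchyLaw hγ A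
  have h2 := integral_log_one_add_sq_cauchyLaw hγ
  have e : ∀ t, chordKernel S2.north (realPoint (slitParam A t)) =
      ENNReal.ofReal ((Real.log (1 + (1 + A ^ 2) * t ^ 2) - Real.log (1 + t ^ 2)) / 2) :=
      fun t => by
    rw [realPoint, chordKernel_of_ne (S2.ofComplex_ne_north _).symm, log_two_div_dist_north,
      Complex.norm_real, Real.norm_eq_abs, sq_abs, one_add_slitParam_sq,
      Real.log_div (by positivity) (by positivity)]
  rw [chordPotential_slitLaw_eq]
  simp_rw [e]
  have hi : Integrable (fun t : ℝ => (Real.log (1 + (1 + A ^ 2) * t ^ 2) -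
    Real.log (1 + t ^ 2)) / 2) (cauchyLaw γ) := (h1.1.sub h2.1).div_const 2
  rw [← ofReal_integral_eq_lintegral_ofReal hi (.of_forall fun t => ?_), integral_div,
    integral_sub h1.1 h2.1, h1.2, h2.2]
  · congr 1
    ring
  · have : Real.log (1 + t ^ 2) ≤ Real.log (1 + (1 + A ^ 2) * t ^ 2) :=
      Real.log_le_log (by positivity) (by nlinarith [mul_nonneg (sq_nonneg A) (sq_nonneg t)])
    simp only [Pi.zero_apply]
    linarith

theorem norm_neg_conj_add_mul_I (z : ℂ) (γ : ℝ) :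
    ‖-starRingEnd ℂ z + γ * Complex.I‖ = ‖z + γ * Complex.I‖ := by
  rw [← Complex.norm_conj (z + γ * Complex.I), ← norm_neg]
  congr 1
  simp
  ring

/-- The logarithmic integral that gives the potential of `slitLaw`. The root `R` of `A² - z²` is
the one that makes the Möbius image of `z` a point of the upper half-plane. -/
theorem integral_log_norm_sq_sub_cauchyLaw {γ : ℝ} (hγ : 0 < γ) {z R : ℂ} (hz : z ≠ 0 ∨ R ≠ 0)
    (him : 0 ≤ (z / R).im) :
    Integrable (fun t : ℝ => Real.log ‖z ^ 2 - R ^ 2 * t ^ 2‖) (cauchyLaw γ) ∧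
      ∫ t : ℝ, Real.log ‖z ^ 2 - R ^ 2 * t ^ 2‖ ∂(cauchyLaw γ) =
        2 * Real.log ‖z + γ * Complex.I * R‖ := by
  have := isProbabilityMeasure_cauchyLaw hγ
  by_cases hR : R = 0
  · subst hR
    simpa using integrable_const (μ := cauchyLaw γ) (2 * Real.log ‖z‖)
  have him' : 0 ≤ (-starRingEnd ℂ (z / R)).im := by
    rwa [Complex.neg_im, Complex.conj_im, neg_neg]
  have h1 := integrable_log_norm_sub_cauchyLaw hγ him
  have h2 := integrable_log_norm_sub_cauchyLaw hγ him'
  have e2 : ∀ t : ℝ, ‖-starRingEnd ℂ (z / R) - t‖ = ‖z / R + t‖ := fun t => by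
    rw [← Complex.norm_conj (z / R + t), ← norm_neg]
    congr 1
    simp
    ring
  simp_rw [e2] at h2
  have hnull : ∀ᵐ t : ℝ ∂(cauchyLaw γ), z / R - t ≠ 0 ∧ z / R + t ≠ 0 := by
    have hs : ∀ w : ℂ, ∀ᵐ t : ℝ ∂(cauchyLaw γ), (t : ℂ) ≠ w := fun w => by
      have hsub : {t : ℝ | (t : ℂ) = w}.Subsingleton := fun a ha b hb => by
        exact_mod_cast (show (a : ℂ) = b from ha.trans hb.symm)
      exact ae_cauchyLaw_notMem γ hsub
    filter_upwards [hs (z / R), hs (-(z / R))] with t ht1 ht2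
    refine ⟨sub_ne_zero.2 ht1.symm, fun h => ht2 ?_⟩
    rw [eq_neg_iff_add_eq_zero, add_comm]
    exact h
  have hae : (fun t : ℝ => Real.log ‖z ^ 2 - R ^ 2 * t ^ 2‖) =ᵐ[cauchyLaw γ]
      fun t => 2 * Real.log ‖R‖ + Real.log ‖z / R - t‖ + Real.log ‖z / R + t‖ := by
    filter_upwards [hnull] with t ht
    have : z ^ 2 - R ^ 2 * t ^ 2 = R ^ 2 * (z / R - t) * (z / R + t) := by
      field_simp
      ring
    rw [this, norm_mul, norm_mul, norm_pow, Real.log_mul (by simp [hR, ht.1]) (by simp [ht.2]),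
      Real.log_mul (by simp [hR]) (by simp [ht.1]), Real.log_pow]
    push_cast
    ring
  have hc : Integrable (fun _ : ℝ => 2 * Real.log ‖R‖) (cauchyLaw γ) := integrable_const _
  have hc1 : Integrable (fun t : ℝ => 2 * Real.log ‖R‖ + Real.log ‖z / R - t‖) (cauchyLaw γ) :=
    hc.add h1.1
  refine ⟨(integrable_congr hae).2 (hc1.add h2.1), ?_⟩
  rw [integral_congr_ae hae, integral_add hc1 h2.1, integral_add hc h1.1, h1.2, h2.2,
    norm_neg_conj_add_mul_I]
  have e3 : z + γ * Complex.I * R = R * (z / R + γ * Complex.I) := by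
    field_simp
  rw [e3, norm_mul, Real.log_mul (by simp [hR]) (norm_ne_zero_iff.2 (add_mul_I_ne_zero hγ him))]
  simp
  ring

/-- The choice of the root `R` of `A² - z²` with `z / R` in the closed upper half-plane plays the
part of the branch of `√(z² - A²)` on the complement of the slit. -/
theorem chordPotential_slitLaw {A γ : ℝ} (hA : 0 < A) (hγ : 0 < γ) {z R : ℂ}
    (hR : R ^ 2 = A ^ 2 - z ^ 2) (him : 0 ≤ (z / R).im) :
    chordPotential ((slitLaw A γ).map realPoint) (S2.ofComplex z) = ENNReal.ofReal
      (Real.log (1 + ‖z‖ ^ 2) / 2 + Real.log (1 + γ * √(1 + A ^ 2)) -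
        Real.log ‖z + γ * Complex.I * R‖) ∧
    0 ≤ Real.log (1 + ‖z‖ ^ 2) / 2 + Real.log (1 + γ * √(1 + A ^ 2)) -
        Real.log ‖z + γ * Complex.I * R‖ := by
  have := isProbabilityMeasure_cauchyLaw hγ
  have hzR : z ≠ 0 ∨ R ≠ 0 := by
    by_contra h
    push Not at h
    rw [h.1, h.2] at hR
    exact pow_ne_zero 2 (Complex.ofReal_ne_zero.2 hA.ne') (by simpa using hR.symm)
  have h1 := integral_log_one_add_mul_sq_cauchyLaw hγ A
  have h2 := integral_log_norm_sq_sub_cauchyLaw hγ hzR him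
  have hk := measurable_chordKernel_right (S2.ofComplex z)
  have hm := measurable_realPoint_slitParam A
  set E : ℝ → ℝ := fun t => Real.log (1 + ‖z‖ ^ 2) + Real.log (1 + (1 + A ^ 2) * t ^ 2) -
    Real.log ‖z ^ 2 - R ^ 2 * t ^ 2‖ with hE
  have hc : Integrable (fun _ : ℝ => Real.log (1 + ‖z‖ ^ 2)) (cauchyLaw γ) := integrable_const _
  have hc1 : Integrable (fun t : ℝ => Real.log (1 + ‖z‖ ^ 2) +
    Real.log (1 + (1 + A ^ 2) * t ^ 2)) (cauchyLaw γ) := hc.add h1.1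
  have hEint : Integrable E (cauchyLaw γ) := hc1.sub h2.1
  have hEval : ∫ t, E t ∂(cauchyLaw γ) = 2 * (Real.log (1 + ‖z‖ ^ 2) / 2 +
      Real.log (1 + γ * √(1 + A ^ 2)) - Real.log ‖z + γ * Complex.I * R‖) := by
    rw [hE, integral_sub hc1 h2.1, integral_add hc h1.1, h1.2, h2.2]
    simp
    ring
  have hnull : ∀ᵐ t : ℝ ∂(cauchyLaw γ), z ≠ slitParam A t ∧ z ≠ slitParam A (-t) := by
    have hs : ∀ᵐ t : ℝ ∂(cauchyLaw γ), z ≠ slitParam A t := by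
      have hsub : {t : ℝ | z = slitParam A t}.Subsingleton := fun a ha b hb =>
        injective_slitParam hA (by exact_mod_cast ha.symm.trans hb)
      exact ae_cauchyLaw_notMem γ hsub
    have hs' : ∀ᵐ t : ℝ ∂(cauchyLaw γ), z ≠ slitParam A (-t) := by
      have hsub : {t : ℝ | z = slitParam A (-t)}.Subsingleton := fun a ha b hb =>
        neg_injective (injective_slitParam hA (by exact_mod_cast ha.symm.trans hb))
      exact ae_cauchyLaw_notMem γ hsub
    filter_upwards [hs, hs'] with t ht ht' using ⟨ht, ht'⟩
  have hker : ∀ᵐ t : ℝ ∂(cauchyLaw γ), chordKernel (S2.ofComplex z) (realPoint (slitParam A t)) +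
      chordKernel (S2.ofComplex z) (realPoint (slitParam A (-t))) = ENNReal.ofReal (E t) ∧
      0 ≤ E t := by
    filter_upwards [hnull] with t ht
    have key : ∀ s : ℝ, z ≠ s → chordKernel (S2.ofComplex z) (realPoint s) =
        ENNReal.ofReal (Real.log (1 + ‖z‖ ^ 2) / 2 + Real.log (1 + s ^ 2) / 2 -
          Real.log ‖z - s‖) ∧ 0 ≤ Real.log (1 + ‖z‖ ^ 2) / 2 + Real.log (1 + s ^ 2) / 2 -
          Real.log ‖z - s‖ := fun s hs => by
      have e : ‖(s : ℂ)‖ ^ 2 = s ^ 2 := by rw [Complex.norm_real, Real.norm_eq_abs, sq_abs]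
      have e2 := chordKernel_ofComplex hs
      have e3 := log_two_div_dist_ofComplex hs
      rw [e] at e2 e3
      exact ⟨e2, e3 ▸ log_two_div_dist_nonneg _ _⟩
    have hE' : E t = (Real.log (1 + ‖z‖ ^ 2) / 2 + Real.log (1 + slitParam A t ^ 2) / 2 -
          Real.log ‖z - slitParam A t‖) + (Real.log (1 + ‖z‖ ^ 2) / 2 +
          Real.log (1 + slitParam A (-t) ^ 2) / 2 - Real.log ‖z - slitParam A (-t)‖) := by
      have n1 : ‖z - slitParam A t‖ ≠ 0 := norm_ne_zero_iff.2 (sub_ne_zero.2 ht.1)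
      have n2 : ‖z - slitParam A (-t)‖ ≠ 0 := norm_ne_zero_iff.2 (sub_ne_zero.2 ht.2)
      have hpos : (0 : ℝ) < 1 + t ^ 2 := by positivity
      have e0 : ((1 : ℂ) + (t : ℂ) ^ 2) ≠ 0 := by exact_mod_cast hpos.ne'
      have e1 : (z - slitParam A t) * (z - slitParam A (-t)) =
          (z ^ 2 - R ^ 2 * t ^ 2) / ((1 + t ^ 2 : ℝ) : ℂ) := by
        have e2 : ((slitParam A t ^ 2 : ℝ) : ℂ) = A ^ 2 * t ^ 2 / (1 + t ^ 2) := by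
          rw [slitParam_sq]
          push_cast
          rfl
        rw [slitParam_neg, hR]
        push_cast at e2 ⊢
        have e3 : (z - (slitParam A t : ℂ)) * (z - -(slitParam A t : ℂ)) =
            z ^ 2 - (slitParam A t : ℂ) ^ 2 := by ring
        rw [e3, e2]
        field_simp
        ring
      have e4 : ‖z ^ 2 - R ^ 2 * t ^ 2‖ =
          ‖z - slitParam A t‖ * ‖z - slitParam A (-t)‖ * (1 + t ^ 2) := by
        rw [← norm_mul, e1, norm_div, Complex.norm_real, Real.norm_of_nonneg hpos.le]
        field_simp
      rw [slitParam_neg, neg_sq, one_add_slitParam_sq, Real.log_div (by positivity)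
        (by positivity), ← slitParam_neg]
      simp only [hE]
      rw [e4, Real.log_mul (mul_ne_zero n1 n2) hpos.ne', Real.log_mul n1 n2]
      ring
    rw [(key _ ht.1).1, (key _ ht.2).1, ← ENNReal.ofReal_add (key _ ht.1).2 (key _ ht.2).2, hE']
    exact ⟨rfl, add_nonneg (key _ ht.1).2 (key _ ht.2).2⟩
  have hE0 : 0 ≤ᵐ[cauchyLaw γ] E := hker.mono fun t ht => ht.2
  have h0 : 0 ≤ Real.log (1 + ‖z‖ ^ 2) / 2 + Real.log (1 + γ * √(1 + A ^ 2)) -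
      Real.log ‖z + γ * Complex.I * R‖ := by
    have := integral_nonneg_of_ae hE0
    rw [hEval] at this
    linarith
  refine ⟨?_, h0⟩
  have hsum : chordPotential ((slitLaw A γ).map realPoint) (S2.ofComplex z) +
      chordPotential ((slitLaw A γ).map realPoint) (S2.ofComplex z) =
      ENNReal.ofReal (∫ t, E t ∂(cauchyLaw γ)) := by
    rw [ofReal_integral_eq_lintegral_ofReal hEint hE0, ← lintegral_congr_ae
      (hker.mono fun t ht => ht.1), lintegral_add_left (f := fun t =>
        chordKernel (S2.ofComplex z) (realPoint (slitParam A t))) (hk.comp hm),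
      lintegral_cauchyLaw_neg γ (f := fun t =>
        chordKernel (S2.ofComplex z) (realPoint (slitParam A t))) (hk.comp hm),
      chordPotential_slitLaw_eq]
  rw [hEval, ← two_mul, ENNReal.ofReal_mul zero_le_two, ENNReal.ofReal_ofNat] at hsum
  exact (ENNReal.mul_right_inj two_ne_zero ENNReal.ofNat_ne_top).1 hsum

/-! ### The measure `μ_V` in the postcritical case -/

/-- The scale `k` with `√(A² + b²) = a b k` and `√(A² + b⁻²) = (1 + a) k / b`. -/
noncomputable def slitScale (a b : ℝ) : ℝ :=
  √((b ^ 4 - 1) / ((b ^ 2 * a + a + 1) * (b ^ 2 * a - a - 1)))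

theorem one_lt_of_postcritical {a b : ℝ} (hb : 1 ≤ b) (hab : 1 < a * (b ^ 2 - 1)) :
    1 < b := by
  rcases hb.eq_or_lt with h | h
  · rw [← h] at hab
    norm_num at hab
  · exact h

theorem slitScale_sq {a b : ℝ} (ha : 0 < a) (hb : 1 ≤ b) (hab : 1 < a * (b ^ 2 - 1)) :
    slitScale a b ^ 2 = (b ^ 4 - 1) / ((b ^ 2 * a + a + 1) * (b ^ 2 * a - a - 1)) := by
  have hQ : 0 < b ^ 2 * a - a - 1 := by nlinarith
  have hP : 0 < b ^ 2 * a + a + 1 := by positivity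
  have h4 : 1 ≤ b ^ 4 := one_le_pow₀ hb
  exact Real.sq_sqrt (div_nonneg (by linarith) (by positivity))

theorem slitScale_pos {a b : ℝ} (ha : 0 < a) (hb : 1 ≤ b) (hab : 1 < a * (b ^ 2 - 1)) :
    0 < slitScale a b := by
  have hQ : 0 < b ^ 2 * a - a - 1 := by nlinarith
  have hP : 0 < b ^ 2 * a + a + 1 := by positivity
  have h4 : 1 < b ^ 4 := one_lt_pow₀ (one_lt_of_postcritical hb hab) (by norm_num)
  exact Real.sqrt_pos.2 (div_pos (by linarith) (by positivity))

theorem constA_pos {a b : ℝ} (ha : 0 < a) (hb : 1 ≤ b) (hab : 1 < a * (b ^ 2 - 1)) :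
    0 < constA a b := by
  have hQ : 0 < b ^ 2 * a - a - 1 := by nlinarith
  have hP : 0 < b ^ 2 * a + a + 1 := by positivity
  have hb0 : 0 < b := by linarith
  unfold constA
  positivity

theorem constA_sq {a b : ℝ} (ha : 0 < a) (hb : 1 ≤ b) (hab : 1 < a * (b ^ 2 - 1)) :
    constA a b ^ 2 = b ^ 2 * (1 + 2 * a) / ((b ^ 2 * a + a + 1) * (b ^ 2 * a - a - 1)) := by
  have hQ : 0 < b ^ 2 * a - a - 1 := by nlinarith
  have hP : 0 < b ^ 2 * a + a + 1 := by positivity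
  rw [constA, div_pow, mul_pow, mul_pow, Real.sq_sqrt (by linarith), Real.sq_sqrt hP.le,
    Real.sq_sqrt hQ.le]

theorem constA_sq_add {a b : ℝ} (ha : 0 < a) (hb : 1 ≤ b) (hab : 1 < a * (b ^ 2 - 1)) :
    constA a b ^ 2 + b ^ 2 = (a * b * slitScale a b) ^ 2 := by
  have hQ : 0 < b ^ 2 * a - a - 1 := by nlinarith
  have hP : 0 < b ^ 2 * a + a + 1 := by positivity
  rw [mul_pow, slitScale_sq ha hb hab, constA_sq ha hb hab]
  generalize hPe : b ^ 2 * a + a + 1 = P at *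
  generalize hQe : b ^ 2 * a - a - 1 = Q at *
  field_simp
  rw [← hPe, ← hQe]
  ring

theorem constA_sq_add_inv {a b : ℝ} (ha : 0 < a) (hb : 1 ≤ b) (hab : 1 < a * (b ^ 2 - 1)) :
    constA a b ^ 2 + (b ^ 2)⁻¹ = ((1 + a) * slitScale a b / b) ^ 2 := by
  have hQ : 0 < b ^ 2 * a - a - 1 := by nlinarith
  have hP : 0 < b ^ 2 * a + a + 1 := by positivity
  have hb0 : 0 < b := by linarith
  rw [div_pow, mul_pow, slitScale_sq ha hb hab, constA_sq ha hb hab]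
  generalize hPe : b ^ 2 * a + a + 1 = P at *
  generalize hQe : b ^ 2 * a - a - 1 = Q at *
  field_simp
  rw [← hPe, ← hQe]
  ring

theorem sqrt_constC_mul {a b : ℝ} (ha : 0 < a) (hb : 1 ≤ b) (hab : 1 < a * (b ^ 2 - 1)) :
    √(constC a b) * constA a b ^ 2 = (1 + 2 * a) * slitScale a b := by
  have hQ : 0 < b ^ 2 * a - a - 1 := by nlinarith
  have hP : 0 < b ^ 2 * a + a + 1 := by positivity
  have hb0 : 0 < b := by linarith
  have h4 : 1 ≤ b ^ 4 := one_le_pow₀ hb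
  have hC : 0 ≤ constC a b := by
    rw [constC]
    have : 0 ≤ b ^ 4 - 1 := by linarith
    positivity
  have hk := (slitScale_pos ha hb hab).le
  refine (pow_left_inj₀ (by positivity) (by positivity) two_ne_zero).1 ?_
  rw [mul_pow, mul_pow, Real.sq_sqrt hC, slitScale_sq ha hb hab, constA_sq ha hb hab, constC]
  field_simp

/-- The density of `μ_V` in the parametrization of the slit by the real line. -/
noncomputable def slitDensity (a b t : ℝ) : ℝ :=
  √(constC a b) * constA a b ^ 2 / (Real.pi * ((constA a b ^ 2 + b ^ 2) * t ^ 2 + b ^ 2) *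
    ((constA a b ^ 2 + (b ^ 2)⁻¹) * t ^ 2 + (b ^ 2)⁻¹))

theorem slitDensity_nonneg (a b t : ℝ) : 0 ≤ slitDensity a b t := by
  have := Real.pi_pos
  unfold slitDensity
  positivity

theorem densityV_slitParam {a b : ℝ} (ha : 0 < a) (hb : 1 ≤ b) (hab : 1 < a * (b ^ 2 - 1))
    (t : ℝ) : constA a b / ((1 + t ^ 2) * √(1 + t ^ 2)) * densityV a b (slitParam (constA a b) t) =
      slitDensity a b t := by
  have hA := constA_pos ha hb hab
  have hb0 : 0 < b := by linarith
  have hpi := Real.pi_pos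
  have hmem : slitParam (constA a b) t ∈ Set.Icc (-constA a b) (constA a b) := by
    have : slitParam (constA a b) t ∈ Set.range (slitParam (constA a b)) := ⟨t, rfl⟩
    rw [range_slitParam hA] at this
    exact Set.Ioo_subset_Icc_self this
  rw [densityV, if_neg (not_le.2 hab), if_pos hmem, slitDensity]
  set A := constA a b
  have h0 : 0 < 1 + t ^ 2 := by positivity
  have e1 : A ^ 2 - slitParam A t ^ 2 = A ^ 2 / (1 + t ^ 2) := by
    rw [slitParam_sq]
    field_simp
    ring
  have e2 : ∀ d : ℝ, slitParam A t ^ 2 + d = ((A ^ 2 + d) * t ^ 2 + d) / (1 + t ^ 2) := fun d => by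
    rw [slitParam_sq]
    field_simp
    ring
  rw [e1, e2, e2, Real.sqrt_div (by positivity), Real.sqrt_sq hA.le]
  have hs := Real.sq_sqrt h0.le
  have hs0 : 0 < √(1 + t ^ 2) := by positivity
  have p1 : 0 < (A ^ 2 + b ^ 2) * t ^ 2 + b ^ 2 := by positivity
  have p2 : 0 < (A ^ 2 + (b ^ 2)⁻¹) * t ^ 2 + (b ^ 2)⁻¹ := by positivity
  generalize (A ^ 2 + b ^ 2) * t ^ 2 + b ^ 2 = p at p1 ⊢
  generalize (A ^ 2 + (b ^ 2)⁻¹) * t ^ 2 + (b ^ 2)⁻¹ = q at p2 ⊢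
  field_simp
  rw [hs]

theorem densityV_eq_zero {a b x : ℝ} (hab : 1 < a * (b ^ 2 - 1))
    (hx : x ∉ Set.Ioo (-constA a b) (constA a b)) : densityV a b x = 0 := by
  rw [densityV, if_neg (not_le.2 hab)]
  split_ifs with h
  · have : x ^ 2 = constA a b ^ 2 := by
      rcases h.1.eq_or_lt with h1 | h1
      · rw [← h1, neg_sq]
      · rcases h.2.eq_or_lt with h2 | h2
        · rw [h2]
        · exact absurd ⟨h1, h2⟩ hx
    simp [this]
  · rfl

theorem muV_eq_map {a b : ℝ} (ha : 0 < a) (hb : 1 ≤ b) (hab : 1 < a * (b ^ 2 - 1)) :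
    muV a b = (volume.withDensity fun t => ENNReal.ofReal (slitDensity a b t)).map
      (slitParam (constA a b)) := by
  have hA := constA_pos ha hb hab
  have hmeas := (continuous_slitParam (constA a b)).measurable
  ext s hs
  have h1 := lintegral_image_eq_lintegral_abs_deriv_mul MeasurableSet.univ
    (fun t _ => (hasDerivAt_slitParam (constA a b) t).hasDerivWithinAt)
    (injective_slitParam hA).injOn (s.indicator fun x => ENNReal.ofReal (densityV a b x))
  rw [Set.image_univ, range_slitParam hA, Measure.restrict_univ] at h1
  have h2 : s.indicator (fun x => ENNReal.ofReal (densityV a b x)) =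
      (Set.Ioo (-constA a b) (constA a b)).indicator
        (s.indicator fun x => ENNReal.ofReal (densityV a b x)) := by
    funext x
    by_cases hx : x ∈ Set.Ioo (-constA a b) (constA a b)
    · rw [Set.indicator_of_mem hx]
    · rw [Set.indicator_of_notMem hx]
      by_cases hxs : x ∈ s
      · rw [Set.indicator_of_mem hxs, densityV_eq_zero hab hx, ENNReal.ofReal_zero]
      · rw [Set.indicator_of_notMem hxs]
  rw [muV, withDensity_apply _ hs, ← lintegral_indicator hs, h2,
    lintegral_indicator measurableSet_Ioo, h1, Measure.map_apply hmeas hs,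
    withDensity_apply _ (hmeas hs), ← lintegral_indicator (hmeas hs)]
  refine lintegral_congr fun t => ?_
  by_cases ht : slitParam (constA a b) t ∈ s
  · have ht' : t ∈ slitParam (constA a b) ⁻¹' s := ht
    rw [Set.indicator_of_mem ht, Set.indicator_of_mem ht', ← ENNReal.ofReal_mul (abs_nonneg _),
      abs_of_nonneg (by positivity), densityV_slitParam ha hb hab]
  · have ht' : t ∉ slitParam (constA a b) ⁻¹' s := ht
    rw [Set.indicator_of_notMem ht, Set.indicator_of_notMem ht', mul_zero]

/-- The Cauchy scale of the harmonic measure of the slit from `i b`. -/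
noncomputable def scaleU (a b : ℝ) : ℝ := (a * slitScale a b)⁻¹

/-- The Cauchy scale of the harmonic measure of the slit from `i / b`. -/
noncomputable def scaleW (a b : ℝ) : ℝ := ((1 + a) * slitScale a b)⁻¹

theorem scaleU_pos {a b : ℝ} (ha : 0 < a) (hb : 1 ≤ b) (hab : 1 < a * (b ^ 2 - 1)) :
    0 < scaleU a b := inv_pos.2 (mul_pos ha (slitScale_pos ha hb hab))

theorem scaleW_pos {a b : ℝ} (ha : 0 < a) (hb : 1 ≤ b) (hab : 1 < a * (b ^ 2 - 1)) :
    0 < scaleW a b := inv_pos.2 (mul_pos (by linarith) (slitScale_pos ha hb hab))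

/-- In the postcritical case `μ_V` is a difference of harmonic measures of its support. -/
theorem muV_add_slitLaw {a b : ℝ} (ha : 0 < a) (hb : 1 ≤ b) (hab : 1 < a * (b ^ 2 - 1)) :
    muV a b + ENNReal.ofReal a • slitLaw (constA a b) (scaleU a b) =
      ENNReal.ofReal (1 + a) • slitLaw (constA a b) (scaleW a b) := by
  have hpi := Real.pi_pos
  have hb0 : 0 < b := by linarith
  have hk := slitScale_pos ha hb hab
  have hmeas := (continuous_slitParam (constA a b)).measurable
  have hm : ∀ γ : ℝ, Measurable fun t : ℝ => ENNReal.ofReal (γ / (Real.pi * (t ^ 2 + γ ^ 2))) :=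
    fun γ => by fun_prop
  rw [muV_eq_map ha hb hab, slitLaw, slitLaw, ← Measure.map_smul, ← Measure.map_smul,
    ← Measure.map_add _ _ hmeas]
  congr 1
  rw [cauchyLaw, cauchyLaw, ← withDensity_smul _ (hm _), ← withDensity_smul _ (hm _),
    ← withDensity_add_right _ ((hm _).const_smul _)]
  congr 1
  funext t
  have hU := (scaleU_pos ha hb hab).le
  have hW := (scaleW_pos ha hb hab).le
  simp only [Pi.add_apply, Pi.smul_apply, smul_eq_mul]
  rw [← ENNReal.ofReal_mul ha.le, ← ENNReal.ofReal_mul (by linarith),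
    ← ENNReal.ofReal_add (slitDensity_nonneg a b t) (by positivity)]
  congr 1
  rw [slitDensity, sqrt_constC_mul ha hb hab, constA_sq_add ha hb hab, constA_sq_add_inv ha hb hab,
    scaleU, scaleW]
  have q1 : a ^ 2 * slitScale a b ^ 2 * t ^ 2 + 1 ≠ 0 := by positivity
  have q2 : (1 + a) ^ 2 * slitScale a b ^ 2 * t ^ 2 + 1 ≠ 0 := by positivity
  have e1 : (a * b * slitScale a b) ^ 2 * t ^ 2 + b ^ 2 =
      b ^ 2 * (a ^ 2 * slitScale a b ^ 2 * t ^ 2 + 1) := by ring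
  have e2 : ((1 + a) * slitScale a b / b) ^ 2 * t ^ 2 + (b ^ 2)⁻¹ =
      ((1 + a) ^ 2 * slitScale a b ^ 2 * t ^ 2 + 1) / b ^ 2 := by
    field_simp
  have e3 : t ^ 2 + ((a * slitScale a b)⁻¹) ^ 2 =
      (a ^ 2 * slitScale a b ^ 2 * t ^ 2 + 1) / (a * slitScale a b) ^ 2 := by
    field_simp
  have e4 : t ^ 2 + (((1 + a) * slitScale a b)⁻¹) ^ 2 =
      ((1 + a) ^ 2 * slitScale a b ^ 2 * t ^ 2 + 1) / ((1 + a) * slitScale a b) ^ 2 := by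
    field_simp
  rw [e1, e2, e3, e4]
  field_simp
  ring

theorem isProbabilityMeasure_muV_of_lt {a b : ℝ} (ha : 0 < a) (hb : 1 ≤ b)
    (hab : 1 < a * (b ^ 2 - 1)) : IsProbabilityMeasure (muV a b) := by
  have i1 := isProbabilityMeasure_slitLaw (constA a b) (scaleU_pos ha hb hab)
  have i2 := isProbabilityMeasure_slitLaw (constA a b) (scaleW_pos ha hb hab)
  have h := congrArg (fun μ : Measure ℝ => μ Set.univ) (muV_add_slitLaw ha hb hab)
  simp only [Measure.coe_add, Measure.coe_smul, Pi.add_apply, Pi.smul_apply, measure_univ,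
    smul_eq_mul, mul_one] at h
  refine ⟨?_⟩
  rw [(ENNReal.eq_ofReal_sub ha.le (by linarith) h).1]
  simp

theorem chordPotential_muV_add_slit {a b : ℝ} (ha : 0 < a) (hb : 1 ≤ b)
    (hab : 1 < a * (b ^ 2 - 1)) (x : S2) :
    chordPotential ((muV a b).map realPoint) x + ENNReal.ofReal a *
        chordPotential ((slitLaw (constA a b) (scaleU a b)).map realPoint) x =
      ENNReal.ofReal (1 + a) *
        chordPotential ((slitLaw (constA a b) (scaleW a b)).map realPoint) x := by
  have hm := measurableEmbedding_realPoint.measurable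
  rw [← chordPotential_smul, ← chordPotential_smul, ← Measure.map_smul, ← Measure.map_smul,
    ← muV_add_slitLaw ha hb hab, Measure.map_add _ _ hm]
  exact (lintegral_add_measure _ _ _).symm

/-! ### Elliptic coordinates and the potential of `μ_V` -/

/-- The point with elliptic coordinates `(ρ, β)` with respect to the foci `± A`; the sets of
constant `ρ` are confocal ellipses. Both coordinates are doubled, so that `z²` depends on
`cosh (ρ + i β)` only. -/
noncomputable def ellipticPoint (A ρ β : ℝ) : ℂ :=
  A * Complex.cosh ((ρ + β * Complex.I) / 2)

theorem Complex.sq_norm_cosh_half (ρ β : ℝ) :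
    ‖Complex.cosh ((ρ + β * Complex.I) / 2)‖ ^ 2 = (Real.cosh ρ + Real.cos β) / 2 := by
  have e : ((ρ : ℂ) + β * Complex.I) / 2 = ((ρ / 2 : ℝ) : ℂ) + ((β / 2 : ℝ) : ℂ) * Complex.I := by
    push_cast
    ring
  have h1 : ρ = 2 * (ρ / 2) := by ring
  have h2 : β = 2 * (β / 2) := by ring
  rw [e, Complex.cosh_add, Complex.cosh_mul_I, Complex.sinh_mul_I, ← Complex.ofReal_cosh,
    ← Complex.ofReal_sinh, ← Complex.ofReal_cos, ← Complex.ofReal_sin, Complex.sq_norm_eq]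
  conv_rhs => rw [h1, h2, Real.cosh_two_mul, Real.cos_two_mul]
  have h3 := Real.cosh_sq (ρ / 2)
  have h4 := Real.sin_sq_add_cos_sq (β / 2)
  generalize Real.cosh (ρ / 2) = C at *
  generalize Real.sinh (ρ / 2) = S at *
  generalize Real.cos (β / 2) = c at *
  generalize Real.sin (β / 2) = s at *
  simp
  linear_combination S ^ 2 * h4 + (c ^ 2 - 1 / 2) * h3

theorem sq_norm_ellipticPoint (A ρ β : ℝ) :
    ‖ellipticPoint A ρ β‖ ^ 2 = A ^ 2 / 2 * (Real.cosh ρ + Real.cos β) := by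
  rw [ellipticPoint, norm_mul, mul_pow, Complex.sq_norm_cosh_half, Complex.norm_real,
    Real.norm_eq_abs, sq_abs]
  ring

theorem cosh_add_cos_nonneg (ρ β : ℝ) : 0 ≤ Real.cosh ρ + Real.cos β := by
  linarith [Real.one_le_cosh ρ, Real.neg_one_le_cos β]

theorem cosh_add_cos_pos {x : ℝ} (hx : 0 < x) (β : ℝ) : 0 < Real.cosh x + Real.cos β := by
  linarith [Real.one_lt_cosh.2 hx.ne', Real.neg_one_le_cos β]

theorem one_add_sq_norm_ellipticPoint {A : ℝ} (hA : 0 < A) (ρ β : ℝ) :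
    1 + ‖ellipticPoint A ρ β‖ ^ 2 =
      A ^ 2 / 2 * (2 / A ^ 2 + Real.cosh ρ + Real.cos β) := by
  rw [sq_norm_ellipticPoint]
  field_simp
  ring

theorem log_one_add_sq_norm_ellipticPoint {A : ℝ} (hA : 0 < A) (ρ β : ℝ) :
    Real.log (1 + ‖ellipticPoint A ρ β‖ ^ 2) =
      Real.log (A ^ 2 / 2) + Real.log (2 / A ^ 2 + Real.cosh ρ + Real.cos β) := by
  have h := cosh_add_cos_nonneg ρ β
  have h2 : 0 < 2 / A ^ 2 := by positivity
  rw [one_add_sq_norm_ellipticPoint hA, Real.log_mul (by positivity) (by linarith)]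

theorem exists_ellipticPoint {A : ℝ} (hA : 0 < A) (z : ℂ) :
    ∃ ρ β : ℝ, 0 ≤ ρ ∧ z = ellipticPoint A ρ β := by
  obtain ⟨v, hv⟩ := Complex.cos_surjective (z / A)
  have hA' : (A : ℂ) ≠ 0 := Complex.ofReal_ne_zero.2 hA.ne'
  have h1 : z = A * Complex.cosh (v * Complex.I) := by
    rw [Complex.cosh_mul_I, hv]
    field_simp
  have h2 : v * Complex.I = (((-(2 * v.im) : ℝ) : ℂ) + ((2 * v.re : ℝ) : ℂ) * Complex.I) / 2 := by
    apply Complex.ext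
    · simp
      ring
    · simp
  rcases le_total 0 (-(2 * v.im)) with h | h
  · exact ⟨_, _, h, by rw [ellipticPoint, ← h2, h1]⟩
  · refine ⟨2 * v.im, -(2 * v.re), by linarith, ?_⟩
    rw [ellipticPoint, h1, h2, ← Complex.cosh_neg]
    congr 2
    push_cast
    ring

theorem div_im_nonneg_of_elliptic {ρ : ℝ} (hρ : 0 ≤ ρ) (A β : ℝ) :
    0 ≤ (ellipticPoint A ρ β /
      (-Complex.I * A * Complex.sinh ((ρ + β * Complex.I) / 2))).im := by
  have e : ((ρ : ℂ) + β * Complex.I) / 2 = ((ρ / 2 : ℝ) : ℂ) + ((β / 2 : ℝ) : ℂ) * Complex.I := by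
    push_cast
    ring
  rw [ellipticPoint, e, Complex.cosh_add, Complex.cosh_mul_I, Complex.sinh_mul_I, Complex.sinh_add,
    Complex.cosh_mul_I, Complex.sinh_mul_I, ← Complex.ofReal_cosh, ← Complex.ofReal_sinh,
    ← Complex.ofReal_cos, ← Complex.ofReal_sin, Complex.div_im, ← sub_div]
  refine div_nonneg ?_ (Complex.normSq_nonneg _)
  have h1 : 0 ≤ Real.sinh (ρ / 2) := Real.sinh_nonneg_iff.2 (by linarith)
  have h2 := (Real.cosh_pos (ρ / 2)).le
  have h3 := Real.sin_sq_add_cos_sq (β / 2)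
  generalize Real.cosh (ρ / 2) = C at *
  generalize Real.sinh (ρ / 2) = S at *
  generalize Real.cos (β / 2) = c at *
  generalize Real.sin (β / 2) = s at *
  have h4 : 0 ≤ A ^ 2 * (S * C) := by positivity
  simp
  refine h4.trans_eq ?_
  linear_combination (-A ^ 2 * (S * C)) * h3

theorem sq_of_elliptic (A ρ β : ℝ) :
    (-Complex.I * A * Complex.sinh ((ρ + β * Complex.I) / 2)) ^ 2 =
      A ^ 2 - ellipticPoint A ρ β ^ 2 := by
  rw [ellipticPoint, mul_pow, mul_pow, mul_pow, neg_sq, Complex.I_sq, Complex.sinh_sq]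
  ring

theorem norm_add_tanh_of_elliptic (A y ρ β : ℝ) :
    ‖ellipticPoint A ρ β + (Real.tanh y : ℂ) * Complex.I *
      (-Complex.I * A * Complex.sinh ((ρ + β * Complex.I) / 2))‖ ^ 2 =
      A ^ 2 / Real.cosh y ^ 2 * ((Real.cosh (ρ + 2 * y) + Real.cos β) / 2) := by
  have hc := (Real.cosh_pos y).ne'
  have hc' : Complex.cosh y ≠ 0 := by
    rw [← Complex.ofReal_cosh]
    exact Complex.ofReal_ne_zero.2 hc
  have e : ellipticPoint A ρ β + (Real.tanh y : ℂ) * Complex.I *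
      (-Complex.I * A * Complex.sinh ((ρ + β * Complex.I) / 2)) =
      ((A / Real.cosh y : ℝ) : ℂ) * Complex.cosh (((ρ + 2 * y : ℝ) + β * Complex.I) / 2) := by
    have e2 : (((ρ + 2 * y : ℝ) : ℂ) + β * Complex.I) / 2 = (ρ + β * Complex.I) / 2 + y := by
      push_cast
      ring
    rw [e2, Complex.cosh_add, ellipticPoint, Real.tanh_eq_sinh_div_cosh]
    push_cast
    field_simp
    linear_combination (-A * Complex.sinh ((ρ + β * Complex.I) / 2) * Complex.sinh y) * Complex.I_sq
  rw [e, norm_mul, mul_pow, Complex.sq_norm_cosh_half, Complex.norm_real, Real.norm_eq_abs, sq_abs,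
    div_pow]

theorem log_one_add_tanh (y : ℝ) : Real.log (1 + Real.tanh y) = y - Real.log (Real.cosh y) := by
  have hc := Real.cosh_pos y
  have : 1 + Real.tanh y = Real.exp y / Real.cosh y := by
    rw [Real.tanh_eq_sinh_div_cosh, ← Real.cosh_add_sinh]
    field_simp
  rw [this, Real.log_div (Real.exp_pos y).ne' hc.ne', Real.log_exp]

theorem tanh_pos {y : ℝ} (hy : 0 < y) : 0 < Real.tanh y := by
  rw [Real.tanh_eq_sinh_div_cosh]
  exact div_pos (Real.sinh_pos_iff.2 hy) (Real.cosh_pos y)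

/-- The value at the north pole of the potential of the harmonic measure of the slit. -/
noncomputable def slitConst (A y : ℝ) : ℝ :=
  Real.log (1 + Real.tanh y * √(1 + A ^ 2)) - Real.log (1 + Real.tanh y)

theorem slitConst_nonneg {y : ℝ} (hy : 0 < y) (A : ℝ) : 0 ≤ slitConst A y := by
  have := tanh_pos hy
  have h1 : 1 ≤ √(1 + A ^ 2) := by
    rw [Real.one_le_sqrt]
    nlinarith [sq_nonneg A]
  exact sub_nonneg.2 (Real.log_le_log (by positivity) (by nlinarith))

theorem chordPotential_slitLaw_elliptic {A y ρ : ℝ} (hA : 0 < A) (hy : 0 < y) (hρ : 0 ≤ ρ)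
    (β : ℝ) :
    chordPotential ((slitLaw A (Real.tanh y)).map realPoint)
        (S2.ofComplex (ellipticPoint A ρ β)) =
      ENNReal.ofReal (Real.log (2 / A ^ 2 + Real.cosh ρ + Real.cos β) / 2 + slitConst A y + y -
        Real.log (Real.cosh (ρ + 2 * y) + Real.cos β) / 2) ∧
    0 ≤ Real.log (2 / A ^ 2 + Real.cosh ρ + Real.cos β) / 2 + slitConst A y + y -
        Real.log (Real.cosh (ρ + 2 * y) + Real.cos β) / 2 := by
  have h := chordPotential_slitLaw hA (tanh_pos hy) (sq_of_elliptic A ρ β)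
    (div_im_nonneg_of_elliptic hρ A β)
  have hc := Real.cosh_pos y
  have hp : 0 < Real.cosh (ρ + 2 * y) + Real.cos β := cosh_add_cos_pos (by linarith) β
  have e : Real.log ‖ellipticPoint A ρ β + (Real.tanh y : ℂ) * Complex.I *
      (-Complex.I * A * Complex.sinh ((ρ + β * Complex.I) / 2))‖ =
      Real.log A - Real.log (Real.cosh y) +
        (Real.log (Real.cosh (ρ + 2 * y) + Real.cos β) - Real.log 2) / 2 := by
    have h1 := congrArg Real.log (norm_add_tanh_of_elliptic A y ρ β)
    rw [Real.log_pow, Real.log_mul (by positivity) (by positivity), Real.log_div (by positivity)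
      (by positivity), Real.log_pow, Real.log_pow, Real.log_div hp.ne' two_ne_zero] at h1
    rw [Nat.cast_ofNat] at h1
    linarith
  rw [e, log_one_add_sq_norm_ellipticPoint hA, Real.log_div (by positivity) two_ne_zero,
    Real.log_pow] at h
  have e2 : (Real.log (2 / A ^ 2 + Real.cosh ρ + Real.cos β) / 2 + slitConst A y + y -
        Real.log (Real.cosh (ρ + 2 * y) + Real.cos β) / 2) =
      (((2 : ℕ) : ℝ) * Real.log A - Real.log 2 +
        Real.log (2 / A ^ 2 + Real.cosh ρ + Real.cos β)) / 2 +
        Real.log (1 + Real.tanh y * √(1 + A ^ 2)) -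
        (Real.log A - Real.log (Real.cosh y) +
          (Real.log (Real.cosh (ρ + 2 * y) + Real.cos β) - Real.log 2) / 2) := by
    rw [slitConst, log_one_add_tanh]
    push_cast
    ring
  rw [e2]
  exact h

/-- The parameter `u` with `A sinh u = b`. -/
noncomputable def paramU (a b : ℝ) : ℝ := Real.arsinh (b / constA a b)

/-- The parameter `w` with `A sinh w = 1 / b`. -/
noncomputable def paramW (a b : ℝ) : ℝ := Real.arsinh (b⁻¹ / constA a b)

theorem constA_mul_sinh_paramU {a b : ℝ} (ha : 0 < a) (hb : 1 ≤ b) (hab : 1 < a * (b ^ 2 - 1)) :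
    constA a b * Real.sinh (paramU a b) = b := by
  have := constA_pos ha hb hab
  rw [paramU, Real.sinh_arsinh]
  field_simp

theorem constA_mul_sinh_paramW {a b : ℝ} (ha : 0 < a) (hb : 1 ≤ b) (hab : 1 < a * (b ^ 2 - 1)) :
    constA a b * Real.sinh (paramW a b) = b⁻¹ := by
  have := constA_pos ha hb hab
  rw [paramW, Real.sinh_arsinh]
  field_simp

theorem paramW_pos {a b : ℝ} (ha : 0 < a) (hb : 1 ≤ b) (hab : 1 < a * (b ^ 2 - 1)) :
    0 < paramW a b := by
  have := constA_pos ha hb hab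
  have hb0 : 0 < b := by linarith
  exact Real.arsinh_pos_iff.2 (by positivity)

theorem paramW_lt_paramU {a b : ℝ} (ha : 0 < a) (hb : 1 ≤ b) (hab : 1 < a * (b ^ 2 - 1)) :
    paramW a b < paramU a b := by
  have := constA_pos ha hb hab
  have hb1 := one_lt_of_postcritical hb hab
  refine Real.arsinh_lt_arsinh.2 ((div_lt_div_iff_of_pos_right this).2 ?_)
  exact (inv_lt_one_of_one_lt₀ hb1).trans hb1

theorem constA_mul_cosh_paramU {a b : ℝ} (ha : 0 < a) (hb : 1 ≤ b) (hab : 1 < a * (b ^ 2 - 1)) :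
    constA a b * Real.cosh (paramU a b) = a * b * slitScale a b := by
  have hA := constA_pos ha hb hab
  have hk := slitScale_pos ha hb hab
  have hb0 : 0 < b := by linarith
  refine (pow_left_inj₀ (mul_nonneg hA.le (Real.cosh_pos _).le) (by positivity) two_ne_zero).1 ?_
  rw [← constA_sq_add ha hb hab, mul_pow, Real.cosh_sq, mul_add, mul_one, ← mul_pow,
    constA_mul_sinh_paramU ha hb hab]
  ring

theorem constA_mul_cosh_paramW {a b : ℝ} (ha : 0 < a) (hb : 1 ≤ b) (hab : 1 < a * (b ^ 2 - 1)) :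
    constA a b * Real.cosh (paramW a b) = (1 + a) * slitScale a b / b := by
  have hA := constA_pos ha hb hab
  have hk := slitScale_pos ha hb hab
  have hb0 : 0 < b := by linarith
  refine (pow_left_inj₀ (mul_nonneg hA.le (Real.cosh_pos _).le) (by positivity) two_ne_zero).1 ?_
  rw [← constA_sq_add_inv ha hb hab, mul_pow, Real.cosh_sq, mul_add, mul_one, ← mul_pow,
    constA_mul_sinh_paramW ha hb hab, inv_pow]
  ring

theorem tanh_paramU {a b : ℝ} (ha : 0 < a) (hb : 1 ≤ b) (hab : 1 < a * (b ^ 2 - 1)) :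
    Real.tanh (paramU a b) = scaleU a b := by
  have hA := constA_pos ha hb hab
  have hk := slitScale_pos ha hb hab
  have hb0 : 0 < b := by linarith
  rw [Real.tanh_eq_sinh_div_cosh, ← mul_div_mul_left _ _ hA.ne', constA_mul_sinh_paramU ha hb hab,
    constA_mul_cosh_paramU ha hb hab, scaleU]
  field_simp

theorem tanh_paramW {a b : ℝ} (ha : 0 < a) (hb : 1 ≤ b) (hab : 1 < a * (b ^ 2 - 1)) :
    Real.tanh (paramW a b) = scaleW a b := by
  have hA := constA_pos ha hb hab
  have hk := slitScale_pos ha hb hab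
  have hb0 : 0 < b := by linarith
  rw [Real.tanh_eq_sinh_div_cosh, ← mul_div_mul_left _ _ hA.ne', constA_mul_sinh_paramW ha hb hab,
    constA_mul_cosh_paramW ha hb hab, scaleW]
  field_simp

/-- The relation between `u` and `w` that makes the density of `μ_V` vanish at `± A`. -/
theorem mul_tanh_paramU {a b : ℝ} (ha : 0 < a) (hb : 1 ≤ b) (hab : 1 < a * (b ^ 2 - 1)) :
    a * Real.tanh (paramU a b) = (1 + a) * Real.tanh (paramW a b) := by
  have hk := slitScale_pos ha hb hab
  rw [tanh_paramU ha hb hab, tanh_paramW ha hb hab, scaleU, scaleW]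
  field_simp

/-- The value at the north pole of the potential of `μ_V`. -/
noncomputable def constV (a b : ℝ) : ℝ :=
  (1 + a) * slitConst (constA a b) (paramW a b) - a * slitConst (constA a b) (paramU a b)

theorem chordPotential_muV_north {a b : ℝ} (ha : 0 < a) (hb : 1 ≤ b)
    (hab : 1 < a * (b ^ 2 - 1)) :
    chordPotential ((muV a b).map realPoint) S2.north = ENNReal.ofReal (constV a b) ∧
      0 ≤ constV a b := by
  have hw := paramW_pos ha hb hab
  have hu := hw.trans (paramW_lt_paramU ha hb hab)
  have h := chordPotential_muV_add_slit ha hb hab S2.north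
  rw [← tanh_paramU ha hb hab, ← tanh_paramW ha hb hab,
    chordPotential_slitLaw_north _ (tanh_pos hu), chordPotential_slitLaw_north _ (tanh_pos hw),
    ← ENNReal.ofReal_mul ha.le, ← ENNReal.ofReal_mul (by linarith)] at h
  exact ENNReal.eq_ofReal_sub (mul_nonneg ha.le (slitConst_nonneg hu _))
    (mul_nonneg (by linarith) (slitConst_nonneg hw _)) h

/-- The potential of `μ_V` in elliptic coordinates, up to the constant `constV`. -/
noncomputable def potentialV (a b ρ β : ℝ) : ℝ :=
  Real.log (2 / constA a b ^ 2 + Real.cosh ρ + Real.cos β) / 2 +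
    ((1 + a) * paramW a b - a * paramU a b) -
    (1 + a) / 2 * Real.log (Real.cosh (ρ + 2 * paramW a b) + Real.cos β) +
    a / 2 * Real.log (Real.cosh (ρ + 2 * paramU a b) + Real.cos β)

theorem chordPotential_muV_elliptic {a b ρ : ℝ} (ha : 0 < a) (hb : 1 ≤ b)
    (hab : 1 < a * (b ^ 2 - 1)) (hρ : 0 ≤ ρ) (β : ℝ) :
    chordPotential ((muV a b).map realPoint) (S2.ofComplex (ellipticPoint (constA a b) ρ β)) =
      ENNReal.ofReal (constV a b + potentialV a b ρ β) ∧ 0 ≤ constV a b + potentialV a b ρ β := by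
  have hw := paramW_pos ha hb hab
  have hu := hw.trans (paramW_lt_paramU ha hb hab)
  have hA := constA_pos ha hb hab
  have h := chordPotential_muV_add_slit ha hb hab (S2.ofComplex (ellipticPoint (constA a b) ρ β))
  have h1 := chordPotential_slitLaw_elliptic hA hu hρ β
  have h2 := chordPotential_slitLaw_elliptic hA hw hρ β
  rw [← tanh_paramU ha hb hab, ← tanh_paramW ha hb hab, h1.1, h2.1,
    ← ENNReal.ofReal_mul ha.le, ← ENNReal.ofReal_mul (by linarith)] at h
  have h3 := ENNReal.eq_ofReal_sub (mul_nonneg ha.le h1.2) (mul_nonneg (by linarith) h2.2) h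
  convert h3 using 2
  · congr 1
    rw [constV, potentialV]
    ring
  · rw [constV, potentialV]
    ring

/-! ### The equilibrium problem on the real line in the postcritical case -/

theorem log_ratio_cosh (s y : ℝ) :
    Real.log (Real.cosh (2 * s) + Real.cosh (2 * y)) - Real.log (Real.cosh (2 * s + 2 * y) + 1) =
      -(Real.log (1 + Real.tanh s * Real.tanh y) - Real.log (1 - Real.tanh s * Real.tanh y)) := by
  have hs := Real.cosh_pos s
  have hy := Real.cosh_pos y
  have h1 : Real.cosh (2 * s) + Real.cosh (2 * y) =
      2 * (Real.cosh s * Real.cosh y) ^ 2 * ((1 + Real.tanh s * Real.tanh y) *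
        (1 - Real.tanh s * Real.tanh y)) := by
    rw [Real.cosh_two_mul, Real.cosh_two_mul, Real.tanh_eq_sinh_div_cosh,
      Real.tanh_eq_sinh_div_cosh, Real.sinh_sq, Real.sinh_sq]
    have e : (1 + Real.sinh s / Real.cosh s * (Real.sinh y / Real.cosh y)) *
        (1 - Real.sinh s / Real.cosh s * (Real.sinh y / Real.cosh y)) =
        1 - Real.sinh s ^ 2 * Real.sinh y ^ 2 / (Real.cosh s * Real.cosh y) ^ 2 := by
      field_simp
      ring
    rw [e, Real.sinh_sq, Real.sinh_sq]
    field_simp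
    ring
  have h2 : Real.cosh (2 * s + 2 * y) + 1 =
      2 * (Real.cosh s * Real.cosh y) ^ 2 * (1 + Real.tanh s * Real.tanh y) ^ 2 := by
    have e : 2 * s + 2 * y = 2 * (s + y) := by ring
    have e2 : Real.cosh (s + y) =
        Real.cosh s * Real.cosh y * (1 + Real.tanh s * Real.tanh y) := by
      rw [Real.cosh_add, Real.tanh_eq_sinh_div_cosh, Real.tanh_eq_sinh_div_cosh]
      field_simp
    rw [e, Real.cosh_two_mul, Real.sinh_sq, e2]
    ring
  have hlt : |Real.tanh s * Real.tanh y| < 1 := by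
    rw [abs_mul]
    exact mul_lt_one_of_nonneg_of_lt_one_left (abs_nonneg _) (Real.abs_tanh_lt_one s)
      (Real.abs_tanh_lt_one y).le
  have hp := abs_lt.1 hlt
  have p1 : 0 < 1 + Real.tanh s * Real.tanh y := by linarith
  have p2 : 0 < 1 - Real.tanh s * Real.tanh y := by linarith
  have hK : 2 * (Real.cosh s * Real.cosh y) ^ 2 ≠ 0 := by positivity
  rw [h1, h2, Real.log_mul hK (by positivity), Real.log_mul p1.ne' p2.ne',
    Real.log_mul hK (by positivity), Real.log_pow]
  push_cast
  ring

/-- The odd power series of `log ((1 + p) / (1 - p))` makes this function star-shaped. -/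
theorem log_one_add_sub_log_one_sub_mul_le {c p : ℝ} (hc0 : 0 ≤ c) (hc1 : c ≤ 1) (hp0 : 0 ≤ p)
    (hp1 : p < 1) : Real.log (1 + c * p) - Real.log (1 - c * p) ≤
      c * (Real.log (1 + p) - Real.log (1 - p)) := by
  have h1 := Real.hasSum_log_sub_log_of_abs_lt_one (x := p) (by rwa [abs_of_nonneg hp0])
  have h2 := Real.hasSum_log_sub_log_of_abs_lt_one (x := c * p) (by
    rw [abs_of_nonneg (by positivity)]
    nlinarith)
  refine hasSum_le (fun k => ?_) h2 (h1.mul_left c)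
  have h3 : c ^ (2 * k + 1) ≤ c := by
    rw [pow_succ]
    exact mul_le_of_le_one_left hc0 (pow_le_one₀ hc0 hc1)
  have h4 : 0 ≤ 2 * (1 / (2 * (k : ℝ) + 1)) * p ^ (2 * k + 1) := by positivity
  calc 2 * (1 / (2 * (k : ℝ) + 1)) * (c * p) ^ (2 * k + 1)
      = c ^ (2 * k + 1) * (2 * (1 / (2 * (k : ℝ) + 1)) * p ^ (2 * k + 1)) := by ring
    _ ≤ c * (2 * (1 / (2 * (k : ℝ) + 1)) * p ^ (2 * k + 1)) := by gcongr

/-- On the real axis, the slit is `ρ = 0` and its complement is `cos β = 1`. -/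
theorem exists_ellipticPoint_real {A : ℝ} (hA : 0 < A) (x : ℝ) :
    ∃ ρ β : ℝ, 0 ≤ ρ ∧ (x : ℂ) = ellipticPoint A ρ β ∧
      (ρ = 0 ∧ x ∈ Set.Icc (-A) A ∨ x ∉ Set.Icc (-A) A ∧ Real.cos β = 1) := by
  have hA' : (A : ℂ) ≠ 0 := Complex.ofReal_ne_zero.2 hA.ne'
  by_cases hx : x ∈ Set.Icc (-A) A
  · refine ⟨0, 2 * Real.arccos (x / A), le_rfl, ?_, Or.inl ⟨rfl, hx⟩⟩
    have e : (((0 : ℝ) : ℂ) + ((2 * Real.arccos (x / A) : ℝ) : ℂ) * Complex.I) / 2 =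
        (Real.arccos (x / A) : ℂ) * Complex.I := by
      push_cast
      ring
    rw [ellipticPoint, e, Complex.cosh_mul_I, ← Complex.ofReal_cos, Real.cos_arccos
      (by rw [le_div_iff₀ hA]; linarith [hx.1]) (by rw [div_le_one hA]; exact hx.2)]
    push_cast
    field_simp
  · rcases le_or_gt x A with h | h
    · have h1 : x < -A := by
        by_contra h2
        exact hx ⟨not_lt.1 h2, h⟩
      have h2 : 1 ≤ -x / A := by
        rw [le_div_iff₀ hA]
        linarith
      refine ⟨2 * Real.arcosh (-x / A), 2 * Real.pi, by linarith [Real.arcosh_nonneg h2], ?_,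
        Or.inr ⟨hx, Real.cos_two_pi⟩⟩
      have e : (((2 * Real.arcosh (-x / A) : ℝ) : ℂ) + ((2 * Real.pi : ℝ) : ℂ) * Complex.I) / 2 =
          (Real.arcosh (-x / A) : ℂ) + Real.pi * Complex.I := by
        push_cast
        ring
      rw [ellipticPoint, e, Complex.cosh_add, Complex.cosh_mul_I, Complex.sinh_mul_I,
        Complex.cos_pi, Complex.sin_pi, ← Complex.ofReal_cosh, Real.cosh_arcosh h2]
      push_cast
      field_simp
      ring
    · have h2 : 1 ≤ x / A := by
        rw [le_div_iff₀ hA]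
        linarith
      refine ⟨2 * Real.arcosh (x / A), 0, by linarith [Real.arcosh_nonneg h2], ?_,
        Or.inr ⟨hx, Real.cos_zero⟩⟩
      have e : (((2 * Real.arcosh (x / A) : ℝ) : ℂ) + ((0 : ℝ) : ℂ) * Complex.I) / 2 =
          (Real.arcosh (x / A) : ℂ) := by
        push_cast
        ring
      rw [ellipticPoint, e, ← Complex.ofReal_cosh, Real.cosh_arcosh h2]
      push_cast
      field_simp

/-- The Frostman conditions for `μ_V` in the postcritical case. On the slit `ρ = 0` the total
potential is constant; off the slit `cos β = 1` on the real axis, and the inequality there is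
`log_one_add_sub_log_one_sub_mul_le` at `c = a / (1 + a)`, by `mul_tanh_paramU`. -/
theorem isEquilibriumMeasure_fieldV_iff_of_lt {a b : ℝ} (ha : 0 < a) (hb : 1 ≤ b)
    (hab : 1 < a * (b ^ 2 - 1)) (ν : Measure ℝ) :
    IsEquilibriumMeasure (fieldV a b) ν ↔ ν = muV a b := by
  have hprob := isProbabilityMeasure_muV_of_lt ha hb hab
  have hA := constA_pos ha hb hab
  have hb0 : 0 < b := by linarith
  have hw := paramW_pos ha hb hab
  have hu := hw.trans (paramW_lt_paramU ha hb hab)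
  have hpot : ∀ {x ρ β : ℝ}, 0 ≤ ρ → (x : ℂ) = ellipticPoint (constA a b) ρ β →
      chordPotential ((muV a b).map realPoint) (realPoint x) +
        ENNReal.ofReal (sphereField a b x) = ENNReal.ofReal (constV a b +
          ((1 + a) * paramW a b - a * paramU a b) + (1 + 2 * a) * Real.log b +
          ((1 + a) / 2 * (Real.log (Real.cosh ρ + Real.cos β - 1 + Real.cosh (2 * paramW a b)) -
              Real.log (Real.cosh (ρ + 2 * paramW a b) + Real.cos β)) -
            a / 2 * (Real.log (Real.cosh ρ + Real.cos β - 1 + Real.cosh (2 * paramU a b)) -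
              Real.log (Real.cosh (ρ + 2 * paramU a b) + Real.cos β)))) := by
    intro x ρ β hρ hx
    have h := chordPotential_muV_elliptic ha hb hab hρ β
    have hsq := sq_norm_ellipticPoint (constA a b) ρ β
    have hlog := log_one_add_sq_norm_ellipticPoint hA ρ β
    rw [← hx] at h hsq hlog
    rw [Complex.norm_real, Real.norm_eq_abs, sq_abs] at hsq hlog
    have hc0 := cosh_add_cos_nonneg ρ β
    have e : ∀ {y d : ℝ}, 0 < y → constA a b * Real.sinh y = d →
        Real.log (x ^ 2 + d ^ 2) = Real.log (constA a b ^ 2 / 2) +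
          Real.log (Real.cosh ρ + Real.cos β - 1 + Real.cosh (2 * y)) := fun {y d} hy hd => by
      have : x ^ 2 + d ^ 2 = constA a b ^ 2 / 2 *
          (Real.cosh ρ + Real.cos β - 1 + Real.cosh (2 * y)) := by
        rw [hsq, ← hd, Real.cosh_two_mul, Real.cosh_sq]
        ring
      have h1 := Real.one_lt_cosh.2 (show 2 * y ≠ 0 by linarith)
      rw [this, Real.log_mul (by positivity) (by linarith)]
    rw [realPoint, h.1, ← ENNReal.ofReal_add h.2 (sphereField_nonneg ha hb x), sphereField,
      potentialV, ← inv_pow, e hu (constA_mul_sinh_paramU ha hb hab),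
      e hw (constA_mul_sinh_paramW ha hb hab), hlog]
    congr 1
    ring
  have hin : ∀ x ∈ Set.Icc (-constA a b) (constA a b),
      chordPotential ((muV a b).map realPoint) (realPoint x) +
        ENNReal.ofReal (sphereField a b x) = ENNReal.ofReal (constV a b +
          ((1 + a) * paramW a b - a * paramU a b) + (1 + 2 * a) * Real.log b) := by
    intro x hx
    obtain ⟨ρ, β, hρ, hxe, h | h⟩ := exists_ellipticPoint_real hA x
    · rw [hpot hρ hxe, h.1]
      congr 1
      rw [Real.cosh_zero, zero_add, zero_add]
      ring_nf
    · exact absurd hx h.1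
  refine isEquilibriumMeasure_fieldV_iff ha hb _ ENNReal.ofReal_ne_top (F := ENNReal.ofReal
    (constV a b + ((1 + a) * paramW a b - a * paramU a b) + (1 + 2 * a) * Real.log b)) ?_ ?_ ν
  · have hs : Set.Icc (-constA a b) (constA a b) ∈ ae (muV a b) := by
      rw [mem_ae_iff, muV, withDensity_apply _ (by
        exact (measurableSet_Icc (a := -constA a b) (b := constA a b)).compl)]
      refine (setLIntegral_congr_fun (g := fun _ => 0)
        (measurableSet_Icc (a := -constA a b) (b := constA a b)).compl fun x hx => ?_).trans
        (by simp)
      change ENNReal.ofReal (densityV a b x) = 0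
      rw [densityV_eq_zero hab fun h => hx (Set.Ioo_subset_Icc_self h), ENNReal.ofReal_zero]
    filter_upwards [hs] with x hx using hin x hx
  · intro x
    by_cases hx : x ∈ Set.Icc (-constA a b) (constA a b)
    · exact (hin x hx).ge
    obtain ⟨ρ, β, hρ, hxe, h | h⟩ := exists_ellipticPoint_real hA x
    · exact absurd h.2 hx
    rw [hpot hρ hxe, h.2]
    refine ENNReal.ofReal_le_ofReal ?_
    have e : ∀ y, Real.log (Real.cosh ρ + 1 - 1 + Real.cosh (2 * y)) -
        Real.log (Real.cosh (ρ + 2 * y) + 1) =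
        -(Real.log (1 + Real.tanh (ρ / 2) * Real.tanh y) -
          Real.log (1 - Real.tanh (ρ / 2) * Real.tanh y)) := fun y => by
      rw [← log_ratio_cosh, add_sub_cancel_right, mul_div_cancel₀ _ two_ne_zero]
    rw [e, e]
    have hT : 0 ≤ Real.tanh (ρ / 2) := by
      rw [Real.tanh_eq_sinh_div_cosh]
      exact div_nonneg (Real.sinh_nonneg_iff.2 (by linarith)) (Real.cosh_pos _).le
    have hU := tanh_pos hu
    have hp1 : Real.tanh (ρ / 2) * Real.tanh (paramU a b) < 1 :=
      mul_lt_one_of_nonneg_of_lt_one_left hT (Real.tanh_lt_one _) (Real.tanh_lt_one _).le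
    have hle := log_one_add_sub_log_one_sub_mul_le (c := a / (1 + a)) (by positivity)
      (by rw [div_le_one (by linarith)]; linarith) (by positivity) hp1
    have hcp : a / (1 + a) * (Real.tanh (ρ / 2) * Real.tanh (paramU a b)) =
        Real.tanh (ρ / 2) * Real.tanh (paramW a b) := by
      have := mul_tanh_paramU ha hb hab
      field_simp
      linear_combination Real.tanh (ρ / 2) * this
    rw [hcp] at hle
    have h3 := mul_le_mul_of_nonneg_left hle (show 0 ≤ 1 + a by linarith)
    have h4 : (1 + a) * (a / (1 + a) * (Real.log (1 + Real.tanh (ρ / 2) * Real.tanh (paramU a b)) -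
        Real.log (1 - Real.tanh (ρ / 2) * Real.tanh (paramU a b)))) =
        a * (Real.log (1 + Real.tanh (ρ / 2) * Real.tanh (paramU a b)) -
        Real.log (1 - Real.tanh (ρ / 2) * Real.tanh (paramU a b))) := by
      field_simp
    rw [h4] at h3
    linarith

/-! ### The inequality between the potentials in the postcritical case -/

section DropletInequality

variable {a L M : ℝ}

/-- The numerator of the derivative of the gap in `t`; its factors are nonnegative for `t ≤ 1`. -/
theorem droplet_numerator_identity (h12 : Real.sinh L = (1 + 2 * a) * Real.sinh M) (s t : ℝ) :
    a * ((Real.cosh (L + s) + t) * (Real.cosh L - Real.cosh M + Real.cosh (M + s) + t)) +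
      (1 + a) * ((Real.cosh (L - s) + t) * (Real.cosh L - Real.cosh M + Real.cosh (M + s) + t)) -
      (1 + 2 * a) * ((Real.cosh (L - s) + t) * (Real.cosh (L + s) + t)) =
    (1 + 2 * a) * ((Real.cosh L - Real.cosh M) * (Real.cosh s - 1) *
      (Real.cosh L + Real.cosh M + Real.cosh (M + s) - t)) := by
  rw [Real.cosh_add, Real.cosh_sub, Real.cosh_add]
  have hL := Real.cosh_sq L
  have hM := Real.cosh_sq M
  have hs := Real.cosh_sq s
  rw [h12] at *
  generalize Real.cosh L = C at *
  generalize Real.cosh M = m at *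
  generalize Real.sinh M = n at *
  generalize Real.cosh s = k at *
  generalize Real.sinh s = h at *
  linear_combination (-(1 + 2 * a) * h ^ 2) * hL + ((1 + 2 * a) * h ^ 2) * hM +
    (-(1 + 2 * a) * (C ^ 2 - m ^ 2)) * hs

theorem droplet_derivative_identity (h12 : Real.sinh L = (1 + 2 * a) * Real.sinh M) (s : ℝ) :
    -a * Real.sinh (L - s) * ((Real.cosh (L + s) + 1) *
        (Real.cosh L - Real.cosh M + Real.cosh (M + s) + 1)) +
      (1 + a) * Real.sinh (L + s) * ((Real.cosh (L - s) + 1) *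
        (Real.cosh L - Real.cosh M + Real.cosh (M + s) + 1)) -
      (1 + 2 * a) * Real.sinh (M + s) * ((Real.cosh (L - s) + 1) * (Real.cosh (L + s) + 1)) =
    -((1 + 2 * a) * ((Real.cosh L - Real.cosh M) * (Real.cosh L + Real.cosh s) *
      (Real.sinh s * (Real.cosh M - 1) + Real.sinh M * (Real.cosh s - 1)))) := by
  rw [Real.cosh_add, Real.cosh_sub, Real.cosh_add, Real.sinh_add, Real.sinh_sub, Real.sinh_add]
  have hL := Real.cosh_sq L
  have hM := Real.cosh_sq M
  have hs := Real.cosh_sq s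
  rw [h12] at *
  generalize Real.cosh L = C at *
  generalize Real.cosh M = m at *
  generalize Real.sinh M = n at *
  generalize Real.cosh s = k at *
  generalize Real.sinh s = h at *
  linear_combination (1 + 2 * a) * ((C - m + (m * k + n * h) + 1) * (k * h) -
      (m * h + n * k) * (k ^ 2 - 1)) * hL - (1 + 2 * a) * ((C + k) * h) * hM +
    (1 + 2 * a) * ((C - m + (m * k + n * h) + 1) * (C * n) -
      (m * h + n * k) * ((1 + 2 * a) * n) ^ 2 - (C + k) * n) * hs

theorem sinh_mul_cosh_sub_one_add (M s : ℝ) :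
    Real.sinh s * (Real.cosh M - 1) + Real.sinh M * (Real.cosh s - 1) =
      4 * Real.sinh (s / 2) * Real.sinh (M / 2) * Real.sinh ((M + s) / 2) := by
  have e1 : s = 2 * (s / 2) := by ring
  have e2 : M = 2 * (M / 2) := by ring
  have e3 : (M + s) / 2 = M / 2 + s / 2 := by ring
  conv_lhs => rw [e1, e2, Real.sinh_two_mul, Real.sinh_two_mul, Real.cosh_two_mul,
    Real.cosh_two_mul, Real.cosh_sq, Real.cosh_sq]
  rw [e3, Real.sinh_add]
  ring

/-- The sum of the potentials of the exterior charges minus the one of the background. -/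
noncomputable def dropletGap (a L M s t : ℝ) : ℝ :=
  a * Real.log (Real.cosh (L - s) + t) + (1 + a) * Real.log (Real.cosh (L + s) + t) -
    (1 + 2 * a) * Real.log (Real.cosh L - Real.cosh M + Real.cosh (M + s) + t)

theorem dropletGap_zero (a L M t : ℝ) : dropletGap a L M 0 t = 0 := by
  rw [dropletGap, sub_zero, add_zero, add_zero, sub_add_cancel]
  ring

theorem dropletGap_one_nonpos (ha : 0 < a) (hM : 0 < M) (hML : M < L)
    (h12 : Real.sinh L = (1 + 2 * a) * Real.sinh M) {s : ℝ} (hs : -M ≤ s) :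
    dropletGap a L M s 1 ≤ 0 := by
  have hCm : 0 < Real.cosh L - Real.cosh M := by
    rw [sub_pos, Real.cosh_lt_cosh, abs_of_pos hM, abs_of_pos (hM.trans hML)]
    exact hML
  have p1 : ∀ s, 0 < Real.cosh (L - s) + 1 := fun s => by linarith [Real.cosh_pos (L - s)]
  have p2 : ∀ s, 0 < Real.cosh (L + s) + 1 := fun s => by linarith [Real.cosh_pos (L + s)]
  have p3 : ∀ s, 0 < Real.cosh L - Real.cosh M + Real.cosh (M + s) + 1 := fun s => by
    linarith [Real.cosh_pos (M + s)]
  have hd : ∀ s, HasDerivAt (fun s => dropletGap a L M s 1)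
      (-((1 + 2 * a) * ((Real.cosh L - Real.cosh M) * (Real.cosh L + Real.cosh s) *
        (4 * Real.sinh (s / 2) * Real.sinh (M / 2) * Real.sinh ((M + s) / 2)))) /
        ((Real.cosh (L - s) + 1) * (Real.cosh (L + s) + 1) *
          (Real.cosh L - Real.cosh M + Real.cosh (M + s) + 1))) s := by
    intro s
    have h1 : HasDerivAt (fun s => Real.cosh (L - s) + 1) (-Real.sinh (L - s)) s := by
      simpa using (((hasDerivAt_id s).const_sub L).cosh).add_const 1
    have h2 : HasDerivAt (fun s => Real.cosh (L + s) + 1) (Real.sinh (L + s)) s := by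
      simpa using (((hasDerivAt_id s).const_add L).cosh).add_const 1
    have h3 : HasDerivAt (fun s => Real.cosh L - Real.cosh M + Real.cosh (M + s) + 1)
        (Real.sinh (M + s)) s := by
      simpa using ((((hasDerivAt_id s).const_add M).cosh).const_add
        (Real.cosh L - Real.cosh M)).add_const 1
    have h := (((h1.log (p1 s).ne').const_mul a).add ((h2.log (p2 s).ne').const_mul (1 + a))).sub
      ((h3.log (p3 s).ne').const_mul (1 + 2 * a))
    refine h.congr_deriv ?_
    rw [← sinh_mul_cosh_sub_one_add, ← droplet_derivative_identity h12]
    have q1 := (p1 s).ne'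
    have q2 := (p2 s).ne'
    have q3 := (p3 s).ne'
    generalize Real.cosh (L - s) + 1 = x at *
    generalize Real.cosh (L + s) + 1 = y at *
    generalize Real.cosh L - Real.cosh M + Real.cosh (M + s) + 1 = T at *
    field_simp
  have hcont : Continuous fun s => dropletGap a L M s 1 :=
    continuous_iff_continuousAt.2 fun s => (hd s).continuousAt
  have hM2 : 0 < Real.sinh (M / 2) := Real.sinh_pos_iff.2 (by linarith)
  rw [← dropletGap_zero a L M 1]
  have hCk : ∀ s, 0 < Real.cosh L + Real.cosh s := fun s => by
    linarith [Real.cosh_pos L, Real.cosh_pos s]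
  have h12' : 0 < 1 + 2 * a := by linarith
  rcases le_total 0 s with h | h
  · refine antitoneOn_of_deriv_nonpos (convex_Ici 0) hcont.continuousOn
      (fun s _ => (hd s).differentiableAt.differentiableWithinAt) (fun r hr => ?_)
      (Set.mem_Ici.2 le_rfl) (Set.mem_Ici.2 h) h
    rw [interior_Ici, Set.mem_Ioi] at hr
    rw [(hd r).deriv]
    have h1 : 0 ≤ Real.sinh (r / 2) := Real.sinh_nonneg_iff.2 (by linarith)
    have h2 : 0 ≤ Real.sinh ((M + r) / 2) := Real.sinh_nonneg_iff.2 (by linarith)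
    have := p1 r
    have := p2 r
    have := p3 r
    have := hCk r
    exact div_nonpos_of_nonpos_of_nonneg (neg_nonpos.2 (by positivity)) (by positivity)
  · refine monotoneOn_of_deriv_nonneg (convex_Icc (-M) 0) hcont.continuousOn
      (fun s _ => (hd s).differentiableAt.differentiableWithinAt) (fun r hr => ?_)
      ⟨hs, h⟩ ⟨by linarith, le_rfl⟩ h
    rw [interior_Icc, Set.mem_Ioo] at hr
    rw [(hd r).deriv]
    have h1 : 0 ≤ -Real.sinh (r / 2) := neg_nonneg.2 (Real.sinh_nonpos_iff.2 (by linarith))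
    have h2 : 0 ≤ Real.sinh ((M + r) / 2) := Real.sinh_nonneg_iff.2 (by linarith)
    have := p1 r
    have := p2 r
    have := p3 r
    have := hCk r
    refine div_nonneg ?_ (by positivity)
    have h3 : 0 ≤ (1 + 2 * a) * ((Real.cosh L - Real.cosh M) * (Real.cosh L + Real.cosh r) *
        (4 * -Real.sinh (r / 2) * Real.sinh (M / 2) * Real.sinh ((M + r) / 2))) := by positivity
    linarith

/-- The gap is nonpositive: it increases with `t`, and at `t = 1` it has its maximum at `s = 0`. -/
theorem dropletGap_nonpos (ha : 0 < a) (hM : 0 < M) (hML : M < L)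
    (h12 : Real.sinh L = (1 + 2 * a) * Real.sinh M) {s t : ℝ} (hs : -M ≤ s) (ht : -1 ≤ t)
    (ht1 : t ≤ 1) (hpos : 0 < Real.cosh (L - s) + t) : dropletGap a L M s t ≤ 0 := by
  have hL := hM.trans hML
  have hCm : 0 < Real.cosh L - Real.cosh M := by
    rw [sub_pos, Real.cosh_lt_cosh, abs_of_pos hM, abs_of_pos hL]
    exact hML
  refine le_trans ?_ (dropletGap_one_nonpos ha hM hML h12 hs)
  have p1 : ∀ r ∈ Set.Icc t 1, 0 < Real.cosh (L - s) + r := fun r hr => by linarith [hr.1]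
  have p2 : ∀ r ∈ Set.Icc t 1, 0 < Real.cosh (L + s) + r := fun r hr => by
    linarith [hr.1, Real.one_lt_cosh.2 (show L + s ≠ 0 by linarith)]
  have p3 : ∀ r ∈ Set.Icc t 1, 0 < Real.cosh L - Real.cosh M + Real.cosh (M + s) + r :=
    fun r hr => by linarith [hr.1, Real.one_le_cosh (M + s)]
  have hd : ∀ r ∈ Set.Icc t 1, HasDerivAt (fun r => dropletGap a L M s r)
      ((1 + 2 * a) * ((Real.cosh L - Real.cosh M) * (Real.cosh s - 1) *
        (Real.cosh L + Real.cosh M + Real.cosh (M + s) - r)) /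
        ((Real.cosh (L - s) + r) * (Real.cosh (L + s) + r) *
          (Real.cosh L - Real.cosh M + Real.cosh (M + s) + r))) r := by
    intro r hr
    have h := (((((hasDerivAt_id r).const_add (Real.cosh (L - s))).log (p1 r hr).ne').const_mul
      a).add ((((hasDerivAt_id r).const_add (Real.cosh (L + s))).log (p2 r hr).ne').const_mul
      (1 + a))).sub ((((hasDerivAt_id r).const_add
      (Real.cosh L - Real.cosh M + Real.cosh (M + s))).log (p3 r hr).ne').const_mul (1 + 2 * a))
    refine h.congr_deriv ?_
    rw [← droplet_numerator_identity h12]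
    have q1 := (p1 r hr).ne'
    have q2 := (p2 r hr).ne'
    have q3 := (p3 r hr).ne'
    simp only [id]
    generalize Real.cosh (L - s) + r = x at *
    generalize Real.cosh (L + s) + r = y at *
    generalize Real.cosh L - Real.cosh M + Real.cosh (M + s) + r = T at *
    field_simp
  refine monotoneOn_of_deriv_nonneg (convex_Icc t 1)
    (fun r hr => (hd r hr).continuousAt.continuousWithinAt)
    (fun r hr => (hd r (interior_subset hr)).differentiableAt.differentiableWithinAt)
    (fun r hr => ?_) ⟨le_rfl, ht1⟩ ⟨ht1, le_rfl⟩ ht1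
  have hr' := interior_subset hr
  rw [(hd r hr').deriv]
  have := p1 r hr'
  have := p2 r hr'
  have := p3 r hr'
  have h1 : 0 ≤ Real.cosh s - 1 := by linarith [Real.one_le_cosh s]
  have h2 : 0 ≤ Real.cosh L + Real.cosh M + Real.cosh (M + s) - r := by
    linarith [Real.one_le_cosh L, Real.one_le_cosh M, Real.one_le_cosh (M + s), hr'.2]
  positivity

end DropletInequality

/-! ### Averages over confocal ellipses -/

theorem Complex.norm_one_add_exp_sq (y β : ℝ) :
    ‖1 + Complex.exp (-y + β * Complex.I)‖ ^ 2 =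
      2 * Real.exp (-y) * (Real.cosh y + Real.cos β) := by
  have e : Complex.exp (-y + β * Complex.I) =
      ((Real.exp (-y) : ℝ) : ℂ) * ((Real.cos β : ℝ) + (Real.sin β : ℝ) * Complex.I) := by
    rw [Complex.exp_add, Complex.exp_mul_I, Complex.ofReal_exp, Complex.ofReal_neg,
      Complex.ofReal_cos, Complex.ofReal_sin]
  have h := Real.sin_sq_add_cos_sq β
  have h2 : Real.exp (-y) * Real.exp y = 1 := by rw [← Real.exp_add]; simp
  rw [e, Complex.sq_norm_eq, Real.cosh_eq]
  generalize Real.exp (-y) = E at *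
  generalize Real.exp y = E' at *
  generalize Real.cos β = c at *
  generalize Real.sin β = s at *
  simp
  linear_combination E ^ 2 * h - h2

theorem Complex.re_exp_div_one_add_exp {y : ℝ} (hy : 0 < y) (β : ℝ) :
    (Complex.exp (-y + β * Complex.I) / (1 + Complex.exp (-y + β * Complex.I))).re =
      (1 - Real.sinh y / (Real.cosh y + Real.cos β)) / 2 := by
  have hp := cosh_add_cos_pos hy β
  have hn := Complex.norm_one_add_exp_sq y β
  have e : Complex.exp (-y + β * Complex.I) =
      ((Real.exp (-y) : ℝ) : ℂ) * ((Real.cos β : ℝ) + (Real.sin β : ℝ) * Complex.I) := by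
    rw [Complex.exp_add, Complex.exp_mul_I, Complex.ofReal_exp, Complex.ofReal_neg,
      Complex.ofReal_cos, Complex.ofReal_sin]
  rw [Complex.div_re, ← add_div, Complex.normSq_eq_norm_sq, hn, e]
  have h := Real.sin_sq_add_cos_sq β
  have h2 : Real.exp (-y) = Real.cosh y - Real.sinh y := (Real.cosh_sub_sinh y).symm
  have h3 := Real.exp_pos (-y)
  have h4 : Real.exp (-y) ≠ 0 := h3.ne'
  have h5 := Real.cosh_sq y
  rw [div_eq_div_iff (by positivity) two_ne_zero]
  field_simp
  generalize Real.exp (-y) = E at *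
  generalize Real.cos β = c at *
  generalize Real.sin β = s at *
  generalize Real.cosh y = C at *
  generalize Real.sinh y = S at *
  simp
  subst h2
  linear_combination (C - S) ^ 2 * h

theorem Complex.norm_exp_neg_add_mul_I (x β : ℝ) :
    ‖Complex.exp (-x + β * Complex.I)‖ = Real.exp (-x) := by
  rw [Complex.norm_exp]
  simp

theorem log_norm_one_add_exp {y : ℝ} (hy : 0 < y) (β : ℝ) :
    Real.log ‖1 + Complex.exp (-y + β * Complex.I)‖ =
      (Real.log 2 + Real.log (Real.cosh y + Real.cos β) - y) / 2 := by
  have hp := cosh_add_cos_pos hy β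
  have h := congrArg Real.log (Complex.norm_one_add_exp_sq y β)
  rw [Real.log_pow, Real.log_mul (by positivity) hp.ne', Real.log_mul two_ne_zero (by positivity),
    Real.log_exp, Nat.cast_ofNat] at h
  linarith

/-- The density of the spherical area on the confocal ellipses, up to a constant factor; here
`h` is `cosh r` for the elliptic coordinate `r`. -/
noncomputable def ellipseDensity (H h α : ℝ) : ℝ :=
  (h - Real.cos α) / (Real.cosh H + Real.cos α) ^ 2

/-- The part of `ellipseDensity` that is regular in the unit disc, in the variable `e^{iα}`. -/
noncomputable def ellipseFactor (H h : ℝ) (z : ℂ) : ℂ :=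
  2 * (2 * h * z - z ^ 2 - 1) / (z + Real.exp H) ^ 2

theorem add_exp_ne_zero_of_norm_lt {z : ℂ} {H : ℝ} (hz : ‖z‖ < Real.exp H) :
    z + Real.exp H ≠ 0 := by
  intro h
  rw [eq_neg_of_add_eq_zero_left h, norm_neg, Complex.norm_real, Real.norm_eq_abs,
    abs_of_pos (Real.exp_pos H)] at hz
  exact lt_irrefl _ hz

theorem hasDerivAt_ellipseFactor {H : ℝ} (h : ℝ) {z : ℂ} (hz : ‖z‖ < Real.exp H) :
    HasDerivAt (ellipseFactor H h) (4 * (h - z) / (z + Real.exp H) ^ 2 -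
      4 * (2 * h * z - z ^ 2 - 1) / (z + Real.exp H) ^ 3) z := by
  have hne := add_exp_ne_zero_of_norm_lt hz
  have h1 : HasDerivAt (fun z : ℂ => 2 * (2 * h * z - z ^ 2 - 1)) (2 * (2 * h - 2 * z)) z := by
    have := (((((hasDerivAt_id z).const_mul (2 * (h : ℂ))).sub
      (hasDerivAt_pow 2 z)).sub_const 1).const_mul 2)
    simpa using this
  have h2 : HasDerivAt (fun z : ℂ => (z + Real.exp H) ^ 2) (2 * (z + Real.exp H)) z := by
    simpa using ((hasDerivAt_id z).add_const (Real.exp H : ℂ)).fun_pow 2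
  refine (h1.div h2 (pow_ne_zero 2 hne)).congr_deriv ?_
  generalize (Real.exp H : ℂ) = E at *
  field_simp
  ring

theorem ellipseFactor_at {H : ℝ} (hH : 0 < H) (h : ℝ) :
    ellipseFactor H h (-Real.exp (-H) : ℝ) =
      ((-Real.exp (-H) * ((h + Real.cosh H) / Real.sinh H ^ 2) : ℝ) : ℂ) ∧
    4 * (h - ((-Real.exp (-H) : ℝ) : ℂ)) / (((-Real.exp (-H) : ℝ) : ℂ) + Real.exp H) ^ 2 -
      4 * (2 * h * ((-Real.exp (-H) : ℝ) : ℂ) - ((-Real.exp (-H) : ℝ) : ℂ) ^ 2 - 1) /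
        (((-Real.exp (-H) : ℝ) : ℂ) + Real.exp H) ^ 3 =
      (((1 + h * Real.cosh H) / Real.sinh H ^ 3 : ℝ) : ℂ) := by
  have hs := (Real.sinh_pos_iff.2 hH).ne'
  have e1 : -Real.exp (-H) = -(Real.cosh H - Real.sinh H) := by rw [Real.cosh_sub_sinh]
  have e2 : Real.exp H = Real.cosh H + Real.sinh H := (Real.cosh_add_sinh H).symm
  have h5 := Real.cosh_sq H
  have e3 : -Real.exp (-H) + Real.exp H = 2 * Real.sinh H := by rw [e1, e2]; ring
  unfold ellipseFactor
  norm_cast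
  rw [e3, e1]
  generalize Real.cosh H = C at *
  generalize Real.sinh H = S at *
  constructor
  · field_simp
    linear_combination h5
  · field_simp
    linear_combination 4 * h5

theorem norm_neg_exp_neg_lt_one {H : ℝ} (hH : 0 < H) : ‖((-Real.exp (-H) : ℝ) : ℂ)‖ < 1 := by
  rw [Complex.norm_real, Real.norm_eq_abs, abs_neg, abs_of_pos (Real.exp_pos _),
    Real.exp_lt_one_iff]
  linarith

/-- Cauchy's formula for the derivative at the double pole of the density inside the disc. -/
theorem integral_mul_ellipseDensity {H : ℝ} (hH : 0 < H) (h : ℝ) {R : ℝ} (hR : 1 < R) {f : ℂ → ℂ}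
    {f' : ℂ} (hf : DifferentiableOn ℂ f (Metric.ball 0 R))
    (hf' : HasDerivAt f f' (-Real.exp (-H) : ℝ)) :
    ∫ α in (0 : ℝ)..2 * Real.pi, f (Complex.exp (α * Complex.I)) * ellipseDensity H h α =
      2 * Real.pi * (((1 + h * Real.cosh H) / Real.sinh H ^ 3 : ℝ) * f (-Real.exp (-H) : ℝ) +
        ((-Real.exp (-H) * ((h + Real.cosh H) / Real.sinh H ^ 2) : ℝ) : ℂ) * f') := by
  have hpi : (2 * Real.pi * Complex.I : ℂ) ≠ 0 := Complex.two_pi_I_ne_zero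
  have hE : 1 < Real.exp H := Real.one_lt_exp_iff.2 hH
  have hw := norm_neg_exp_neg_lt_one hH
  have hU : IsOpen (Metric.ball (0 : ℂ) (min R (Real.exp H))) := Metric.isOpen_ball
  have hsub : Metric.closedBall (0 : ℂ) 1 ⊆ Metric.ball 0 (min R (Real.exp H)) :=
    Metric.closedBall_subset_ball (lt_min hR hE)
  have hd : DifferentiableOn ℂ (fun z => ellipseFactor H h z * f z)
      (Metric.ball 0 (min R (Real.exp H))) := by
    refine DifferentiableOn.mul (fun z hz => ?_)
      (hf.mono (Metric.ball_subset_ball (min_le_left _ _)))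
    rw [mem_ball_zero_iff, lt_min_iff] at hz
    exact (hasDerivAt_ellipseFactor h hz.2).differentiableAt.differentiableWithinAt
  have hC := Complex.two_pi_I_inv_smul_circleIntegral_sub_sq_inv_smul_of_differentiable hU hsub hd
    (mem_ball_zero_iff.2 hw)
  have hder : HasDerivAt (fun z => ellipseFactor H h z * f z) _ _ :=
    (hasDerivAt_ellipseFactor h (hw.trans hE)).mul hf'
  rw [(ellipseFactor_at hH h).1, (ellipseFactor_at hH h).2] at hder
  rw [hder.deriv, smul_eq_mul, inv_mul_eq_iff_eq_mul₀ hpi] at hC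
  have e : ∀ α : ℝ, deriv (circleMap 0 1) α • (((circleMap 0 1 α - (-Real.exp (-H) : ℝ)) ^ 2)⁻¹ •
      (ellipseFactor H h (circleMap 0 1 α) * f (circleMap 0 1 α))) =
      Complex.I * (f (Complex.exp (α * Complex.I)) * ellipseDensity H h α) := by
    intro α
    have hm : circleMap 0 1 α = Complex.exp (α * Complex.I) := by simp [circleMap]
    rw [deriv_circleMap, hm, ellipseFactor, smul_eq_mul, smul_eq_mul]
    have hn : ‖Complex.exp (α * Complex.I)‖ = 1 := Complex.norm_exp_ofReal_mul_I α
    have h1 : Complex.exp (α * Complex.I) + Real.exp H ≠ 0 :=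
      add_exp_ne_zero_of_norm_lt (hn.trans_lt hE)
    have h2 : Complex.exp (α * Complex.I) - (-Real.exp (-H) : ℝ) ≠ 0 := fun h0 => by
      rw [sub_eq_zero.1 h0] at hn
      exact hw.ne hn
    have h3 := Complex.exp_ne_zero (α * Complex.I)
    have h4 : Complex.exp (α * Complex.I) * Complex.exp (-(α * Complex.I)) = 1 := by
      rw [← Complex.exp_add, add_neg_cancel, Complex.exp_zero]
    have h5 : (Real.exp H : ℂ) * (Real.exp (-H) : ℝ) = 1 := by
      rw [← Complex.ofReal_mul, ← Real.exp_add, add_neg_cancel, Real.exp_zero, Complex.ofReal_one]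
    have h6 : Complex.exp (α * Complex.I) ≠ 0 := h3
    have e1 : ((ellipseDensity H h α : ℝ) : ℂ) = (h - (Complex.exp (α * Complex.I) +
        Complex.exp (-(α * Complex.I))) / 2) / (((Real.exp H : ℂ) + (Real.exp (-H) : ℝ)) / 2 +
        (Complex.exp (α * Complex.I) + Complex.exp (-(α * Complex.I))) / 2) ^ 2 := by
      rw [ellipseDensity, Real.cosh_eq]
      push_cast
      rw [Complex.cos, neg_mul]
    rw [e1]
    have e2 : Complex.exp (-(α * Complex.I)) = (Complex.exp (α * Complex.I))⁻¹ := Complex.exp_neg _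
    have e3 : ((Real.exp (-H) : ℝ) : ℂ) = (Real.exp H : ℂ)⁻¹ := by
      rw [Real.exp_neg, Complex.ofReal_inv]
    have h7 : (Real.exp H : ℂ) ≠ 0 := left_ne_zero_of_mul_eq_one h5
    rw [Complex.ofReal_neg] at h2 ⊢
    rw [e2, e3]
    rw [e3] at h2
    clear h4 h5 e1 e2 e3 hn hm
    generalize Complex.exp (α * Complex.I) = w at *
    generalize (Real.exp H : ℂ) = E at *
    generalize f w = F
    -- Here `cosh H + cos α` is factored in the variable `w = e^{iα}`, exhibiting its two zeros.
    have h8 : (E + E⁻¹) / 2 + (w + w⁻¹) / 2 = (w - -E⁻¹) * (w + E) / (2 * w) := by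
      field_simp
      ring
    rw [h8]
    generalize w - -E⁻¹ = P at *
    field_simp
    ring
  rw [circleIntegral] at hC
  simp_rw [e] at hC
  rw [intervalIntegral.integral_const_mul] at hC
  refine mul_left_cancel₀ Complex.I_ne_zero (hC.trans ?_)
  ring

/-- The mean over a confocal ellipse of the logarithmic kernel of an exterior point, in the
elliptic coordinates. -/
theorem integral_log_norm_mul_ellipseDensity {H x : ℝ} (hH : 0 < H) (hx : 0 < x) (h β : ℝ) :
    ∫ α in (0 : ℝ)..2 * Real.pi, Real.log ‖1 - Complex.exp (-x + β * Complex.I) *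
        Complex.exp (α * Complex.I)‖ * ellipseDensity H h α =
      Real.pi * ((1 + h * Real.cosh H) / Real.sinh H ^ 3 *
        (Real.log 2 + Real.log (Real.cosh (H + x) + Real.cos β) - (H + x)) +
        (h + Real.cosh H) / Real.sinh H ^ 2 *
          (1 - Real.sinh (H + x) / (Real.cosh (H + x) + Real.cos β))) := by
  set U := Complex.exp (-x + β * Complex.I) with hUdef
  have hU : ‖U‖ = Real.exp (-x) := Complex.norm_exp_neg_add_mul_I x β
  have hslit : ∀ z ∈ Metric.ball (0 : ℂ) (Real.exp x), 1 - U * z ∈ Complex.slitPlane := by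
    intro z hz
    rw [mem_ball_zero_iff] at hz
    refine Complex.mem_slitPlane_of_norm_lt_one (z := -(U * z)) ?_
    rw [norm_neg, norm_mul, hU]
    calc Real.exp (-x) * ‖z‖ < Real.exp (-x) * Real.exp x := by gcongr
      _ = 1 := by rw [← Real.exp_add]; simp
  have hR : 1 < Real.exp x := Real.one_lt_exp_iff.2 hx
  have hd1 : ∀ z, HasDerivAt (fun z => 1 - U * z) (-U) z := fun z => by
    simpa using ((hasDerivAt_id z).const_mul U).const_sub 1
  have hd : ∀ z ∈ Metric.ball (0 : ℂ) (Real.exp x),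
      HasDerivAt (fun z => Complex.log (1 - U * z)) (-U / (1 - U * z)) z :=
    fun z hz => (hd1 z).clog (hslit z hz)
  have hκ : ((-Real.exp (-H) : ℝ) : ℂ) ∈ Metric.ball (0 : ℂ) (Real.exp x) :=
    mem_ball_zero_iff.2 ((norm_neg_exp_neg_lt_one hH).trans hR)
  have hI := integral_mul_ellipseDensity hH h hR
    (fun z hz => (hd z hz).differentiableAt.differentiableWithinAt) (hd _ hκ)
  have hV : 1 - U * (-Real.exp (-H) : ℝ) =
      1 + Complex.exp (-((H + x : ℝ) : ℂ) + β * Complex.I) := by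
    have : Complex.exp (-((H + x : ℝ) : ℂ) + β * Complex.I) = U * Complex.exp (-H) := by
      rw [hUdef, ← Complex.exp_add]
      congr 1
      push_cast
      ring
    rw [this]
    push_cast
    ring
  have hV2 : ((-Real.exp (-H) * ((h + Real.cosh H) / Real.sinh H ^ 2) : ℝ) : ℂ) *
      (-U / (1 - U * (-Real.exp (-H) : ℝ))) = ((h + Real.cosh H) / Real.sinh H ^ 2 : ℝ) *
      (Complex.exp (-((H + x : ℝ) : ℂ) + β * Complex.I) /
        (1 + Complex.exp (-((H + x : ℝ) : ℂ) + β * Complex.I))) := by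
    rw [← hV]
    have : Complex.exp (-((H + x : ℝ) : ℂ) + β * Complex.I) = U * Complex.exp (-H) := by
      rw [hUdef, ← Complex.exp_add]
      congr 1
      push_cast
      ring
    rw [this]
    push_cast
    ring
  rw [hV2, hV] at hI
  have hre := congrArg Complex.re hI
  have hcont : Continuous fun α : ℝ => Complex.log (1 - U * Complex.exp (α * Complex.I)) *
      (ellipseDensity H h α : ℂ) := by
    refine Continuous.mul ?_ ?_
    · refine Continuous.clog (by fun_prop) fun α => hslit _ ?_
      rw [mem_ball_zero_iff, Complex.norm_exp_ofReal_mul_I]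
      exact hR
    · unfold ellipseDensity
      exact Complex.continuous_ofReal.comp (Continuous.div (by fun_prop) (by fun_prop) fun α =>
        (pow_pos (cosh_add_cos_pos hH α) 2).ne')
  rw [← Complex.reCLM_apply, ← ContinuousLinearMap.intervalIntegral_comp_comm _
    (hcont.intervalIntegrable _ _)] at hre
  refine Eq.trans ?_ (hre.trans ?_)
  · refine intervalIntegral.integral_congr fun α _ => ?_
    simp only [Complex.reCLM_apply, Complex.re_mul_ofReal, Complex.log_re]
  · have hy : 0 < H + x := by linarith
    have e1 := log_norm_one_add_exp hy β
    have e2 := Complex.re_exp_div_one_add_exp hy β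
    rw [← Complex.log_re] at e1
    have e3 : (2 * Real.pi : ℂ) = ((2 * Real.pi : ℝ) : ℂ) := by push_cast; rfl
    rw [e3, Complex.re_ofReal_mul, Complex.add_re, Complex.re_ofReal_mul, Complex.re_ofReal_mul,
      e1, e2]
    ring

theorem integral_ellipseDensity {H : ℝ} (hH : 0 < H) (h : ℝ) :
    ∫ α in (0 : ℝ)..2 * Real.pi, ellipseDensity H h α =
      2 * Real.pi * ((1 + h * Real.cosh H) / Real.sinh H ^ 3) := by
  have hI := integral_mul_ellipseDensity hH h one_lt_two
    (differentiableOn_const (1 : ℂ)) (hasDerivAt_const _ (1 : ℂ))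
  simp only [one_mul, mul_one, mul_zero, add_zero] at hI
  rw [intervalIntegral.integral_ofReal] at hI
  exact_mod_cast hI

/-- The logarithmic kernel of two pairs of antipodal points in elliptic coordinates. -/
theorem log_norm_cosh_sub_cosh {ρ r : ℝ} (hr : 0 < r) (hρ : 0 ≤ ρ) (hne : ρ ≠ r) (β α : ℝ) :
    Real.log ‖Complex.cosh (ρ + β * Complex.I) - Complex.cosh (r + α * Complex.I)‖ =
      (ρ + r + |ρ - r|) / 2 - Real.log 2 +
        Real.log ‖1 - Complex.exp (-(|ρ - r| : ℝ) + (-β : ℝ) * Complex.I) *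
          Complex.exp (α * Complex.I)‖ +
        Real.log ‖1 - Complex.exp (-(ρ + r : ℝ) + β * Complex.I) *
          Complex.exp (α * Complex.I)‖ := by
  have hd : 0 < |ρ - r| := abs_pos.2 (sub_ne_zero.2 hne)
  have hpos : ∀ {x : ℝ} (γ : ℝ), 0 < x →
      ‖1 - Complex.exp (-x + γ * Complex.I) * Complex.exp (α * Complex.I)‖ ≠ 0 := by
    intro x γ hx h0
    rw [norm_eq_zero, sub_eq_zero] at h0
    have h1 := congrArg norm h0
    rw [norm_one, norm_mul, Complex.norm_exp_neg_add_mul_I, Complex.norm_exp_ofReal_mul_I,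
      mul_one] at h1
    exact (Real.exp_lt_one_iff.2 (by linarith : -x < 0)).ne h1.symm
  have e2 : ‖1 - Complex.exp (-(ρ + r : ℝ) + β * Complex.I) * Complex.exp (α * Complex.I)‖ =
      ‖1 - Complex.exp (-(r + α * Complex.I) - (ρ + β * Complex.I))‖ := by
    rw [← Complex.norm_conj, map_sub, map_one, ← Complex.exp_add, ← Complex.exp_conj]
    congr 3
    simp
    ring
  have key : ∀ Z W : ℂ, Complex.cosh Z - Complex.cosh W = Complex.exp Z / 2 *
      (1 - Complex.exp (W - Z)) * (1 - Complex.exp (-W - Z)) := by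
    intro Z W
    rw [Complex.cosh, Complex.cosh, Complex.exp_sub, Complex.exp_sub, Complex.exp_neg,
      Complex.exp_neg]
    have := Complex.exp_ne_zero Z
    have := Complex.exp_ne_zero W
    field_simp
    ring
  have hn : ∀ x y : ℝ, ‖Complex.exp (x + y * Complex.I)‖ = Real.exp x := fun x y => by
    rw [Complex.norm_exp]
    simp
  have h2 := hpos β (by linarith : 0 < ρ + r)
  have h1 := hpos (-β) hd
  have e1 : ‖Complex.cosh (ρ + β * Complex.I) - Complex.cosh (r + α * Complex.I)‖ =
      Real.exp ((ρ + r + |ρ - r|) / 2) / 2 *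
      ‖1 - Complex.exp (-(|ρ - r| : ℝ) + (-β : ℝ) * Complex.I) * Complex.exp (α * Complex.I)‖ *
      ‖1 - Complex.exp (-(ρ + r : ℝ) + β * Complex.I) * Complex.exp (α * Complex.I)‖ := by
    rw [e2]
    rcases lt_or_gt_of_ne hne with h | h
    · rw [← norm_neg, neg_sub, key, norm_mul, norm_mul, norm_div, hn, abs_of_neg (sub_neg.2 h)]
      congr 1
      · congr 1
        · rw [Complex.norm_two]
          congr 2
          ring
        · rw [← Complex.norm_conj, map_sub, map_one, ← Complex.exp_add, ← Complex.exp_conj]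
          congr 3
          simp
          ring
      · congr 3
        ring
    · rw [key, norm_mul, norm_mul, norm_div, hn, abs_of_pos (sub_pos.2 h)]
      congr 1
      · congr 1
        · rw [Complex.norm_two]
          congr 2
          ring
        · rw [← Complex.exp_add]
          congr 3
          push_cast
          ring
  rw [e1, Real.log_mul (mul_ne_zero (by positivity) h1) h2, Real.log_mul (by positivity) h1,
    Real.log_div (Real.exp_pos _).ne' two_ne_zero, Real.log_exp]

theorem continuous_ellipseDensity {H : ℝ} (hH : 0 < H) (h : ℝ) :
    Continuous (ellipseDensity H h) := by
  unfold ellipseDensity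
  exact Continuous.div (by fun_prop) (by fun_prop) fun α =>
    (pow_pos (cosh_add_cos_pos hH α) 2).ne'

theorem continuous_log_norm_one_sub {x : ℝ} (hx : 0 < x) (β : ℝ) :
    Continuous fun α : ℝ => Real.log ‖1 - Complex.exp (-x + β * Complex.I) *
      Complex.exp (α * Complex.I)‖ := by
  refine Continuous.log (by fun_prop) fun α h0 => ?_
  rw [norm_eq_zero, sub_eq_zero] at h0
  have h1 := congrArg norm h0
  rw [norm_one, norm_mul, Complex.norm_exp_neg_add_mul_I, Complex.norm_exp_ofReal_mul_I,
    mul_one] at h1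
  exact (Real.exp_lt_one_iff.2 (by linarith : -x < 0)).ne h1.symm

theorem continuous_log_norm_cosh_sub_cosh {ρ r : ℝ} (hr : 0 < r) (hρ : 0 ≤ ρ) (hne : ρ ≠ r)
    (β : ℝ) : Continuous fun α : ℝ =>
      Real.log ‖Complex.cosh (ρ + β * Complex.I) - Complex.cosh (r + α * Complex.I)‖ := by
  simp_rw [log_norm_cosh_sub_cosh hr hρ hne]
  exact (continuous_const.add (continuous_log_norm_one_sub (abs_pos.2 (sub_ne_zero.2 hne)) _)).add
    (continuous_log_norm_one_sub (by linarith) _)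

theorem integral_log_norm_cosh_sub_cosh_mul_ellipseDensity {H ρ r : ℝ} (hH : 0 < H) (hr : 0 < r)
    (hρ : 0 ≤ ρ) (hne : ρ ≠ r) (h β : ℝ) :
    ∫ α in (0 : ℝ)..2 * Real.pi, Real.log ‖Complex.cosh (ρ + β * Complex.I) -
        Complex.cosh (r + α * Complex.I)‖ * ellipseDensity H h α =
      Real.pi * ((1 + h * Real.cosh H) / Real.sinh H ^ 3 *
        (Real.log (Real.cosh (H + |ρ - r|) + Real.cos β) +
          Real.log (Real.cosh (H + (ρ + r)) + Real.cos β) - 2 * H) +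
        (h + Real.cosh H) / Real.sinh H ^ 2 *
          (2 - Real.sinh (H + |ρ - r|) / (Real.cosh (H + |ρ - r|) + Real.cos β) -
            Real.sinh (H + (ρ + r)) / (Real.cosh (H + (ρ + r)) + Real.cos β))) := by
  have hd : 0 < |ρ - r| := abs_pos.2 (sub_ne_zero.2 hne)
  have hs : 0 < ρ + r := by linarith
  have hc := continuous_ellipseDensity hH h
  have c0 : Continuous fun α => ((ρ + r + |ρ - r|) / 2 - Real.log 2) * ellipseDensity H h α :=
    continuous_const.mul hc
  have c1 : Continuous fun α : ℝ => Real.log ‖1 - Complex.exp (-(|ρ - r| : ℝ) +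
      (-β : ℝ) * Complex.I) * Complex.exp (α * Complex.I)‖ * ellipseDensity H h α :=
    (continuous_log_norm_one_sub hd (-β)).mul hc
  have c2 : Continuous fun α : ℝ => Real.log ‖1 - Complex.exp (-(ρ + r : ℝ) + β * Complex.I) *
      Complex.exp (α * Complex.I)‖ * ellipseDensity H h α :=
    (continuous_log_norm_one_sub hs β).mul hc
  simp_rw [log_norm_cosh_sub_cosh hr hρ hne, add_mul _ _ (ellipseDensity H h _)]
  rw [intervalIntegral.integral_add ((c0.fun_add c1).intervalIntegrable _ _)
    (c2.intervalIntegrable _ _), intervalIntegral.integral_add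
    (c0.intervalIntegrable _ _) (c1.intervalIntegrable _ _),
    intervalIntegral.integral_const_mul, integral_ellipseDensity hH,
    integral_log_norm_mul_ellipseDensity hH hd, integral_log_norm_mul_ellipseDensity hH hs,
    Real.cos_neg]
  ring

/-! ### Dependence on the ellipse -/

/-- The elliptic coordinate `H` with `cosh H = B + cosh r`, that of the pole of the spherical
density on the ellipse `r`. -/
noncomputable def poleCoord (B r : ℝ) : ℝ := Real.arcosh (B + Real.cosh r)

/-- The derivative of `poleCoord`; up to a constant factor this is also the spherical area inside
the ellipse `r`. -/
noncomputable def ellipseMass (B r : ℝ) : ℝ := Real.sinh r / Real.sinh (poleCoord B r)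

section PoleCoord

variable {B : ℝ}

theorem cosh_poleCoord (hB : 0 < B) (r : ℝ) : Real.cosh (poleCoord B r) = B + Real.cosh r :=
  Real.cosh_arcosh (by linarith [Real.one_le_cosh r])

theorem poleCoord_pos (hB : 0 < B) (r : ℝ) : 0 < poleCoord B r :=
  Real.arcosh_pos (by linarith [Real.one_le_cosh r])

theorem lt_poleCoord (hB : 0 < B) {r : ℝ} (hr : 0 ≤ r) : r < poleCoord B r := by
  have h : Real.cosh r < Real.cosh (poleCoord B r) := by
    rw [cosh_poleCoord hB]
    linarith
  rwa [Real.cosh_lt_cosh, abs_of_nonneg hr, abs_of_pos (poleCoord_pos hB r)] at h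

theorem hasDerivAt_poleCoord (hB : 0 < B) (r : ℝ) :
    HasDerivAt (poleCoord B) (ellipseMass B r) r := by
  have h1 : 1 < B + Real.cosh r := by linarith [Real.one_le_cosh r]
  have h := (Real.hasDerivAt_arcosh h1).comp r ((Real.hasDerivAt_cosh r).const_add B)
  refine h.congr_deriv ?_
  rw [← Real.sinh_arcosh h1.le, ellipseMass, poleCoord]
  ring

theorem one_sub_ellipseMass_sq (hB : 0 < B) (r : ℝ) :
    1 - ellipseMass B r ^ 2 =
      B * ((Real.cosh r + Real.cosh (poleCoord B r)) / Real.sinh (poleCoord B r) ^ 2) := by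
  have hs := (Real.sinh_pos_iff.2 (poleCoord_pos hB r)).ne'
  have h1 := Real.cosh_sq r
  have h2 := Real.cosh_sq (poleCoord B r)
  have h3 := cosh_poleCoord hB r
  rw [ellipseMass]
  rw [h3] at h2 ⊢
  field_simp
  linear_combination h1 - h2

/-- The derivative of `ellipseMass`. -/
noncomputable def ellipseMassDeriv (B r : ℝ) : ℝ :=
  B * ((1 + Real.cosh r * Real.cosh (poleCoord B r)) / Real.sinh (poleCoord B r) ^ 3)

theorem hasDerivAt_ellipseMass (hB : 0 < B) (r : ℝ) :
    HasDerivAt (ellipseMass B) (ellipseMassDeriv B r) r := by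
  have hs := (Real.sinh_pos_iff.2 (poleCoord_pos hB r)).ne'
  have h := (Real.hasDerivAt_sinh r).div ((hasDerivAt_poleCoord hB r).sinh) hs
  refine h.congr_deriv ?_
  have h1 := Real.cosh_sq r
  have h2 := Real.cosh_sq (poleCoord B r)
  have h3 := cosh_poleCoord hB r
  rw [ellipseMass, ellipseMassDeriv]
  rw [h3] at h2 ⊢
  field_simp
  linear_combination (B + Real.cosh r) * h1 - Real.cosh r * h2

theorem ellipseMass_zero : ellipseMass B 0 = 0 := by simp [ellipseMass]

/-- The mean of the logarithmic kernel over the ellipse `r`. -/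
noncomputable def ellipseMean (B ρ β r : ℝ) : ℝ :=
  B / (2 * Real.pi) * ∫ α in (0 : ℝ)..2 * Real.pi,
    Real.log ‖Complex.cosh (ρ + β * Complex.I) - Complex.cosh (r + α * Complex.I)‖ *
      ellipseDensity (poleCoord B r) (Real.cosh r) α

theorem ellipseMean_eq (hB : 0 < B) {ρ r : ℝ} (hr : 0 < r) (hρ : 0 ≤ ρ) (hne : ρ ≠ r) (β : ℝ) :
    ellipseMean B ρ β r = ellipseMassDeriv B r *
        (Real.log (Real.cosh (poleCoord B r + |ρ - r|) + Real.cos β) +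
          Real.log (Real.cosh (poleCoord B r + (ρ + r)) + Real.cos β) - 2 * poleCoord B r) / 2 +
        (1 - ellipseMass B r ^ 2) *
          (2 - Real.sinh (poleCoord B r + |ρ - r|) /
              (Real.cosh (poleCoord B r + |ρ - r|) + Real.cos β) -
            Real.sinh (poleCoord B r + (ρ + r)) /
              (Real.cosh (poleCoord B r + (ρ + r)) + Real.cos β)) / 2 := by
  have hpi := Real.pi_ne_zero
  rw [ellipseMean, integral_log_norm_cosh_sub_cosh_mul_ellipseDensity (poleCoord_pos hB r) hr hρ
    hne, one_sub_ellipseMass_sq hB, ellipseMassDeriv, div_mul_eq_mul_div,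
    div_eq_iff (by positivity)]
  ring

theorem hasDerivAt_log_cosh_add_cos {f : ℝ → ℝ} {f' r : ℝ} (hf : HasDerivAt f f' r)
    (hpos : 0 < f r) (β : ℝ) : HasDerivAt (fun r => Real.log (Real.cosh (f r) + Real.cos β))
      (f' * (Real.sinh (f r) / (Real.cosh (f r) + Real.cos β))) r := by
  refine ((hf.cosh.add_const _).log (cosh_add_cos_pos hpos β).ne').congr_deriv ?_
  ring

/-- A primitive in `r` of the mean of the logarithmic kernel, for a point outside the ellipse. -/
noncomputable def outerPrimitive (B ρ β r : ℝ) : ℝ :=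
  (1 + ellipseMass B r) / 2 * Real.log (Real.cosh (poleCoord B r - r + ρ) + Real.cos β) -
    (1 - ellipseMass B r) / 2 * Real.log (Real.cosh (poleCoord B r + r + ρ) + Real.cos β) -
    ellipseMass B r * poleCoord B r + r

/-- A primitive in `r` of the mean of the logarithmic kernel, for a point inside the ellipse. -/
noncomputable def innerPrimitive (B ρ β r : ℝ) : ℝ :=
  -((1 - ellipseMass B r) / 2) * (Real.log (Real.cosh (poleCoord B r + r - ρ) + Real.cos β) +
    Real.log (Real.cosh (poleCoord B r + r + ρ) + Real.cos β)) -
    ellipseMass B r * poleCoord B r + r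

/-- The primitive is differentiable up to `r = 0` and `r = ρ`, where the mean itself is not
available. -/
theorem exists_hasDerivAt_outerPrimitive (hB : 0 < B) {ρ r : ℝ} (hr : 0 ≤ r) (hρ : 0 ≤ ρ) (β : ℝ) :
    ∃ D, HasDerivAt (outerPrimitive B ρ β) D r ∧ (0 < r → r < ρ → D = ellipseMean B ρ β r) := by
  have hlt := lt_poleCoord hB hr
  have hH := hasDerivAt_poleCoord hB r
  have hq := hasDerivAt_ellipseMass hB r
  have h1 := hasDerivAt_log_cosh_add_cos ((hH.sub (hasDerivAt_id r)).add_const ρ)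
    (by simp only [Pi.sub_apply, id]; linarith) β
  have h2 := hasDerivAt_log_cosh_add_cos ((hH.add (hasDerivAt_id r)).add_const ρ)
    (by simp only [Pi.add_apply, id]; linarith) β
  have h := ((((hq.const_add 1).div_const 2).mul h1).sub
    (((hq.const_sub 1).div_const 2).mul h2)).sub
    (hq.mul hH) |>.add (hasDerivAt_id r)
  refine ⟨_, h, fun hr0 hrρ => ?_⟩
  rw [ellipseMean_eq hB hr0 hρ hrρ.ne', abs_of_pos (sub_pos.2 hrρ)]
  simp only [Pi.sub_apply, Pi.add_apply, id]
  have e1 : poleCoord B r + (ρ - r) = poleCoord B r - r + ρ := by ring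
  have e2 : poleCoord B r + (ρ + r) = poleCoord B r + r + ρ := by ring
  rw [e1, e2]
  ring

theorem exists_hasDerivAt_innerPrimitive (hB : 0 < B) {ρ r : ℝ} (hr : 0 ≤ r) (hρ : 0 ≤ ρ)
    (hρr : ρ ≤ r) (β : ℝ) :
    ∃ D, HasDerivAt (innerPrimitive B ρ β) D r ∧ (0 < r → ρ < r → D = ellipseMean B ρ β r) := by
  have hlt := lt_poleCoord hB hr
  have hH := hasDerivAt_poleCoord hB r
  have hq := hasDerivAt_ellipseMass hB r
  have h1 := hasDerivAt_log_cosh_add_cos ((hH.add (hasDerivAt_id r)).sub_const ρ)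
    (by simp only [Pi.add_apply, id]; linarith) β
  have h2 := hasDerivAt_log_cosh_add_cos ((hH.add (hasDerivAt_id r)).add_const ρ)
    (by simp only [Pi.add_apply, id]; linarith) β
  have h := ((((hq.const_sub 1).div_const 2).neg.mul (h1.add h2)).sub
    (hq.mul hH)).add (hasDerivAt_id r)
  refine ⟨_, h, fun hr0 hrρ => ?_⟩
  rw [ellipseMean_eq hB hr0 hρ hrρ.ne, abs_of_neg (sub_neg.2 hrρ)]
  simp only [Pi.add_apply, Pi.neg_apply, id]
  have e1 : poleCoord B r + -(ρ - r) = poleCoord B r + r - ρ := by ring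
  have e2 : poleCoord B r + (ρ + r) = poleCoord B r + r + ρ := by ring
  rw [e1, e2]
  ring_nf

theorem outerPrimitive_zero (ρ β : ℝ) : outerPrimitive B ρ β 0 = 0 := by
  simp only [outerPrimitive, ellipseMass_zero, sub_zero, add_zero]
  ring

/-- The jump between the two primitives when the ellipse passes through the point; it is the term
by which the two formulas for the potential of the region differ. -/
theorem outerPrimitive_sub_innerPrimitive (hB : 0 < B) (ρ β : ℝ) :
    outerPrimitive B ρ β ρ - innerPrimitive B ρ β ρ =
      Real.log (B + Real.cosh ρ + Real.cos β) := by
  rw [outerPrimitive, innerPrimitive, sub_add_cancel, add_sub_cancel_right, ← cosh_poleCoord hB]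
  ring

end PoleCoord

/-- The fundamental theorem of calculus in `[0, ∞]`, for a nonnegative derivative; integrability is
automatic. -/
theorem lintegral_Ioc_ofReal_deriv {f f' : ℝ → ℝ} {a b : ℝ} (hab : a ≤ b)
    (hc : ContinuousOn f (Set.Icc a b)) (hd : ∀ x ∈ Set.Ioo a b, HasDerivAt f (f' x) x)
    (hn : ∀ x ∈ Set.Ioo a b, 0 ≤ f' x) :
    ∫⁻ x in Set.Ioc a b, ENNReal.ofReal (f' x) = ENNReal.ofReal (f b - f a) ∧ 0 ≤ f b - f a := by
  have hi := intervalIntegral.integrableOn_deriv_of_nonneg hc hd hn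
  have h := intervalIntegral.integral_eq_sub_of_hasDerivAt_of_le hab hc hd
    ((intervalIntegrable_iff_integrableOn_Ioc_of_le hab).2 hi)
  have hi' : IntegrableOn f' (Set.Ioo a b) := hi.mono_set Set.Ioo_subset_Ioc_self
  have hn' : 0 ≤ᵐ[volume.restrict (Set.Ioo a b)] f' :=
    (ae_restrict_iff' measurableSet_Ioo).2 (.of_forall hn)
  rw [intervalIntegral.integral_of_le hab, integral_Ioc_eq_integral_Ioo] at h
  rw [← h, ← restrict_Ioo_eq_restrict_Ioc]
  exact ⟨(ofReal_integral_eq_lintegral_ofReal hi' hn').symm, integral_nonneg_of_ae hn'⟩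

theorem ellipseDensity_nonneg (H r α : ℝ) : 0 ≤ ellipseDensity H (Real.cosh r) α :=
  div_nonneg (by linarith [Real.one_le_cosh r, Real.cos_le_one α]) (sq_nonneg _)

theorem lintegral_ofReal_mul_ellipseDensity {B : ℝ} (hB : 0 < B) (r : ℝ) {k : ℝ → ℝ}
    (hk : Continuous k) (hk0 : ∀ α ∈ Set.Ioo 0 (2 * Real.pi), 0 ≤ k α) :
    ∫⁻ α in Set.Ioo 0 (2 * Real.pi), ENNReal.ofReal (k α) *
        ENNReal.ofReal (B / (4 * Real.pi) * ellipseDensity (poleCoord B r) (Real.cosh r) α) =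
      ENNReal.ofReal (B / (4 * Real.pi) * ∫ α in (0 : ℝ)..2 * Real.pi, k α *
        ellipseDensity (poleCoord B r) (Real.cosh r) α) ∧
    0 ≤ B / (4 * Real.pi) * ∫ α in (0 : ℝ)..2 * Real.pi, k α *
        ellipseDensity (poleCoord B r) (Real.cosh r) α := by
  have hpi := Real.pi_pos
  have hc := hk.mul (continuous_ellipseDensity (poleCoord_pos hB r) (Real.cosh r))
  have hi : IntegrableOn (fun α => B / (4 * Real.pi) *
      (k α * ellipseDensity (poleCoord B r) (Real.cosh r) α)) (Set.Ioo 0 (2 * Real.pi)) :=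
    (continuous_const.mul hc).integrableOn_Icc.mono_set Set.Ioo_subset_Icc_self
  have hn : ∀ α ∈ Set.Ioo 0 (2 * Real.pi), 0 ≤ B / (4 * Real.pi) *
      (k α * ellipseDensity (poleCoord B r) (Real.cosh r) α) := fun α hα =>
    mul_nonneg (by positivity) (mul_nonneg (hk0 α hα) (ellipseDensity_nonneg _ _ _))
  have hn' : 0 ≤ᵐ[volume.restrict (Set.Ioo 0 (2 * Real.pi))] fun α => B / (4 * Real.pi) *
      (k α * ellipseDensity (poleCoord B r) (Real.cosh r) α) :=
    (ae_restrict_iff' measurableSet_Ioo).2 (.of_forall hn)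
  rw [intervalIntegral.integral_of_le (by linarith), integral_Ioc_eq_integral_Ioo,
    ← integral_const_mul]
  refine ⟨?_, integral_nonneg_of_ae hn'⟩
  rw [ofReal_integral_eq_lintegral_ofReal hi hn']
  refine setLIntegral_congr_fun measurableSet_Ioo fun α hα => ?_
  rw [← ENNReal.ofReal_mul (hk0 α hα)]
  congr 1
  ring

/-- The mean over the ellipse `r` of the logarithm of `B + cosh r + cos α`, which is `1 + |w|²` up
to a constant factor. -/
noncomputable def northMean (B r : ℝ) : ℝ :=
  B / (2 * Real.pi) * ∫ α in (0 : ℝ)..2 * Real.pi, Real.log (B + Real.cosh r + Real.cos α) *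
    ellipseDensity (poleCoord B r) (Real.cosh r) α

section Means

variable {B : ℝ}

theorem add_cosh_add_cos_pos (hB : 0 < B) (r α : ℝ) : 0 < B + Real.cosh r + Real.cos α := by
  linarith [cosh_add_cos_nonneg r α]

theorem continuous_northMean (hB : 0 < B) : Continuous (northMean B) := by
  refine continuous_const.mul
    (intervalIntegral.continuous_parametric_intervalIntegral_of_continuous' ?_ _ _)
  have hH : Continuous (poleCoord B) :=
    continuous_iff_continuousAt.2 fun r => (hasDerivAt_poleCoord hB r).continuousAt
  unfold ellipseDensity
  refine Continuous.mul (Continuous.log (by fun_prop) fun p =>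
    (add_cosh_add_cos_pos hB _ _).ne') (Continuous.div (by fun_prop) ?_ fun p =>
    (pow_pos (cosh_add_cos_pos (poleCoord_pos hB _) _) 2).ne')
  exact ((Real.continuous_cosh.comp (hH.comp continuous_fst)).add (by fun_prop)).pow 2

/-- A primitive of `northMean`. -/
noncomputable def northPrimitive (B r : ℝ) : ℝ := ∫ s in (0 : ℝ)..r, northMean B s

theorem hasDerivAt_northPrimitive (hB : 0 < B) (r : ℝ) :
    HasDerivAt (northPrimitive B) (northMean B r) r :=
  (continuous_northMean hB).integral_hasStrictDerivAt 0 r |>.hasDerivAt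

theorem northPrimitive_zero : northPrimitive B 0 = 0 := intervalIntegral.integral_same

theorem continuous_log_add_cosh_add_cos (hB : 0 < B) (r : ℝ) :
    Continuous fun α => Real.log (B + Real.cosh r + Real.cos α) :=
  Continuous.log (by fun_prop) fun α => (add_cosh_add_cos_pos hB r α).ne'

theorem integral_const_mul_ellipseDensity (hB : 0 < B) (r k : ℝ) :
    B / (4 * Real.pi) * ∫ α in (0 : ℝ)..2 * Real.pi,
      k * ellipseDensity (poleCoord B r) (Real.cosh r) α = k * ellipseMassDeriv B r / 2 := by
  have hpi := Real.pi_ne_zero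
  rw [intervalIntegral.integral_const_mul, integral_ellipseDensity (poleCoord_pos hB r),
    ellipseMassDeriv]
  field_simp
  ring

theorem integral_north_mul_ellipseDensity (hB : 0 < B) (r k : ℝ) :
    B / (4 * Real.pi) * ∫ α in (0 : ℝ)..2 * Real.pi,
      (k + Real.log (B + Real.cosh r + Real.cos α)) *
        ellipseDensity (poleCoord B r) (Real.cosh r) α =
      (k * ellipseMassDeriv B r + northMean B r) / 2 := by
  have hpi := Real.pi_ne_zero
  have hc := continuous_ellipseDensity (poleCoord_pos hB r) (Real.cosh r)
  have c0 : Continuous fun α => k * ellipseDensity (poleCoord B r) (Real.cosh r) α :=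
    continuous_const.mul hc
  have c1 : Continuous fun α => Real.log (B + Real.cosh r + Real.cos α) *
      ellipseDensity (poleCoord B r) (Real.cosh r) α :=
    (continuous_log_add_cosh_add_cos hB r).mul hc
  simp_rw [add_mul k]
  rw [intervalIntegral.integral_add (c0.intervalIntegrable _ _) (c1.intervalIntegrable _ _),
    mul_add, integral_const_mul_ellipseDensity hB, northMean]
  field_simp
  ring

theorem integral_pair_mul_ellipseDensity (hB : 0 < B) {ρ r : ℝ} (hr : 0 < r) (hρ : 0 ≤ ρ)
    (hne : ρ ≠ r) (β k : ℝ) :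
    B / (4 * Real.pi) * ∫ α in (0 : ℝ)..2 * Real.pi,
      (k + Real.log (B + Real.cosh r + Real.cos α) -
        Real.log ‖Complex.cosh (ρ + β * Complex.I) - Complex.cosh (r + α * Complex.I)‖) *
        ellipseDensity (poleCoord B r) (Real.cosh r) α =
      (k * ellipseMassDeriv B r + northMean B r - ellipseMean B ρ β r) / 2 := by
  have hpi := Real.pi_ne_zero
  have hc := continuous_ellipseDensity (poleCoord_pos hB r) (Real.cosh r)
  have c0 : Continuous fun α => (k + Real.log (B + Real.cosh r + Real.cos α)) *
      ellipseDensity (poleCoord B r) (Real.cosh r) α :=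
    (continuous_const.add (continuous_log_add_cosh_add_cos hB r)).mul hc
  have c1 : Continuous fun α : ℝ => Real.log ‖Complex.cosh (ρ + β * Complex.I) -
      Complex.cosh (r + α * Complex.I)‖ * ellipseDensity (poleCoord B r) (Real.cosh r) α :=
    (continuous_log_norm_cosh_sub_cosh hr hρ hne β).mul hc
  simp_rw [sub_mul]
  rw [intervalIntegral.integral_sub (c0.intervalIntegrable _ _) (c1.intervalIntegrable _ _),
    mul_sub, integral_north_mul_ellipseDensity hB, ellipseMean]
  field_simp
  ring

end Means

/-! ### The region inside a confocal ellipse -/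

/-- Negative inside, and positive outside, the image on the sphere of the ellipse with foci `± A`
and elliptic coordinate `M`; it vanishes at the north pole. -/
noncomputable def confocalGauge (A M : ℝ) (x : S2) : ℝ :=
  ‖(x.1 0 : ℂ) + x.1 1 * Complex.I - A * (1 - x.1 2 : ℝ)‖ +
    ‖(x.1 0 : ℂ) + x.1 1 * Complex.I + A * (1 - x.1 2 : ℝ)‖ -
    2 * A * Real.cosh (M / 2) * (1 - x.1 2)

theorem continuous_confocalGauge (A M : ℝ) : Continuous (confocalGauge A M) := by
  unfold confocalGauge
  fun_prop

theorem confocalGauge_ofComplex (A M : ℝ) (z : ℂ) :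
    confocalGauge A M (S2.ofComplex z) =
      2 / (1 + ‖z‖ ^ 2) * (‖z - A‖ + ‖z + A‖ - 2 * A * Real.cosh (M / 2)) := by
  have hp : 0 < 1 + ‖z‖ ^ 2 := by positivity
  have e1 : ((S2.ofComplex z).1 0 : ℂ) + (S2.ofComplex z).1 1 * Complex.I =
      (2 / (1 + ‖z‖ ^ 2) : ℝ) * z := by
    rw [S2.ofComplex_apply_zero, S2.ofComplex_apply_one,
      show z.re ^ 2 + z.im ^ 2 + 1 = 1 + ‖z‖ ^ 2 by rw [Complex.sq_norm_eq]; ring]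
    push_cast
    linear_combination (2 / (1 + (‖z‖ : ℂ) ^ 2)) * Complex.re_add_im z
  have e2 : 1 - (S2.ofComplex z).1 2 = 2 / (1 + ‖z‖ ^ 2) := by
    have : z.re ^ 2 + z.im ^ 2 + 1 ≠ 0 := by positivity
    have : 1 + (z.re ^ 2 + z.im ^ 2) ≠ 0 := by positivity
    rw [S2.ofComplex_apply_two, Complex.sq_norm_eq]
    field_simp
    ring
  rw [confocalGauge, e1, e2, mul_comm (A : ℂ), ← mul_sub, ← mul_add, norm_mul, norm_mul,
    Complex.norm_real, Real.norm_eq_abs, abs_of_pos (by positivity)]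
  ring

theorem confocalGauge_north (A M : ℝ) : confocalGauge A M S2.north = 0 := by
  simp [confocalGauge]

/-- The closed region bounded by a confocal ellipse, together with the north pole, which is
negligible. -/
def confocalRegion (A M : ℝ) : Set S2 := {x | confocalGauge A M x ≤ 0}

/-- The open region bounded by a confocal ellipse. -/
def confocalInterior (A M : ℝ) : Set S2 := {x | confocalGauge A M x < 0}

theorem isClosed_confocalRegion (A M : ℝ) : IsClosed (confocalRegion A M) :=
  isClosed_le (continuous_confocalGauge A M) continuous_const

theorem isOpen_confocalInterior (A M : ℝ) : IsOpen (confocalInterior A M) :=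
  isOpen_lt (continuous_confocalGauge A M) continuous_const

theorem confocalInterior_subset (A M : ℝ) : confocalInterior A M ⊆ confocalRegion A M :=
  fun x hx => le_of_lt (show confocalGauge A M x < 0 from hx)

theorem north_notMem_confocalInterior (A M : ℝ) : S2.north ∉ confocalInterior A M := fun h =>
  (confocalGauge_north A M).not_lt h

theorem norm_sub_add_norm_add_ellipticPoint {A : ℝ} (hA : 0 < A) (ρ β : ℝ) :
    ‖ellipticPoint A ρ β - A‖ + ‖ellipticPoint A ρ β + A‖ = 2 * A * Real.cosh (ρ / 2) := by
  have e : ((ρ : ℂ) + β * Complex.I) / 2 = ((ρ / 2 : ℝ) : ℂ) + ((β / 2 : ℝ) : ℂ) * Complex.I := by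
    push_cast
    ring
  have hC := Real.one_le_cosh (ρ / 2)
  have hc := Real.cos_le_one (β / 2)
  have hc' := Real.neg_one_le_cos (β / 2)
  have h3 := Real.cosh_sq (ρ / 2)
  have h4 := Real.sin_sq_add_cos_sq (β / 2)
  have hn : ∀ σ : ℝ, σ ^ 2 = 1 →
      ‖Complex.cosh ((ρ + β * Complex.I) / 2) + σ‖ =
        |Real.cosh (ρ / 2) + σ * Real.cos (β / 2)| := by
    intro σ hσ
    rw [← sq_eq_sq₀ (norm_nonneg _) (abs_nonneg _), sq_abs, e, Complex.cosh_add, Complex.cosh_mul_I,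
      Complex.sinh_mul_I, ← Complex.ofReal_cosh, ← Complex.ofReal_sinh, ← Complex.ofReal_cos,
      ← Complex.ofReal_sin, Complex.sq_norm_eq]
    generalize Real.cosh (ρ / 2) = C at *
    generalize Real.sinh (ρ / 2) = S at *
    generalize Real.cos (β / 2) = c at *
    generalize Real.sin (β / 2) = s at *
    simp
    linear_combination S ^ 2 * h4 + (c ^ 2 - 1) * h3 + (1 - c ^ 2) * hσ
  have h1 := hn 1 (by norm_num)
  have h2 := hn (-1) (by norm_num)
  rw [abs_of_nonneg (by linarith)] at h1 h2
  have e1 : ellipticPoint A ρ β - A =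
      A * (Complex.cosh ((ρ + β * Complex.I) / 2) + ((-1 : ℝ) : ℂ)) := by
    rw [ellipticPoint]
    push_cast
    ring
  have e2 : ellipticPoint A ρ β + A =
      A * (Complex.cosh ((ρ + β * Complex.I) / 2) + ((1 : ℝ) : ℂ)) := by
    rw [ellipticPoint]
    push_cast
    ring
  rw [e1, e2, norm_mul, norm_mul, h1, h2, Complex.norm_real, Real.norm_eq_abs, abs_of_pos hA]
  ring

section Region

variable {A M ρ : ℝ}

theorem cosh_half_le_iff (hM : 0 ≤ M) (hρ : 0 ≤ ρ) :
    Real.cosh (ρ / 2) ≤ Real.cosh (M / 2) ↔ ρ ≤ M := by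
  rw [Real.cosh_le_cosh, abs_of_nonneg (by linarith), abs_of_nonneg (by linarith)]
  constructor <;> intro h <;> linarith

theorem ofComplex_mem_confocalRegion {z : ℂ} : S2.ofComplex z ∈ confocalRegion A M ↔
    ‖z - A‖ + ‖z + A‖ ≤ 2 * A * Real.cosh (M / 2) := by
  have hp : 0 < 2 / (1 + ‖z‖ ^ 2) := by positivity
  change confocalGauge A M _ ≤ 0 ↔ _
  rw [confocalGauge_ofComplex, ← not_lt, mul_pos_iff_of_pos_left hp, not_lt, sub_nonpos]

theorem ellipticPoint_mem_iff (hA : 0 < A) (hM : 0 ≤ M) (hρ : 0 ≤ ρ) (β : ℝ) :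
    ‖ellipticPoint A ρ β - A‖ + ‖ellipticPoint A ρ β + A‖ ≤ 2 * A * Real.cosh (M / 2) ↔ ρ ≤ M := by
  rw [norm_sub_add_norm_add_ellipticPoint hA, mul_le_mul_iff_right₀ (by positivity),
    cosh_half_le_iff hM hρ]

theorem ellipticPoint_notMem_confocalInterior (hA : 0 < A) (hρ : 0 ≤ ρ) {β : ℝ}
    (h : S2.ofComplex (ellipticPoint A ρ β) ∉ confocalInterior A M) : M ≤ ρ := by
  by_contra! hcon
  refine h ?_
  change confocalGauge A M _ < 0
  rw [confocalGauge_ofComplex, norm_sub_add_norm_add_ellipticPoint hA]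
  have : Real.cosh (ρ / 2) < Real.cosh (M / 2) := by
    rw [Real.cosh_lt_cosh, abs_of_nonneg (by linarith), abs_of_nonneg (by linarith)]
    linarith
  exact mul_neg_of_pos_of_neg (by positivity) (by nlinarith)

/-- The part of a confocal region in the upper half plane. -/
def upperRegion (A M : ℝ) : Set ℂ :=
  {w | 0 < w.im ∧ ‖w - A‖ + ‖w + A‖ ≤ 2 * A * Real.cosh (M / 2)}

/-- Elliptic coordinates as a function of a complex variable. -/
noncomputable def ellipticMap (A : ℝ) (ζ : ℂ) : ℂ := A * Complex.cosh (ζ / 2)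

theorem ellipticMap_eq (A r α : ℝ) :
    ellipticMap A ((r : ℂ) + α * Complex.I) = ellipticPoint A r α :=
  rfl

theorem ellipticPoint_im (A r α : ℝ) :
    (ellipticPoint A r α).im = A * (Real.sinh (r / 2) * Real.sin (α / 2)) := by
  have e : ((r : ℂ) + α * Complex.I) / 2 = ((r / 2 : ℝ) : ℂ) + ((α / 2 : ℝ) : ℂ) * Complex.I := by
    push_cast
    ring
  rw [ellipticPoint, e, Complex.cosh_add, Complex.cosh_mul_I, Complex.sinh_mul_I,
    ← Complex.ofReal_cosh, ← Complex.ofReal_sinh, ← Complex.ofReal_cos, ← Complex.ofReal_sin,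
    Complex.im_ofReal_mul]
  simp only [Complex.add_im, Complex.mul_im, Complex.mul_re, Complex.ofReal_re, Complex.ofReal_im,
    Complex.I_re, Complex.I_im]
  ring

theorem image_ellipticMap (hA : 0 < A) (hM : 0 ≤ M) :
    ellipticMap A '' (Set.Ioc 0 M ×ℂ Set.Ioo 0 (2 * Real.pi)) = upperRegion A M := by
  have hpi := Real.pi_pos
  ext w
  constructor
  · rintro ⟨ζ, ⟨hr, hα⟩, rfl⟩
    rw [← Complex.re_add_im ζ, ellipticMap_eq]
    have hr' : ζ.re ∈ Set.Ioc 0 M := hr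
    have hα' : ζ.im ∈ Set.Ioo 0 (2 * Real.pi) := hα
    refine ⟨?_, (ellipticPoint_mem_iff hA hM hr'.1.le _).2 hr'.2⟩
    rw [ellipticPoint_im]
    have h1 : 0 < Real.sinh (ζ.re / 2) := Real.sinh_pos_iff.2 (by linarith [hr'.1])
    have h2 : 0 < Real.sin (ζ.im / 2) :=
      Real.sin_pos_of_pos_of_lt_pi (by linarith [hα'.1]) (by linarith [hα'.2])
    positivity
  · rintro ⟨him, hw⟩
    obtain ⟨ρ, β, hρ, rfl⟩ := exists_ellipticPoint hA w
    rw [ellipticPoint_mem_iff hA hM hρ] at hw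
    rw [ellipticPoint_im, mul_pos_iff_of_pos_left hA] at him
    have h1 : 0 ≤ Real.sinh (ρ / 2) := Real.sinh_nonneg_iff.2 (by linarith)
    have hs : 0 < Real.sin (β / 2) := not_le.1 fun h =>
      him.not_ge (mul_nonpos_of_nonneg_of_nonpos h1 h)
    have hρ0 : 0 < ρ := lt_of_le_of_ne hρ fun h => by
      rw [← h] at him
      simp at him
    -- The elliptic coordinate `β` has period `4π`, and the upper half plane is `0 < β < 2π`.
    obtain ⟨n, hn⟩ : ∃ n : ℤ, β - n * (4 * Real.pi) ∈ Set.Ico 0 (4 * Real.pi) := by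
      refine ⟨⌊β / (4 * Real.pi)⌋, ?_, ?_⟩
      · have := Int.floor_le (β / (4 * Real.pi))
        rw [le_div_iff₀ (by positivity)] at this
        linarith
      · have := Int.lt_floor_add_one (β / (4 * Real.pi))
        rw [div_lt_iff₀ (by positivity)] at this
        linarith
    have hsin : Real.sin ((β - n * (4 * Real.pi)) / 2) = Real.sin (β / 2) := by
      rw [show (β - n * (4 * Real.pi)) / 2 = β / 2 - n * (2 * Real.pi) by ring,
        Real.sin_sub_int_mul_two_pi]
    have hlt : β - n * (4 * Real.pi) < 2 * Real.pi := by
      by_contra! hcon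
      have : Real.sin ((β - n * (4 * Real.pi)) / 2) ≤ 0 := by
        rw [show (β - n * (4 * Real.pi)) / 2 =
          ((β - n * (4 * Real.pi)) / 2 - 2 * Real.pi) + 2 * Real.pi by ring, Real.sin_add_two_pi]
        exact Real.sin_nonpos_of_nonpos_of_neg_pi_le (by linarith [hn.2]) (by linarith)
      linarith
    have hpos : 0 < β - n * (4 * Real.pi) := lt_of_le_of_ne hn.1 fun h => by
      rw [← h] at hsin
      simp at hsin
      linarith
    refine ⟨(ρ : ℂ) + ((β - n * (4 * Real.pi) : ℝ) : ℂ) * Complex.I, ⟨?_, ?_⟩, ?_⟩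
    · simpa using ⟨hρ0, hw⟩
    · rw [Set.mem_preimage, show ((ρ : ℂ) + ((β - n * (4 * Real.pi) : ℝ) : ℂ) * Complex.I).im =
        β - n * (4 * Real.pi) by simp]
      exact ⟨hpos, hlt⟩
    · rw [ellipticMap_eq, ellipticPoint, ellipticPoint]
      congr 1
      rw [← Complex.cos_mul_I, ← Complex.cos_mul_I, ← Complex.cos_add_int_mul_two_pi _ (-n)]
      congr 1
      push_cast
      linear_combination (-2 * n * Real.pi : ℂ) * Complex.I_sq

theorem injOn_ellipticMap (hA : 0 < A) (M : ℝ) :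
    Set.InjOn (ellipticMap A) (Set.Ioc 0 M ×ℂ Set.Ioo 0 (2 * Real.pi)) := by
  rintro ζ ⟨hr, hα⟩ ξ ⟨hs, hβ⟩ h
  have hpi := Real.pi_pos
  have hr' : ζ.re ∈ Set.Ioc 0 M := hr
  have hα' : ζ.im ∈ Set.Ioo 0 (2 * Real.pi) := hα
  have hs' : ξ.re ∈ Set.Ioc 0 M := hs
  have hβ' : ξ.im ∈ Set.Ioo 0 (2 * Real.pi) := hβ
  have h1 := mul_left_cancel₀ (Complex.ofReal_ne_zero.2 hA.ne') h
  rw [← Complex.cos_mul_I, ← Complex.cos_mul_I, Complex.cos_eq_cos_iff] at h1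
  obtain ⟨k, hk | hk⟩ := h1
  · have him := congrArg Complex.im hk
    have hre := congrArg Complex.re hk
    simp at him hre
    have h2 : (k : ℝ) < 1 := by
      by_contra! hcon
      nlinarith [hα'.1, hα'.2, hβ'.1, hβ'.2]
    have h3 : (-1 : ℝ) < k := by
      by_contra! hcon
      nlinarith [hα'.1, hα'.2, hβ'.1, hβ'.2]
    have hk0 : k = 0 := by
      have h2' : k < 1 := by exact_mod_cast h2
      have h3' : -1 < k := by exact_mod_cast h3
      omega
    rw [hk0] at hre
    apply Complex.ext
    · linarith
    · simp at hre
      linarith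
  · have him := congrArg Complex.im hk
    simp at him
    linarith [hr'.1, hs'.1]

end Region

/-! ### Integration over a confocal region -/

theorem Complex.volume_im_eq_zero : volume {w : ℂ | w.im = 0} = 0 := by
  have h := Measure.addHaar_submodule (volume : Measure ℂ) (LinearMap.ker Complex.imLm) (by
    intro h
    have : Complex.I ∈ LinearMap.ker Complex.imLm := by rw [h]; trivial
    simp at this)
  exact h

theorem hasDerivAt_ellipticMap (A : ℝ) (ζ : ℂ) :
    HasDerivAt (ellipticMap A) (A * (Complex.sinh (ζ / 2) * (1 / 2))) ζ := by
  have h := (((hasDerivAt_id ζ).div_const 2).ccosh).const_mul (A : ℂ)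
  exact h

theorem Complex.sq_norm_sinh_half (ρ β : ℝ) :
    ‖Complex.sinh ((ρ + β * Complex.I) / 2)‖ ^ 2 = (Real.cosh ρ - Real.cos β) / 2 := by
  have h := Complex.sq_norm_cosh_half ρ (β + Real.pi)
  rw [Real.cos_add_pi] at h
  rw [← sub_eq_add_neg] at h
  rw [← h, show ((ρ : ℂ) + ((β + Real.pi : ℝ) : ℂ) * Complex.I) / 2 =
    (ρ + β * Complex.I) / 2 + Real.pi / 2 * Complex.I by push_cast; ring, Complex.cosh_add,
    Complex.cosh_mul_I, Complex.sinh_mul_I, Complex.cos_pi_div_two, Complex.sin_pi_div_two]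
  simp

/-- The change of variables to elliptic coordinates in the upper half of a confocal region. -/
theorem setLIntegral_upperRegion {A M : ℝ} (hA : 0 < A) (hM : 0 ≤ M) {g : ℂ → ℝ≥0∞}
    (hg : Measurable g) :
    ∫⁻ w in upperRegion A M, ENNReal.ofReal (sphereDensity w) * g w =
      ∫⁻ r in Set.Ioc 0 M, ∫⁻ α in Set.Ioo 0 (2 * Real.pi), g (ellipticPoint A r α) *
        ENNReal.ofReal (2 / A ^ 2 / (4 * Real.pi) *
          ellipseDensity (poleCoord (2 / A ^ 2) r) (Real.cosh r) α) := by
  have hs : MeasurableSet (Set.Ioc 0 M ×ℂ Set.Ioo 0 (2 * Real.pi)) :=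
    (Complex.measurable_re measurableSet_Ioc).inter (Complex.measurable_im measurableSet_Ioo)
  have hB : 0 < 2 / A ^ 2 := by positivity
  have hpi := Real.pi_pos
  have hg' : Measurable fun p : ℝ × ℝ => g (ellipticPoint A p.1 p.2) *
      ENNReal.ofReal (2 / A ^ 2 / (4 * Real.pi) *
        ellipseDensity (poleCoord (2 / A ^ 2) p.1) (Real.cosh p.1) p.2) := by
    have hH : Continuous (poleCoord (2 / A ^ 2)) :=
      continuous_iff_continuousAt.2 fun r => (hasDerivAt_poleCoord hB r).continuousAt
    have hm : Measurable (poleCoord (2 / A ^ 2)) := hH.measurable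
    refine Measurable.mul (hg.comp ?_) (ENNReal.measurable_ofReal.comp ?_)
    · unfold ellipticPoint
      fun_prop
    · unfold ellipseDensity
      fun_prop
  rw [← image_ellipticMap hA hM, lintegral_image_eq_lintegral_abs_det_fderiv_mul volume hs
    (fun ζ _ => (((hasDerivAt_ellipticMap A ζ).hasFDerivAt.restrictScalars ℝ).hasFDerivWithinAt))
    (injOn_ellipticMap hA M)]
  have e : ∀ ζ : ℂ, ENNReal.ofReal |((ContinuousLinearMap.toSpanSingleton ℂ
      ((A : ℂ) * (Complex.sinh (ζ / 2) * (1 / 2)))).restrictScalars ℝ).det| *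
      (ENNReal.ofReal (sphereDensity (ellipticMap A ζ)) * g (ellipticMap A ζ)) =
      g (ellipticPoint A ζ.re ζ.im) * ENNReal.ofReal (2 / A ^ 2 / (4 * Real.pi) *
          ellipseDensity (poleCoord (2 / A ^ 2) ζ.re) (Real.cosh ζ.re) ζ.im) := by
    intro ζ
    -- The Jacobian determinant of a holomorphic map is the squared norm of its derivative.
    have h1 : ((ContinuousLinearMap.toSpanSingleton ℂ
      ((A : ℂ) * (Complex.sinh (ζ / 2) * (1 / 2)))).restrictScalars ℝ).det =
        A ^ 2 / 8 * (Real.cosh ζ.re - Real.cos ζ.im) := by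
      have h2 := Complex.sq_norm_sinh_half ζ.re ζ.im
      rw [Complex.re_add_im] at h2
      have h3 : ((ContinuousLinearMap.toSpanSingleton ℂ
        ((A : ℂ) * (Complex.sinh (ζ / 2) * (1 / 2)))).restrictScalars ℝ).det =
          ‖(A : ℂ) * (Complex.sinh (ζ / 2) * (1 / 2))‖ ^ 2 := by
        rw [← Complex.normSq_eq_norm_sq, ← Algebra.norm_complex_apply]
        change LinearMap.det (((ContinuousLinearMap.toSpanSingleton ℂ
          ((A : ℂ) * (Complex.sinh (ζ / 2) * (1 / 2)))) : ℂ →ₗ[ℂ] ℂ).restrictScalars ℝ) = _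
        rw [LinearMap.det_restrictScalars]
        congr 1
        simp
      rw [h3, norm_mul, norm_mul, mul_pow, mul_pow, h2, Complex.norm_real, Real.norm_eq_abs,
        sq_abs]
      norm_num
      ring
    have hnn : 0 ≤ A ^ 2 / 8 * (Real.cosh ζ.re - Real.cos ζ.im) :=
      mul_nonneg (by positivity) (by linarith [Real.one_le_cosh ζ.re, Real.cos_le_one ζ.im])
    have h4 := ellipticMap_eq A ζ.re ζ.im
    rw [Complex.re_add_im] at h4
    rw [h1, abs_of_nonneg hnn, h4, ← mul_assoc, ← ENNReal.ofReal_mul hnn, mul_comm]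
    congr 2
    rw [sphereDensity, one_add_sq_norm_ellipticPoint hA, ellipseDensity, cosh_poleCoord hB]
    have := add_cosh_add_cos_pos hB ζ.re ζ.im
    field_simp
    ring
  simp_rw [e]
  rw [← Complex.volume_preserving_equiv_real_prod.symm.setLIntegral_comp_preimage_emb
    Complex.measurableEquivRealProd.symm.measurableEmbedding]
  have hpre : Complex.measurableEquivRealProd.symm ⁻¹' (Set.Ioc 0 M ×ℂ Set.Ioo 0 (2 * Real.pi)) =
      Set.Ioc 0 M ×ˢ Set.Ioo 0 (2 * Real.pi) := by
    ext p
    rfl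
  rw [hpre, Measure.volume_eq_prod]
  exact setLIntegral_prod _ hg'.aemeasurable

/-- Integration over a confocal region in elliptic coordinates. The lower half of the region is
covered by the central symmetry `w ↦ -w`, so that antipodal pairs on each ellipse are summed. -/
theorem lintegral_confocalRegion {A M : ℝ} (hA : 0 < A) (hM : 0 ≤ M) {K : S2 → ℝ≥0∞}
    (hK : Measurable K) :
    ∫⁻ x in confocalRegion A M, K x ∂sphereMeasure =
      ∫⁻ r in Set.Ioc 0 M, ∫⁻ α in Set.Ioo 0 (2 * Real.pi),
        (K (S2.ofComplex (ellipticPoint A r α)) + K (S2.ofComplex (-ellipticPoint A r α))) *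
        ENNReal.ofReal (2 / A ^ 2 / (4 * Real.pi) *
          ellipseDensity (poleCoord (2 / A ^ 2) r) (Real.cosh r) α) := by
  have hD := (isClosed_confocalRegion A M).measurableSet
  have hdm : Measurable fun w => ENNReal.ofReal (sphereDensity w) :=
    continuous_sphereDensity.measurable.ennreal_ofReal
  have hK' : Measurable fun w : ℂ => K (S2.ofComplex w) :=
    hK.comp S2.continuous_ofComplex.measurable
  have hf : Measurable fun w => ENNReal.ofReal (sphereDensity w) * K (S2.ofComplex w) :=
    hdm.mul hK'
  have hE : MeasurableSet (S2.ofComplex ⁻¹' confocalRegion A M) :=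
    S2.continuous_ofComplex.measurable hD
  have hI : MeasurableSet {w : ℂ | 0 < w.im} :=
    measurableSet_lt measurable_const Complex.measurable_im
  rw [sphereMeasure_eq_map, setLIntegral_map hD hK S2.continuous_ofComplex.measurable,
    restrict_withDensity hE, lintegral_withDensity_eq_lintegral_mul _ hdm hK']
  simp only [Pi.mul_apply]
  rw [← lintegral_inter_add_sdiff _ _ hI]
  have h1 : S2.ofComplex ⁻¹' confocalRegion A M ∩ {w : ℂ | 0 < w.im} = upperRegion A M := by
    ext w
    rw [Set.mem_inter_iff, Set.mem_preimage, ofComplex_mem_confocalRegion, and_comm]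
    rfl
  have hU : MeasurableSet (upperRegion A M) := h1 ▸ hE.inter hI
  have h2 : (S2.ofComplex ⁻¹' confocalRegion A M \ {w : ℂ | 0 < w.im} : Set ℂ) =ᵐ[volume]
      Neg.neg ⁻¹' upperRegion A M := by
    have hs : {w : ℂ | w.im = 0}ᶜ ∈ ae (volume : Measure ℂ) :=
      compl_mem_ae_iff.2 Complex.volume_im_eq_zero
    filter_upwards [hs] with w hw
    have hw' : w.im ≠ 0 := hw
    refine propext ?_
    change (w ∈ S2.ofComplex ⁻¹' confocalRegion A M ∧ ¬ 0 < w.im) ↔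
      (0 < (-w).im ∧ ‖-w - A‖ + ‖-w + A‖ ≤ 2 * A * Real.cosh (M / 2))
    rw [Set.mem_preimage, ofComplex_mem_confocalRegion, not_lt, Complex.neg_im, neg_pos,
      ← neg_add', norm_neg, ← sub_eq_neg_add, norm_sub_rev (A : ℂ), add_comm ‖w + A‖, and_comm,
      hw'.le_iff_lt]
  have h3 : ∫⁻ w in Neg.neg ⁻¹' upperRegion A M,
      ENNReal.ofReal (sphereDensity w) * K (S2.ofComplex w) =
      ∫⁻ w in upperRegion A M, ENNReal.ofReal (sphereDensity w) * K (S2.ofComplex (-w)) := by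
    rw [← (Measure.measurePreserving_neg (volume : Measure ℂ)).setLIntegral_comp_preimage_emb
      (MeasurableEquiv.neg ℂ).measurableEmbedding
      (fun w => ENNReal.ofReal (sphereDensity w) * K (S2.ofComplex (-w)))]
    refine lintegral_congr fun w => ?_
    rw [neg_neg, sphereDensity, sphereDensity, norm_neg]
  rw [h1, setLIntegral_congr h2, h3, ← lintegral_add_left hf]
  simp_rw [← mul_add]
  exact setLIntegral_upperRegion hA hM
    (g := fun w => K (S2.ofComplex w) + K (S2.ofComplex (-w))) (hK'.add (hK'.comp measurable_neg))

/-! ### The potential of the uniform distribution inside an ellipse -/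

section RegionPotential

variable {A M ρ r : ℝ}

theorem ellipticPoint_injective_left (hA : 0 < A) (hρ : 0 ≤ ρ) (hr : 0 ≤ r) {β α : ℝ}
    (h : ellipticPoint A ρ β = ellipticPoint A r α ∨ ellipticPoint A ρ β = -ellipticPoint A r α) :
    ρ = r := by
  have h1 := norm_sub_add_norm_add_ellipticPoint hA ρ β
  have h2 := norm_sub_add_norm_add_ellipticPoint hA r α
  have h3 : ‖ellipticPoint A ρ β - A‖ + ‖ellipticPoint A ρ β + A‖ =
      ‖ellipticPoint A r α - A‖ + ‖ellipticPoint A r α + A‖ := by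
    rcases h with h | h
    · rw [h]
    · rw [h, ← neg_add', norm_neg, ← sub_eq_neg_add, norm_sub_rev (A : ℂ), add_comm]
  rw [h1, h2] at h3
  have h4 : Real.cosh (ρ / 2) = Real.cosh (r / 2) := mul_left_cancel₀ (by positivity) h3
  have h5 := Real.cosh_injOn (Set.mem_Ici.2 (by linarith : 0 ≤ ρ / 2))
    (Set.mem_Ici.2 (by linarith : 0 ≤ r / 2)) h4
  linarith

theorem ellipticPoint_sq (A ρ β : ℝ) :
    ellipticPoint A ρ β ^ 2 = (A ^ 2 / 2 : ℝ) * (Complex.cosh (ρ + β * Complex.I) + 1) := by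
  have h : (ρ : ℂ) + β * Complex.I = 2 * ((ρ + β * Complex.I) / 2) := by ring
  conv_rhs => rw [h, Complex.cosh_two_mul, Complex.sinh_sq]
  rw [ellipticPoint]
  push_cast
  ring

theorem chordKernel_add_chordKernel_neg_of_ne (hA : 0 < A) {β α : ℝ}
    (h1 : ellipticPoint A ρ β ≠ ellipticPoint A r α)
    (h2 : ellipticPoint A ρ β ≠ -ellipticPoint A r α) :
    chordKernel (S2.ofComplex (ellipticPoint A ρ β)) (S2.ofComplex (ellipticPoint A r α)) +
      chordKernel (S2.ofComplex (ellipticPoint A ρ β)) (S2.ofComplex (-ellipticPoint A r α)) =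
    ENNReal.ofReal (Real.log (A ^ 2 / 2) + Real.log (2 / A ^ 2 + Real.cosh ρ + Real.cos β) +
      Real.log (2 / A ^ 2 + Real.cosh r + Real.cos α) -
      Real.log ‖Complex.cosh (ρ + β * Complex.I) - Complex.cosh (r + α * Complex.I)‖) ∧
    0 ≤ Real.log (A ^ 2 / 2) + Real.log (2 / A ^ 2 + Real.cosh ρ + Real.cos β) +
      Real.log (2 / A ^ 2 + Real.cosh r + Real.cos α) -
      Real.log ‖Complex.cosh (ρ + β * Complex.I) - Complex.cosh (r + α * Complex.I)‖ := by
  have n1 := norm_pos_iff.2 (sub_ne_zero.2 h1)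
  have n2 := norm_pos_iff.2 (sub_ne_zero.2 h2)
  have hk1 := log_two_div_dist_nonneg (S2.ofComplex (ellipticPoint A ρ β))
    (S2.ofComplex (ellipticPoint A r α))
  have hk2 := log_two_div_dist_nonneg (S2.ofComplex (ellipticPoint A ρ β))
    (S2.ofComplex (-ellipticPoint A r α))
  rw [log_two_div_dist_ofComplex h1] at hk1
  rw [log_two_div_dist_ofComplex h2] at hk2
  have hprod : ‖ellipticPoint A ρ β - ellipticPoint A r α‖ *
      ‖ellipticPoint A ρ β - -ellipticPoint A r α‖ = A ^ 2 / 2 *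
      ‖Complex.cosh (ρ + β * Complex.I) - Complex.cosh (r + α * Complex.I)‖ := by
    rw [← norm_mul, show (ellipticPoint A ρ β - ellipticPoint A r α) *
      (ellipticPoint A ρ β - -ellipticPoint A r α) = (A ^ 2 / 2 : ℝ) *
      (Complex.cosh (ρ + β * Complex.I) - Complex.cosh (r + α * Complex.I)) by
        linear_combination ellipticPoint_sq A ρ β - ellipticPoint_sq A r α, norm_mul,
      Complex.norm_real, Real.norm_eq_abs, abs_of_pos (by positivity)]
  have hA2 : 0 < A ^ 2 / 2 := by positivity
  have hpos : 0 < ‖Complex.cosh (ρ + β * Complex.I) - Complex.cosh (r + α * Complex.I)‖ :=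
    pos_of_mul_pos_right (hprod ▸ mul_pos n1 n2) hA2.le
  have hlog := congrArg Real.log hprod
  rw [Real.log_mul n1.ne' n2.ne', Real.log_mul hA2.ne' hpos.ne'] at hlog
  rw [chordKernel_ofComplex h1, chordKernel_ofComplex h2, ← ENNReal.ofReal_add hk1 hk2]
  rw [norm_neg, log_one_add_sq_norm_ellipticPoint hA, log_one_add_sq_norm_ellipticPoint hA] at *
  constructor
  · congr 1
    linarith
  · linarith

theorem chordKernel_add_chordKernel_neg (hA : 0 < A) (hρ : 0 ≤ ρ) (hr : 0 ≤ r) (hne : ρ ≠ r)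
    (β α : ℝ) :
    chordKernel (S2.ofComplex (ellipticPoint A ρ β)) (S2.ofComplex (ellipticPoint A r α)) +
      chordKernel (S2.ofComplex (ellipticPoint A ρ β)) (S2.ofComplex (-ellipticPoint A r α)) =
    ENNReal.ofReal (Real.log (A ^ 2 / 2) + Real.log (2 / A ^ 2 + Real.cosh ρ + Real.cos β) +
      Real.log (2 / A ^ 2 + Real.cosh r + Real.cos α) -
      Real.log ‖Complex.cosh (ρ + β * Complex.I) - Complex.cosh (r + α * Complex.I)‖) ∧
    0 ≤ Real.log (A ^ 2 / 2) + Real.log (2 / A ^ 2 + Real.cosh ρ + Real.cos β) +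
      Real.log (2 / A ^ 2 + Real.cosh r + Real.cos α) -
      Real.log ‖Complex.cosh (ρ + β * Complex.I) - Complex.cosh (r + α * Complex.I)‖ :=
  chordKernel_add_chordKernel_neg_of_ne hA
    (fun h => hne (ellipticPoint_injective_left hA hρ hr (Or.inl h)))
    (fun h => hne (ellipticPoint_injective_left hA hρ hr (Or.inr h)))

/-- The derivative in `r` of the potential of the uniform distribution inside the ellipse `r`. -/
noncomputable def regionPotentialDeriv (A ρ β r : ℝ) : ℝ :=
  ((Real.log (A ^ 2 / 2) + Real.log (2 / A ^ 2 + Real.cosh ρ + Real.cos β)) *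
    ellipseMassDeriv (2 / A ^ 2) r + northMean (2 / A ^ 2) r - ellipseMean (2 / A ^ 2) ρ β r) / 2

/-- The contribution of one ellipse to the potential; the point lies on another ellipse. -/
theorem lintegral_pair (hA : 0 < A) (hρ : 0 ≤ ρ) (hr : 0 < r) (hne : ρ ≠ r) (β : ℝ) :
    ∫⁻ α in Set.Ioo 0 (2 * Real.pi),
        (chordKernel (S2.ofComplex (ellipticPoint A ρ β)) (S2.ofComplex (ellipticPoint A r α)) +
        chordKernel (S2.ofComplex (ellipticPoint A ρ β)) (S2.ofComplex (-ellipticPoint A r α))) *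
        ENNReal.ofReal (2 / A ^ 2 / (4 * Real.pi) *
          ellipseDensity (poleCoord (2 / A ^ 2) r) (Real.cosh r) α) =
      ENNReal.ofReal (regionPotentialDeriv A ρ β r) ∧ 0 ≤ regionPotentialDeriv A ρ β r := by
  have hB : 0 < 2 / A ^ 2 := by positivity
  have hk := fun α => chordKernel_add_chordKernel_neg hA hρ hr.le hne β α
  simp_rw [fun α => (hk α).1]
  have h := lintegral_ofReal_mul_ellipseDensity hB r
    ((continuous_const.add (continuous_log_add_cosh_add_cos hB r)).sub
      (continuous_log_norm_cosh_sub_cosh hr hρ hne β))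
    (fun α _ => (hk α).2)
  have e := integral_pair_mul_ellipseDensity hB hr hρ hne β
    (Real.log (A ^ 2 / 2) + Real.log (2 / A ^ 2 + Real.cosh ρ + Real.cos β))
  simp only [Pi.sub_apply, Pi.add_apply] at h
  rw [e] at h
  exact h

/-- The ellipses that do not enclose the point. -/
theorem setLIntegral_pair_outer (hA : 0 < A) (hM : 0 ≤ M) (hρ : M ≤ ρ) (β : ℝ) :
    ∫⁻ r in Set.Ioc 0 M, ∫⁻ α in Set.Ioo 0 (2 * Real.pi),
        (chordKernel (S2.ofComplex (ellipticPoint A ρ β)) (S2.ofComplex (ellipticPoint A r α)) +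
        chordKernel (S2.ofComplex (ellipticPoint A ρ β)) (S2.ofComplex (-ellipticPoint A r α))) *
        ENNReal.ofReal (2 / A ^ 2 / (4 * Real.pi) *
          ellipseDensity (poleCoord (2 / A ^ 2) r) (Real.cosh r) α) =
      ENNReal.ofReal (((Real.log (A ^ 2 / 2) +
        Real.log (2 / A ^ 2 + Real.cosh ρ + Real.cos β)) * ellipseMass (2 / A ^ 2) M +
        northPrimitive (2 / A ^ 2) M - outerPrimitive (2 / A ^ 2) ρ β M) / 2) ∧
    0 ≤ ((Real.log (A ^ 2 / 2) +
        Real.log (2 / A ^ 2 + Real.cosh ρ + Real.cos β)) * ellipseMass (2 / A ^ 2) M +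
        northPrimitive (2 / A ^ 2) M - outerPrimitive (2 / A ^ 2) ρ β M) / 2 := by
  have hB : 0 < 2 / A ^ 2 := by positivity
  have hρ0 := hM.trans hρ
  have hd : ∀ r, 0 ≤ r → ∃ D, HasDerivAt (fun r => ((Real.log (A ^ 2 / 2) +
      Real.log (2 / A ^ 2 + Real.cosh ρ + Real.cos β)) * ellipseMass (2 / A ^ 2) r +
      northPrimitive (2 / A ^ 2) r - outerPrimitive (2 / A ^ 2) ρ β r) / 2) D r ∧
      (0 < r → r < ρ → D = regionPotentialDeriv A ρ β r) := by
    intro r hr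
    obtain ⟨D, h1, h2⟩ := exists_hasDerivAt_outerPrimitive hB hr hρ0 β
    refine ⟨_, ((((hasDerivAt_ellipseMass hB r).const_mul _).add
      (hasDerivAt_northPrimitive hB r)).sub h1).div_const 2, fun h3 h4 => ?_⟩
    rw [h2 h3 h4, regionPotentialDeriv]
  have h := lintegral_Ioc_ofReal_deriv hM (fun r hr => by
      obtain ⟨D, h1, -⟩ := hd r hr.1
      exact h1.continuousAt.continuousWithinAt) (fun r hr => by
      obtain ⟨D, h1, h2⟩ := hd r hr.1.le
      exact h2 hr.1 (hr.2.trans_le hρ) ▸ h1)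
    (fun r hr => (lintegral_pair hA hρ0 hr.1 (hr.2.trans_le hρ).ne' β).2)
  rw [← restrict_Ioo_eq_restrict_Ioc] at h ⊢
  rw [setLIntegral_congr_fun measurableSet_Ioo fun r hr =>
    (lintegral_pair hA hρ0 hr.1 (hr.2.trans_le hρ).ne' β).1]
  simpa only [ellipseMass_zero, northPrimitive_zero, outerPrimitive_zero, mul_zero, add_zero,
    sub_zero, zero_div] using h

/-- The ellipses that enclose the point. -/
theorem setLIntegral_pair_inner (hA : 0 < A) (hρ0 : 0 ≤ ρ) (hρ : ρ ≤ M) (β : ℝ) :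
    ∫⁻ r in Set.Ioc ρ M, ∫⁻ α in Set.Ioo 0 (2 * Real.pi),
        (chordKernel (S2.ofComplex (ellipticPoint A ρ β)) (S2.ofComplex (ellipticPoint A r α)) +
        chordKernel (S2.ofComplex (ellipticPoint A ρ β)) (S2.ofComplex (-ellipticPoint A r α))) *
        ENNReal.ofReal (2 / A ^ 2 / (4 * Real.pi) *
          ellipseDensity (poleCoord (2 / A ^ 2) r) (Real.cosh r) α) =
      ENNReal.ofReal (((Real.log (A ^ 2 / 2) +
        Real.log (2 / A ^ 2 + Real.cosh ρ + Real.cos β)) * ellipseMass (2 / A ^ 2) M +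
        northPrimitive (2 / A ^ 2) M - innerPrimitive (2 / A ^ 2) ρ β M) / 2 -
        ((Real.log (A ^ 2 / 2) +
        Real.log (2 / A ^ 2 + Real.cosh ρ + Real.cos β)) * ellipseMass (2 / A ^ 2) ρ +
        northPrimitive (2 / A ^ 2) ρ - innerPrimitive (2 / A ^ 2) ρ β ρ) / 2) ∧
    0 ≤ ((Real.log (A ^ 2 / 2) +
        Real.log (2 / A ^ 2 + Real.cosh ρ + Real.cos β)) * ellipseMass (2 / A ^ 2) M +
        northPrimitive (2 / A ^ 2) M - innerPrimitive (2 / A ^ 2) ρ β M) / 2 -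
        ((Real.log (A ^ 2 / 2) +
        Real.log (2 / A ^ 2 + Real.cosh ρ + Real.cos β)) * ellipseMass (2 / A ^ 2) ρ +
        northPrimitive (2 / A ^ 2) ρ - innerPrimitive (2 / A ^ 2) ρ β ρ) / 2 := by
  have hB : 0 < 2 / A ^ 2 := by positivity
  have hd : ∀ r, ρ ≤ r → ∃ D, HasDerivAt (fun r => ((Real.log (A ^ 2 / 2) +
      Real.log (2 / A ^ 2 + Real.cosh ρ + Real.cos β)) * ellipseMass (2 / A ^ 2) r +
      northPrimitive (2 / A ^ 2) r - innerPrimitive (2 / A ^ 2) ρ β r) / 2) D r ∧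
      (ρ < r → D = regionPotentialDeriv A ρ β r) := by
    intro r hr
    obtain ⟨D, h1, h2⟩ := exists_hasDerivAt_innerPrimitive hB (hρ0.trans hr) hρ0 hr β
    refine ⟨_, ((((hasDerivAt_ellipseMass hB r).const_mul _).add
      (hasDerivAt_northPrimitive hB r)).sub h1).div_const 2, fun h4 => ?_⟩
    rw [h2 (hρ0.trans_lt h4) h4, regionPotentialDeriv]
  have h := lintegral_Ioc_ofReal_deriv hρ (fun r hr => by
      obtain ⟨D, h1, -⟩ := hd r hr.1
      exact h1.continuousAt.continuousWithinAt) (fun r hr => by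
      obtain ⟨D, h1, h2⟩ := hd r hr.1.le
      exact h2 hr.1 ▸ h1)
    (fun r hr => (lintegral_pair hA hρ0 (hρ0.trans_lt hr.1) hr.1.ne β).2)
  rw [← restrict_Ioo_eq_restrict_Ioc] at h ⊢
  rw [setLIntegral_congr_fun measurableSet_Ioo fun r hr =>
    (lintegral_pair hA hρ0 (hρ0.trans_lt hr.1) hr.1.ne β).1]
  exact h

/-- The potential of the region at a point outside it or on its boundary. -/
theorem chordPotential_confocalRegion_of_le (hA : 0 < A) (hM : 0 ≤ M) (hρ : M ≤ ρ) (β : ℝ) :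
    chordPotential (sphereMeasure.restrict (confocalRegion A M))
        (S2.ofComplex (ellipticPoint A ρ β)) =
      ENNReal.ofReal (((Real.log (A ^ 2 / 2) +
        Real.log (2 / A ^ 2 + Real.cosh ρ + Real.cos β)) * ellipseMass (2 / A ^ 2) M +
        northPrimitive (2 / A ^ 2) M - outerPrimitive (2 / A ^ 2) ρ β M) / 2) ∧
    0 ≤ ((Real.log (A ^ 2 / 2) +
        Real.log (2 / A ^ 2 + Real.cosh ρ + Real.cos β)) * ellipseMass (2 / A ^ 2) M +
        northPrimitive (2 / A ^ 2) M - outerPrimitive (2 / A ^ 2) ρ β M) / 2 := by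
  rw [chordPotential, lintegral_confocalRegion hA hM (measurable_chordKernel_right _)]
  exact setLIntegral_pair_outer hA hM hρ β

/-- The potential of the region at its own points. -/
theorem chordPotential_confocalRegion_of_ge (hA : 0 < A) (hρ0 : 0 ≤ ρ) (hρ : ρ ≤ M) (β : ℝ) :
    chordPotential (sphereMeasure.restrict (confocalRegion A M))
        (S2.ofComplex (ellipticPoint A ρ β)) =
      ENNReal.ofReal (((Real.log (A ^ 2 / 2) +
        Real.log (2 / A ^ 2 + Real.cosh ρ + Real.cos β)) * ellipseMass (2 / A ^ 2) M +
        northPrimitive (2 / A ^ 2) M - innerPrimitive (2 / A ^ 2) ρ β M -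
        Real.log (2 / A ^ 2 + Real.cosh ρ + Real.cos β)) / 2) ∧
    0 ≤ ((Real.log (A ^ 2 / 2) +
        Real.log (2 / A ^ 2 + Real.cosh ρ + Real.cos β)) * ellipseMass (2 / A ^ 2) M +
        northPrimitive (2 / A ^ 2) M - innerPrimitive (2 / A ^ 2) ρ β M -
        Real.log (2 / A ^ 2 + Real.cosh ρ + Real.cos β)) / 2 := by
  have h1 := setLIntegral_pair_outer hA hρ0 le_rfl β
  have h2 := setLIntegral_pair_inner hA hρ0 hρ β
  have h3 := outerPrimitive_sub_innerPrimitive (by positivity : 0 < 2 / A ^ 2) ρ β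
  have h4 := add_nonneg h1.2 h2.2
  rw [chordPotential, lintegral_confocalRegion hA (hρ0.trans hρ) (measurable_chordKernel_right _),
    ← Set.Ioc_union_Ioc_eq_Ioc hρ0 hρ, lintegral_union measurableSet_Ioc
      (Set.Ioc_disjoint_Ioc_of_le le_rfl), h1.1, h2.1, ← ENNReal.ofReal_add h1.2 h2.2]
  constructor
  · congr 1
    linarith
  · linarith

theorem chordPotential_confocalRegion_north (hA : 0 < A) (hM : 0 ≤ M) :
    chordPotential (sphereMeasure.restrict (confocalRegion A M)) S2.north =
      ENNReal.ofReal ((Real.log (A ^ 2 / 2) * ellipseMass (2 / A ^ 2) M +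
        northPrimitive (2 / A ^ 2) M) / 2) ∧
    0 ≤ (Real.log (A ^ 2 / 2) * ellipseMass (2 / A ^ 2) M + northPrimitive (2 / A ^ 2) M) / 2 := by
  have hB : 0 < 2 / A ^ 2 := by positivity
  have hk : ∀ r α : ℝ, chordKernel S2.north (S2.ofComplex (ellipticPoint A r α)) +
      chordKernel S2.north (S2.ofComplex (-ellipticPoint A r α)) =
      ENNReal.ofReal (Real.log (A ^ 2 / 2) + Real.log (2 / A ^ 2 + Real.cosh r + Real.cos α)) ∧
      0 ≤ Real.log (A ^ 2 / 2) + Real.log (2 / A ^ 2 + Real.cosh r + Real.cos α) := by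
    intro r α
    have h0 : 0 ≤ Real.log (1 + ‖ellipticPoint A r α‖ ^ 2) :=
      Real.log_nonneg (by nlinarith [sq_nonneg ‖ellipticPoint A r α‖])
    rw [chordKernel_of_ne (S2.ofComplex_ne_north _).symm,
      chordKernel_of_ne (S2.ofComplex_ne_north _).symm, log_two_div_dist_north,
      log_two_div_dist_north, norm_neg, ← ENNReal.ofReal_add (by positivity) (by positivity),
      add_halves, log_one_add_sq_norm_ellipticPoint hA] at *
    exact ⟨rfl, h0⟩
  have hin : ∀ r, _ := fun r => lintegral_ofReal_mul_ellipseDensity hB r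
    (continuous_const.add (continuous_log_add_cosh_add_cos hB r)) (fun α _ => (hk r α).2)
  simp only [Pi.add_apply, integral_north_mul_ellipseDensity hB] at hin
  have hd : ∀ r, HasDerivAt (fun r => (Real.log (A ^ 2 / 2) * ellipseMass (2 / A ^ 2) r +
      northPrimitive (2 / A ^ 2) r) / 2) ((Real.log (A ^ 2 / 2) * ellipseMassDeriv (2 / A ^ 2) r +
      northMean (2 / A ^ 2) r) / 2) r := fun r =>
    (((hasDerivAt_ellipseMass hB r).const_mul _).add (hasDerivAt_northPrimitive hB r)).div_const 2
  have h := lintegral_Ioc_ofReal_deriv hM (fun r _ => (hd r).continuousAt.continuousWithinAt)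
    (fun r _ => hd r) (fun r _ => (hin r).2)
  rw [chordPotential, lintegral_confocalRegion hA hM (measurable_chordKernel_right _)]
  simp_rw [fun r α => (hk r α).1, fun r => (hin r).1]
  simpa only [ellipseMass_zero, northPrimitive_zero, mul_zero, add_zero, sub_zero, zero_div] using h

theorem sphereMeasure_confocalRegion (hA : 0 < A) (hM : 0 ≤ M) :
    sphereMeasure (confocalRegion A M) = ENNReal.ofReal (ellipseMass (2 / A ^ 2) M) := by
  have hB : 0 < 2 / A ^ 2 := by positivity
  have h1 := lintegral_confocalRegion hA hM (measurable_const (a := (1 : ℝ≥0∞)))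
  rw [setLIntegral_one] at h1
  have hin : ∀ r, _ := fun r => lintegral_ofReal_mul_ellipseDensity hB r
    (continuous_const (y := (2 : ℝ))) (fun _ _ => zero_le_two)
  simp only [integral_const_mul_ellipseDensity hB, mul_div_cancel_left₀ _ (two_ne_zero' ℝ)] at hin
  have h := lintegral_Ioc_ofReal_deriv hM
    (fun r _ => (hasDerivAt_ellipseMass hB r).continuousAt.continuousWithinAt)
    (fun r _ => hasDerivAt_ellipseMass hB r) (fun r _ => (hin r).2)
  have e : (1 + 1 : ℝ≥0∞) = ENNReal.ofReal 2 := by norm_num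
  rw [h1, e]
  simp_rw [fun r => (hin r).1]
  rw [h.1, ellipseMass_zero, sub_zero]

end RegionPotential

/-! ### The postcritical droplet -/

theorem sphereMeasure_north : sphereMeasure {S2.north} = 0 := by
  have h : S2.ofComplex ⁻¹' {S2.north} = ∅ := Set.eq_empty_of_forall_notMem fun z hz =>
    S2.ofComplex_ne_north z hz
  rw [sphereMeasure_eq_map, Measure.map_apply S2.continuous_ofComplex.measurable
    (measurableSet_singleton _), h, measure_empty]

theorem sq_norm_cosh_sub_cosh_add_pi_mul_I (ρ β s : ℝ) :
    ‖Complex.cosh (ρ + β * Complex.I) - Complex.cosh (s + Real.pi * Complex.I)‖ ^ 2 =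
      (Real.cosh (s + ρ) + Real.cos β) * (Real.cosh (s - ρ) + Real.cos β) := by
  have h1 := Complex.sq_norm_cosh_half (s + ρ) β
  have h2 := Complex.sq_norm_cosh_half (s - ρ) (-β)
  have e : Complex.cosh (ρ + β * Complex.I) - Complex.cosh (s + Real.pi * Complex.I) =
      2 * Complex.cosh (((s + ρ : ℝ) + β * Complex.I) / 2) *
        Complex.cosh (((s - ρ : ℝ) + (-β : ℝ) * Complex.I) / 2) := by
    have e1 : (ρ : ℂ) + β * Complex.I = ((s + ρ : ℝ) + β * Complex.I) / 2 -
        ((s - ρ : ℝ) + (-β : ℝ) * Complex.I) / 2 := by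
      push_cast
      ring
    have e2 : (s : ℂ) = ((s + ρ : ℝ) + β * Complex.I) / 2 +
        ((s - ρ : ℝ) + (-β : ℝ) * Complex.I) / 2 := by
      push_cast
      ring
    rw [Complex.cosh_add (s : ℂ), Complex.cosh_mul_I, Complex.sinh_mul_I, Complex.cos_pi,
      Complex.sin_pi, zero_mul, mul_zero, add_zero, mul_neg_one, sub_neg_eq_add]
    conv_lhs => rw [e1, e2, Complex.cosh_add, Complex.cosh_sub]
    ring
  rw [e, norm_mul, norm_mul, mul_pow, mul_pow, h1, h2, Complex.norm_two, Real.cos_neg]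
  ring

section Postcritical

variable {a b : ℝ}

theorem ellipticPoint_two_mul_paramU (ha : 0 < a) (hb : 1 ≤ b) (hab : 1 < a * (b ^ 2 - 1)) :
    ellipticPoint (constA a b) (2 * paramU a b) Real.pi = b * Complex.I := by
  have h := constA_mul_sinh_paramU ha hb hab
  have e : (((2 * paramU a b : ℝ) : ℂ) + Real.pi * Complex.I) / 2 =
      (paramU a b : ℂ) + Real.pi / 2 * Complex.I := by
    push_cast
    ring
  rw [ellipticPoint, e, Complex.cosh_add, Complex.cosh_mul_I, Complex.sinh_mul_I,
    Complex.cos_pi_div_two, Complex.sin_pi_div_two, mul_zero, zero_add, one_mul, ← mul_assoc,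
    ← Complex.ofReal_sinh, ← Complex.ofReal_mul, h]

theorem sinh_add_eq_mul_sinh_sub (ha : 0 < a) (hb : 1 ≤ b) (hab : 1 < a * (b ^ 2 - 1)) :
    Real.sinh (paramU a b + paramW a b) =
      (1 + 2 * a) * Real.sinh (paramU a b - paramW a b) := by
  have h := mul_tanh_paramU ha hb hab
  have h1 := (Real.cosh_pos (paramU a b)).ne'
  have h2 := (Real.cosh_pos (paramW a b)).ne'
  rw [Real.tanh_eq_sinh_div_cosh, Real.tanh_eq_sinh_div_cosh] at h
  field_simp at h
  rw [Real.sinh_add, Real.sinh_sub]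
  linear_combination (-2) * h

theorem two_div_constA_sq (ha : 0 < a) (hb : 1 ≤ b) (hab : 1 < a * (b ^ 2 - 1)) :
    2 / constA a b ^ 2 =
      Real.cosh (paramU a b + paramW a b) - Real.cosh (paramU a b - paramW a b) := by
  have h1 := constA_mul_sinh_paramU ha hb hab
  have h2 := constA_mul_sinh_paramW ha hb hab
  have hA := constA_pos ha hb hab
  have hb0 : b ≠ 0 := by linarith
  have h3 : constA a b ^ 2 * (Real.sinh (paramU a b) * Real.sinh (paramW a b)) = 1 := by
    rw [← mul_inv_cancel₀ hb0]
    conv_rhs => rw [← h2]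
    conv_rhs => enter [1]; rw [← h1]
    ring
  rw [Real.cosh_add, Real.cosh_sub, div_eq_iff (by positivity)]
  linear_combination (-2) * h3

theorem poleCoord_postcritical (ha : 0 < a) (hb : 1 ≤ b) (hab : 1 < a * (b ^ 2 - 1)) :
    poleCoord (2 / constA a b ^ 2) (paramU a b - paramW a b) = paramU a b + paramW a b := by
  have hw := paramW_pos ha hb hab
  have hu := paramW_lt_paramU ha hb hab
  rw [poleCoord, two_div_constA_sq ha hb hab, sub_add_cancel, Real.arcosh_cosh (by linarith)]

theorem ellipseMass_postcritical (ha : 0 < a) (hb : 1 ≤ b) (hab : 1 < a * (b ^ 2 - 1)) :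
    ellipseMass (2 / constA a b ^ 2) (paramU a b - paramW a b) = 1 / (1 + 2 * a) := by
  have hu := paramW_lt_paramU ha hb hab
  have : 0 < Real.sinh (paramU a b - paramW a b) := Real.sinh_pos_iff.2 (by linarith)
  rw [ellipseMass, poleCoord_postcritical ha hb hab, sinh_add_eq_mul_sinh_sub ha hb hab]
  field_simp

/-- The closed droplet in the postcritical case, up to the negligible north pole: the inside of an
ellipse with foci `± A`. -/
noncomputable def ellipseDroplet (a b : ℝ) : Set S2 :=
  confocalRegion (constA a b) (paramU a b - paramW a b)

theorem isProbabilityMeasure_uniformDroplet_ellipseDroplet (ha : 0 < a) (hb : 1 ≤ b)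
    (hab : 1 < a * (b ^ 2 - 1)) : IsProbabilityMeasure (uniformDroplet a (ellipseDroplet a b)) := by
  have hu := paramW_lt_paramU ha hb hab
  refine ⟨?_⟩
  rw [uniformDroplet, Measure.smul_apply, Measure.restrict_apply_univ, ellipseDroplet,
    sphereMeasure_confocalRegion (constA_pos ha hb hab) (by linarith),
    ellipseMass_postcritical ha hb hab, smul_eq_mul, ← ENNReal.ofReal_mul (by linarith),
    mul_one_div_cancel (by linarith), ENNReal.ofReal_one]

/-- The value at the north pole of the potential of the uniform law on the droplet. -/
noncomputable def dropletConst (a b : ℝ) : ℝ :=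
  Real.log (constA a b ^ 2 / 2) / 2 +
    (1 + 2 * a) / 2 * northPrimitive (2 / constA a b ^ 2) (paramU a b - paramW a b)

theorem chordPotential_ellipseDroplet_north (ha : 0 < a) (hb : 1 ≤ b)
    (hab : 1 < a * (b ^ 2 - 1)) :
    chordPotential (uniformDroplet a (ellipseDroplet a b)) S2.north =
      ENNReal.ofReal (dropletConst a b) ∧ 0 ≤ dropletConst a b := by
  have hu := paramW_lt_paramU ha hb hab
  have h12 : 0 < 1 + 2 * a := by linarith
  have h := chordPotential_confocalRegion_north (constA_pos ha hb hab)
    (M := paramU a b - paramW a b) (by linarith)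
  have e : dropletConst a b = (1 + 2 * a) * ((Real.log (constA a b ^ 2 / 2) *
      ellipseMass (2 / constA a b ^ 2) (paramU a b - paramW a b) +
      northPrimitive (2 / constA a b ^ 2) (paramU a b - paramW a b)) / 2) := by
    rw [dropletConst, ellipseMass_postcritical ha hb hab]
    field_simp
  rw [uniformDroplet, chordPotential_smul, ellipseDroplet, h.1, ← ENNReal.ofReal_mul h12.le, e]
  exact ⟨rfl, mul_nonneg h12.le h.2⟩

/-- Outside the droplet its potential is, up to a constant, the potential of `μ_V`. -/
theorem chordPotential_ellipseDroplet_outside (ha : 0 < a) (hb : 1 ≤ b)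
    (hab : 1 < a * (b ^ 2 - 1)) {ρ : ℝ} (hρ : paramU a b - paramW a b ≤ ρ) (β : ℝ) :
    chordPotential (uniformDroplet a (ellipseDroplet a b))
        (S2.ofComplex (ellipticPoint (constA a b) ρ β)) =
      ENNReal.ofReal (dropletConst a b + potentialV a b ρ β) ∧
    0 ≤ dropletConst a b + potentialV a b ρ β := by
  have hu := paramW_lt_paramU ha hb hab
  have h12 : 0 < 1 + 2 * a := by linarith
  have h := chordPotential_confocalRegion_of_le (constA_pos ha hb hab)
    (M := paramU a b - paramW a b) (by linarith) hρ β
  have e : dropletConst a b + potentialV a b ρ β =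
      (1 + 2 * a) * (((Real.log (constA a b ^ 2 / 2) +
        Real.log (2 / constA a b ^ 2 + Real.cosh ρ + Real.cos β)) *
        ellipseMass (2 / constA a b ^ 2) (paramU a b - paramW a b) +
        northPrimitive (2 / constA a b ^ 2) (paramU a b - paramW a b) -
        outerPrimitive (2 / constA a b ^ 2) ρ β (paramU a b - paramW a b)) / 2) := by
    rw [dropletConst, potentialV, outerPrimitive, ellipseMass_postcritical ha hb hab,
      poleCoord_postcritical ha hb hab,
      show paramU a b + paramW a b - (paramU a b - paramW a b) + ρ = ρ + 2 * paramW a b by ring,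
      show paramU a b + paramW a b + (paramU a b - paramW a b) + ρ = ρ + 2 * paramU a b by ring]
    field_simp
    ring
  rw [uniformDroplet, chordPotential_smul, ellipseDroplet, h.1, ← ENNReal.ofReal_mul h12.le, e]
  exact ⟨rfl, mul_nonneg h12.le h.2⟩

/-- The potential of the droplet at its own points. -/
theorem chordPotential_ellipseDroplet_inside (ha : 0 < a) (hb : 1 ≤ b)
    (hab : 1 < a * (b ^ 2 - 1)) {ρ : ℝ} (hρ0 : 0 ≤ ρ) (hρ : ρ ≤ paramU a b - paramW a b) (β : ℝ) :
    chordPotential (uniformDroplet a (ellipseDroplet a b))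
        (S2.ofComplex (ellipticPoint (constA a b) ρ β)) =
      ENNReal.ofReal (dropletConst a b + ((1 + a) * paramW a b - a * paramU a b) -
        a * Real.log (2 / constA a b ^ 2 + Real.cosh ρ + Real.cos β) +
        a / 2 * (Real.log (Real.cosh (2 * paramU a b - ρ) + Real.cos β) +
          Real.log (Real.cosh (2 * paramU a b + ρ) + Real.cos β))) ∧
    0 ≤ dropletConst a b + ((1 + a) * paramW a b - a * paramU a b) -
        a * Real.log (2 / constA a b ^ 2 + Real.cosh ρ + Real.cos β) +
        a / 2 * (Real.log (Real.cosh (2 * paramU a b - ρ) + Real.cos β) +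
          Real.log (Real.cosh (2 * paramU a b + ρ) + Real.cos β)) := by
  have h12 : 0 < 1 + 2 * a := by linarith
  have h := chordPotential_confocalRegion_of_ge (constA_pos ha hb hab) hρ0 hρ β
  have e : dropletConst a b + ((1 + a) * paramW a b - a * paramU a b) -
        a * Real.log (2 / constA a b ^ 2 + Real.cosh ρ + Real.cos β) +
        a / 2 * (Real.log (Real.cosh (2 * paramU a b - ρ) + Real.cos β) +
          Real.log (Real.cosh (2 * paramU a b + ρ) + Real.cos β)) =
      (1 + 2 * a) * (((Real.log (constA a b ^ 2 / 2) +
        Real.log (2 / constA a b ^ 2 + Real.cosh ρ + Real.cos β)) *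
        ellipseMass (2 / constA a b ^ 2) (paramU a b - paramW a b) +
        northPrimitive (2 / constA a b ^ 2) (paramU a b - paramW a b) -
        innerPrimitive (2 / constA a b ^ 2) ρ β (paramU a b - paramW a b) -
        Real.log (2 / constA a b ^ 2 + Real.cosh ρ + Real.cos β)) / 2) := by
    rw [dropletConst, innerPrimitive, ellipseMass_postcritical ha hb hab,
      poleCoord_postcritical ha hb hab,
      show paramU a b + paramW a b + (paramU a b - paramW a b) - ρ = 2 * paramU a b - ρ by ring,
      show paramU a b + paramW a b + (paramU a b - paramW a b) + ρ = 2 * paramU a b + ρ by ring]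
    field_simp
    ring
  rw [uniformDroplet, chordPotential_smul, ellipseDroplet, h.1, ← ENNReal.ofReal_mul h12.le, e]
  exact ⟨rfl, mul_nonneg h12.le h.2⟩

/-- The external field in elliptic coordinates. -/
theorem chordPotential_twoCharges_elliptic (ha : 0 < a) (hb : 1 ≤ b) (hab : 1 < a * (b ^ 2 - 1))
    {ρ β : ℝ} (h1 : ellipticPoint (constA a b) ρ β ≠ b * Complex.I)
    (h2 : ellipticPoint (constA a b) ρ β ≠ -(b * Complex.I)) :
    chordPotential (twoCharges a (imagPoint b) (imagPoint (-b)))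
        (S2.ofComplex (ellipticPoint (constA a b) ρ β)) =
      ENNReal.ofReal (a * Real.log (1 + b ^ 2) +
        a * Real.log (2 / constA a b ^ 2 + Real.cosh ρ + Real.cos β) -
        a / 2 * (Real.log (Real.cosh (2 * paramU a b - ρ) + Real.cos β) +
          Real.log (Real.cosh (2 * paramU a b + ρ) + Real.cos β))) ∧
    0 ≤ a * Real.log (1 + b ^ 2) +
        a * Real.log (2 / constA a b ^ 2 + Real.cosh ρ + Real.cos β) -
        a / 2 * (Real.log (Real.cosh (2 * paramU a b - ρ) + Real.cos β) +
          Real.log (Real.cosh (2 * paramU a b + ρ) + Real.cos β)) ∧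
    0 < Real.cosh (2 * paramU a b - ρ) + Real.cos β := by
  have hA := constA_pos ha hb hab
  have hp := ellipticPoint_two_mul_paramU ha hb hab
  have hk := chordKernel_add_chordKernel_neg_of_ne hA (ρ := ρ) (β := β) (r := 2 * paramU a b)
    (α := Real.pi) (by rwa [hp]) (by rwa [hp])
  have hlog := log_one_add_sq_norm_ellipticPoint hA (2 * paramU a b) Real.pi
  rw [hp] at hk hlog
  have hnorm : ‖(b : ℂ) * Complex.I‖ ^ 2 = b ^ 2 := by simp
  rw [hnorm] at hlog
  have hsq := ellipticPoint_sq (constA a b) ρ β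
  have hsq' := ellipticPoint_sq (constA a b) (2 * paramU a b) Real.pi
  rw [hp] at hsq'
  have hne : Complex.cosh (ρ + β * Complex.I) -
      Complex.cosh ((2 * paramU a b : ℝ) + Real.pi * Complex.I) ≠ 0 := by
    intro h0
    have h3 : (ellipticPoint (constA a b) ρ β - b * Complex.I) *
        (ellipticPoint (constA a b) ρ β - -(b * Complex.I)) = 0 := by
      linear_combination hsq - hsq' + (constA a b ^ 2 / 2 : ℝ) * h0
    rcases mul_eq_zero.1 h3 with h | h
    · exact h1 (sub_eq_zero.1 h)
    · exact h2 (sub_eq_zero.1 h)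
  have hn := norm_pos_iff.2 hne
  have hs := sq_norm_cosh_sub_cosh_add_pi_mul_I ρ β (2 * paramU a b)
  have hprod : 0 < (Real.cosh (2 * paramU a b + ρ) + Real.cos β) *
      (Real.cosh (2 * paramU a b - ρ) + Real.cos β) := hs ▸ pow_pos hn 2
  have p1 : 0 < Real.cosh (2 * paramU a b + ρ) + Real.cos β :=
    pos_of_mul_pos_left hprod (cosh_add_cos_nonneg _ _)
  have p2 : 0 < Real.cosh (2 * paramU a b - ρ) + Real.cos β :=
    pos_of_mul_pos_right hprod p1.le
  have hl := congrArg Real.log hs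
  rw [Real.log_pow, Real.log_mul p1.ne' p2.ne', Nat.cast_ofNat] at hl
  have e : a * Real.log (1 + b ^ 2) +
        a * Real.log (2 / constA a b ^ 2 + Real.cosh ρ + Real.cos β) -
        a / 2 * (Real.log (Real.cosh (2 * paramU a b - ρ) + Real.cos β) +
          Real.log (Real.cosh (2 * paramU a b + ρ) + Real.cos β)) =
      a * (Real.log (constA a b ^ 2 / 2) +
        Real.log (2 / constA a b ^ 2 + Real.cosh ρ + Real.cos β) +
        Real.log (2 / constA a b ^ 2 + Real.cosh (2 * paramU a b) + Real.cos Real.pi) -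
        Real.log ‖Complex.cosh (ρ + β * Complex.I) -
          Complex.cosh ((2 * paramU a b : ℝ) + Real.pi * Complex.I)‖) := by
    linear_combination a * hlog + a / 2 * hl
  have e2 : imagPoint (-b) = S2.ofComplex (-(b * Complex.I)) := by
    rw [imagPoint]
    congr 1
    push_cast
    ring
  rw [chordPotential_twoCharges, ← mul_add, imagPoint, e2, hk.1, ← ENNReal.ofReal_mul ha.le, e]
  exact ⟨rfl, mul_nonneg ha.le hk.2, p2⟩

theorem chordPotential_twoCharges_eq_top (ha : 0 < a) {z : ℂ}
    (h : z = b * Complex.I ∨ z = -(b * Complex.I)) :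
    chordPotential (twoCharges a (imagPoint b) (imagPoint (-b))) (S2.ofComplex z) = ⊤ := by
  have h0 : ENNReal.ofReal a ≠ 0 := by simpa using ha
  rw [chordPotential_twoCharges]
  rcases h with rfl | rfl
  · rw [imagPoint, chordKernel_self, ENNReal.mul_top h0, top_add]
  · have e2 : imagPoint (-b) = S2.ofComplex (-(b * Complex.I)) := by
      rw [imagPoint]
      congr 1
      push_cast
      ring
    rw [e2, chordKernel_self, ENNReal.mul_top h0, add_top]

/-- In the elliptic coordinates centred at the boundary of the droplet, this is the comparison of
the potential of the droplet with the field, and with the potential of `μ_V`. -/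
theorem dropletGap_elliptic_nonpos (ha : 0 < a) (hb : 1 ≤ b) (hab : 1 < a * (b ^ 2 - 1))
    {ρ β : ℝ} (hρ : 0 ≤ ρ) (hpos : 0 < Real.cosh (2 * paramU a b - ρ) + Real.cos β) :
    a * Real.log (Real.cosh (2 * paramU a b - ρ) + Real.cos β) +
      (1 + a) * Real.log (Real.cosh (ρ + 2 * paramW a b) + Real.cos β) -
      (1 + 2 * a) * Real.log (2 / constA a b ^ 2 + Real.cosh ρ + Real.cos β) ≤ 0 := by
  have hw := paramW_pos ha hb hab
  have hu := paramW_lt_paramU ha hb hab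
  have e1 : paramU a b + paramW a b - (ρ - (paramU a b - paramW a b)) = 2 * paramU a b - ρ := by
    ring
  have e2 : paramU a b + paramW a b + (ρ - (paramU a b - paramW a b)) = ρ + 2 * paramW a b := by
    ring
  have e3 : paramU a b - paramW a b + (ρ - (paramU a b - paramW a b)) = ρ := by ring
  have h := dropletGap_nonpos ha (L := paramU a b + paramW a b) (M := paramU a b - paramW a b)
    (by linarith) (by linarith) (sinh_add_eq_mul_sinh_sub ha hb hab)
    (s := ρ - (paramU a b - paramW a b)) (by linarith) (Real.neg_one_le_cos β) (Real.cos_le_one β)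
    (by rwa [e1])
  rw [dropletGap, e1, e2, e3, ← two_div_constA_sq ha hb hab] at h
  exact h

theorem isEquilibriumMeasure_iff_ellipseDroplet (ha : 0 < a) (hb : 1 ≤ b)
    (hab : 1 < a * (b ^ 2 - 1)) (ν : Measure S2) :
    IsEquilibriumMeasure (logPotential (twoCharges a (imagPoint b) (imagPoint (-b)))) ν ↔
      ν = uniformDroplet a (ellipseDroplet a b) := by
  have := isProbabilityMeasure_uniformDroplet_ellipseDroplet ha hb hab
  have hA := constA_pos ha hb hab
  have hw := paramW_pos ha hb hab
  have hu := paramW_lt_paramU ha hb hab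
  have hm : ∀ᵐ x ∂(uniformDroplet a (ellipseDroplet a b)), x ∈ ellipseDroplet a b := by
    rw [uniformDroplet]
    exact Measure.ae_smul_measure (ae_restrict_mem (isClosed_confocalRegion _ _).measurableSet) _
  have hn : ∀ᵐ x ∂(uniformDroplet a (ellipseDroplet a b)), x ≠ S2.north := by
    rw [uniformDroplet]
    exact Measure.ae_smul_measure (ae_restrict_of_ae
      (compl_mem_ae_iff.2 sphereMeasure_north : {S2.north}ᶜ ∈ ae sphereMeasure)) _
  have hin : ∀ ρ β, 0 ≤ ρ → ρ ≤ paramU a b - paramW a b →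
      chordPotential (uniformDroplet a (ellipseDroplet a b))
        (S2.ofComplex (ellipticPoint (constA a b) ρ β)) +
      chordPotential (twoCharges a (imagPoint b) (imagPoint (-b)))
        (S2.ofComplex (ellipticPoint (constA a b) ρ β)) = ENNReal.ofReal
      (dropletConst a b + ((1 + a) * paramW a b - a * paramU a b) + a * Real.log (1 + b ^ 2)) := by
    intro ρ β hρ0 hρ
    have hp := ellipticPoint_two_mul_paramU ha hb hab
    have hu2 : 0 ≤ 2 * paramU a b := by linarith
    have hne : ρ ≠ 2 * paramU a b := ne_of_lt (by linarith)
    have hQ := chordPotential_twoCharges_elliptic ha hb hab (ρ := ρ) (β := β)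
      (fun h => hne (ellipticPoint_injective_left hA hρ0 hu2 (Or.inl (h.trans hp.symm))))
      (fun h => hne (ellipticPoint_injective_left hA hρ0 hu2
        (Or.inr (h.trans (congrArg Neg.neg hp.symm)))))
    have hP := chordPotential_ellipseDroplet_inside ha hb hab hρ0 hρ β
    rw [hP.1, hQ.1, ← ENNReal.ofReal_add hP.2 hQ.2.1]
    congr 1
    ring
  refine isEquilibriumMeasure_sphere_iff ha _ (F := ENNReal.ofReal
    (dropletConst a b + ((1 + a) * paramW a b - a * paramU a b) + a * Real.log (1 + b ^ 2)))
    ENNReal.ofReal_ne_top ?_ ?_ ν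
  · filter_upwards [hm, hn] with x hx hxn
    obtain ⟨z, rfl⟩ := S2.exists_ofComplex hxn
    obtain ⟨ρ, β, hρ, rfl⟩ := exists_ellipticPoint hA z
    rw [ellipseDroplet, ofComplex_mem_confocalRegion,
      ellipticPoint_mem_iff hA (by linarith) hρ] at hx
    exact hin ρ β hρ hx
  · intro x hxn
    obtain ⟨z, rfl⟩ := S2.exists_ofComplex hxn
    obtain ⟨ρ, β, hρ, rfl⟩ := exists_ellipticPoint hA z
    rcases le_total ρ (paramU a b - paramW a b) with h | h
    · exact (hin ρ β hρ h).ge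
    · by_cases hc : ellipticPoint (constA a b) ρ β = b * Complex.I ∨
        ellipticPoint (constA a b) ρ β = -(b * Complex.I)
      · rw [chordPotential_twoCharges_eq_top ha hc, add_top]
        exact le_top
      · rw [not_or] at hc
        have hP := chordPotential_ellipseDroplet_outside ha hb hab h β
        have hQ := chordPotential_twoCharges_elliptic ha hb hab hc.1 hc.2
        have hg := dropletGap_elliptic_nonpos ha hb hab hρ hQ.2.2
        rw [hP.1, hQ.1, ← ENNReal.ofReal_add hP.2 hQ.2.1]
        refine ENNReal.ofReal_le_ofReal ?_
        rw [potentialV, add_comm ρ (2 * paramU a b)]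
        linarith

theorem exists_potential_comparison_of_lt (ha : 0 < a) (hb : 1 ≤ b)
    (hab : 1 < a * (b ^ 2 - 1)) : ∃ m : ℝ,
    (∀ x, x ∉ confocalInterior (constA a b) (paramU a b - paramW a b) →
      chordPotential (uniformDroplet a (ellipseDroplet a b)) x + ENNReal.ofReal |m| =
        chordPotential ((muV a b).map realPoint) x + ENNReal.ofReal (|m| + m)) ∧
    (∀ x, chordPotential (uniformDroplet a (ellipseDroplet a b)) x + ENNReal.ofReal |m| ≤
        chordPotential ((muV a b).map realPoint) x + ENNReal.ofReal (|m| + m)) := by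
  have hA := constA_pos ha hb hab
  have hw := paramW_pos ha hb hab
  have hu := paramW_lt_paramU ha hb hab
  have h1 : ∀ x, x ∉ confocalInterior (constA a b) (paramU a b - paramW a b) →
      chordPotential (uniformDroplet a (ellipseDroplet a b)) x +
        ENNReal.ofReal |dropletConst a b - constV a b| =
        chordPotential ((muV a b).map realPoint) x + ENNReal.ofReal
          (|dropletConst a b - constV a b| + (dropletConst a b - constV a b)) := by
    intro x hx
    by_cases hxn : x = S2.north
    · rw [hxn]
      have hP := chordPotential_ellipseDroplet_north ha hb hab
      have hV := chordPotential_muV_north ha hb hab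
      exact ENNReal.ofReal_sum_of_eq_add hP.1 hP.2 hV.1 hV.2 (by ring)
    · obtain ⟨z, rfl⟩ := S2.exists_ofComplex hxn
      obtain ⟨ρ, β, hρ, rfl⟩ := exists_ellipticPoint hA z
      have hP := chordPotential_ellipseDroplet_outside ha hb hab
        (ellipticPoint_notMem_confocalInterior hA hρ hx) β
      have hV := chordPotential_muV_elliptic ha hb hab hρ β
      exact ENNReal.ofReal_sum_of_eq_add hP.1 hP.2 hV.1 hV.2 (by ring)
  refine ⟨dropletConst a b - constV a b, h1, fun x => ?_⟩
  by_cases hx : x ∈ confocalInterior (constA a b) (paramU a b - paramW a b)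
  · have hxn : x ≠ S2.north := fun h => north_notMem_confocalInterior _ _ (h ▸ hx)
    obtain ⟨z, rfl⟩ := S2.exists_ofComplex hxn
    obtain ⟨ρ, β, hρ, rfl⟩ := exists_ellipticPoint hA z
    have hle := confocalInterior_subset _ _ hx
    rw [ofComplex_mem_confocalRegion, ellipticPoint_mem_iff hA (by linarith) hρ] at hle
    have hP := chordPotential_ellipseDroplet_inside ha hb hab hρ hle β
    have hV := chordPotential_muV_elliptic ha hb hab hρ β
    have hg := dropletGap_elliptic_nonpos ha hb hab hρ
      (cosh_add_cos_pos (by linarith : 0 < 2 * paramU a b - ρ) β)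
    refine ENNReal.ofReal_sum_of_le_add hP.1 hP.2 hV.1 hV.2 ?_
    rw [potentialV, add_comm ρ (2 * paramU a b)]
    linarith
  · exact (h1 x hx).le

end Postcritical

/-! ### The droplet and its mother body -/

theorem eq_imagPoint_of_stereo_eq {p : S2} {t : ℝ}
    (h : stereo p = ((t * Complex.I : ℂ) : OnePoint ℂ)) : p = imagPoint t := by
  rw [imagPoint, S2.ofComplex_eq_stereo_symm, ← h, Equiv.symm_apply_apply]

/-- In both regimes there is a closed set `D₀` whose uniform law satisfies the Frostman conditions
on the sphere, and whose potential compares with that of `μ_V`. -/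
theorem exists_droplet {a b : ℝ} (ha : 0 < a) (hb : 1 ≤ b) :
    IsProbabilityMeasure (muV a b) ∧
    (∀ ν : Measure ℝ, IsEquilibriumMeasure (fieldV a b) ν ↔ ν = muV a b) ∧
    ∃ D₀ O : Set S2, IsClosed D₀ ∧ IsOpen O ∧ O ⊆ D₀ ∧
      IsProbabilityMeasure (uniformDroplet a D₀) ∧
      (∀ ν, IsEquilibriumMeasure (logPotential (twoCharges a (imagPoint b) (imagPoint (-b)))) ν ↔
        ν = uniformDroplet a D₀) ∧
      ∃ m : ℝ, (∀ x, x ∉ O → chordPotential (uniformDroplet a D₀) x + ENNReal.ofReal |m| =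
        chordPotential ((muV a b).map realPoint) x + ENNReal.ofReal (|m| + m)) ∧
      (∀ x, chordPotential (uniformDroplet a D₀) x + ENNReal.ofReal |m| ≤
        chordPotential ((muV a b).map realPoint) x + ENNReal.ofReal (|m| + m)) := by
  rcases le_or_gt (a * (b ^ 2 - 1)) 1 with hab | hab
  · exact ⟨isProbabilityMeasure_muV_of_le ha hb hab,
      isEquilibriumMeasure_fieldV_iff_of_le ha hb hab,
      capDroplet a b, capInterior a b, isClosed_capDroplet a b, isOpen_capInterior a b,
      capInterior_subset a b, isProbabilityMeasure_uniformDroplet_capDroplet ha hb hab,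
      isEquilibriumMeasure_iff_capDroplet ha hb hab, exists_potential_comparison_of_le ha hb hab⟩
  · exact ⟨isProbabilityMeasure_muV_of_lt ha hb hab,
      isEquilibriumMeasure_fieldV_iff_of_lt ha hb hab,
      ellipseDroplet a b, confocalInterior (constA a b) (paramU a b - paramW a b),
      isClosed_confocalRegion _ _, isOpen_confocalInterior _ _, confocalInterior_subset _ _,
      isProbabilityMeasure_uniformDroplet_ellipseDroplet ha hb hab,
      isEquilibriumMeasure_iff_ellipseDroplet ha hb hab,
      exists_potential_comparison_of_lt ha hb hab⟩

theorem theorem1p2 (a b : ℝ) (ha : 0 < a) (hb : 1 ≤ b) (p₁ p₂ : S2)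
    (hp₁ : stereo p₁ = ((b * Complex.I : ℂ) : OnePoint ℂ))
    (hp₂ : stereo p₂ = ((-(b * Complex.I) : ℂ) : OnePoint ℂ)) :
    (∃! μ : Measure S2, IsEquilibriumMeasure (logPotential (twoCharges a p₁ p₂)) μ) ∧
    (∀ ν : Measure ℝ, IsEquilibriumMeasure (fieldV a b) ν ↔ ν = muV a b) ∧
    ∀ μ : Measure S2, IsEquilibriumMeasure (logPotential (twoCharges a p₁ p₂)) μ →
    ∀ D : Set S2, D = μ.support →
    ∃ σ : Measure S2,
      σ = ENNReal.ofReal (1 / (2 * a)) •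
        (muV a b).map (fun t : ℝ => stereo.symm ((t : ℂ) : OnePoint ℂ)) ∧
      σ.support ⊆ greatCircle ∧
      σ Set.univ = ENNReal.ofReal (1 / (2 * a)) ∧
      ∃ m : ℝ,
        (∀ x : S2, x ∉ D →
          logPotential (sphereMeasure.restrict D) x =
            logPotential (ENNReal.ofReal (2 * a / (1 + 2 * a)) • σ) x + (m : EReal)) ∧
        (∀ x : S2, x ∈ D →
          logPotential (sphereMeasure.restrict D) x ≤
            logPotential (ENNReal.ofReal (2 * a / (1 + 2 * a)) • σ) x + (m : EReal)) := by
  obtain rfl : p₁ = imagPoint b := eq_imagPoint_of_stereo_eq hp₁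
  obtain rfl : p₂ = imagPoint (-b) := eq_imagPoint_of_stereo_eq <| by
    rw [hp₂]
    push_cast
    rw [neg_mul]
  obtain ⟨hV, hVeq, D₀, O, hD₀, hO, hOD, hprob, heq, m, h1, h2⟩ := exists_droplet ha hb
  refine ⟨⟨uniformDroplet a D₀, (heq _).2 rfl, fun ν hν => (heq ν).1 hν⟩, hVeq, ?_⟩
  rintro μ hμ D rfl
  obtain rfl := (heq μ).1 hμ
  exact motherBody_of_potentials ha hD₀ hO hOD (abs_nonneg m) (by linarith [neg_abs_le m]) h1 h2
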